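/- The model is the word RAM with words of $w$ bits: programs are finite texts, the same for all $n$ and $w$, built from sequencing, branching and while-loops over registers; each arithmetic ($+,-,\cdot,\div,\bmod$, modulo $2^w$), bitwise, shift or comparison instruction on a constant number of words, each memory read or write, each test, and each word written to the write-only output takes one unit of time. Memory may initially contain arbitrary data. Space is the number of bits of the memory cells and registers used. There is an absolute constant $T$ such that for every integer $c\ge 1$ there are six programs (init, insert, delete, search, findany, enumerate), constants $w_0,K$ and a function $g$ with $g(n)=o(n)$, all depending only on $c$, such that for all $n\ge 0$ and all word lengths $w\ge w_0$ with $n<2^w$ the programs maintain a collection of $c$ disjoint sets $S_0,\dots,S_{c-1}$ that partition the universe $\{1,\dots,n\}$, using at most $$n\lg c+g(n)+Kw$$ bits, registers included ($\lg=\log_2$). In particular the space is $n\lg c+o(n)$ bits whenever $w=o(n)$, for instance for the usual word length $w=\Theta(\lg n)$. Between operations only the memory is retained. The operations are as follows, where $i\in\{1,\dots,n\}$ and $j,l\in\{0,\dots,c-1\}$ are arbitrary. (a) init$(n,j)$, in at most $T$ steps and from arbitrary memory contents: set up the partition with $S_j=\{1,\dots,n\}$ and all other sets empty. (b) insert$(i,j)$,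 in at most $T$ steps: put $i$ into $S_j$, taking it out of the set that contained it. (c) delete$(i,j,l)$, in at most $T$ steps: if $i\in S_j$, remove $i$ from $S_j$ and, as the sets must continue to cover the universe, put it into the set $S_l$ named by the caller; otherwise change nothing. (d) search$(i,j)$, in at most $T$ steps: determine whether $i\in S_j$. (e) findany$(j)$, in at most $T$ steps: return some element of $S_j$, or NIL if $S_j=\emptyset$. (f) enumerate$(j)$, in at most $T(k+1)$ steps, where $k=|S_j|$: output every element of $S_j$ exactly once, in no particular order. -/

import Mathlib

open Filter Asymptotics

/-! ### The word RAM

Memory cells and registers hold words of `w` bits.  A program is a fixed finite text that mentions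
neither `w` nor the size of the input; every elementary instruction takes one unit of time. -/

namespace WordRAM

/-- The arithmetic, bitwise and comparison instructions. -/
inductive BinOp
  | add | sub | mul | div | mod | and | or | xor | shl | shr | eq | lt

/-- Unsigned `w`-bit arithmetic modulo `2 ^ w`; comparisons return `1` (true) or `0` (false). -/
def BinOp.eval {w : ℕ} : BinOp → BitVec w → BitVec w → BitVec w
  | .add, x, y => x + y
  | .sub, x, y => x - y
  | .mul, x, y => x * y
  | .div, x, y => x / y
  | .mod, x, y => x % y
  | .and, x, y => x &&& y
  | .or, x, y => x ||| y
  | .xor, x, y => x ^^^ y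
  | .shl, x, y => x <<< y
  | .shr, x, y => x >>> y
  | .eq, x, y => if x = y then 1#w else 0#w
  | .lt, x, y => if x.toNat < y.toNat then 1#w else 0#w

/-- An operand: a register, a constant (reduced modulo `2 ^ w`), or the word length `w`. -/
inductive Operand
  | reg (r : ℕ)
  | const (v : ℕ)
  | wordLength

/-- Programs. -/
inductive Cmd
  | skip
  /-- `r := f a b` -/
  | assign (r : ℕ) (f : BinOp) (a b : Operand)
  /-- `r := memory[a]` -/
  | load (r : ℕ) (a : Operand)
  /-- `memory[a] := b` -/
  | store (a b : Operand)
  /-- append `a` to the write-only output -/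
  | emit (a : Operand)
  | seq (p q : Cmd)
  /-- if `a` is nonzero then `p` else `q` -/
  | ite (a : Operand) (p q : Cmd)
  /-- while `a` is nonzero do `p` -/
  | loop (a : Operand) (p : Cmd)

/-- Number of registers of a machine that can hold this operand. -/
def Operand.registers : Operand → ℕ
  | .reg r => r + 1
  | .const _ => 0
  | .wordLength => 0

/-- Number of registers of a machine that can run this program. -/
def Cmd.registers : Cmd → ℕ
  | .skip => 0
  | .assign r _ a b => max (r + 1) (max a.registers b.registers)
  | .load r a => max (r + 1) a.registers
  | .store a b => max a.registers b.registers
  | .emit a => a.registers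
  | .seq p q => max p.registers q.registers
  | .ite a p q => max a.registers (max p.registers q.registers)
  | .loop a p => max a.registers p.registers

/-- A configuration: registers, memory, and what has been written to the output so far. -/
structure State (w : ℕ) where
  regs : ℕ → BitVec w
  mem : ℕ → BitVec w
  out : List (BitVec w)

/-- The value of an operand. -/
def Operand.eval {w : ℕ} (s : State w) : Operand → BitVec w
  | .reg r => s.regs r
  | .const v => BitVec.ofNat w v
  | .wordLength => BitVec.ofNat w w

/-- `Exec M p s t s'`: on a machine whose memory consists of the `M` cells `0, …, M - 1`, the
program `p`, started in `s`, halts in `s'` after `t` steps.  There is no rule for an access outside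
the memory, so a program that attempts one does not halt in this sense. -/
inductive Exec {w : ℕ} (M : ℕ) : Cmd → State w → ℕ → State w → Prop
  | skip (s : State w) : Exec M .skip s 0 s
  | assign (s : State w) (r : ℕ) (f : BinOp) (a b : Operand) :
      Exec M (.assign r f a b) s 1
        { s with regs := Function.update s.regs r (f.eval (a.eval s) (b.eval s)) }
  | load (s : State w) (r : ℕ) (a : Operand) (h : (a.eval s).toNat < M) :
      Exec M (.load r a) s 1
        { s with regs := Function.update s.regs r (s.mem (a.eval s).toNat) }
  | store (s : State w) (a b : Operand) (h : (a.eval s).toNat < M) :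
      Exec M (.store a b) s 1
        { s with mem := Function.update s.mem (a.eval s).toNat (b.eval s) }
  | emit (s : State w) (a : Operand) :
      Exec M (.emit a) s 1 { s with out := s.out ++ [a.eval s] }
  | seq {s₁ s₂ s₃ : State w} {p q : Cmd} {t₁ t₂ : ℕ}
      (hp : Exec M p s₁ t₁ s₂) (hq : Exec M q s₂ t₂ s₃) :
      Exec M (.seq p q) s₁ (t₁ + t₂) s₃
  | ite_true {s s' : State w} {a : Operand} {p : Cmd} {t : ℕ} (q : Cmd)
      (ha : a.eval s ≠ 0#w) (hp : Exec M p s t s') :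
      Exec M (.ite a p q) s (t + 1) s'
  | ite_false {s s' : State w} {a : Operand} {q : Cmd} {t : ℕ} (p : Cmd)
      (ha : a.eval s = 0#w) (hq : Exec M q s t s') :
      Exec M (.ite a p q) s (t + 1) s'
  | loop_exit {s : State w} {a : Operand} (p : Cmd) (ha : a.eval s = 0#w) :
      Exec M (.loop a p) s 1 s
  | loop_step {s₁ s₂ s₃ : State w} {a : Operand} {p : Cmd} {t₁ t₂ : ℕ}
      (ha : a.eval s₁ ≠ 0#w) (hp : Exec M p s₁ t₁ s₂) (hl : Exec M (.loop a p) s₂ t₂ s₃) :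
      Exec M (.loop a p) s₁ (t₁ + t₂ + 1) s₃

/-- Called with the words `args` in registers `0, 1, …` (the contents of all other registers being
arbitrary), with memory contents `mem` and empty output, the program `p` halts within `T` steps in a
configuration that satisfies `post`. -/
def Call {w : ℕ} (M : ℕ) (p : Cmd) (args : List (BitVec w)) (mem : ℕ → BitVec w) (T : ℕ)
    (post : State w → Prop) : Prop :=
  ∀ regs : ℕ → BitVec w, (∀ (k : ℕ) (hk : k < args.length), regs k = args[k]) →
    ∃ t s', t ≤ T ∧ Exec M p { regs := regs, mem := mem, out := [] } t s' ∧ post s'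

end WordRAM

/-! ### Collections of disjoint sets

A partition of the universe into the sets `S_j`, `j : Fin c`, is given by the map
`S : Fin n → Fin c` that sends every element to the index of the set containing it. -/

/-- The element `i` as a machine word: the universe is `{1, …, n}`, and `0` stands for NIL. -/
def eltWord (w : ℕ) {n : ℕ} (i : Fin n) : BitVec w := BitVec.ofNat w (i.val + 1)

/-- The set index `j` as a machine word. -/
def idxWord (w : ℕ) {c : ℕ} (j : Fin c) : BitVec w := BitVec.ofNat w j.val

/-- The set `S_j`. -/
def cell {n c : ℕ} (S : Fin n → Fin c) (j : Fin c) : Finset (Fin n) :=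
  Finset.univ.filter (fun i => S i = j)

/-- The programs that make up a data structure for a collection of disjoint sets. -/
structure SetCollection where
  init : WordRAM.Cmd
  insert : WordRAM.Cmd
  delete : WordRAM.Cmd
  search : WordRAM.Cmd
  findany : WordRAM.Cmd
  enumerate : WordRAM.Cmd

/-- Number of registers used by the programs. -/
def SetCollection.registers (D : SetCollection) : ℕ :=
  max D.init.registers (max D.insert.registers (max D.delete.registers
    (max D.search.registers (max D.findany.registers D.enumerate.registers))))

/-- On a machine with `M` memory cells of `w` bits, the programs of `D` maintain a partition of a
universe of size `n` into `c` sets, with time constant `T`.  Here `Rep S mem` says that the memory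
contents `mem` represent the partition `S`; nothing but the memory survives from one operation to
the next. -/
structure SetCollection.Maintains (D : SetCollection) (n c w M T : ℕ)
    (Rep : (Fin n → Fin c) → (ℕ → BitVec w) → Prop) : Prop where
  /-- `init n j`: from arbitrary memory contents, set up the partition in which `S_j` is the whole
  universe and the other sets are empty. -/
  init : ∀ (j : Fin c) (mem : ℕ → BitVec w),
    WordRAM.Call M D.init [BitVec.ofNat w n, idxWord w j] mem T fun s =>
      Rep (fun _ => j) s.mem
  /-- `insert i j`: put `i` into `S_j` (and hence take it out of the set that contained it). -/
  insert : ∀ (S : Fin n → Fin c) (mem : ℕ → BitVec w), Rep S mem → ∀ (i : Fin n) (j : Fin c),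
    WordRAM.Call M D.insert [eltWord w i, idxWord w j] mem T fun s =>
      Rep (Function.update S i j) s.mem
  /-- `delete i j l`: if `i` is in `S_j`, remove it from there; since the sets have to cover the
  universe, it goes to the set `S_l` named by the caller. -/
  delete : ∀ (S : Fin n → Fin c) (mem : ℕ → BitVec w), Rep S mem → ∀ (i : Fin n) (j l : Fin c),
    WordRAM.Call M D.delete [eltWord w i, idxWord w j, idxWord w l] mem T fun s =>
      Rep (if i ∈ cell S j then Function.update S i l else S) s.mem
  /-- `search i j`: is `i` in `S_j`? -/
  search : ∀ (S : Fin n → Fin c) (mem : ℕ → BitVec w), Rep S mem → ∀ (i : Fin n) (j : Fin c),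
    WordRAM.Call M D.search [eltWord w i, idxWord w j] mem T fun s =>
      Rep S s.mem ∧ s.regs 0 = if i ∈ cell S j then 1#w else 0#w
  /-- `findany j`: return some element of `S_j`, or NIL if `S_j` is empty. -/
  findany : ∀ (S : Fin n → Fin c) (mem : ℕ → BitVec w), Rep S mem → ∀ j : Fin c,
    WordRAM.Call M D.findany [idxWord w j] mem T fun s =>
      Rep S s.mem ∧ ((∃ i ∈ cell S j, s.regs 0 = eltWord w i) ∨ (cell S j = ∅ ∧ s.regs 0 = 0#w))
  /-- `enumerate j`: output the elements of `S_j`, each exactly once, in some order. -/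
  enumerate : ∀ (S : Fin n → Fin c) (mem : ℕ → BitVec w), Rep S mem → ∀ j : Fin c,
    WordRAM.Call M D.enumerate [idxWord w j] mem (T * ((cell S j).card + 1)) fun s =>
      Rep S s.mem ∧ ∃ l : List (Fin n), l.Nodup ∧ l.toFinset = cell S j ∧ s.out = l.map (eltWord w)

/-! Call the index of the set containing an element its colour. Cut the universe into leaves of `d =
2 ^ t` elements, `t` being least with `w ≤ (2 ^ t) ^ 8`, and store the colours of a leaf as a
base-`c` number in `f ≤ d * lg c + t + 1` bits. Leaves are packed into words and grouped into blocks
of about `w / h` leaves, where `h = 8 + 8 * t`. For each block and each colour, one word tells which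
leaves of the block contain the colour, and two words serve a list of the blocks in which the colour
occurs. A query descends from the list to a block, a leaf and an element. These O(c) words per block
amount to O(c * (t + 1)) bits per leaf, hence to O(c * n * (t + 1) / 2 ^ t) bits in all. Since `n <
2 ^ w` and `w ≤ 2 ^ (8 * t)`, `log log n ≤ 8 * t`, and the overhead is bounded by an o(n) term that
does not mention `w` (`space_le`, `low_le`).

Leaves are processed in constant time by word parallelism. With `k = 2 * f + 2`, `2 ^ k` is
congruent to `c` modulo `2 ^ k - c`, so one reduction turns spread-out digits into a base-`c`
number. Conversely, if `x / c ^ d` is stored as a binary fraction with `f` bits, a single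
multiplication gives all the quotients `x / c ^ p` at once (`Codec.field_div`, `Codec.floors`,
`Codec.digits`). Places with a given colour are found by xor and guard bits (`zero_fields`), and the
index of a one bit comes from a reduction modulo `2 ^ k - 1` (`log_eq`). In all programs `c` occurs
only inside constants, so the time bound is the same for all `c` (`timeK_eq`).

Initialisation in constant time relies on arrays that tolerate arbitrary contents. Colour lists are
sparse sets with mutual pointers (`SpInv`). A block that was never touched consists of the initial
colour `j0` only; to find and list such blocks, the touched and untouched blocks are kept as an
implicit permutation (`LzInv`).

The remaining obstacle is that `t` has no evident constant-time formula. So every insertion doubles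
the leaf size once, until `d ^ 8` reaches `w`. Meanwhile the few inserted elements live in an early
structure (`EInv`), essentially two words of packed keys and colours. After that, each insertion
also moves one early entry to the main structure, until the early structure can be dropped
(`wp_ins`). It needs the universe not to be too small; a tiny universe is a single leaf whose
parameters have closed formulas (`tiny_spec`).

Programs are written over the natural numbers, compiled to the machine and verified by weakest
preconditions (`wp_sound`) and a loop rule (`Tr.while_list`). `maintains` collects the six
operations, `big_spec` chooses the parameters. -/

namespace SetColl
open WordRAM

/-! ### A structured language over natural numbers -/

/-- Logical memory locations. -/
inductive Loc
  | hdr (i : ℕ) | cnt (j : ℕ) | es (k : ℕ) | ed (k : ℕ)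
  | ta (b : ℕ) | tb (b : ℕ) | li (b : ℕ) | dn (j b : ℕ) | sp (j b : ℕ) | sm (j b : ℕ) | lf (i : ℕ)
  deriving DecidableEq

/-- A placement of the logical locations in the memory of a machine. -/
structure Lay where
  w : ℕ
  M : ℕ
  addr : Loc → ℕ
  valid : Loc → Prop
  lt : ∀ l, valid l → addr l < M
  inj : ∀ l l', valid l → valid l' → addr l = addr l' → l = l'

/-- Abstract states: registers, logical memory, output. -/
structure St where
  ρ : ℕ → ℕ
  m : Loc → ℕ
  out : List ℕ

def St.set (σ : St) (r v : ℕ) : St := { σ with ρ := Function.update σ.ρ r v }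
def St.sto (σ : St) (l : Loc) (v : ℕ) : St := { σ with m := Function.update σ.m l v }
def St.emit (σ : St) (v : ℕ) : St := { σ with out := σ.out ++ [v] }

@[simp] theorem St.set_m (σ : St) (r v : ℕ) : (σ.set r v).m = σ.m := rfl
@[simp] theorem St.set_out (σ : St) (r v : ℕ) : (σ.set r v).out = σ.out := rfl
@[simp] theorem St.set_ρ_self (σ : St) (r v : ℕ) : (σ.set r v).ρ r = v := by simp [St.set]
@[simp] theorem St.set_ρ_ne (σ : St) (r v r' : ℕ) (h : r' ≠ r) : (σ.set r v).ρ r' = σ.ρ r' := by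
  simp [St.set, h]
@[simp] theorem St.sto_ρ (σ : St) (l : Loc) (v : ℕ) : (σ.sto l v).ρ = σ.ρ := rfl
@[simp] theorem St.sto_out (σ : St) (l : Loc) (v : ℕ) : (σ.sto l v).out = σ.out := rfl
@[simp] theorem St.sto_m_self (σ : St) (l : Loc) (v : ℕ) : (σ.sto l v).m l = v := by
  simp [St.sto]
@[simp] theorem St.sto_m_ne (σ : St) (l l' : Loc) (v : ℕ) (h : l' ≠ l) :
    (σ.sto l v).m l' = σ.m l' := by simp [St.sto, h]
@[simp] theorem St.emit_ρ (σ : St) (v : ℕ) : (σ.emit v).ρ = σ.ρ := rfl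
@[simp] theorem St.emit_m (σ : St) (v : ℕ) : (σ.emit v).m = σ.m := rfl
@[simp] theorem St.emit_out (σ : St) (v : ℕ) : (σ.emit v).out = σ.out ++ [v] := rfl

/-- Expressions. -/
inductive Ex
  | reg (r : ℕ) | cst (v : ℕ) | wl
  | bin (f : BinOp) (a b : Ex)
  | ld (a : Ex)
  | cond (a x y : Ex)

instance (n : ℕ) : OfNat Ex n := ⟨.cst n⟩
instance : Add Ex := ⟨.bin .add⟩
instance : Sub Ex := ⟨.bin .sub⟩
instance : Mul Ex := ⟨.bin .mul⟩
instance : Div Ex := ⟨.bin .div⟩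
instance : Mod Ex := ⟨.bin .mod⟩
instance : HShiftLeft Ex Ex Ex := ⟨.bin .shl⟩
instance : HShiftRight Ex Ex Ex := ⟨.bin .shr⟩
instance : HAnd Ex Ex Ex := ⟨.bin .and⟩
instance : HOr Ex Ex Ex := ⟨.bin .or⟩
instance : HXor Ex Ex Ex := ⟨.bin .xor⟩
def Ex.eq (a b : Ex) : Ex := .bin .eq a b
def Ex.lt (a b : Ex) : Ex := .bin .lt a b

/-- The operations on natural numbers. -/
def opVal : BinOp → ℕ → ℕ → ℕ
  | .add, x, y => x + y
  | .sub, x, y => x - y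
  | .mul, x, y => x * y
  | .div, x, y => x / y
  | .mod, x, y => x % y
  | .and, x, y => x &&& y
  | .or, x, y => x ||| y
  | .xor, x, y => x ^^^ y
  | .shl, x, y => x * 2 ^ y
  | .shr, x, y => x / 2 ^ y
  | .eq, x, y => if x = y then 1 else 0
  | .lt, x, y => if x < y then 1 else 0

/-- No overflow occurs. -/
def opOk (w : ℕ) : BinOp → ℕ → ℕ → Prop
  | .add, x, y => x + y < 2 ^ w
  | .sub, x, y => y ≤ x
  | .mul, x, y => x * y < 2 ^ w
  | .shl, x, y => x * 2 ^ y < 2 ^ w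
  | _, _, _ => True

/-- Reduction modulo `2 ^ w` is invisible as long as nothing overflows, so all later reasoning can
take place over `ℕ`. A positive word length is needed for comparisons, whose result `1` must be
representable. -/
theorem toNat_eval {w : ℕ} (hw : 1 ≤ w) (f : BinOp) (x y : BitVec w)
    (h : opOk w f x.toNat y.toNat) : (f.eval x y).toNat = opVal f x.toNat y.toNat := by
  have h1 : 1 < 2 ^ w := Nat.one_lt_two_pow (by omega)
  cases f <;> simp only [opOk, BinOp.eval, opVal] at *
  · rw [BitVec.toNat_add, Nat.mod_eq_of_lt h]
  · rw [BitVec.toNat_sub_of_le (by simpa [BitVec.le_def] using h)]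
  · rw [BitVec.toNat_mul, Nat.mod_eq_of_lt h]
  · simp
  · simp
  · simp
  · simp
  · simp
  · simp only [BitVec.shiftLeft_eq', BitVec.toNat_shiftLeft, Nat.shiftLeft_eq]
    rw [Nat.mod_eq_of_lt h]
  · simp only [BitVec.ushiftRight_eq', BitVec.toNat_ushiftRight, Nat.shiftRight_eq_div_pow]
  · by_cases hxy : x = y
    · simp [hxy, Nat.mod_eq_of_lt h1]
    · have : x.toNat ≠ y.toNat := fun h => hxy (BitVec.eq_of_toNat_eq h)
      simp [hxy, this]
  · by_cases hxy : x.toNat < y.toNat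
    · simp [hxy, Nat.mod_eq_of_lt h1]
    · simp [hxy]

open Classical in
/-- The location with a given address. -/
noncomputable def Lay.dec (L : Lay) (a : ℕ) : Loc :=
  -- The default is a dummy: loads and stores are admitted only at addresses satisfying
  -- `Lay.isAddr`.
  if h : ∃ l, L.valid l ∧ L.addr l = a then h.choose else .hdr 0

theorem Lay.dec_addr (L : Lay) {l : Loc} (h : L.valid l) : L.dec (L.addr l) = l := by
  have h' : ∃ l', L.valid l' ∧ L.addr l' = L.addr l := ⟨l, h, rfl⟩
  unfold Lay.dec
  rw [dif_pos h']
  exact L.inj _ _ h'.choose_spec.1 h h'.choose_spec.2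

def Lay.isAddr (L : Lay) (a : ℕ) : Prop := ∃ l, L.valid l ∧ L.addr l = a

noncomputable def Ex.val (L : Lay) (σ : St) : Ex → ℕ
  | .reg r => σ.ρ r
  | .cst v => v
  | .wl => L.w
  | .bin f a b => opVal f (a.val L σ) (b.val L σ)
  | .ld a => σ.m (L.dec (a.val L σ))
  | .cond a x y => if a.val L σ = 0 then y.val L σ else x.val L σ

/-- Registers from 64 on are reserved for the temporaries of compiled expressions. In a conditional
only the selected branch has to be evaluable, so an index read from uninitialised memory may be used
behind a bounds test. -/
def Ex.ok (L : Lay) (σ : St) : Ex → Prop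
  | .reg r => r < 64
  | .cst v => v < 2 ^ L.w
  | .wl => True
  | .bin f a b => a.ok L σ ∧ b.ok L σ ∧ opOk L.w f (a.val L σ) (b.val L σ)
  | .ld a => a.ok L σ ∧ L.isAddr (a.val L σ)
  | .cond a x y => a.ok L σ ∧ (a.val L σ ≠ 0 → x.ok L σ) ∧ (a.val L σ = 0 → y.ok L σ)

/-- Charging both branches of a conditional makes the cost a function of the shape of the expression
alone, independent of the state and of the constants in it. -/
def Ex.cost : Ex → ℕ
  | .reg _ => 1
  | .cst _ => 1
  | .wl => 1
  | .bin _ a b => a.cost + b.cost + 1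
  | .ld a => a.cost + 1
  | .cond a x y => a.cost + (x.cost + y.cost) + 1

/-- Code that leaves the value of an expression in register `t`, using only registers from `t`
on. -/
def Ex.compile : Ex → ℕ → Cmd
  | .reg r, t => .assign t .add (.reg r) (.const 0)
  | .cst v, t => .assign t .add (.const v) (.const 0)
  | .wl, t => .assign t .add .wordLength (.const 0)
  | .bin f a b, t => .seq (.seq (a.compile t) (b.compile (t + 1))) (.assign t f (.reg t) (.reg (t + 1)))
  | .ld a, t => .seq (a.compile t) (.load t (.reg t))
  | .cond a x y, t => .seq (a.compile t) (.ite (.reg t) (x.compile t) (y.compile t))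

/-- The machine state `s` is described by the abstract state `σ`. -/
structure Lay.Sim (L : Lay) (s : State L.w) (σ : St) : Prop where
  regs : ∀ r < 64, (s.regs r).toNat = σ.ρ r
  mem : ∀ l, L.valid l → (s.mem (L.addr l)).toNat = σ.m l
  out : s.out.map BitVec.toNat = σ.out

theorem Lay.Sim.of_regs {L : Lay} {s s' : State L.w} {σ : St} (h : L.Sim s σ) {t : ℕ} (ht : 64 ≤ t)
    (hr : ∀ r < t, s'.regs r = s.regs r) (hm : s'.mem = s.mem) (ho : s'.out = s.out) :
    L.Sim s' σ :=
  ⟨fun r hr' => by rw [hr r (by omega), h.regs r hr'], fun l hl => by rw [hm, h.mem l hl],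
    by rw [ho, h.out]⟩

/-- Only registers from `t` on are changed. This preserves the simulation relation, which sees
registers below 64, and protects the left operand of a binary operation in register `t` while the
right one is computed from `t + 1` on. -/
theorem Ex.compile_spec (L : Lay) (hw : 1 ≤ L.w) (e : Ex) : ∀ (t : ℕ), 64 ≤ t →
    ∀ (s : State L.w) (σ : St), L.Sim s σ → e.ok L σ →
    ∃ s' n, n ≤ e.cost ∧ Exec L.M (e.compile t) s n s' ∧ (s'.regs t).toNat = e.val L σ ∧
      (∀ r < t, s'.regs r = s.regs r) ∧ s'.mem = s.mem ∧ s'.out = s.out := by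
  induction e with
  | reg r =>
    intro t ht s σ h hok
    refine ⟨_, 1, le_rfl, Exec.assign _ _ _ _ _, ?_, ?_, rfl, rfl⟩
    · simp [Operand.eval, BinOp.eval, Ex.val, h.regs r hok]
    · intro r' hr'; simp [Function.update_of_ne (ne_of_lt hr')]
  | cst v =>
    intro t ht s σ h hok
    refine ⟨_, 1, le_rfl, Exec.assign _ _ _ _ _, ?_, ?_, rfl, rfl⟩
    · simpa [Operand.eval, BinOp.eval, Ex.val] using Nat.mod_eq_of_lt hok
    · intro r' hr'; simp [Function.update_of_ne (ne_of_lt hr')]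
  | wl =>
    intro t ht s σ h hok
    refine ⟨_, 1, le_rfl, Exec.assign _ _ _ _ _, ?_, ?_, rfl, rfl⟩
    · simp [Operand.eval, BinOp.eval, Ex.val, Nat.mod_eq_of_lt (Nat.lt_two_pow_self (n := L.w))]
    · intro r' hr'; simp [Function.update_of_ne (ne_of_lt hr')]
  | bin f a b iha ihb =>
    intro t ht s σ h hok
    obtain ⟨s1, n1, hn1, he1, hv1, hr1, hm1, ho1⟩ := iha t ht s σ h hok.1
    have h1 := h.of_regs ht hr1 hm1 ho1
    obtain ⟨s2, n2, hn2, he2, hv2, hr2, hm2, ho2⟩ := ihb (t + 1) (by omega) s1 σ h1 hok.2.1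
    refine ⟨_, n1 + n2 + 1, ?_, Exec.seq (Exec.seq he1 he2) (Exec.assign _ _ _ _ _), ?_, ?_, ?_, ?_⟩
    · simp only [Ex.cost]; omega
    · simp only [Function.update_self, Operand.eval, Ex.val]
      rw [toNat_eval hw]
      · rw [hr2 t (by omega), hv1, hv2]
      · rw [hr2 t (by omega), hv1, hv2]; exact hok.2.2
    · intro r hr
      simp [Function.update_of_ne (ne_of_lt hr), hr2 r (by omega), hr1 r hr]
    · simp [hm1, hm2]
    · simp [ho1, ho2]
  | ld a iha =>
    intro t ht s σ h hok
    obtain ⟨s1, n1, hn1, he1, hv1, hr1, hm1, ho1⟩ := iha t ht s σ h hok.1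
    obtain ⟨l, hl, hla⟩ := hok.2
    have h1 := h.of_regs ht hr1 hm1 ho1
    refine ⟨_, n1 + 1, ?_, Exec.seq he1 (Exec.load _ _ _ ?_), ?_, ?_, ?_, ?_⟩
    · simp only [Ex.cost]; omega
    · simp only [Operand.eval, hv1, ← hla]; exact L.lt l hl
    · simp only [Function.update_self, Operand.eval, Ex.val, hv1, ← hla, h1.mem l hl, L.dec_addr hl]
    · intro r hr
      simp [Function.update_of_ne (ne_of_lt hr), hr1 r hr]
    · simp [hm1]
    · simp [ho1]
  | cond a x y iha ihx ihy =>
    intro t ht s σ h hok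
    obtain ⟨s1, n1, hn1, he1, hv1, hr1, hm1, ho1⟩ := iha t ht s σ h hok.1
    have h1 := h.of_regs ht hr1 hm1 ho1
    by_cases ha : a.val L σ = 0
    · obtain ⟨s2, n2, hn2, he2, hv2, hr2, hm2, ho2⟩ := ihy t ht s1 σ h1 (hok.2.2 ha)
      refine ⟨s2, n1 + (n2 + 1), ?_, Exec.seq he1 (Exec.ite_false _ ?_ he2), ?_, ?_, ?_, ?_⟩
      · simp only [Ex.cost]; omega
      · apply BitVec.eq_of_toNat_eq; simp [Operand.eval, hv1, ha]
      · simp [Ex.val, ha, hv2]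
      · intro r hr; rw [hr2 r hr, hr1 r hr]
      · rw [hm2, hm1]
      · rw [ho2, ho1]
    · obtain ⟨s2, n2, hn2, he2, hv2, hr2, hm2, ho2⟩ := ihx t ht s1 σ h1 (hok.2.1 ha)
      refine ⟨s2, n1 + (n2 + 1), ?_, Exec.seq he1 (Exec.ite_true _ ?_ he2), ?_, ?_, ?_, ?_⟩
      · simp only [Ex.cost]; omega
      · intro h0; apply ha; rw [← hv1]
        have := congrArg BitVec.toNat h0
        simpa [Operand.eval] using this
      · simp [Ex.val, ha, hv2]
      · intro r hr; rw [hr2 r hr, hr1 r hr]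
      · rw [hm2, hm1]
      · rw [ho2, ho1]

/-- Programs. -/
inductive Pg
  | skip
  | set (r : ℕ) (e : Ex)
  | sto (a e : Ex)
  | emit (e : Ex)
  | seq (p q : Pg)
  | ite (e : Ex) (p q : Pg)
  | whl (e : Ex) (p : Pg)

def Pg.compile : Pg → Cmd
  | .skip => .skip
  | .set r e => .seq (e.compile 64) (.assign r .add (.reg 64) (.const 0))
  | .sto a e => .seq (.seq (a.compile 64) (e.compile 65)) (.store (.reg 64) (.reg 65))
  | .emit e => .seq (e.compile 64) (.emit (.reg 64))
  | .seq p q => .seq p.compile q.compile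
  | .ite e p q => .seq (e.compile 64) (.ite (.reg 64) p.compile q.compile)
  | .whl e p => .seq (e.compile 64) (.loop (.reg 64) (.seq p.compile (e.compile 64)))

/-- A bound for the running time of a loop-free program. -/
def Pg.cost : Pg → ℕ
  | .skip => 0
  | .set _ e => e.cost + 1
  | .sto a e => a.cost + e.cost + 1
  | .emit e => e.cost + 1
  | .seq p q => p.cost + q.cost
  | .ite e p q => e.cost + (p.cost + q.cost) + 1
  | .whl _ _ => 0

/-- Weakest preconditions of loop-free programs. -/
def wp (L : Lay) : Pg → (St → Prop) → St → Prop
  | .skip, Q, σ => Q σ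
  | .set r e, Q, σ => r < 64 ∧ e.ok L σ ∧ Q (σ.set r (e.val L σ))
  | .sto a e, Q, σ => a.ok L σ ∧ e.ok L σ ∧ L.isAddr (a.val L σ) ∧
      Q (σ.sto (L.dec (a.val L σ)) (e.val L σ))
  | .emit e, Q, σ => e.ok L σ ∧ Q (σ.emit (e.val L σ))
  | .seq p q, Q, σ => wp L p (wp L q Q) σ
  | .ite e p q, Q, σ => e.ok L σ ∧ (e.val L σ ≠ 0 → wp L p Q σ) ∧ (e.val L σ = 0 → wp L q Q σ)
  | .whl _ _, _, _ => False

/-- Started in a machine state described by `σ`, the program halts within `t` steps in a machine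
state described by some `σ'` that satisfies `Q`. -/
def Tr (L : Lay) (p : Pg) (σ : St) (t : ℕ) (Q : St → Prop) : Prop :=
  ∀ s, L.Sim s σ → ∃ s' n σ', n ≤ t ∧ Exec L.M p.compile s n s' ∧ L.Sim s' σ' ∧ Q σ'

theorem Tr.mono {L : Lay} {p : Pg} {σ : St} {t t' : ℕ} {Q Q' : St → Prop} (h : Tr L p σ t Q)
    (ht : t ≤ t') (hQ : ∀ σ, Q σ → Q' σ) : Tr L p σ t' Q' := by
  intro s hs
  obtain ⟨s', n, σ', hn, he, h1, h2⟩ := h s hs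
  exact ⟨s', n, σ', hn.trans ht, he, h1, hQ _ h2⟩

theorem Tr.seq {L : Lay} {p q : Pg} {σ : St} {t t' : ℕ} {Q R : St → Prop}
    (h : Tr L p σ t R) (h' : ∀ σ', R σ' → Tr L q σ' t' Q) : Tr L (.seq p q) σ (t + t') Q := by
  intro s hs
  obtain ⟨s1, n1, σ1, hn1, he1, h1, h2⟩ := h s hs
  obtain ⟨s2, n2, σ2, hn2, he2, h3, h4⟩ := h' σ1 h2 s1 h1
  exact ⟨s2, n1 + n2, σ2, by omega, Exec.seq he1 he2, h3, h4⟩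

theorem Ex.run (L : Lay) (hw : 1 ≤ L.w) (e : Ex) {s : State L.w} {σ : St} (h : L.Sim s σ)
    (hok : e.ok L σ) : ∃ s' n, n ≤ e.cost ∧ Exec L.M (e.compile 64) s n s' ∧
      (s'.regs 64).toNat = e.val L σ ∧ L.Sim s' σ := by
  obtain ⟨s1, n1, hn1, he1, hv1, hr1, hm1, ho1⟩ := e.compile_spec L hw 64 le_rfl s σ h hok
  exact ⟨s1, n1, hn1, he1, hv1, h.of_regs le_rfl hr1 hm1 ho1⟩

theorem reg_eq_zero_iff {L : Lay} {s : State L.w} {v : ℕ} (h : (s.regs 64).toNat = v) :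
    (Operand.reg 64).eval s = 0#L.w ↔ v = 0 := by
  constructor
  · intro h0
    rw [← h]; simpa [Operand.eval] using congrArg BitVec.toNat h0
  · intro h0
    apply BitVec.eq_of_toNat_eq; simp [Operand.eval, h, h0]

theorem wp_sound {L : Lay} (hw : 1 ≤ L.w) (p : Pg) : ∀ {Q : St → Prop} {σ : St},
    wp L p Q σ → Tr L p σ p.cost Q := by
  induction p with
  | skip => intro Q σ h s hs; exact ⟨s, 0, σ, le_rfl, Exec.skip _, hs, h⟩
  | set r e =>
    intro Q σ h s hs
    obtain ⟨s1, n1, hn1, he1, hv1, h1⟩ := e.run L hw hs h.2.1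
    refine ⟨_, n1 + 1, _, ?_, Exec.seq he1 (Exec.assign _ _ _ _ _), ?_, h.2.2⟩
    · simp only [Pg.cost]; omega
    · refine ⟨fun r' hr' => ?_, fun l hl => h1.mem l hl, h1.out⟩
      by_cases hrr : r' = r
      · subst hrr; simp [Operand.eval, BinOp.eval, hv1]
      · simp [hrr, h1.regs r' hr']
  | sto a e =>
    intro Q σ h s hs
    obtain ⟨h1, h2, ⟨l, hl, hla⟩, h3⟩ := h
    obtain ⟨s1, n1, hn1, he1, hv1, hr1, hm1, ho1⟩ := a.compile_spec L hw 64 le_rfl s σ hs h1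
    have hs1 := hs.of_regs le_rfl hr1 hm1 ho1
    obtain ⟨s2, n2, hn2, he2, hv2, hr2, hm2, ho2⟩ :=
      e.compile_spec L hw 65 (by norm_num) s1 σ hs1 h2
    have hs2 := hs1.of_regs (t := 65) (by norm_num) hr2 hm2 ho2
    have ha : (s2.regs 64).toNat = L.addr l := by rw [hr2 64 (by norm_num), hv1, hla]
    refine ⟨_, n1 + n2 + 1, _, ?_, Exec.seq (Exec.seq he1 he2) (Exec.store _ _ _ ?_), ?_, h3⟩
    · simp only [Pg.cost]; omega
    · simp only [Operand.eval, ha]; exact L.lt l hl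
    · refine ⟨fun r hr => hs2.regs r hr, fun l' hl' => ?_, hs2.out⟩
      rw [← hla, L.dec_addr hl]
      simp only [Operand.eval, ha]
      by_cases hll : l' = l
      · subst hll; simp [hv2]
      · have : L.addr l' ≠ L.addr l := fun h => hll (L.inj _ _ hl' hl h)
        simp [hll, this, hs2.mem l' hl']
  | emit e =>
    intro Q σ h s hs
    obtain ⟨s1, n1, hn1, he1, hv1, h1⟩ := e.run L hw hs h.1
    refine ⟨_, n1 + 1, _, ?_, Exec.seq he1 (Exec.emit _ _), ?_, h.2⟩
    · simp only [Pg.cost]; omega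
    · refine ⟨fun r' hr' => h1.regs r' hr', fun l hl => h1.mem l hl, ?_⟩
      simp [Operand.eval, hv1, h1.out]
  | seq p q ihp ihq =>
    intro Q σ h
    exact (ihp h).seq fun σ' h' => ihq h'
  | ite e p q ihp ihq =>
    intro Q σ h s hs
    obtain ⟨s1, n1, hn1, he1, hv1, h1⟩ := e.run L hw hs h.1
    by_cases h0 : e.val L σ = 0
    · obtain ⟨s2, n2, σ2, hn2, he2, h2, hq⟩ := ihq (h.2.2 h0) s1 h1
      refine ⟨s2, n1 + (n2 + 1), σ2, ?_, Exec.seq he1 (Exec.ite_false _ ?_ he2), h2, hq⟩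
      · simp only [Pg.cost]; omega
      · exact (reg_eq_zero_iff hv1).2 h0
    · obtain ⟨s2, n2, σ2, hn2, he2, h2, hq⟩ := ihp (h.2.1 h0) s1 h1
      refine ⟨s2, n1 + (n2 + 1), σ2, ?_, Exec.seq he1 (Exec.ite_true _ ?_ he2), h2, hq⟩
      · simp only [Pg.cost]; omega
      · exact fun h => h0 ((reg_eq_zero_iff hv1).1 h)
  | whl e p => intro Q σ h; exact h.elim

/-- The invariant is indexed by the list of the work items that remain, which serves as termination
measure and as account for the running time: each item pays for its own pass and for one evaluation
of the guard. -/
theorem Tr.while_list {L : Lay} (hw : 1 ≤ L.w) {α : Type*} {e : Ex} {p : Pg}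
    {I : List α → St → Prop} {ct : α → ℕ}
    (h0 : ∀ σ, I [] σ → e.ok L σ ∧ e.val L σ = 0)
    (h1 : ∀ a l σ, I (a :: l) σ → e.ok L σ ∧ e.val L σ ≠ 0 ∧ Tr L p σ (ct a) (I l))
    (l : List α) (σ : St) (h : I l σ) :
    Tr L (.whl e p) σ (e.cost + 1 + (l.map fun a => ct a + e.cost + 1).sum) (I []) := by
  -- The compiled loop tests register 64, so the induction carries along that this register holds
  -- the current value of the guard.
  have key : ∀ (l : List α) (σ : St), I l σ → ∀ s, L.Sim s σ → (s.regs 64).toNat = e.val L σ →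
      ∃ s' n σ', n ≤ 1 + (l.map fun a => ct a + e.cost + 1).sum ∧
        Exec L.M (.loop (.reg 64) (.seq p.compile (e.compile 64))) s n s' ∧ L.Sim s' σ' ∧
        I [] σ' := by
    intro l
    induction l with
    | nil =>
      intro σ h s hs hv
      exact ⟨s, 1, σ, by simp, Exec.loop_exit _ ((reg_eq_zero_iff hv).2 (h0 σ h).2), hs, h⟩
    | cons a l ih =>
      intro σ h s hs hv
      obtain ⟨_, hne, ht⟩ := h1 a l σ h
      obtain ⟨s1, n1, σ1, hn1, he1, hs1, hI⟩ := ht s hs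
      have hok : e.ok L σ1 := by
        cases l with
        | nil => exact (h0 σ1 hI).1
        | cons b l => exact (h1 b l σ1 hI).1
      obtain ⟨s2, n2, hn2, he2, hv2, hs2⟩ := e.run L hw hs1 hok
      obtain ⟨s3, n3, σ3, hn3, he3, hs3, hI3⟩ := ih σ1 hI s2 hs2 hv2
      refine ⟨s3, n1 + n2 + n3 + 1, σ3, ?_,
        Exec.loop_step (fun h => hne ((reg_eq_zero_iff hv).1 h)) (Exec.seq he1 he2) he3, hs3, hI3⟩
      simp only [List.map_cons, List.sum_cons]; omega
  intro s hs
  have hok : e.ok L σ := by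
    cases l with
    | nil => exact (h0 σ h).1
    | cons b l => exact (h1 b l σ h).1
  obtain ⟨s1, n1, hn1, he1, hv1, hs1⟩ := e.run L hw hs hok
  obtain ⟨s2, n2, σ2, hn2, he2, hs2, hI⟩ := key l σ h s1 hs1 hv1
  exact ⟨s2, n1 + n2, σ2, by omega, Exec.seq he1 he2, hs2, hI⟩

/-! ### Values and admissibility of compound expressions. -/

section
variable (L : Lay) (σ : St) (a b x y : Ex)
@[simp] theorem val_add : (a + b).val L σ = a.val L σ + b.val L σ := rfl
@[simp] theorem val_sub : (a - b).val L σ = a.val L σ - b.val L σ := rfl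
@[simp] theorem val_mul : (a * b).val L σ = a.val L σ * b.val L σ := rfl
@[simp] theorem val_div : (a / b).val L σ = a.val L σ / b.val L σ := rfl
@[simp] theorem val_mod : (a % b).val L σ = a.val L σ % b.val L σ := rfl
@[simp] theorem val_shl : (a <<< b).val L σ = a.val L σ * 2 ^ b.val L σ := rfl
@[simp] theorem val_shr : (a >>> b).val L σ = a.val L σ / 2 ^ b.val L σ := rfl
@[simp] theorem val_and : (a &&& b).val L σ = a.val L σ &&& b.val L σ := rfl
@[simp] theorem val_or : (a ||| b).val L σ = a.val L σ ||| b.val L σ := rfl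
@[simp] theorem val_xor : (a ^^^ b).val L σ = a.val L σ ^^^ b.val L σ := rfl
@[simp] theorem val_eq : (Ex.eq a b).val L σ = if a.val L σ = b.val L σ then 1 else 0 := rfl
@[simp] theorem val_lt : (Ex.lt a b).val L σ = if a.val L σ < b.val L σ then 1 else 0 := rfl
@[simp] theorem val_cond : (Ex.cond a x y).val L σ =
    if a.val L σ = 0 then y.val L σ else x.val L σ := rfl
theorem val_ld {l : Loc} (hl : L.valid l) (h : a.val L σ = L.addr l) :
    (Ex.ld a).val L σ = σ.m l := by rw [Ex.val, h, L.dec_addr hl]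

@[simp] theorem ok_reg (r : ℕ) : (Ex.reg r).ok L σ ↔ r < 64 := Iff.rfl
@[simp] theorem ok_add : (a + b).ok L σ ↔ a.ok L σ ∧ b.ok L σ ∧ a.val L σ + b.val L σ < 2 ^ L.w :=
  Iff.rfl
@[simp] theorem ok_sub : (a - b).ok L σ ↔ a.ok L σ ∧ b.ok L σ ∧ b.val L σ ≤ a.val L σ := Iff.rfl
@[simp] theorem ok_mul : (a * b).ok L σ ↔ a.ok L σ ∧ b.ok L σ ∧ a.val L σ * b.val L σ < 2 ^ L.w :=
  Iff.rfl
@[simp] theorem ok_div : (a / b).ok L σ ↔ a.ok L σ ∧ b.ok L σ :=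
  ⟨fun h => ⟨h.1, h.2.1⟩, fun h => ⟨h.1, h.2, trivial⟩⟩
@[simp] theorem ok_mod : (a % b).ok L σ ↔ a.ok L σ ∧ b.ok L σ :=
  ⟨fun h => ⟨h.1, h.2.1⟩, fun h => ⟨h.1, h.2, trivial⟩⟩
@[simp] theorem ok_shl : (a <<< b).ok L σ ↔
    a.ok L σ ∧ b.ok L σ ∧ a.val L σ * 2 ^ b.val L σ < 2 ^ L.w := Iff.rfl
@[simp] theorem ok_shr : (a >>> b).ok L σ ↔ a.ok L σ ∧ b.ok L σ :=
  ⟨fun h => ⟨h.1, h.2.1⟩, fun h => ⟨h.1, h.2, trivial⟩⟩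
@[simp] theorem ok_and : (a &&& b).ok L σ ↔ a.ok L σ ∧ b.ok L σ :=
  ⟨fun h => ⟨h.1, h.2.1⟩, fun h => ⟨h.1, h.2, trivial⟩⟩
@[simp] theorem ok_or : (a ||| b).ok L σ ↔ a.ok L σ ∧ b.ok L σ :=
  ⟨fun h => ⟨h.1, h.2.1⟩, fun h => ⟨h.1, h.2, trivial⟩⟩
@[simp] theorem ok_xor : (a ^^^ b).ok L σ ↔ a.ok L σ ∧ b.ok L σ :=
  ⟨fun h => ⟨h.1, h.2.1⟩, fun h => ⟨h.1, h.2, trivial⟩⟩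
@[simp] theorem ok_eq : (Ex.eq a b).ok L σ ↔ a.ok L σ ∧ b.ok L σ :=
  ⟨fun h => ⟨h.1, h.2.1⟩, fun h => ⟨h.1, h.2, trivial⟩⟩
@[simp] theorem ok_lt : (Ex.lt a b).ok L σ ↔ a.ok L σ ∧ b.ok L σ :=
  ⟨fun h => ⟨h.1, h.2.1⟩, fun h => ⟨h.1, h.2, trivial⟩⟩
@[simp] theorem ok_cond : (Ex.cond a x y).ok L σ ↔
    a.ok L σ ∧ (a.val L σ ≠ 0 → x.ok L σ) ∧ (a.val L σ = 0 → y.ok L σ) := Iff.rfl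
theorem ok_ld {l : Loc} (ha : a.ok L σ) (hl : L.valid l) (h : a.val L σ = L.addr l) :
    (Ex.ld a).ok L σ := ⟨ha, l, hl, h.symm⟩

theorem wp_sto {l : Loc} (Q : St → Prop) (hl : L.valid l) (ha : a.ok L σ)
    (h : a.val L σ = L.addr l) (hb : b.ok L σ) (hQ : Q (σ.sto l (b.val L σ))) :
    wp L (.sto a b) Q σ :=
  ⟨ha, hb, ⟨l, hl, h.symm⟩, by rw [h, L.dec_addr hl]; exact hQ⟩
end

/-! ### Packed numbers -/

/-- The number with the fields `a 0, …, a (m - 1)` at the offsets `o 0, …, o (m - 1)`. -/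
def pk (o a : ℕ → ℕ) (m : ℕ) : ℕ := ∑ s ∈ Finset.range m, a s * 2 ^ o s

/-- Consecutive offsets differ by at least `g`. -/
def Sep (o : ℕ → ℕ) (g m : ℕ) : Prop := ∀ s, s + 1 < m → o s + g ≤ o (s + 1)

theorem Sep.pred {o : ℕ → ℕ} {g m : ℕ} (h : Sep o g (m + 1)) : Sep o g m :=
  fun s hs => h s (by omega)

theorem Sep.mono {o : ℕ → ℕ} {g g' m : ℕ} (h : Sep o g m) (hg : g' ≤ g) : Sep o g' m :=
  fun s hs => by have := h s hs; omega

theorem sep_mul {k g m : ℕ} (h : g ≤ k) : Sep (fun s => k * s) g m :=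
  fun s _ => by simp only [Nat.mul_add]; omega

theorem Sep.add_le {o : ℕ → ℕ} {g m : ℕ} (h : Sep o g m) {s t : ℕ} (hst : s < t) (ht : t < m) :
    o s + g ≤ o t := by
  induction t, hst using Nat.le_induction with
  | base => exact h s ht
  | succ t hst ih => have := ih (by omega); have := h t (by omega); omega

theorem pk_succ (o a : ℕ → ℕ) (m : ℕ) : pk o a (m + 1) = pk o a m + a m * 2 ^ o m :=
  Finset.sum_range_succ _ _

theorem pk_zero (o a : ℕ → ℕ) : pk o a 0 = 0 := rfl

theorem pk_congr {o a b : ℕ → ℕ} {m : ℕ} (h : ∀ s < m, a s = b s) : pk o a m = pk o b m :=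
  Finset.sum_congr rfl fun s hs => by rw [h s (Finset.mem_range.1 hs)]

theorem pk_lt {o a : ℕ → ℕ} {g m B : ℕ} (h : Sep o g m) (ha : ∀ s < m, a s < 2 ^ g)
    (hB : ∀ s < m, o s + g ≤ B) : pk o a m < 2 ^ B := by
  induction m generalizing B with
  | zero => exact Nat.two_pow_pos B
  | succ m ih =>
    rw [pk_succ]
    have h1 : pk o a m < 2 ^ o m := ih h.pred (fun s hs => ha s (by omega))
      (fun s hs => h.add_le hs (by omega))
    have h2 : (a m + 1) * 2 ^ o m ≤ 2 ^ g * 2 ^ o m := Nat.mul_le_mul_right _ (ha m (by omega))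
    have h3 : 2 ^ g * 2 ^ o m ≤ 2 ^ B := by
      rw [← pow_add]; exact Nat.pow_le_pow_right (by norm_num) (by have := hB m (by omega); omega)
    rw [Nat.add_mul] at h2; omega

theorem pk_lt_offset {o a : ℕ → ℕ} {g m : ℕ} (h : Sep o g (m + 1)) (ha : ∀ s < m, a s < 2 ^ g) :
    pk o a m < 2 ^ o m :=
  pk_lt h.pred ha fun _ hs => h.add_le hs (by omega)

/-- Bits below and above position `i` do not interact, so both sides agree bit by bit. -/
theorem xor_block {i x y : ℕ} (a b : ℕ) (hx : x < 2 ^ i) (hy : y < 2 ^ i) :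
    (x + a * 2 ^ i) ^^^ (y + b * 2 ^ i) = (x ^^^ y) + (a ^^^ b) * 2 ^ i := by
  have hxy : x ^^^ y < 2 ^ i := Nat.xor_lt_two_pow hx hy
  apply Nat.eq_of_testBit_eq; intro j
  rw [Nat.testBit_xor, add_comm x, add_comm y, add_comm (x ^^^ y), mul_comm a, mul_comm b,
    mul_comm (a ^^^ b), Nat.testBit_two_pow_mul_add _ hx, Nat.testBit_two_pow_mul_add _ hy,
    Nat.testBit_two_pow_mul_add _ hxy]
  split <;> simp [Nat.testBit_xor]

theorem and_block {i x y : ℕ} (a b : ℕ) (hx : x < 2 ^ i) (hy : y < 2 ^ i) :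
    (x + a * 2 ^ i) &&& (y + b * 2 ^ i) = (x &&& y) + (a &&& b) * 2 ^ i := by
  have hxy : x &&& y < 2 ^ i := Nat.and_lt_two_pow _ hy
  apply Nat.eq_of_testBit_eq; intro j
  rw [Nat.testBit_and, add_comm x, add_comm y, add_comm (x &&& y), mul_comm a, mul_comm b,
    mul_comm (a &&& b), Nat.testBit_two_pow_mul_add _ hx, Nat.testBit_two_pow_mul_add _ hy,
    Nat.testBit_two_pow_mul_add _ hxy]
  split <;> simp [Nat.testBit_and]

theorem pk_xor {o a b : ℕ → ℕ} {g m : ℕ} (h : Sep o g m) (ha : ∀ s < m, a s < 2 ^ g)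
    (hb : ∀ s < m, b s < 2 ^ g) : pk o a m ^^^ pk o b m = pk o (fun s => a s ^^^ b s) m := by
  induction m with
  | zero => simp [pk_zero]
  | succ m ih =>
    rw [pk_succ, pk_succ, pk_succ,
      xor_block _ _ (pk_lt_offset h fun s hs => ha s (by omega))
        (pk_lt_offset h fun s hs => hb s (by omega)),
      ih h.pred (fun s hs => ha s (by omega)) (fun s hs => hb s (by omega))]

theorem pk_and {o a b : ℕ → ℕ} {g m : ℕ} (h : Sep o g m) (ha : ∀ s < m, a s < 2 ^ g)
    (hb : ∀ s < m, b s < 2 ^ g) : pk o a m &&& pk o b m = pk o (fun s => a s &&& b s) m := by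
  induction m with
  | zero => simp [pk_zero]
  | succ m ih =>
    rw [pk_succ, pk_succ, pk_succ,
      and_block _ _ (pk_lt_offset h fun s hs => ha s (by omega))
        (pk_lt_offset h fun s hs => hb s (by omega)),
      ih h.pred (fun s hs => ha s (by omega)) (fun s hs => hb s (by omega))]

theorem pk_add (o a b : ℕ → ℕ) (m : ℕ) :
    pk o a m + pk o b m = pk o (fun s => a s + b s) m := by
  simp only [pk, ← Finset.sum_add_distrib, Nat.add_mul]

/-- No field borrows from the next one, whatever the offsets are. -/
theorem pk_sub {o a b : ℕ → ℕ} {m : ℕ} (h : ∀ s < m, b s ≤ a s) :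
    pk o a m - pk o b m = pk o (fun s => a s - b s) m := by
  have : pk o (fun s => a s - b s) m + pk o b m = pk o a m := by
    rw [pk_add]; exact pk_congr fun s hs => Nat.sub_add_cancel (h s hs)
  omega

theorem pk_le {o a b : ℕ → ℕ} {m : ℕ} (h : ∀ s < m, a s ≤ b s) : pk o a m ≤ pk o b m :=
  Finset.sum_le_sum fun s hs => Nat.mul_le_mul_right _ (h s (Finset.mem_range.1 hs))

theorem pk_mul (o a : ℕ → ℕ) (m x : ℕ) : x * pk o a m = pk o (fun s => x * a s) m := by
  simp only [pk, Finset.mul_sum, mul_assoc]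

theorem pk_le_of_mem {o a : ℕ → ℕ} {m s : ℕ} (h : s < m) : a s * 2 ^ o s ≤ pk o a m :=
  Finset.single_le_sum (f := fun s => a s * 2 ^ o s) (fun _ _ => Nat.zero_le _)
    (Finset.mem_range.2 h)

theorem pk_update {o a : ℕ → ℕ} {m s v : ℕ} (h : s < m) :
    pk o a m - a s * 2 ^ o s + v * 2 ^ o s = pk o (Function.update a s v) m := by
  have h1 : ∑ x ∈ (Finset.range m).erase s, Function.update a s v x * 2 ^ o x
      = ∑ x ∈ (Finset.range m).erase s, a x * 2 ^ o x :=
    Finset.sum_congr rfl fun x hx => by rw [Function.update_of_ne (Finset.ne_of_mem_erase hx)]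
  have h2 := Finset.sum_erase_add (Finset.range m) (fun x => a x * 2 ^ o x) (Finset.mem_range.2 h)
  have h3 := Finset.sum_erase_add (Finset.range m) (fun x => Function.update a s v x * 2 ^ o x)
    (Finset.mem_range.2 h)
  simp only [Function.update_self] at h3
  unfold pk; omega

/-- Reading a field. -/
theorem pk_field {o a : ℕ → ℕ} {g m s : ℕ} (h : Sep o g m) (ha : ∀ s < m, a s < 2 ^ g)
    (hs : s < m) : pk o a m / 2 ^ o s % 2 ^ g = a s := by
  induction m with
  | zero => omega
  | succ m ih =>
    rw [pk_succ]
    rcases Nat.lt_succ_iff_lt_or_eq.1 hs with hs' | rfl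
    · have h1 := h.add_le hs' (Nat.lt_succ_self m)
      have h2 : a m * 2 ^ o m = 2 ^ o s * (2 ^ g * (a m * 2 ^ (o m - o s - g))) := by
        rw [← mul_assoc, ← pow_add, mul_comm, mul_comm (a m), ← mul_assoc, ← pow_add]
        congr 2; omega
      rw [h2, Nat.add_mul_div_left _ _ (Nat.two_pow_pos _), Nat.add_mul_mod_self_left]
      exact ih h.pred (fun s hs => ha s (by omega)) hs'
    · have h1 := pk_lt_offset h (a := a) fun s hs => ha s (by omega)
      rw [mul_comm, Nat.add_mul_div_left _ _ (Nat.two_pow_pos _), Nat.div_eq_of_lt h1, zero_add,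
        Nat.mod_eq_of_lt (ha _ hs)]

/-! ### Sets of positions -/

/-- The number whose one bits are at the offsets `o s`, `s ∈ A`. -/
def bs (o : ℕ → ℕ) (A : Finset ℕ) : ℕ := ∑ s ∈ A, 2 ^ o s

theorem bs_erase {o : ℕ → ℕ} {A : Finset ℕ} {s : ℕ} (h : s ∈ A) :
    bs o A = bs o (A.erase s) + 2 ^ o s := (Finset.sum_erase_add A (fun s => 2 ^ o s) h).symm

theorem bs_eq_zero {o : ℕ → ℕ} {A : Finset ℕ} : bs o A = 0 ↔ A = ∅ := by
  constructor
  · intro h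
    rw [Finset.eq_empty_iff_forall_notMem]
    intro s hs
    rw [bs_erase hs] at h
    have := Nat.two_pow_pos (o s); omega
  · rintro rfl; rfl

theorem pk_one_eq_bs (o : ℕ → ℕ) (m : ℕ) : pk o (fun _ => 1) m = bs o (Finset.range m) := by
  simp [pk, bs]

/-- Detection of the fields that are zero. -/
theorem zero_fields {o z : ℕ → ℕ} {u m : ℕ} (h : Sep o (u + 1) m) (hz : ∀ s < m, z s < 2 ^ u) :
    ((pk o (fun _ => 1) m * 2 ^ u - pk o z m) &&& (pk o (fun _ => 1) m * 2 ^ u)) / 2 ^ u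
      = bs o ((Finset.range m).filter fun s => z s = 0) := by
  have hu : 2 ^ u < 2 ^ (u + 1) := Nat.pow_lt_pow_right (by norm_num) (by omega)
  rw [mul_comm, pk_mul, pk_sub (fun s hs => by have := hz s hs; omega),
    pk_and h (fun s hs => by omega) (fun s hs => by omega)]
  -- As `z s < 2 ^ u`, the guard bit `2 ^ u` of a field survives the subtraction of `z s` exactly if
  -- `z s = 0`.
  have : pk o (fun s => (2 ^ u * 1 - z s) &&& (2 ^ u * 1)) m
      = 2 ^ u * bs o ((Finset.range m).filter fun s => z s = 0) := by
    rw [bs, Finset.sum_filter, pk, Finset.mul_sum]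
    refine Finset.sum_congr rfl fun s hs => ?_
    have := hz s (Finset.mem_range.1 hs)
    split_ifs with h0
    · simp [h0]
    · have h1 : 2 ^ u - z s < 2 ^ u := by omega
      have : (2 ^ u - z s) &&& 2 ^ u = 0 := by
        rw [Nat.and_two_pow, Nat.testBit_lt_two_pow h1]; simp
      simp [this]
  rw [this, Nat.mul_div_cancel_left _ (Nat.two_pow_pos u)]

theorem bs_lt {o : ℕ → ℕ} {A : Finset ℕ} {B : ℕ} (ho : Set.InjOn o A) (h : ∀ s ∈ A, o s < B) :
    bs o A < 2 ^ B := by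
  have : bs o A = ∑ p ∈ A.image o, 2 ^ p := by
    rw [Finset.sum_image ho]; rfl
  rw [this]
  exact Nat.geomSum_lt le_rfl (by simpa using h)

theorem bs_dvd {o : ℕ → ℕ} {A : Finset ℕ} {B : ℕ} (h : ∀ s ∈ A, B ≤ o s) : 2 ^ B ∣ bs o A :=
  Finset.dvd_sum fun s hs => Nat.pow_dvd_pow 2 (h s hs)

theorem bs_filter_add (o : ℕ → ℕ) (A : Finset ℕ) (p : ℕ → Prop) [DecidablePred p] :
    bs o (A.filter p) + bs o (A.filter fun s => ¬ p s) = bs o A :=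
  Finset.sum_filter_add_sum_filter_not _ _ _

theorem bs_mod {o : ℕ → ℕ} {A : Finset ℕ} (B : ℕ) (ho : Set.InjOn o A) :
    bs o A % 2 ^ B = bs o (A.filter fun s => o s < B) := by
  rw [← bs_filter_add o A fun s => o s < B]
  obtain ⟨x, hx⟩ := bs_dvd (o := o) (A := A.filter fun s => ¬ o s < B) (B := B)
    (fun s hs => by simpa using (Finset.mem_filter.1 hs).2)
  rw [hx, Nat.add_mul_mod_self_left, Nat.mod_eq_of_lt]
  exact bs_lt (fun x hx y hy => ho (Finset.mem_filter.1 hx).1 (Finset.mem_filter.1 hy).1)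
    (fun s hs => (Finset.mem_filter.1 hs).2)

/-- Reduction modulo `2 ^ (o i + 1)` removes the higher bits; the lower ones sum to less than `2 ^ o
i` and vanish in the quotient. -/
theorem bs_bit {o : ℕ → ℕ} {A : Finset ℕ} {i : ℕ} (ho : ∀ s ∈ A, o s = o i → s = i)
    (hA : Set.InjOn o A) : bs o A / 2 ^ o i % 2 = if i ∈ A then 1 else 0 := by
  have h1 : bs o A / 2 ^ o i % 2 = bs o (A.filter fun s => o s < o i + 1) / 2 ^ o i := by
    rw [← bs_mod _ hA, pow_succ, Nat.mod_mul_right_div_self]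
  rw [h1]
  have h2 := bs_filter_add o (A.filter fun s => o s < o i + 1) (fun s => o s < o i)
  have h3 : bs o ((A.filter fun s => o s < o i + 1).filter fun s => o s < o i) < 2 ^ o i :=
    bs_lt (fun x hx y hy => hA (Finset.mem_filter.1 (Finset.mem_filter.1 hx).1).1
      (Finset.mem_filter.1 (Finset.mem_filter.1 hy).1).1) (fun s hs => (Finset.mem_filter.1 hs).2)
  have h4 : ((A.filter fun s => o s < o i + 1).filter fun s => ¬ o s < o i)
      = if i ∈ A then {i} else ∅ := by
    ext s
    simp only [Finset.mem_filter]
    constructor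
    · rintro ⟨⟨h5, h6⟩, h7⟩
      have := ho s h5 (by omega); subst this; simp [h5]
    · split_ifs with hi
      · intro h; rw [Finset.mem_singleton] at h; subst h; exact ⟨⟨hi, by omega⟩, by omega⟩
      · simp
  rw [← h2, h4]
  split_ifs with hi
  · rw [show bs o {i} = 2 ^ o i by simp [bs], Nat.add_div_right _ (Nat.two_pow_pos _),
      Nat.div_eq_of_lt h3]
  · rw [show bs o ∅ = 0 from rfl, add_zero, Nat.div_eq_of_lt h3]

/-- Subtracting one turns the lowest one bit into zero and the zeros below it into ones, and leaves
the higher bits alone. -/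
theorem and_pred (i u : ℕ) :
    (2 ^ i + 2 ^ (i + 1) * u) &&& (2 ^ i + 2 ^ (i + 1) * u - 1) = 2 ^ (i + 1) * u := by
  have h1 : 2 ^ i < 2 ^ (i + 1) := Nat.pow_lt_pow_right (by norm_num) (by omega)
  have h0 := Nat.two_pow_pos i
  have h2 : 2 ^ i + 2 ^ (i + 1) * u - 1 = (2 ^ i - 1) + u * 2 ^ (i + 1) := by
    rw [mul_comm]; omega
  rw [h2, mul_comm (2 ^ (i + 1)) u, and_block _ _ h1 (by omega)]
  have : 2 ^ i &&& (2 ^ i - 1) = 0 := by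
    rw [Nat.and_comm, Nat.and_two_pow, Nat.testBit_lt_two_pow (by omega)]; simp
  rw [this, Nat.and_self, zero_add]

/-- Clearing the lowest one bit. -/
theorem bs_clear {o : ℕ → ℕ} {A : Finset ℕ} (ho : ∀ s ∈ A, ∀ t ∈ A, s < t → o s < o t)
    (hA : A.Nonempty) : bs o A &&& (bs o A - 1) = bs o (A.erase (A.min' hA)) := by
  obtain ⟨u, hu⟩ := bs_dvd (o := o) (A := A.erase (A.min' hA)) (B := o (A.min' hA) + 1)
    (fun s hs => ho _ (A.min'_mem hA) _ (Finset.mem_of_mem_erase hs)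
      (lt_of_le_of_ne (A.min'_le _ (Finset.mem_of_mem_erase hs)) (Finset.ne_of_mem_erase hs).symm))
  rw [bs_erase (A.min'_mem hA), add_comm, hu, and_pred]

theorem bs_lowest {o : ℕ → ℕ} {A : Finset ℕ} (ho : ∀ s ∈ A, ∀ t ∈ A, s < t → o s < o t)
    (hA : A.Nonempty) : bs o A - (bs o A &&& (bs o A - 1)) = 2 ^ o (A.min' hA) := by
  have := bs_erase (o := o) (A.min'_mem hA)
  rw [bs_clear ho hA, this, Nat.add_sub_cancel_left]

/-! ### Geometric sums -/

theorem ones_eq {k : ℕ} (hk : 1 ≤ k) (i : ℕ) :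
    (2 ^ (k * i) - 1) / (2 ^ k - 1) = pk (fun s => k * s) (fun _ => 1) i := by
  rw [pow_mul, ← Nat.geomSum_eq (Nat.le_self_pow (by omega) 2)]
  simp [pk, pow_mul]

/-- The quotient is a sum of `i` powers of `2 ^ k`, each congruent to 1 modulo `2 ^ k - 1`. So the
index of a one bit at a multiple of `k` is found without a logarithm instruction. -/
theorem log_eq {k i : ℕ} (hk : 1 ≤ k) (hi : i < 2 ^ k - 1) :
    (2 ^ (k * i) - 1) / (2 ^ k - 1) % (2 ^ k - 1) = i := by
  rw [ones_eq hk, pk]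
  have h1 : ∀ s, (1 * 2 ^ (k * s)) ≡ 1 [MOD 2 ^ k - 1] := by
    intro s
    have h2 : 2 ^ k ≡ 1 [MOD 2 ^ k - 1] := by
      have h3 := Nat.two_pow_pos k
      have : 2 ^ k = 1 + (2 ^ k - 1) := by omega
      conv_lhs => rw [this]
      simp [Nat.ModEq]
    simpa [pow_mul] using h2.pow s
  have h2 : (∑ s ∈ Finset.range i, 1 * 2 ^ (k * s)) ≡ i [MOD 2 ^ k - 1] := by
    have : (∑ s ∈ Finset.range i, 1 * 2 ^ (k * s)) ≡ ∑ s ∈ Finset.range i, 1 [MOD 2 ^ k - 1] := by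
      induction i with
      | zero => exact Nat.ModEq.refl _
      | succ i ih =>
        rw [Finset.sum_range_succ, Finset.sum_range_succ]; exact (ih (by omega)).add (h1 i)
    simpa using this
  rw [h2, Nat.mod_eq_of_lt hi]

/-- Overwriting a field changes no other field. -/
theorem field_self {W sh f v : ℕ} (hv : v < 2 ^ f) :
    (W - W / 2 ^ sh % 2 ^ f * 2 ^ sh + v * 2 ^ sh) / 2 ^ sh % 2 ^ f = v := by
  have h0 := Nat.two_pow_pos sh
  have h1 := Nat.div_add_mod W (2 ^ sh)
  have h2 := Nat.div_add_mod (W / 2 ^ sh) (2 ^ f)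
  have h3 := Nat.mod_lt W h0
  set a := W / 2 ^ sh / 2 ^ f
  set b := W / 2 ^ sh % 2 ^ f
  set e := W % 2 ^ sh
  have : W - b * 2 ^ sh + v * 2 ^ sh = e + 2 ^ sh * (v + 2 ^ f * a) := by
    rw [← h2] at h1; rw [← h1]; simp only [Nat.mul_add, mul_comm b]
    rw [mul_comm v]; omega
  rw [this, Nat.add_mul_div_left _ _ h0, Nat.div_eq_of_lt h3, zero_add, Nat.add_mul_mod_self_left,
    Nat.mod_eq_of_lt hv]

theorem field_other {W sh sh' f v : ℕ} (hv : v < 2 ^ f) (h : sh + f ≤ sh' ∨ sh' + f ≤ sh) :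
    (W - W / 2 ^ sh % 2 ^ f * 2 ^ sh + v * 2 ^ sh) / 2 ^ sh' % 2 ^ f = W / 2 ^ sh' % 2 ^ f := by
  have h0 := Nat.two_pow_pos sh
  have h1 := Nat.div_add_mod W (2 ^ sh)
  have h2 := Nat.div_add_mod (W / 2 ^ sh) (2 ^ f)
  have h3 := Nat.mod_lt W h0
  have h4 := Nat.mod_lt (W / 2 ^ sh) (Nat.two_pow_pos f)
  generalize W / 2 ^ sh / 2 ^ f = a at *
  generalize W / 2 ^ sh % 2 ^ f = b at *
  generalize W % 2 ^ sh = e at *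
  rw [← h2] at h1
  have h5 : W - b * 2 ^ sh + v * 2 ^ sh = e + 2 ^ sh * (v + 2 ^ f * a) := by
    rw [← h1]; simp only [Nat.mul_add, mul_comm b]; rw [mul_comm v]; omega
  have h6 : W = e + 2 ^ sh * (b + 2 ^ f * a) := by
    rw [← h1]; simp only [Nat.mul_add]; omega
  rw [h5]
  conv_rhs => rw [h6]
  rcases h with h | h
  · have key : ∀ x, x < 2 ^ f → (e + 2 ^ sh * (x + 2 ^ f * a)) / 2 ^ sh'
        = a / 2 ^ (sh' - sh - f) := by
      intro x hx
      have : (2 : ℕ) ^ sh' = 2 ^ sh * (2 ^ f * 2 ^ (sh' - sh - f)) := by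
        rw [← pow_add, ← pow_add]; congr 1; omega
      rw [this, ← Nat.div_div_eq_div_mul, Nat.add_mul_div_left _ _ h0, Nat.div_eq_of_lt h3,
        zero_add, ← Nat.div_div_eq_div_mul, Nat.add_mul_div_left _ _ (Nat.two_pow_pos f),
        Nat.div_eq_of_lt hx, zero_add]
    rw [key v hv, key b h4]
  · have key : ∀ x, (e + 2 ^ sh * x) / 2 ^ sh' % 2 ^ f = e / 2 ^ sh' % 2 ^ f := by
      intro x
      have : (2 : ℕ) ^ sh = 2 ^ sh' * (2 ^ f * 2 ^ (sh - sh' - f)) := by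
        rw [← pow_add, ← pow_add]; congr 1; omega
      rw [this, mul_assoc, Nat.add_mul_div_left _ _ (Nat.two_pow_pos _), mul_assoc,
        Nat.add_mul_mod_self_left]
    rw [key, key]

/-! ### Blocks of digits in base `c` -/

/-- The number with digits `y 0, …, y (d - 1)` in base `c`. -/
def hn (c : ℕ) (y : ℕ → ℕ) (d : ℕ) : ℕ := ∑ i ∈ Finset.range d, y i * c ^ i

theorem hn_succ (c : ℕ) (y : ℕ → ℕ) (d : ℕ) : hn c y (d + 1) = hn c y d + y d * c ^ d :=
  Finset.sum_range_succ _ _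

theorem hn_lt {c : ℕ} {y : ℕ → ℕ} {d : ℕ} (hy : ∀ i < d, y i < c) :
    hn c y d < c ^ d := by
  induction d with
  | zero => simp [hn]
  | succ d ih =>
    rw [hn_succ]
    have h1 := ih fun i hi => hy i (by omega)
    have h2 : (y d + 1) * c ^ d ≤ c * c ^ d := Nat.mul_le_mul_right _ (hy d (by omega))
    rw [pow_succ, mul_comm (c ^ d)]; rw [Nat.add_mul] at h2; omega

theorem hn_digit {c : ℕ} (hc : 1 ≤ c) {y : ℕ → ℕ} {d p : ℕ} (hy : ∀ i < d, y i < c) (hp : p < d) :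
    hn c y d / c ^ p % c = y p := by
  induction d with
  | zero => omega
  | succ d ih =>
    rw [hn_succ]
    rcases Nat.lt_succ_iff_lt_or_eq.1 hp with hp' | rfl
    · have h2 : y d * c ^ d = c ^ p * (c * (y d * c ^ (d - p - 1))) := by
        rw [← mul_assoc, ← pow_succ, mul_left_comm, ← pow_add]; congr 2; omega
      rw [h2, Nat.add_mul_div_left _ _ (Nat.pow_pos hc), Nat.add_mul_mod_self_left]
      exact ih (fun i hi => hy i (by omega)) hp'
    · rw [mul_comm (y p), Nat.add_mul_div_left _ _ (Nat.pow_pos hc),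
        Nat.div_eq_of_lt (hn_lt fun i hi => hy i (by omega)), zero_add,
        Nat.mod_eq_of_lt (hy p (by omega))]

/-- Bounds on the parameters of the encoding: `d` digits are stored in `f` bits, and spread out with
stride `2 * f + 2`. -/
structure Codec (c d f : ℕ) : Prop where
  hc : 1 ≤ c
  hd : 1 ≤ d
  hf : c ^ d < 2 ^ f

namespace Codec
variable {c d f : ℕ} (h : Codec c d f)
include h

theorem c_lt : c < 2 ^ f := lt_of_le_of_lt (Nat.le_self_pow (by have := h.hd; omega) c) h.hf

theorem f_pos : 1 ≤ f := by
  by_contra h0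
  have h1 : f = 0 := by omega
  have h2 := h.hf; have h3 := Nat.pow_pos (n := d) h.hc
  rw [h1] at h2; omega

theorem add_lt : c ^ d + c < 2 ^ (2 * f + 2) := by
  have h1 := h.hf
  have h2 := h.c_lt
  have : 2 ^ f + 2 ^ f ≤ 2 ^ (2 * f + 2) := by
    rw [← two_mul, ← pow_succ']; exact Nat.pow_le_pow_right (by norm_num) (by omega)
  omega

theorem modEq : 2 ^ (2 * f + 2) ≡ c [MOD 2 ^ (2 * f + 2) - c] := by
  have h1 := h.add_lt
  have h2 : 2 ^ (2 * f + 2) = c + (2 ^ (2 * f + 2) - c) := by omega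
  generalize 2 ^ (2 * f + 2) - c = N at *
  rw [h2]; simp [Nat.ModEq]

/-- A shift and a reduction replace the loop that would compute `c ^ d`. -/
theorem pow_mod : 2 ^ ((2 * f + 2) * d) % (2 ^ (2 * f + 2) - c) = c ^ d := by
  have h1 := h.modEq.pow d
  have h2 := h.add_lt
  rw [← pow_mul] at h1
  rw [h1, Nat.mod_eq_of_lt (by omega)]

/-- Evaluating the digits at `2 ^ k` and reducing modulo `2 ^ k - c` is evaluating them at `c`; the
result is below `c ^ d` and so already reduced. -/
theorem pk_mod {y : ℕ → ℕ} (hy : ∀ i < d, y i < c) :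
    pk (fun s => (2 * f + 2) * s) y d % (2 ^ (2 * f + 2) - c) = hn c y d := by
  have h1 : ∀ e, pk (fun s => (2 * f + 2) * s) y e ≡ hn c y e [MOD 2 ^ (2 * f + 2) - c] := by
    intro e
    induction e with
    | zero => exact Nat.ModEq.refl _
    | succ e ih =>
      rw [pk_succ, hn_succ, pow_mul]
      exact ih.add ((Nat.ModEq.refl _).mul (h.modEq.pow e))
  have h2 := hn_lt hy
  have h3 := h.add_lt
  rw [h1 d, Nat.mod_eq_of_lt (by omega)]

/-- From `x + 1 ≤ c ^ d < 2 ^ f` it follows that `x * 2 ^ f ≤ c ^ d * 2 ^ f - 2 ^ f < c ^ d * (2 ^ f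
- 1)`. Hence the code, which is the quotient rounded down plus one, still fits into `f` bits. -/
theorem enc_lt {x : ℕ} (hx : x < c ^ d) : x * 2 ^ f / c ^ d + 1 < 2 ^ f := by
  have h1 := h.hf
  have h2 : 0 < c ^ d := Nat.pow_pos h.hc
  have h4 : x * 2 ^ f / c ^ d + 1 < 2 ^ f ↔ x * 2 ^ f / c ^ d < 2 ^ f - 1 := by omega
  rw [h4, Nat.div_lt_iff_lt_mul h2, Nat.sub_mul, one_mul]
  have h3 : (x + 1) * 2 ^ f ≤ c ^ d * 2 ^ f := Nat.mul_le_mul_right _ hx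
  rw [Nat.add_mul, one_mul] at h3
  rw [mul_comm (2 ^ f) (c ^ d)]; omega

/-- With `a = 2 ^ k`, the factorisation of `a ^ (d + 1) - c ^ (d + 1)` by `a - c` has cofactor the
sum of `a ^ p * c ^ (d - p)`, and the remainder `c ^ (d + 1)` is smaller than the divisor. One
division thus lays out all powers of `c` in separate fields. -/
theorem quot_eq : 2 ^ ((2 * f + 2) * (d + 1)) / (2 ^ (2 * f + 2) - c)
    = pk (fun s => (2 * f + 2) * s) (fun p => c ^ (d - p)) (d + 1) := by
  have h3 := h.add_lt
  have h0 : 0 < 2 ^ (2 * f + 2) - c := by omega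
  have h4 : c ^ (d + 1) < 2 ^ (2 * f + 2) - c := by
    have h1 : c ^ (d + 1) < 2 ^ f * 2 ^ f := by
      rw [pow_succ]; exact Nat.mul_lt_mul'' h.hf h.c_lt
    rw [← pow_add] at h1
    have h2 : 2 ^ (f + f) + 2 ^ (f + f) ≤ 2 ^ (2 * f + 2) := by
      rw [← two_mul, ← pow_succ']; exact Nat.pow_le_pow_right (by norm_num) (by omega)
    have h5 : 2 ^ f ≤ 2 ^ (f + f) := Nat.pow_le_pow_right (by norm_num) (by omega)
    have := h.c_lt
    omega
  have key : pk (fun s => (2 * f + 2) * s) (fun p => c ^ (d - p)) (d + 1) * (2 ^ (2 * f + 2) - c)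
      + c ^ (d + 1) = 2 ^ ((2 * f + 2) * (d + 1)) := by
    have h5 : pk (fun s => (2 * f + 2) * s) (fun p => c ^ (d - p)) (d + 1)
        = ∑ i ∈ Finset.range (d + 1), (2 ^ (2 * f + 2)) ^ i * c ^ (d + 1 - 1 - i) := by
      rw [pk]; refine Finset.sum_congr rfl fun i _ => ?_
      rw [mul_comm, pow_mul]; rfl
    have h6 := (Commute.all ((2 : ℤ) ^ (2 * f + 2)) (c : ℤ)).geom_sum₂_mul (d + 1)
    rw [Nat.add_sub_cancel] at h6
    rw [h5, pow_mul, Nat.add_sub_cancel]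
    zify
    rw [Nat.cast_sub (by omega)]
    push_cast
    linarith [h6]
  rw [← key, mul_comm, Nat.mul_add_div h0, Nat.div_eq_of_lt h4, add_zero]

/-- Let `X` be the code of `x`. As real numbers, `x / c ^ d < X / 2 ^ f ≤ x / c ^ d + 1 / 2 ^ f < (x
+ 1) / c ^ d`, the last step because `c ^ d < 2 ^ f`. Multiplied by `c ^ (d - p)`, this places `X *
c ^ (d - p) / 2 ^ f` strictly between `x / c ^ p` and `(x + 1) / c ^ p`, and no integer lies
strictly between these. -/
theorem field_div {x p : ℕ} (hp : p ≤ d) :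
    (x * 2 ^ f / c ^ d + 1) * c ^ (d - p) / 2 ^ f = x / c ^ p := by
  have hcp : 0 < c ^ p := Nat.pow_pos h.hc
  have hcd : 0 < c ^ d := Nat.pow_pos h.hc
  have hC : c ^ d = c ^ (d - p) * c ^ p := by rw [← pow_add]; congr 1; omega
  have h1 := Nat.div_add_mod (x * 2 ^ f) (c ^ d)
  have h2 := Nat.mod_lt (x * 2 ^ f) hcd
  have h3 := Nat.div_add_mod x (c ^ p)
  have h4 := Nat.mod_lt x hcp
  have hf := h.hf
  generalize x * 2 ^ f / c ^ d = A at *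
  generalize x / c ^ p = Q at *
  generalize x * 2 ^ f % c ^ d = R at *
  generalize x % c ^ p = r at *
  apply Nat.div_eq_of_lt_le
  · -- lower bound
    by_contra hlt
    push Not at hlt
    have h5 : (A + 1) * c ^ (d - p) * c ^ p < Q * 2 ^ f * c ^ p := Nat.mul_lt_mul_of_pos_right hlt hcp
    have h6 : (A + 1) * c ^ (d - p) * c ^ p = c ^ d * A + c ^ d := by rw [hC]; ring
    have h7 : Q * 2 ^ f * c ^ p ≤ x * 2 ^ f := by
      calc Q * 2 ^ f * c ^ p = (c ^ p * Q) * 2 ^ f := by ring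
        _ ≤ x * 2 ^ f := Nat.mul_le_mul_right _ (by omega)
    omega
  · by_contra hlt
    push Not at hlt
    have h5 : (Q + 1) * 2 ^ f * c ^ p ≤ (A + 1) * c ^ (d - p) * c ^ p := Nat.mul_le_mul_right _ hlt
    have h6 : (A + 1) * c ^ (d - p) * c ^ p = c ^ d * A + c ^ d := by rw [hC]; ring
    have h7 : (x + 1) * 2 ^ f ≤ (Q + 1) * 2 ^ f * c ^ p := by
      calc (x + 1) * 2 ^ f ≤ (c ^ p * (Q + 1)) * 2 ^ f :=
            Nat.mul_le_mul_right _ (by rw [Nat.mul_add]; omega)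
        _ = _ := by ring
    rw [Nat.add_mul, one_mul] at h7
    omega

/-- The stride `2 * f + 2` is chosen so that a product of two `f`-bit numbers stays inside its
field. -/
theorem spread_lt {x p : ℕ} (hx : x < c ^ d) :
    (x * 2 ^ f / c ^ d + 1) * c ^ (d - p) < 2 ^ (2 * f + 2) := by
  have h1 : c ^ (d - p) ≤ 2 ^ f :=
    (Nat.pow_le_pow_right h.hc (by omega)).trans h.hf.le
  calc _ ≤ 2 ^ f * 2 ^ f := Nat.mul_le_mul (h.enc_lt hx).le h1
    _ < _ := by rw [← pow_add]; exact Nat.pow_lt_pow_right (by norm_num) (by omega)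

/-- A single product of the code with the word of powers puts every `X * c ^ (d - p)` into its own
field. Clearing the low `f` bits of each field and shifting divides all of them by `2 ^ f` at once.
-/
theorem floors {x : ℕ} (hx : x < c ^ d) {V : ℕ}
    (hV : V = (x * 2 ^ f / c ^ d + 1) *
      pk (fun s => (2 * f + 2) * s) (fun p => c ^ (d - p)) (d + 1)) :
    V < 2 ^ ((2 * f + 2) * (d + 1)) ∧
    (V - (V &&& (pk (fun s => (2 * f + 2) * s) (fun _ => 1) (d + 1) * (2 ^ f - 1)))) / 2 ^ f
      = pk (fun s => (2 * f + 2) * s) (fun p => x / c ^ p) (d + 1) := by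
  have hsep : Sep (fun s => (2 * f + 2) * s) (2 * f + 2) (d + 1) := sep_mul le_rfl
  have hpos := Nat.two_pow_pos f
  have hff : 2 ^ f ≤ 2 ^ (2 * f + 2) := Nat.pow_le_pow_right (by norm_num) (by omega)
  rw [pk_mul] at hV
  constructor
  · rw [hV]
    exact pk_lt hsep (fun s _ => h.spread_lt hx)
      (fun s hs => by
        calc (2 * f + 2) * s + (2 * f + 2) = (2 * f + 2) * (s + 1) := by ring
          _ ≤ _ := Nat.mul_le_mul_left _ hs)
  · rw [hV, mul_comm (pk _ (fun _ => 1) _), pk_mul,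
      pk_and hsep (fun s _ => h.spread_lt hx) (fun s _ => by omega), pk_sub (fun s _ => Nat.and_le_left)]
    have : pk (fun s => (2 * f + 2) * s) (fun s => (x * 2 ^ f / c ^ d + 1) * c ^ (d - s) -
        ((x * 2 ^ f / c ^ d + 1) * c ^ (d - s) &&& (2 ^ f - 1) * 1)) (d + 1)
        = 2 ^ f * pk (fun s => (2 * f + 2) * s) (fun p => x / c ^ p) (d + 1) := by
      rw [pk_mul]
      refine pk_congr fun p hp => ?_
      rw [mul_one, Nat.and_two_pow_sub_one_eq_mod, ← h.field_div (x := x) (p := p) (by omega)]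
      have := Nat.div_add_mod ((x * 2 ^ f / c ^ d + 1) * c ^ (d - p)) (2 ^ f)
      omega
    rw [this, Nat.mul_div_cancel_left _ hpos]

/-- Digit `p` is `x / c ^ p - c * (x / c ^ (p + 1))`. A shift by one field aligns the two quotients
in all places, and the extra top field is zero because `x < c ^ d`. -/
theorem digits {y : ℕ → ℕ} (hy : ∀ i < d, y i < c) {FL : ℕ}
    (hF : FL = pk (fun s => (2 * f + 2) * s) (fun p => hn c y d / c ^ p) (d + 1)) :
    c * (FL / 2 ^ (2 * f + 2)) ≤ FL ∧
    FL - c * (FL / 2 ^ (2 * f + 2)) = pk (fun s => (2 * f + 2) * s) y d := by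
  have hx := hn_lt hy
  have h1 : FL / 2 ^ (2 * f + 2)
      = pk (fun s => (2 * f + 2) * s) (fun p => hn c y d / c ^ (p + 1)) d := by
    have h2 : FL = hn c y d + 2 ^ (2 * f + 2) *
        pk (fun s => (2 * f + 2) * s) (fun p => hn c y d / c ^ (p + 1)) d := by
      rw [hF, pk, Finset.sum_range_succ', pk_mul, pk]
      simp only [pow_zero, Nat.div_one, Nat.mul_zero, mul_one]
      rw [add_comm]; congr 1
      refine Finset.sum_congr rfl fun i _ => ?_
      rw [Nat.mul_add (2 * f + 2), pow_add]; ring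
    rw [h2, Nat.add_mul_div_left _ _ (Nat.two_pow_pos _), Nat.div_eq_of_lt, zero_add]
    have := h.add_lt; omega
  have h3 : FL = pk (fun s => (2 * f + 2) * s) (fun p => hn c y d / c ^ p) d := by
    rw [hF, pk_succ, Nat.div_eq_of_lt hx]; simp
  have h4 : ∀ p, c * (hn c y d / c ^ (p + 1)) ≤ hn c y d / c ^ p := fun p => by
    rw [pow_succ, ← Nat.div_div_eq_div_mul]; exact Nat.mul_div_le _ _
  rw [h1, h3, pk_mul]
  refine ⟨pk_le fun s _ => h4 s, ?_⟩
  rw [pk_sub fun s _ => h4 s]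
  refine pk_congr fun p hp => ?_
  rw [pow_succ, ← Nat.div_div_eq_div_mul, ← hn_digit h.hc hy hp]
  have := Nat.div_add_mod (hn c y d / c ^ p) c
  omega

end Codec

/-! ### Sparse sets in uninitialized arrays -/

/-- Membership in the set represented by the arrays `dn`, `sp` and the size `t`. -/
def SpMem (dn sp : ℕ → ℕ) (t b : ℕ) : Prop := sp b < t ∧ dn (sp b) = b

/-- Only the first `t` entries of `dn` and the entries of `sp` that they point to are constrained.
With `t = 0` nothing is, so arrays with arbitrary contents represent the empty set: a stray `sp b`
is exposed by the bound or by the failing back pointer. -/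
structure SpInv (dn sp : ℕ → ℕ) (t nb : ℕ) : Prop where
  lt : ∀ p < t, dn p < nb
  inv : ∀ p < t, sp (dn p) = p

namespace SpInv
variable {dn sp : ℕ → ℕ} {t nb : ℕ} (h : SpInv dn sp t nb)
include h

theorem mem_dn {p : ℕ} (hp : p < t) : SpMem dn sp t (dn p) :=
  ⟨by rw [h.inv p hp]; exact hp, by rw [h.inv p hp]⟩

theorem inj {p q : ℕ} (hp : p < t) (hq : q < t) (hpq : dn p = dn q) : p = q := by
  rw [← h.inv p hp, ← h.inv q hq, hpq]

theorem mem_lt {b : ℕ} (hb : SpMem dn sp t b) : b < nb := by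
  rw [← hb.2]; exact h.lt _ hb.1

theorem le : t ≤ nb := by
  have : (Finset.range t).card ≤ (Finset.range nb).card :=
    Finset.card_le_card_of_injOn dn (fun p hp => by simpa using h.lt p (by simpa using hp))
      (fun p hp q hq => h.inj (by simpa using hp) (by simpa using hq))
  simpa using this

theorem lt_of_not_mem {b : ℕ} (hb : b < nb) (hn : ¬ SpMem dn sp t b) : t < nb := by
  have : (Finset.range t).card ≤ ((Finset.range nb).erase b).card :=
    Finset.card_le_card_of_injOn dn (fun p hp => by
        have hp' : p < t := by simpa using hp
        have := h.lt p hp'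
        have h2 := h.mem_dn hp'
        simp only [Finset.coe_erase, Finset.coe_range, Set.mem_sdiff, Set.mem_Iio,
          Set.mem_singleton_iff]
        exact ⟨this, fun h3 => hn (h3 ▸ h2)⟩)
      (fun p hp q hq => h.inj (by simpa using hp) (by simpa using hq))
  rw [Finset.card_erase_of_mem (by simpa using hb)] at this
  simp at this; omega

theorem add {b : ℕ} (hb : b < nb) (hn : ¬ SpMem dn sp t b) :
    SpInv (Function.update dn t b) (Function.update sp b t) (t + 1) nb ∧
    ∀ x, SpMem (Function.update dn t b) (Function.update sp b t) (t + 1) x ↔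
      x = b ∨ SpMem dn sp t x := by
  have h1 := h.lt
  have h2 := h.inv
  have h3 : ∀ p < t, dn p ≠ b := fun p hp h3 => hn (h3 ▸ h.mem_dn hp)
  refine ⟨⟨fun p hp => ?_, fun p hp => ?_⟩, fun x => ?_⟩
  · rcases Nat.lt_succ_iff_lt_or_eq.1 hp with hp | rfl
    · rw [Function.update_of_ne (by omega)]; exact h1 p hp
    · simpa using hb
  · rcases Nat.lt_succ_iff_lt_or_eq.1 hp with hp | rfl
    · rw [Function.update_of_ne (a := p) (by omega), Function.update_of_ne (h3 p hp)]; exact h2 p hp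
    · simp
  · unfold SpMem
    by_cases hx : x = b
    · subst hx; simp
    · rw [Function.update_of_ne hx]
      simp only [hx, false_or]
      constructor
      · rintro ⟨h4, h5⟩
        by_cases h6 : sp x = t
        · rw [h6] at h5; simp at h5; exact absurd h5.symm hx
        · rw [Function.update_of_ne h6] at h5; exact ⟨by omega, h5⟩
      · rintro ⟨h4, h5⟩
        rw [Function.update_of_ne (by omega)]; exact ⟨by omega, h5⟩

/-- The last listed member moves into the gap left by `b`. If `b` is itself the last one, both
writes are harmless. -/
theorem del {b : ℕ} (hb : SpMem dn sp t b) :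
    SpInv (Function.update dn (sp b) (dn (t - 1))) (Function.update sp (dn (t - 1)) (sp b)) (t - 1)
      nb ∧
    ∀ x, SpMem (Function.update dn (sp b) (dn (t - 1))) (Function.update sp (dn (t - 1)) (sp b))
      (t - 1) x ↔ SpMem dn sp t x ∧ x ≠ b := by
  have h1 := h.lt
  have h2 := h.inv
  have ht : 0 < t := by have := hb.1; omega
  have hl := h2 (t - 1) (by omega)
  have hbs := hb.1
  have hbd := hb.2
  refine ⟨⟨fun p hp => ?_, fun p hp => ?_⟩, fun x => ?_⟩
  · by_cases hps : p = sp b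
    · subst hps; simp only [Function.update_self]; exact h1 _ (by omega)
    · rw [Function.update_of_ne hps]; exact h1 _ (by omega)
  · by_cases hps : p = sp b
    · subst hps; simp only [Function.update_self]
    · rw [Function.update_of_ne hps, Function.update_of_ne]; exact h2 _ (by omega)
      intro h3
      have := h.inj (by omega) (by omega) h3; omega
  · unfold SpMem
    by_cases hx : x = dn (t - 1)
    · subst hx
      simp only [Function.update_self, and_true]
      rw [hl]
      constructor
      · intro h4
        exact ⟨by omega, fun h5 => by rw [h5] at hl; omega⟩
      · rintro ⟨_, h5⟩
        have : sp b ≠ t - 1 := fun h6 => h5 (by rw [← h6, hbd])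
        omega
    · rw [Function.update_of_ne hx]
      constructor
      · rintro ⟨h4, h5⟩
        have h6 : sp x ≠ sp b := fun h6 => by rw [h6] at h5; simp at h5; exact hx h5.symm
        rw [Function.update_of_ne h6] at h5
        exact ⟨⟨by omega, h5⟩, fun h7 => h6 (by rw [h7])⟩
      · rintro ⟨⟨h4, h5⟩, h6⟩
        have h7 : sp x ≠ sp b := fun h7 => h6 (by rw [← h5, h7, hbd])
        rw [Function.update_of_ne h7]
        refine ⟨?_, h5⟩
        have : sp x ≠ t - 1 := fun h8 => hx (by rw [← h5, h8])
        omega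

end SpInv

/-! ### Permutations in uninitialized arrays -/

/-- The first `t` positions hold the members; an array entry beyond them is valid only if its index
is a member, and otherwise the position holds its own index. -/
structure LzInv (ta tb : ℕ → ℕ) (t nb : ℕ) : Prop extends SpInv ta tb t nb where
  low : ∀ x < t, ¬ SpMem ta tb t x → t ≤ tb x ∧ SpMem ta tb t (tb x) ∧ ta (tb x) = x
  high : ∀ i, t ≤ i → SpMem ta tb t i →
    ta i < t ∧ ¬ SpMem ta tb t (ta i) ∧ tb (ta i) = i

open Classical in
/-- The element at a position `i ≥ t`. -/
noncomputable def lz (ta tb : ℕ → ℕ) (t i : ℕ) : ℕ := if SpMem ta tb t i then ta i else i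

/-- The position of a nonmember. -/
def lpos (tb : ℕ → ℕ) (t b : ℕ) : ℕ := if b < t then tb b else b

namespace LzInv
variable {ta tb : ℕ → ℕ} {t nb : ℕ} (h : LzInv ta tb t nb)
include h

theorem lz_not_mem {i : ℕ} (hi : t ≤ i) : ¬ SpMem ta tb t (lz ta tb t i) := by
  unfold lz; split_ifs with h1
  · exact (h.high i hi h1).2.1
  · exact h1

theorem lz_lt {i : ℕ} (hi : t ≤ i) (hin : i < nb) : lz ta tb t i < nb := by
  unfold lz; split_ifs with h1
  · have := (h.high i hi h1).1; omega
  · exact hin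

theorem lpos_lz {i : ℕ} (hi : t ≤ i) : lpos tb t (lz ta tb t i) = i := by
  unfold lz lpos; split_ifs with h1 h2 h2
  · exact (h.high i hi h1).2.2
  · have := (h.high i hi h1).1; omega
  · omega
  · rfl

/-- Nonmembers below `t` have lost their natural position to the list of members; each is paired
with a member at or beyond `t`, whose natural position is free and whose membership certifies the
array entry there. Together with `lz_lt`, `lz_not_mem` and `lpos_lz` this makes `lz` a bijection
from the positions `t, …, nb - 1` onto the nonmembers, so these can be listed although no array was
initialised. -/
theorem lpos_spec {b : ℕ} (hb : ¬ SpMem ta tb t b) (hbn : b < nb) :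
    t ≤ lpos tb t b ∧ lpos tb t b < nb ∧ lz ta tb t (lpos tb t b) = b := by
  unfold lpos; split_ifs with h1
  · obtain ⟨h3, h4, h5⟩ := h.low b h1 hb
    exact ⟨h3, h.mem_lt h4, by rw [lz, if_pos h4, h5]⟩
  · exact ⟨by omega, hbn, by rw [lz, if_neg hb]⟩

theorem lz_inj {i j : ℕ} (hi : t ≤ i) (hj : t ≤ j) (hij : lz ta tb t i = lz ta tb t j) : i = j := by
  rw [← h.lpos_lz hi, ← h.lpos_lz hj, hij]

/-- If the nonmember `b` stands first among the nonmembers, it becomes a member by itself. -/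
theorem touch_eq {b : ℕ} (hb : ¬ SpMem ta tb t b) (hbn : b < nb) (hy : lz ta tb t t = b) :
    LzInv (Function.update ta t b) (Function.update tb b t) (t + 1) nb := by
  obtain ⟨hs, hm⟩ := h.toSpInv.add hbn hb
  refine { hs with low := fun x hx hxm => ?_, high := fun i hi him => ?_ }
  · rw [hm] at hxm; push Not at hxm
    have hxt : x < t := by
      rcases Nat.lt_succ_iff_lt_or_eq.1 hx with h1 | rfl
      · exact h1
      · exact absurd (by rw [← hy, lz, if_neg hxm.2]) hxm.1
    obtain ⟨h3, h4, h5⟩ := h.low x hxt hxm.2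
    have h6 : tb x ≠ t := fun h6 => hxm.1 (by rw [← hy, lz, if_pos (h6 ▸ h4), ← h6, h5])
    rw [Function.update_of_ne hxm.1, Function.update_of_ne h6, hm]
    exact ⟨by omega, Or.inr h4, h5⟩
  · rw [hm] at him
    have hib : SpMem ta tb t i := by
      rcases him with rfl | h1
      · have := h.lpos_lz (le_refl t)
        rw [hy] at this; unfold lpos at this; split_ifs at this <;> omega
      · exact h1
    obtain ⟨h3, h4, h5⟩ := h.high i (by omega) hib
    have h6 : ta i ≠ b := fun h6 => by
      have := h.lz_inj (i := i) (j := t) (by omega) le_rfl (by rw [hy, lz, if_pos hib, h6])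
      omega
    rw [Function.update_of_ne (a := i) (by omega), Function.update_of_ne h6, hm]
    exact ⟨by omega, by push Not; exact ⟨h6, h4⟩, h5⟩

/-- Otherwise the first nonmember moves to the position of `b`. -/
theorem touch_ne {b : ℕ} (hb : ¬ SpMem ta tb t b) (hbn : b < nb) {y p : ℕ}
    (hy : lz ta tb t t = y) (hyb : y ≠ b) (hp : lpos tb t b = p) :
    LzInv (Function.update (Function.update ta t b) p y)
      (Function.update (Function.update tb b t) y p) (t + 1) nb ∧
    ∀ x, SpMem (Function.update (Function.update ta t b) p y)
      (Function.update (Function.update tb b t) y p) (t + 1) x ↔ x = b ∨ SpMem ta tb t x := by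
  have hm0 := h.lz_not_mem (le_refl t)
  obtain ⟨hp1, hp2, hp3⟩ := h.lpos_spec hb hbn
  have htn : t < nb := h.toSpInv.lt_of_not_mem hbn hb
  rw [hp] at hp1 hp2 hp3
  rw [hy] at hm0
  -- If `p` were `t`, then `b` would itself be the first nonmember, against `hyb`.
  have hpt : t < p := by
    rcases Nat.lt_or_eq_of_le hp1 with h1 | h1
    · exact h1
    · exact absurd (by rw [← hy, h1, ← hp3]; rw [h1]) hyb
  have hyt : y ≤ t := by
    rw [← hy]; unfold lz; split_ifs with h1
    · exact (h.high t le_rfl h1).1.le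
    · exact le_rfl
  obtain ⟨hs, hm⟩ := h.toSpInv.add hbn hb
  have hmem : ∀ x, SpMem (Function.update (Function.update ta t b) p y)
      (Function.update (Function.update tb b t) y p) (t + 1) x ↔ x = b ∨ SpMem ta tb t x := by
    intro x
    rw [← hm x]
    unfold SpMem
    by_cases hxy : x = y
    · subst hxy
      -- The displaced `y` remains a nonmember because its new pointer `p` exceeds `t`.
      simp only [Function.update_self]
      have h1 : ¬ SpMem (Function.update ta t b) (Function.update tb b t) (t + 1) x := by
        rw [hm]; push Not; exact ⟨hyb, hm0⟩
      unfold SpMem at h1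
      constructor
      · rintro ⟨h2, _⟩; omega
      · intro h2; exact absurd h2 h1
    · rw [Function.update_of_ne hxy]
      refine and_congr_right fun h1 => ?_
      rw [Function.update_of_ne (by omega)]
  refine ⟨⟨⟨fun q hq => ?_, fun q hq => ?_⟩, fun x hx hxm => ?_, fun i hi him => ?_⟩, hmem⟩
  · rw [Function.update_of_ne (by omega)]; exact hs.lt q hq
  · rw [Function.update_of_ne (a := q) (by omega), Function.update_of_ne]; exact hs.inv q hq
    intro h1
    have := hs.mem_dn hq
    rw [h1, hm] at this
    rcases this with h2 | h2
    · exact hyb h2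
    · exact hm0 h2
  · rw [hmem] at hxm; push Not at hxm
    by_cases hxy : x = y
    · subst hxy
      simp only [Function.update_self, hmem, and_true]
      refine ⟨by omega, ?_⟩
      unfold lpos at hp; split_ifs at hp with h1
      · right; rw [← hp]; exact (h.low b h1 hb).2.1
      · left; exact hp.symm
    · have hxt : x < t := by
        rcases Nat.lt_succ_iff_lt_or_eq.1 hx with h1 | rfl
        · exact h1
        · exact absurd (by rw [← hy, lz, if_neg hxm.2]) hxy
      obtain ⟨h3, h4, h5⟩ := h.low x hxt hxm.2
      have h6 : tb x ≠ t := fun h6 => hxy (by rw [← hy, lz, if_pos (h6 ▸ h4), ← h6, h5])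
      have h7 : tb x ≠ p := fun h7 => hxm.1 (by rw [← hp3, lz, if_pos (h7 ▸ h4), ← h7, h5])
      rw [Function.update_of_ne hxy, Function.update_of_ne hxm.1, Function.update_of_ne h7,
        Function.update_of_ne h6, hmem]
      exact ⟨by omega, Or.inr h4, h5⟩
  · rw [hmem] at him
    by_cases hip : i = p
    · subst hip
      simp only [Function.update_self, hmem, and_true]
      have : y ≠ t ∨ y = t := by omega
      refine ⟨by omega, by push Not; exact ⟨hyb, hm0⟩⟩
    · have hib : SpMem ta tb t i := by
        rcases him with rfl | h1
        · unfold lpos at hp; split_ifs at hp with h1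
          · omega
          · exact absurd hp hip
        · exact h1
      obtain ⟨h3, h4, h5⟩ := h.high i (by omega) hib
      have h6 : ta i ≠ b := fun h6 => hip (h.lz_inj (by omega) (by omega)
        (by rw [hp3, lz, if_pos hib, h6]))
      have h7 : ta i ≠ y := fun h7 => by
        have := h.lz_inj (i := i) (j := t) (by omega) le_rfl (by rw [hy, lz, if_pos hib, h7])
        omega
      rw [Function.update_of_ne hip, Function.update_of_ne (a := i) (by omega),
        Function.update_of_ne h7, Function.update_of_ne h6, hmem]
      exact ⟨by omega, by push Not; exact ⟨h6, h4⟩, h5⟩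

end LzInv

/-! ### Parameters and memory layout -/

/-- Here `c` is the number of colours, `n` the size of the universe, `w` the word length, `d` the
number of elements of a leaf, `f` the number of bits of an encoded leaf, and `h` the distance of the
bits that stand for consecutive leaves in a summary word. -/
structure Par where
  c : ℕ
  n : ℕ
  w : ℕ
  d : ℕ
  f : ℕ
  h : ℕ

namespace Par
variable (P : Par)

/-- stride of the digits -/
def k : ℕ := 2 * P.f + 2
/-- leaves per block -/
def q : ℕ := P.w / P.h - 1
/-- leaves per word -/
def r : ℕ := P.w / P.f
/-- number of leaves -/
def nl : ℕ := P.n / P.d + if 0 < P.n % P.d then 1 else 0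
/-- number of blocks -/
def nb : ℕ := P.nl / P.q + if 0 < P.nl % P.q then 1 else 0
/-- number of buckets -/
def nk : ℕ := P.n / (P.w * P.w) + 1
/-- size of a block record -/
def S : ℕ := 3 * P.c + 3
/-- address of the block records -/
def FB : ℕ := 20 + P.c + 2 * P.nk
/-- address of the leaves -/
def LB : ℕ := P.FB + P.nb * P.S
/-- size of the memory -/
def M : ℕ := P.LB + P.nl / P.r + 1

def addr : Loc → ℕ
  | .hdr i => i
  | .cnt j => 20 + j
  | .es k => 20 + P.c + 2 * k
  | .ed k => 20 + P.c + 2 * k + 1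
  | .ta b => P.FB + b * P.S
  | .tb b => P.FB + b * P.S + 1
  | .li b => P.FB + b * P.S + 2
  | .dn j b => P.FB + b * P.S + 3 * j + 3
  | .sp j b => P.FB + b * P.S + 3 * j + 4
  | .sm j b => P.FB + b * P.S + 3 * j + 5
  | .lf i => P.LB + i

def valid : Loc → Prop
  | .hdr i => i < 20
  | .cnt j => j < P.c
  | .es k => k < P.nk
  | .ed k => k < P.nk
  | .ta b => b < P.nb
  | .tb b => b < P.nb
  | .li b => b < P.nb
  | .dn j b => j < P.c ∧ b < P.nb
  | .sp j b => j < P.c ∧ b < P.nb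
  | .sm j b => j < P.c ∧ b < P.nb
  | .lf i => i ≤ P.nl / P.r

theorem rec_lt {b o : ℕ} (hb : b < P.nb) (ho : o < P.S) : P.FB + b * P.S + o < P.LB := by
  have : (b + 1) * P.S ≤ P.nb * P.S := Nat.mul_le_mul_right _ hb
  unfold LB; rw [Nat.add_mul, one_mul] at this; omega

theorem addr_lt (l : Loc) (h : P.valid l) : P.addr l < P.M := by
  have h1 : P.FB ≤ P.LB := Nat.le_add_right _ _
  have h2 : ∀ j < P.c, 3 * j + 5 < P.S := fun j hj => by unfold S; omega
  have h3 : 3 ≤ P.S := by unfold S; omega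
  have hM : P.M = P.LB + P.nl / P.r + 1 := rfl
  have hF : P.FB = 20 + P.c + 2 * P.nk := rfl
  cases l <;> simp only [addr, valid] at * <;> generalize P.nl / P.r = g at *
  case ta b => have := P.rec_lt (o := 0) h (by omega); omega
  case tb b => have := P.rec_lt (o := 1) h (by omega); omega
  case li b => have := P.rec_lt (o := 2) h (by omega); omega
  case dn j b => have := h2 j h.1; have := P.rec_lt (o := 3 * j + 3) h.2 (by omega); omega
  case sp j b => have := h2 j h.1; have := P.rec_lt (o := 3 * j + 4) h.2 (by omega); omega
  case sm j b => have := h2 j h.1; have := P.rec_lt (o := 3 * j + 5) h.2 (by omega); omega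
  all_goals omega

def field (b o : ℕ) : Loc :=
  if o = 0 then .ta b else if o = 1 then .tb b else if o = 2 then .li b else
  if o % 3 = 0 then .dn (o / 3 - 1) b else if o % 3 = 1 then .sp (o / 3 - 1) b
  else .sm (o / 3 - 1) b

/-- The location at a given address. -/
def undo (a : ℕ) : Loc :=
  if a < 20 then .hdr a else if a < 20 + P.c then .cnt (a - 20) else
  if a < P.FB then
    if (a - 20 - P.c) % 2 = 0 then .es ((a - 20 - P.c) / 2) else .ed ((a - 20 - P.c) / 2) else
  if a < P.LB then field ((a - P.FB) / P.S) ((a - P.FB) % P.S) else .lf (a - P.LB)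

theorem undo_rec {b o : ℕ} (hb : b < P.nb) (ho : o < P.S) :
    P.undo (P.FB + b * P.S + o) = field b o := by
  have h1 := P.rec_lt hb ho
  have hF : P.FB = 20 + P.c + 2 * P.nk := rfl
  have h2 : P.FB + b * P.S + o - P.FB = o + P.S * b := by rw [mul_comm]; omega
  unfold undo
  rw [if_neg (by omega), if_neg (by omega), if_neg (by omega), if_pos h1, h2,
    Nat.add_mul_div_left _ _ (by omega), Nat.add_mul_mod_self_left, Nat.div_eq_of_lt ho,
    Nat.mod_eq_of_lt ho, zero_add]

/-- An explicit left inverse gives injectivity of the placement without comparing all pairs of kinds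
of locations. -/
theorem undo_addr (l : Loc) (h : P.valid l) : P.undo (P.addr l) = l := by
  have h2 : ∀ j < P.c, 3 * j + 5 < P.S := fun j hj => by unfold S; omega
  have h3 : 3 ≤ P.S := by unfold S; omega
  have hF : P.FB = 20 + P.c + 2 * P.nk := rfl
  have hL : P.FB ≤ P.LB := Nat.le_add_right _ _
  cases l <;> simp only [addr, valid] at *
  case hdr i => simp [undo, h]
  case cnt j => unfold undo; rw [if_neg (by omega), if_pos (by omega)]; congr 1; omega
  case es k =>
    unfold undo; rw [if_neg (by omega), if_neg (by omega), if_pos (by omega), if_pos (by omega)]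
    congr 1; omega
  case ed k =>
    unfold undo; rw [if_neg (by omega), if_neg (by omega), if_pos (by omega), if_neg (by omega)]
    congr 1; omega
  case ta b => have := P.undo_rec (o := 0) h (by omega); simpa [field] using this
  case tb b => have := P.undo_rec (o := 1) h (by omega); simpa [field] using this
  case li b => have := P.undo_rec (o := 2) h (by omega); simpa [field] using this
  case dn j b =>
    have := h2 j h.1
    rw [add_assoc, P.undo_rec (o := 3 * j + 3) h.2 (by omega)]
    unfold field
    rw [if_neg (by omega), if_neg (by omega), if_neg (by omega), if_pos (by omega)]
    congr 1; omega
  case sp j b =>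
    have := h2 j h.1
    rw [add_assoc, P.undo_rec (o := 3 * j + 4) h.2 (by omega)]
    unfold field
    rw [if_neg (by omega), if_neg (by omega), if_neg (by omega), if_neg (by omega),
      if_pos (by omega)]
    congr 1; omega
  case sm j b =>
    have := h2 j h.1
    rw [add_assoc, P.undo_rec (o := 3 * j + 5) h.2 (by omega)]
    unfold field
    rw [if_neg (by omega), if_neg (by omega), if_neg (by omega), if_neg (by omega),
      if_neg (by omega)]
    congr 1; omega
  case lf i =>
    unfold undo
    rw [if_neg (by omega), if_neg (by omega), if_neg (by omega), if_neg (by omega)]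
    congr 1; omega

/-- The memory layout. -/
def lay : Lay where
  w := P.w
  M := P.M
  addr := P.addr
  valid := P.valid
  lt := P.addr_lt
  inj l l' h h' e := by rw [← P.undo_addr l h, ← P.undo_addr l' h', e]

@[simp] theorem lay_w : P.lay.w = P.w := rfl

/-- The parameters suit the word length. -/
structure Good : Prop where
  codec : Codec P.c P.d P.f
  -- Decoding a leaf passes through `d + 1` fields, one more than there are digits.
  kd : P.k * (P.d + 1) < P.w
  df : P.d < 2 ^ P.f
  h1 : 1 ≤ P.h
  hw : 2 * P.h ≤ P.w
  -- This is what allows leaf indices to be recovered modulo `2 ^ h - 1`.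
  hq : P.w / P.h ≤ 2 ^ P.h - 1
  n_lt : P.n < 2 ^ P.w
  M_le : P.M ≤ 2 ^ P.w
  c_lt : 4 * P.c + 64 < 2 ^ P.w
  w_ge : 64 ≤ P.w
  c_lt_w : P.c < P.w

end Par

/-! ### Evaluation of expressions -/

/-- The expression can be evaluated and has the value `v`. -/
def EV (L : Lay) (σ : St) (e : Ex) (v : ℕ) : Prop := e.ok L σ ∧ e.val L σ = v

namespace EV
variable {L : Lay} {σ : St} {a b e : Ex} {x y z v : ℕ}

theorem reg {r : ℕ} (h : σ.ρ r = v) (hr : r < 64 := by decide) : EV L σ (.reg r) v := ⟨hr, h⟩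
theorem cst (h : v < 2 ^ L.w) : EV L σ (.cst v) v := ⟨h, rfl⟩
theorem num (n : ℕ) (h : n < 2 ^ L.w) : EV L σ (OfNat.ofNat n : Ex) n := ⟨h, rfl⟩
theorem wl : EV L σ .wl L.w := ⟨trivial, rfl⟩
theorem add (h1 : EV L σ a x) (h2 : EV L σ b y) (h : x + y < 2 ^ L.w) : EV L σ (a + b) (x + y) :=
  ⟨(ok_add ..).2 ⟨h1.1, h2.1, by rw [h1.2, h2.2]; exact h⟩, by rw [val_add, h1.2, h2.2]⟩
theorem sub (h1 : EV L σ a x) (h2 : EV L σ b y) (h : y ≤ x) : EV L σ (a - b) (x - y) :=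
  ⟨(ok_sub ..).2 ⟨h1.1, h2.1, by rw [h1.2, h2.2]; exact h⟩, by rw [val_sub, h1.2, h2.2]⟩
theorem mul (h1 : EV L σ a x) (h2 : EV L σ b y) (h : x * y < 2 ^ L.w) : EV L σ (a * b) (x * y) :=
  ⟨(ok_mul ..).2 ⟨h1.1, h2.1, by rw [h1.2, h2.2]; exact h⟩, by rw [val_mul, h1.2, h2.2]⟩
theorem div (h1 : EV L σ a x) (h2 : EV L σ b y) : EV L σ (a / b) (x / y) :=
  ⟨(ok_div ..).2 ⟨h1.1, h2.1⟩, by rw [val_div, h1.2, h2.2]⟩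
theorem mod (h1 : EV L σ a x) (h2 : EV L σ b y) : EV L σ (a % b) (x % y) :=
  ⟨(ok_mod ..).2 ⟨h1.1, h2.1⟩, by rw [val_mod, h1.2, h2.2]⟩
theorem and (h1 : EV L σ a x) (h2 : EV L σ b y) : EV L σ (a &&& b) (x &&& y) :=
  ⟨(ok_and ..).2 ⟨h1.1, h2.1⟩, by rw [val_and, h1.2, h2.2]⟩
theorem or (h1 : EV L σ a x) (h2 : EV L σ b y) : EV L σ (a ||| b) (x ||| y) :=
  ⟨(ok_or ..).2 ⟨h1.1, h2.1⟩, by rw [val_or, h1.2, h2.2]⟩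
theorem xor (h1 : EV L σ a x) (h2 : EV L σ b y) : EV L σ (a ^^^ b) (x ^^^ y) :=
  ⟨(ok_xor ..).2 ⟨h1.1, h2.1⟩, by rw [val_xor, h1.2, h2.2]⟩
theorem shl (h1 : EV L σ a x) (h2 : EV L σ b y) (h : x * 2 ^ y < 2 ^ L.w) :
    EV L σ (a <<< b) (x * 2 ^ y) :=
  ⟨(ok_shl ..).2 ⟨h1.1, h2.1, by rw [h1.2, h2.2]; exact h⟩, by rw [val_shl, h1.2, h2.2]⟩
theorem shr (h1 : EV L σ a x) (h2 : EV L σ b y) : EV L σ (a >>> b) (x / 2 ^ y) :=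
  ⟨(ok_shr ..).2 ⟨h1.1, h2.1⟩, by rw [val_shr, h1.2, h2.2]⟩
theorem eq (h1 : EV L σ a x) (h2 : EV L σ b y) : EV L σ (Ex.eq a b) (if x = y then 1 else 0) :=
  ⟨(ok_eq ..).2 ⟨h1.1, h2.1⟩, by rw [val_eq, h1.2, h2.2]⟩
theorem lt (h1 : EV L σ a x) (h2 : EV L σ b y) : EV L σ (Ex.lt a b) (if x < y then 1 else 0) :=
  ⟨(ok_lt ..).2 ⟨h1.1, h2.1⟩, by rw [val_lt, h1.2, h2.2]⟩
theorem cond_pos (h : EV L σ e x) (hx : x ≠ 0) (h1 : EV L σ a y) : EV L σ (.cond e a b) y :=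
  ⟨(ok_cond ..).2 ⟨h.1, fun _ => h1.1, fun h0 => absurd (h.2.symm.trans h0) hx⟩,
    by rw [val_cond, h.2, if_neg hx, h1.2]⟩
theorem cond_neg (h : EV L σ e 0) (h1 : EV L σ b y) : EV L σ (.cond e a b) y :=
  ⟨(ok_cond ..).2 ⟨h.1, fun h0 => absurd h.2 h0, fun _ => h1.1⟩, by rw [val_cond, if_pos h.2, h1.2]⟩
theorem ld {l : Loc} (h : EV L σ a (L.addr l)) (hl : L.valid l) : EV L σ (.ld a) (σ.m l) :=
  ⟨ok_ld _ _ _ h.1 hl h.2, val_ld _ _ _ hl h.2⟩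
theorem of_eq (h : EV L σ e x) (hxy : x = y) : EV L σ e y := hxy ▸ h

theorem lt' {p : Prop} [Decidable p] (h1 : EV L σ a x) (h2 : EV L σ b y) (h : x < y ↔ p) :
    EV L σ (Ex.lt a b) (if p then 1 else 0) := (h1.lt h2).of_eq (by simp [h])
theorem eq' {p : Prop} [Decidable p] (h1 : EV L σ a x) (h2 : EV L σ b y) (h : x = y ↔ p) :
    EV L σ (Ex.eq a b) (if p then 1 else 0) := (h1.eq h2).of_eq (by simp [h])
theorem cond {p : Prop} [Decidable p] (h : EV L σ e (if p then 1 else 0)) (h1 : p → EV L σ a y)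
    (h2 : ¬p → EV L σ b y) : EV L σ (.cond e a b) y := by
  by_cases hp : p
  · exact cond_pos h (by simp [hp]) (h1 hp)
  · exact cond_neg (h.of_eq (by simp [hp])) (h2 hp)

end EV

section
variable {L : Lay} {σ : St} {a e : Ex} {x v : ℕ} {Q : St → Prop} {p q : Pg}

theorem wp_set_of {r : ℕ} (h : EV L σ e v) (hQ : Q (σ.set r v)) (hr : r < 64 := by decide) :
    wp L (.set r e) Q σ := ⟨hr, h.1, by rw [h.2]; exact hQ⟩
theorem wp_sto_of {l : Loc} (ha : EV L σ a (L.addr l)) (hl : L.valid l) (h : EV L σ e v)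
    (hQ : Q (σ.sto l v)) : wp L (.sto a e) Q σ :=
  wp_sto _ _ _ _ _ hl ha.1 ha.2 h.1 (by rw [h.2]; exact hQ)
theorem wp_ite_of {c : Prop} [Decidable c] (h : EV L σ e (if c then 1 else 0)) (h1 : c → wp L p Q σ)
    (h2 : ¬ c → wp L q Q σ) : wp L (.ite e p q) Q σ := by
  refine ⟨h.1, fun h0 => ?_, fun h0 => ?_⟩ <;> rw [h.2] at h0
  · by_cases hc : c
    · exact h1 hc
    · simp [hc] at h0
  · by_cases hc : c
    · simp [hc] at h0
    · exact h2 hc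
theorem wp_emit_of (h : EV L σ e v) (hQ : Q (σ.emit v)) : wp L (.emit e) Q σ :=
  ⟨h.1, by rw [h.2]; exact hQ⟩
end

set_option linter.unusedSectionVars false

/-! ### Expressions for parameters and addresses -/

/-- Header words: 0 is `n`, 1 the initial colour `j0`, 2 the mode, 3 to 5 are `d`, `f`, `h`, 6 is
the number of touched blocks, 7 a bitmap of the colours whose counter is valid. The early structure
uses 8 (number of entries), 9 and 10 (packed keys and colours), 11 (a one in each field), 12 and 13
(start and length of an interval without entries) and 14 (number of listed buckets). During
migration, 15 and 16 are the numbers of entries moved and to be moved. -/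
def hd (i : ℕ) : Ex := .ld (.cst i)
def nE : Ex := hd 0
def j0E : Ex := hd 1
def dE : Ex := hd 3
def fE : Ex := hd 4
def hE : Ex := hd 5
def tE : Ex := hd 6
def ciE : Ex := hd 7
def kE : Ex := 2 * fE + 2
def qE : Ex := .wl / hE - 1
def rE : Ex := .wl / fE
def nlE : Ex := nE / dE + .lt 0 (nE % dE)
def nbE : Ex := nlE / qE + .lt 0 (nlE % qE)
def nkE : Ex := nE / (.wl * .wl) + 1
def FBE (c : ℕ) : Ex := .cst (20 + c) + 2 * nkE
def recE (c : ℕ) (b : Ex) : Ex := FBE c + b * .cst (3 * c + 3)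
def tbA (c : ℕ) (b : Ex) : Ex := recE c b + 1
def liA (c : ℕ) (b : Ex) : Ex := recE c b + 2
def dnA (c : ℕ) (j b : Ex) : Ex := recE c b + 3 * j + 3
def spA (c : ℕ) (j b : Ex) : Ex := recE c b + 3 * j + 4
def smA (c : ℕ) (j b : Ex) : Ex := recE c b + 3 * j + 5
def lfA (c : ℕ) (i : Ex) : Ex := FBE c + nbE * .cst (3 * c + 3) + i
def esA (c : ℕ) (k : Ex) : Ex := .cst (20 + c) + 2 * k
def edA (c : ℕ) (k : Ex) : Ex := .cst (20 + c) + 2 * k + 1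
def cntA (j : Ex) : Ex := 20 + j

/-- `onesE k i` has a one bit at each of the first `i` multiples of `k`. -/
def onesE (k i : Ex) : Ex := (((1 : Ex) <<< (k * i)) - 1) / (((1 : Ex) <<< k) - 1)
def logE (k v : Ex) : Ex := (v - 1) / (((1 : Ex) <<< k) - 1) % (((1 : Ex) <<< k) - 1)
def lsbE (v : Ex) : Ex := v - (v &&& (v - 1))
def modE (c : ℕ) : Ex := ((1 : Ex) <<< kE) - .cst c
def powE (c : ℕ) : Ex := ((1 : Ex) <<< (kE * dE)) % modE c
def encE (c : ℕ) (Y : Ex) : Ex := ((Y % modE c) <<< fE) / powE c + 1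
def spreadE (c : ℕ) (X : Ex) : Ex := X * (((1 : Ex) <<< (kE * (dE + 1))) / modE c)
def floorE (c : ℕ) (X : Ex) : Ex :=
  (spreadE c X - (spreadE c X &&& (onesE kE (dE + 1) * (((1 : Ex) <<< fE) - 1)))) >>> fE
def decE (c : ℕ) (X : Ex) : Ex := floorE c X - .cst c * (floorE c X >>> kE)
def leftE (l : Ex) : Ex := .cond (.lt (nE - l * dE) dE) (nE - l * dE) dE
def guardE : Ex := onesE kE dE <<< (kE - 1)
-- The xor with `j` copied into every field makes the matching fields zero, and the guard bits
-- reveal them. The final reduction drops the places of the last leaf that lie outside the universe.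
def matE (Y j l : Ex) : Ex :=
  (((guardE - (Y ^^^ (j * onesE kE dE))) &&& guardE) >>> (kE - 1)) % ((1 : Ex) <<< (kE * leftE l))
def leafE (c : ℕ) (l : Ex) : Ex :=
  (Ex.ld (lfA c (l / rE)) >>> (fE * (l % rE))) % ((1 : Ex) <<< fE)
-- The word `i` is the bitmap of the leaves of the block that have ever been written; a leaf that
-- has not been written consists of the initial colour only.
def YE (c : ℕ) (l i : Ex) : Ex :=
  .cond ((i >>> (l % qE)) % 2) (decE c (leafE c l)) (j0E * onesE kE dE)
def digE (Y i : Ex) : Ex := (Y >>> (kE * i)) % ((1 : Ex) <<< kE)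
def fullE (b : Ex) : Ex := onesE hE (.cond (.lt (nlE - b * qE) qE) (nlE - b * qE) qE)

theorem ceil_le (a b : ℕ) : a / b + (if 0 < a % b then 1 else 0) ≤ a := by
  rcases Nat.eq_zero_or_pos b with rfl | hb
  · simp; split_ifs <;> omega
  · have h1 := Nat.div_add_mod a b
    have h2 : a / b ≤ b * (a / b) := Nat.le_mul_of_pos_left _ hb
    split_ifs <;> omega

theorem mul_lt_of_lt_ceil {a b x : ℕ} (hx : x < a / b + if 0 < a % b then 1 else 0) :
    x * b < a := by
  have h1 := Nat.div_add_mod a b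
  have h2 : x * b ≤ b * (a / b) := by
    rw [mul_comm]; exact Nat.mul_le_mul_left _ (by split_ifs at hx <;> omega)
  split_ifs at hx with h
  · omega
  · have h3 : (x + 1) * b ≤ b * (a / b) := by
      rw [mul_comm]; exact Nat.mul_le_mul_left _ (by omega)
    rcases Nat.eq_zero_or_pos b with rfl | hb
    · simp at hx
    · rw [Nat.add_mul] at h3; omega

theorem lt_ceil {a b x : ℕ} (hb : 0 < b) (hx : x < a) :
    x / b < a / b + if 0 < a % b then 1 else 0 := by
  have h1 := Nat.div_add_mod a b
  rw [Nat.div_lt_iff_lt_mul hb, Nat.add_mul, mul_comm (a / b)]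
  split_ifs with h
  · have := Nat.mod_lt a hb; omega
  · omega

structure Hdr (P : Par) (m : Loc → ℕ) : Prop where
  n : m (.hdr 0) = P.n
  d : m (.hdr 3) = P.d
  f : m (.hdr 4) = P.f
  h : m (.hdr 5) = P.h

namespace Par.Good
variable {P : Par} (G : P.Good)
include G

theorem small {x : ℕ} (hx : x ≤ 64) : x < 2 ^ P.w := by have := G.c_lt; omega
theorem w_lt : P.w < 2 ^ P.w := Nat.lt_two_pow_self
theorem ww_lt : P.w * P.w < 2 ^ P.w := by
  have : ∀ m, 64 ≤ m → m * m < 2 ^ m := by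
    intro m hm
    induction m, hm using Nat.le_induction with
    | base => norm_num
    | succ m hm ih => rw [pow_succ]; nlinarith
  exact this _ G.w_ge
theorem nl_le : P.nl ≤ P.n := ceil_le _ _
theorem nb_le : P.nb ≤ P.nl := ceil_le _ _
theorem q_pos : 1 ≤ P.q := by
  have h1 : 2 ≤ P.w / P.h := (Nat.le_div_iff_mul_le G.h1).2 G.hw
  unfold Par.q; omega
-- The leaf given up in the definition of `q` pays for the strict inequality: the constant with a
-- one per leaf is computed from `2 ^ (h * q)`, which has to fit into a word.
theorem hq_lt : P.h * P.q < P.w := by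
  have h1 := Nat.mul_div_le P.w P.h
  have h2 : P.h * P.q + P.h = P.h * (P.w / P.h) := by
    have := G.q_pos
    rw [← Nat.mul_succ]; congr 1; unfold Par.q at *; omega
  have := G.h1
  omega
theorem q_lt : P.q < 2 ^ P.h - 1 := by have := G.hq; have := G.q_pos; unfold Par.q at *; omega
theorem q_lt_w : P.q < P.w := by
  have := G.hq_lt; have := Nat.le_mul_of_pos_left P.q G.h1; omega
theorem k_lt : P.k < P.w := by
  have := G.kd; have := Nat.le_mul_of_pos_right P.k (show 0 < P.d + 1 by omega); omega
theorem kd_lt : P.k * P.d < P.w := by have := G.kd; rw [Nat.mul_add] at this; omega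
theorem f_lt : P.f < P.w := by have := G.k_lt; unfold Par.k at this; omega
theorem d_lt : P.d < P.w := by
  have := G.kd_lt
  have := Nat.le_mul_of_pos_left P.d (show 0 < P.k by unfold Par.k; omega); omega
theorem r_pos : 1 ≤ P.r := (Nat.le_div_iff_mul_le G.codec.f_pos).2 (by have := G.f_lt; omega)
theorem fr_le : P.f * P.r ≤ P.w := Nat.mul_div_le _ _
theorem d_lt_k : P.d < 2 ^ P.k - 1 := by
  have h1 := G.df
  have h2 : 2 ^ P.f + 2 ^ P.f ≤ 2 ^ P.k := by
    rw [← two_mul, ← pow_succ']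
    exact Nat.pow_le_pow_right (by norm_num) (by unfold Par.k; omega)
  have := Nat.two_pow_pos P.f
  omega
theorem c_le_k : P.c < 2 ^ (P.k - 1) :=
  G.codec.c_lt.trans_le (Nat.pow_le_pow_right (by norm_num) (by unfold Par.k; omega))
theorem pow_lt {x : ℕ} (hx : x < P.w) : 2 ^ x < 2 ^ P.w := Nat.pow_lt_pow_right (by norm_num) hx
theorem addr_lt {l : Loc} (h : P.valid l) : P.addr l < 2 ^ P.w :=
  (P.addr_lt l h).trans_le G.M_le
theorem LB_lt : P.LB < 2 ^ P.w := by
  have := G.M_le; have : P.M = P.LB + P.nl / P.r + 1 := rfl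
  generalize P.nl / P.r = g at *; omega

end Par.Good

/-! ### Evaluation of addresses and of word-parallel expressions. -/

namespace EV
variable {P : Par} (G : P.Good) {σ : St} {a b e i j l X Y : Ex} {x y v : ℕ}

section
include G
theorem nm (n : ℕ) (h : n ≤ 64 := by norm_num) : EV P.lay σ (OfNat.ofNat n : Ex) n :=
  EV.num n (G.small h)

theorem hd (i : ℕ) (hi : i < 20 := by norm_num) : EV P.lay σ (hd i) (σ.m (.hdr i)) :=
  EV.ld (EV.cst (G.small (x := i) (by omega))) hi

theorem ones {k i : Ex} (hk : EV P.lay σ k x) (hi : EV P.lay σ i y) (hx : 1 ≤ x) (hxw : x < P.w)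
    (h : x * y < P.w) : EV P.lay σ (onesE k i) (pk (fun s => x * s) (fun _ => 1) y) := by
  refine (((nm G 1).shl (hk.mul hi (h.trans G.w_lt)) (by rw [one_mul]; exact G.pow_lt h)).sub (nm G 1)
    (by rw [one_mul]; exact Nat.one_le_two_pow) |>.div
    (((nm G 1).shl hk (by rw [one_mul]; exact G.pow_lt hxw)).sub (nm G 1)
    (by rw [one_mul]; exact Nat.one_le_two_pow))).of_eq ?_
  rw [one_mul, one_mul, ones_eq hx]

theorem log {k : Ex} (hk : EV P.lay σ k x) (hv : EV P.lay σ e (2 ^ (x * y))) (hx : 1 ≤ x)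
    (hxw : x < P.w) (hy : y < 2 ^ x - 1) : EV P.lay σ (logE k e) y := by
  have h1 := ((nm G 1).shl hk (by rw [one_mul]; exact G.pow_lt hxw)).sub (nm G 1)
    (by rw [one_mul]; exact Nat.one_le_two_pow)
  refine (((hv.sub (nm G 1) Nat.one_le_two_pow).div h1).mod h1).of_eq ?_
  rw [one_mul, log_eq hx hy]

theorem lsb {o : ℕ → ℕ} {A : Finset ℕ} (ho : ∀ s ∈ A, ∀ t ∈ A, s < t → o s < o t)
    (hA : A.Nonempty) (hv : EV P.lay σ e (bs o A)) : EV P.lay σ (lsbE e) (2 ^ o (A.min' hA)) := by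
  have h0 : 1 ≤ bs o A := by
    rcases Nat.eq_zero_or_pos (bs o A) with h | h
    · exact absurd (bs_eq_zero.1 h) hA.ne_empty
    · exact h
  refine (hv.sub (hv.and (hv.sub (nm G 1) h0)) Nat.and_le_left).of_eq (bs_lowest ho hA)

theorem clear {o : ℕ → ℕ} {A : Finset ℕ} (ho : ∀ s ∈ A, ∀ t ∈ A, s < t → o s < o t)
    (hA : A.Nonempty) (hv : EV P.lay σ e (bs o A)) :
    EV P.lay σ (e &&& (e - 1)) (bs o (A.erase (A.min' hA))) := by
  have h0 : 1 ≤ bs o A := by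
    rcases Nat.eq_zero_or_pos (bs o A) with h | h
    · exact absurd (bs_eq_zero.1 h) hA.ne_empty
    · exact h
  exact (hv.and (hv.sub (nm G 1) h0)).of_eq (bs_clear ho hA)
end

variable (H : Hdr P σ.m)
include G H

theorem n : EV P.lay σ nE P.n := (hd G 0).of_eq H.n
theorem d : EV P.lay σ dE P.d := (hd G 3).of_eq H.d
theorem f : EV P.lay σ fE P.f := (hd G 4).of_eq H.f
theorem h : EV P.lay σ hE P.h := (hd G 5).of_eq H.h
theorem k : EV P.lay σ kE P.k := by
  have h1 := G.k_lt; have h2 := G.w_lt; unfold Par.k at h1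
  exact ((nm G 2).mul (f G H) (by simp; omega)).add (nm G 2) (by simp; omega)
theorem q : EV P.lay σ qE P.q :=
  ((EV.wl (L := P.lay)).div (h G H)).sub (nm G 1) (by have := G.q_pos; unfold Par.q at *; simp; omega)
theorem r : EV P.lay σ rE P.r := (EV.wl (L := P.lay)).div (f G H)
theorem nl : EV P.lay σ nlE P.nl :=
  ((n G H).div (d G H)).add ((nm G 0).lt ((n G H).mod (d G H)))
    (G.nl_le.trans_lt G.n_lt)
theorem nb : EV P.lay σ nbE P.nb :=
  ((nl G H).div (q G H)).add ((nm G 0).lt ((nl G H).mod (q G H)))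
    (G.nb_le.trans_lt (G.nl_le.trans_lt G.n_lt))
theorem FB : EV P.lay σ (FBE P.c) P.FB := by
  have h1 : P.FB ≤ P.LB := Nat.le_add_right _ _
  have h2 := G.LB_lt
  have h3 : P.FB = 20 + P.c + 2 * P.nk := rfl
  have h4 : P.nk = P.n / (P.w * P.w) + 1 := rfl
  have h5 : EV P.lay σ nkE P.nk :=
    ((n G H).div ((EV.wl (L := P.lay)).mul EV.wl G.ww_lt)).add (nm G 1)
      (by simp only [Par.lay_w]; rw [← h4]; omega)
  exact (EV.cst (v := 20 + P.c) (by simp; omega)).add ((nm G 2).mul h5 (by simp; omega))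
    (by simp; omega)
theorem cS : EV P.lay σ (.cst (3 * P.c + 3)) P.S :=
  EV.cst (by have := G.c_lt; simp; omega)
theorem lf (hi : EV P.lay σ i x) (hx : x ≤ P.nl / P.r) :
    EV P.lay σ (lfA P.c i) (P.addr (.lf x)) := by
  have h1 := G.addr_lt (l := .lf x) hx
  have h2 := G.LB_lt
  have h3 : P.LB = P.FB + P.nb * P.S := rfl
  refine ((FB G H).add ((nb G H).mul (cS G H) ?_) ?_).add hi h1
  · simp only [Par.lay_w]; omega
  · simp only [Par.lay_w]; omega
theorem rec (hb : EV P.lay σ b y) (hy : y < P.nb) : EV P.lay σ (recE P.c b) (P.addr (.ta y)) := by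
  have h1 := G.addr_lt (l := .ta y) hy
  have h3 : P.addr (.ta y) = P.FB + y * P.S := rfl
  exact (FB G H).add (hb.mul (cS G H) (by simp only [Par.lay_w]; omega)) h1
theorem tb (hb : EV P.lay σ b y) (hy : y < P.nb) : EV P.lay σ (tbA P.c b) (P.addr (.tb y)) :=
  (rec G H hb hy).add (nm G 1) (G.addr_lt (l := .tb y) hy)
theorem li (hb : EV P.lay σ b y) (hy : y < P.nb) : EV P.lay σ (liA P.c b) (P.addr (.li y)) :=
  (rec G H hb hy).add (nm G 2) (G.addr_lt (l := .li y) hy)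
theorem recj (hj : EV P.lay σ j x) (hb : EV P.lay σ b y) (hx : x < P.c) (hy : y < P.nb) :
    EV P.lay σ (recE P.c b + 3 * j) (P.FB + y * P.S + 3 * x) := by
  have h1 : P.FB + y * P.S + 3 * x + 5 < 2 ^ P.w := G.addr_lt (l := .sm x y) ⟨hx, hy⟩
  exact (rec G H hb hy).add ((nm G 3).mul hj (by simp only [Par.lay_w]; omega))
    (by simp only [Par.lay_w, Par.addr]; omega)
theorem dn (hj : EV P.lay σ j x) (hb : EV P.lay σ b y) (hx : x < P.c) (hy : y < P.nb) :
    EV P.lay σ (dnA P.c j b) (P.addr (.dn x y)) :=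
  (recj G H hj hb hx hy).add (nm G 3) (G.addr_lt (l := .dn x y) ⟨hx, hy⟩)
theorem sp (hj : EV P.lay σ j x) (hb : EV P.lay σ b y) (hx : x < P.c) (hy : y < P.nb) :
    EV P.lay σ (spA P.c j b) (P.addr (.sp x y)) :=
  (recj G H hj hb hx hy).add (nm G 4) (G.addr_lt (l := .sp x y) ⟨hx, hy⟩)
theorem sm (hj : EV P.lay σ j x) (hb : EV P.lay σ b y) (hx : x < P.c) (hy : y < P.nb) :
    EV P.lay σ (smA P.c j b) (P.addr (.sm x y)) :=
  (recj G H hj hb hx hy).add (nm G 5) (G.addr_lt (l := .sm x y) ⟨hx, hy⟩)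
omit H in
theorem cnt (hj : EV P.lay σ j x) (hx : x < P.c) : EV P.lay σ (cntA j) (P.addr (.cnt x)) :=
  (nm G 20).add hj (G.addr_lt (l := .cnt x) hx)

theorem modc : EV P.lay σ (modE P.c) (2 ^ P.k - P.c) := by
  have h1 := G.c_lt
  refine (((nm G 1).shl (k G H) (by rw [one_mul]; exact G.pow_lt G.k_lt)).sub
    (EV.cst (by simp only [Par.lay_w]; omega)) ?_).of_eq (by rw [one_mul])
  have := G.codec.add_lt; rw [one_mul]; unfold Par.k; omega

theorem powc : EV P.lay σ (powE P.c) (P.c ^ P.d) := by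
  refine (((nm G 1).shl ((k G H).mul (d G H) (G.kd_lt.trans G.w_lt))
    (by rw [one_mul]; exact G.pow_lt G.kd_lt)).mod (modc G H)).of_eq ?_
  rw [one_mul]; exact G.codec.pow_mod

theorem enc {y : ℕ → ℕ} (hy : ∀ i < P.d, y i < P.c)
    (hY : EV P.lay σ Y (pk (fun s => P.k * s) y P.d)) :
    EV P.lay σ (encE P.c Y) (hn P.c y P.d * 2 ^ P.f / P.c ^ P.d + 1) := by
  have h1 := hn_lt hy
  have h2 := G.codec.enc_lt h1
  have h3 := G.pow_lt G.f_lt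
  have h4 : hn P.c y P.d * 2 ^ P.f < 2 ^ P.w := by
    calc _ < 2 ^ P.f * 2 ^ P.f :=
          Nat.mul_lt_mul_of_pos_right (h1.trans G.codec.hf) (Nat.two_pow_pos _)
      _ ≤ 2 ^ P.w := by
          rw [← pow_add]
          exact Nat.pow_le_pow_right (by norm_num) (by have := G.k_lt; unfold Par.k at this; omega)
  have h5 : EV P.lay σ (Y % modE P.c) (hn P.c y P.d) :=
    (hY.mod (modc G H)).of_eq (G.codec.pk_mod hy)
  exact ((h5.shl (f G H) h4).div (powc G H)).add (nm G 1) (h2.trans h3)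

theorem dec {y : ℕ → ℕ} (hy : ∀ i < P.d, y i < P.c)
    (hX : EV P.lay σ X (hn P.c y P.d * 2 ^ P.f / P.c ^ P.d + 1)) :
    EV P.lay σ (decE P.c X) (pk (fun s => P.k * s) y P.d) := by
  have h1 := hn_lt hy
  have hk := k G H
  have hd1 : EV P.lay σ (dE + 1) (P.d + 1) :=
    (d G H).add (nm G 1) (by have := G.d_lt; have := G.w_lt; simp only [Par.lay_w]; omega)
  obtain ⟨h2, h3⟩ := G.codec.floors h1 (V := _) rfl
  have hlt := G.pow_lt G.kd
  have h4 : EV P.lay σ (spreadE P.c X) ((hn P.c y P.d * 2 ^ P.f / P.c ^ P.d + 1) *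
      pk (fun s => (2 * P.f + 2) * s) (fun p => P.c ^ (P.d - p)) (P.d + 1)) := by
    have h5 : EV P.lay σ (((1 : Ex) <<< (kE * (dE + 1))) / modE P.c)
        (pk (fun s => (2 * P.f + 2) * s) (fun p => P.c ^ (P.d - p)) (P.d + 1)) := by
      refine (((nm G 1).shl (hk.mul hd1 (G.kd.trans G.w_lt))
        (by rw [one_mul]; exact hlt)).div (modc G H)).of_eq ?_
      rw [one_mul]; exact G.codec.quot_eq
    exact hX.mul h5 (h2.trans hlt)
  have hff : 2 ^ P.f ≤ 2 ^ (2 * P.f + 2) := Nat.pow_le_pow_right (by norm_num) (by omega)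
  have h6 : EV P.lay σ (floorE P.c X)
      (pk (fun s => (2 * P.f + 2) * s) (fun p => hn P.c y P.d / P.c ^ p) (P.d + 1)) := by
    refine ((h4.sub (h4.and ((ones G hk hd1 (by unfold Par.k; omega) G.k_lt G.kd).mul
      (((nm G 1).shl (f G H) (by rw [one_mul]; exact G.pow_lt G.f_lt)).sub (nm G 1)
      (by rw [one_mul]; exact Nat.one_le_two_pow)) ?_)) Nat.and_le_left).shr (f G H)).of_eq ?_
    · rw [one_mul, mul_comm, pk_mul]
      refine (pk_lt (sep_mul le_rfl) (fun s _ => ?_) (B := P.k * (P.d + 1)) fun s hs => ?_).trans hlt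
      · have := Nat.two_pow_pos P.f; unfold Par.k; omega
      · calc P.k * s + P.k = P.k * (s + 1) := by ring
          _ ≤ _ := Nat.mul_le_mul_left _ hs
    · rw [one_mul]; exact h3
  obtain ⟨h7, h8⟩ := G.codec.digits hy (FL := _) rfl
  refine (h6.sub ((EV.cst (by have := G.c_lt; simp only [Par.lay_w]; omega)).mul (h6.shr hk) ?_)
    h7).of_eq h8
  refine lt_of_le_of_lt h7 ((pk_lt (sep_mul le_rfl) (fun s _ => ?_) (B := P.k * (P.d + 1))
    fun s hs => ?_).trans hlt)
  · refine (Nat.div_le_self _ _).trans_lt (h1.trans (G.codec.hf.trans_le hff))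
  · calc P.k * s + P.k = P.k * (s + 1) := by ring
      _ ≤ _ := Nat.mul_le_mul_left _ hs

theorem onesd : EV P.lay σ (onesE kE dE) (pk (fun s => P.k * s) (fun _ => 1) P.d) :=
  ones G (k G H) (d G H) (by unfold Par.k; omega) G.k_lt G.kd_lt

theorem guard : EV P.lay σ guardE (pk (fun s => P.k * s) (fun _ => 1) P.d * 2 ^ (P.k - 1)) := by
  have hk1 : 1 ≤ P.k := by unfold Par.k; omega
  refine (onesd G H).shl ((k G H).sub (nm G 1) hk1) ?_
  rw [mul_comm, pk_mul]
  refine (pk_lt (sep_mul le_rfl) (fun s _ => ?_) (B := P.k * P.d) fun s hs => ?_).trans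
    (G.pow_lt G.kd_lt)
  · rw [mul_one]; exact Nat.pow_lt_pow_right (by norm_num) (by omega)
  · calc P.k * s + P.k = P.k * (s + 1) := by ring
      _ ≤ _ := Nat.mul_le_mul_left _ hs

theorem left (hl : EV P.lay σ l x) (hx : x < P.nl) :
    EV P.lay σ (leftE l) (min (P.n - x * P.d) P.d) := by
  have h1 : x * P.d < P.n := mul_lt_of_lt_ceil hx
  have h2 := (n G H).sub (hl.mul (d G H) (h1.trans G.n_lt)) h1.le
  refine EV.cond (h2.lt (d G H)) (fun h => h2.of_eq ?_) (fun h => (d G H).of_eq ?_) <;> omega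

theorem mat {y : ℕ → ℕ} {v : ℕ} (hy : ∀ i < P.d, y i < P.c)
    (hY : EV P.lay σ Y (pk (fun s => P.k * s) y P.d)) (hj : EV P.lay σ j v) (hv : v < P.c)
    (hl : EV P.lay σ l x) (hx : x < P.nl) :
    EV P.lay σ (matE Y j l) (bs (fun s => P.k * s)
      ((Finset.range P.d).filter fun i => x * P.d + i < P.n ∧ y i = v)) := by
  have hk1 : 1 ≤ P.k := by unfold Par.k; omega
  have hc := G.c_le_k
  have hkk : 2 ^ (P.k - 1) ≤ 2 ^ P.k := Nat.pow_le_pow_right (by norm_num) (by omega)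
  have hB : ∀ s < P.d, P.k * s + P.k ≤ P.k * P.d := fun s hs => by
    calc P.k * s + P.k = P.k * (s + 1) := by ring
      _ ≤ _ := Nat.mul_le_mul_left _ hs
  have hsep : Sep (fun s => P.k * s) P.k P.d := sep_mul le_rfl
  have hj1 : EV P.lay σ (j * onesE kE dE) (pk (fun s => P.k * s) (fun _ => v) P.d) := by
    have h1 : v * pk (fun s => P.k * s) (fun _ => 1) P.d = pk (fun s => P.k * s) (fun _ => v) P.d := by
      rw [pk_mul]; simp
    refine (hj.mul (onesd G H) ?_).of_eq h1
    rw [h1]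
    exact (pk_lt hsep (fun s _ => by omega) hB).trans (G.pow_lt G.kd_lt)
  have hz : EV P.lay σ (Y ^^^ (j * onesE kE dE)) (pk (fun s => P.k * s) (fun s => y s ^^^ v) P.d) :=
    (hY.xor hj1).of_eq (pk_xor hsep (fun s hs => by have := hy s hs; omega) (fun s _ => by omega))
  have hzz : ∀ s < P.d, y s ^^^ v < 2 ^ (P.k - 1) := fun s hs =>
    Nat.xor_lt_two_pow ((hy s hs).trans hc) (hv.trans hc)
  have hsep' : Sep (fun s => P.k * s) (P.k - 1 + 1) P.d := hsep.mono (by omega)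
  have hle : pk (fun s => P.k * s) (fun s => y s ^^^ v) P.d
      ≤ pk (fun s => P.k * s) (fun _ => 1) P.d * 2 ^ (P.k - 1) := by
    rw [mul_comm, pk_mul]; exact pk_le fun s hs => by have := hzz s hs; omega
  have hinj : Set.InjOn (fun s => P.k * s)
      ((Finset.range P.d).filter fun s => y s ^^^ v = 0 : Finset ℕ) :=
    fun s _ t _ hst => Nat.eq_of_mul_eq_mul_left hk1 hst
  have hleft := left G H hl hx
  have hlk : P.k * min (P.n - x * P.d) P.d < P.w :=
    (Nat.mul_le_mul_left _ (min_le_right _ _)).trans_lt G.kd_lt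
  refine (((((guard G H).sub hz hle).and (guard G H)).shr ((k G H).sub (nm G 1) hk1)).mod
    ((nm G 1).shl ((k G H).mul hleft (hlk.trans G.w_lt))
    (by rw [one_mul]; exact G.pow_lt hlk))).of_eq ?_
  rw [zero_fields hsep' hzz, one_mul, bs_mod _ hinj]
  congr 1
  have hxn : x * P.d < P.n := mul_lt_of_lt_ceil hx
  ext i
  simp only [Finset.mem_filter, Finset.mem_range, Nat.xor_eq_zero_iff,
    Nat.mul_lt_mul_left (show 0 < P.k by omega), lt_min_iff]
  constructor
  · rintro ⟨⟨h1, h2⟩, h3, h4⟩; exact ⟨h1, by omega, h2⟩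
  · rintro ⟨h1, h2, h3⟩; exact ⟨⟨h1, h3⟩, by omega, h1⟩

theorem leaf (hl : EV P.lay σ l x) (hx : x < P.nl) :
    EV P.lay σ (leafE P.c l) (σ.m (.lf (x / P.r)) / 2 ^ (P.f * (x % P.r)) % 2 ^ P.f) := by
  have h2 : x / P.r ≤ P.nl / P.r := Nat.div_le_div_right hx.le
  have h3 : P.f * (x % P.r) < 2 ^ P.w :=
    ((Nat.mul_le_mul_left _ (Nat.mod_lt _ G.r_pos).le).trans G.fr_le).trans_lt G.w_lt
  refine ((((EV.ld (lf G H (hl.div (r G H)) h2) h2).shr ((f G H).mul (hl.mod (r G H)) h3)).mod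
    ((nm G 1).shl (f G H) (by rw [one_mul]; exact G.pow_lt G.f_lt)))).of_eq (by rw [one_mul])

theorem dig {y : ℕ → ℕ} (hy : ∀ i < P.d, y i < P.c)
    (hY : EV P.lay σ Y (pk (fun s => P.k * s) y P.d)) (hi : EV P.lay σ i x) (hx : x < P.d) :
    EV P.lay σ (digE Y i) (y x) := by
  have hkk : 2 ^ (P.k - 1) ≤ 2 ^ P.k := Nat.pow_le_pow_right (by norm_num) (by omega)
  have hc := G.c_le_k
  refine ((hY.shr ((k G H).mul hi (((Nat.mul_le_mul_left _ hx.le).trans_lt G.kd_lt).trans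
    G.w_lt))).mod ((nm G 1).shl (k G H) (by rw [one_mul]; exact G.pow_lt G.k_lt))).of_eq ?_
  rw [one_mul]
  exact pk_field (o := fun s => P.k * s) (sep_mul le_rfl)
    (fun s hs => by have := hy s hs; omega) hx

/-- The leaves of a block. -/
theorem full (hb : EV P.lay σ b x) (hx : x < P.nb) :
    EV P.lay σ (fullE b) (bs (fun s => P.h * s) (Finset.range (min (P.nl - x * P.q) P.q))) := by
  have h1 : x * P.q < P.nl := mul_lt_of_lt_ceil hx
  have h2 := (nl G H).sub (hb.mul (q G H) (h1.trans (G.nl_le.trans_lt G.n_lt))) h1.le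
  have h3 := EV.cond (a := nlE - b * qE) (b := qE) (h2.lt (q G H))
    (fun h => h2.of_eq (y := min (P.nl - x * P.q) P.q) (by omega)) (fun h => (q G H).of_eq (by omega))
  have h4 := G.hw
  have h5 := G.h1
  rw [← pk_one_eq_bs]
  exact ones G (h G H) h3 h5 (by omega)
    ((Nat.mul_le_mul_left _ (min_le_right _ _)).trans_lt G.hq_lt)

end EV

/-! ### The main data structure: invariant and queries -/

def Bit (x i : ℕ) : Prop := x / 2 ^ i % 2 = 1

instance (x i : ℕ) : Decidable (Bit x i) := inferInstanceAs (Decidable (_ = _))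
instance (dn sp : ℕ → ℕ) (t b : ℕ) : Decidable (SpMem dn sp t b) :=
  inferInstanceAs (Decidable (_ ∧ _))

theorem bit_iff_testBit (x i : ℕ) : Bit x i ↔ x.testBit i = true := by
  rw [Nat.testBit_eq_decide_div_mod_eq, Bit]; simp

theorem bit_zero (i : ℕ) : ¬ Bit 0 i := by simp [Bit]

theorem bit_or_pow (x i j : ℕ) : Bit (x ||| 2 ^ i) j ↔ Bit x j ∨ j = i := by
  rw [bit_iff_testBit, bit_iff_testBit, Nat.testBit_or, Nat.testBit_two_pow, Bool.or_eq_true,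
    decide_eq_true_eq, eq_comm (a := j)]

/-- Membership in a sparse set. -/
def spmE (aD aS : Ex → Ex) (t b : Ex) : Ex :=
  .cond (.lt (.ld (aS b)) t) (.eq (.ld (aD (.ld (aS b)))) b) 0
def tchE (c : ℕ) (b : Ex) : Ex := spmE (recE c) (tbA c) tE b
def lzE (c : ℕ) (i : Ex) : Ex := .cond (tchE c i) (.ld (recE c i)) i
def liE (c : ℕ) (b : Ex) : Ex := .cond (tchE c b) (.ld (liA c b)) 0
-- Zeroing `c` counters would take time depending on `c`. Instead, a counter is read as zero until
-- its bit in header word 7 is set; since `c < w`, one word of such bits suffices.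
def cntE (j : Ex) : Ex := .cond ((ciE >>> j) % 2) (.ld (cntA j)) 0
def memE (c : ℕ) (j b : Ex) : Ex := spmE (dnA c j) (spA c j) (cntE j) b
/-- The colour of an element. -/
def colE (c : ℕ) (x : Ex) : Ex := digE (YE c (x / dE) (liE c (x / dE / qE))) (x % dE)
/-- The number of blocks that contain colour `j`, the `p`th of them, and its leaves with `j`. -/
def totE (j : Ex) : Ex := cntE j + .cond (.eq j j0E) (nbE - tE) 0
def blkE (c : ℕ) (j p : Ex) : Ex :=
  .cond (.lt p (cntE j)) (.ld (dnA c j p)) (lzE c (tE + (p - cntE j)))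
def vE (c : ℕ) (j p b : Ex) : Ex := .cond (.lt p (cntE j)) (.ld (smA c j b)) (fullE b)

section
variable (P : Par) (m : Loc → ℕ) (s : ℕ → ℕ)

/-- Block `b` has been touched. -/
def Tch (b : ℕ) : Prop := SpMem (fun b => m (.ta b)) (fun b => m (.tb b)) (m (.hdr 6)) b
instance (b : ℕ) : Decidable (Tch m b) := inferInstanceAs (Decidable (SpMem ..))
/-- Leaf `l` has been written. -/
def Ini (l : ℕ) : Prop := Tch m (l / P.q) ∧ Bit (m (.li (l / P.q))) (l % P.q)
def cntV (j : ℕ) : ℕ := if Bit (m (.hdr 7)) j then m (.cnt j) else 0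
def liV (b : ℕ) : ℕ := if Tch m b then m (.li b) else 0
/-- Touched block `b` is listed for colour `j`. -/
def Mem (j b : ℕ) : Prop := SpMem (fun b => m (.dn j b)) (fun b => m (.sp j b)) (cntV m j) b
instance (j b : ℕ) : Decidable (Mem m j b) := inferInstanceAs (Decidable (SpMem ..))
/-- The places in leaf `l` with colour `j`. -/
def mts (j l : ℕ) : Finset ℕ :=
  (Finset.range P.d).filter fun i => l * P.d + i < P.n ∧ s (l * P.d + i) = j
/-- The leaves in block `b` with colour `j`. -/
def lvs (j b : ℕ) : Finset ℕ :=
  (Finset.range P.q).filter fun v => (mts P s j (b * P.q + v)).Nonempty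
def encV (y : ℕ → ℕ) : ℕ := hn P.c y P.d * 2 ^ P.f / P.c ^ P.d + 1
def fieldV (l : ℕ) : ℕ := m (.lf (l / P.r)) / 2 ^ (P.f * (l % P.r)) % 2 ^ P.f

/-- A colour lists only touched blocks. Untouched blocks consist of `j0` and need no record, by
`nlf`. The bound `bd` is all that is required of leaf words with arbitrary contents. -/
structure FInv (j0 : ℕ) : Prop where
  lz : LzInv (fun b => m (.ta b)) (fun b => m (.tb b)) (m (.hdr 6)) P.nb
  lf : ∀ l < P.nl, Ini P m l → fieldV P m l = encV P fun i => s (l * P.d + i)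
  nlf : ∀ l < P.nl, ¬ Ini P m l → ∀ i < P.d, s (l * P.d + i) = j0
  bd : ∀ i ≤ P.nl / P.r, m (.lf i) < 2 ^ P.w
  col : ∀ x, s x < P.c
  sp : ∀ j < P.c, SpInv (fun b => m (.dn j b)) (fun b => m (.sp j b)) (cntV m j) P.nb
  mem : ∀ j < P.c, ∀ b, Mem m j b ↔ Tch m b ∧ (lvs P s j b).Nonempty
  sm : ∀ j < P.c, ∀ b, Mem m j b → m (.sm j b) = bs (fun v => P.h * v) (lvs P s j b)

/-- For the initial colour, the untouched blocks are appended virtually to the listed ones, in the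
order of the implicit permutation. -/
def tot (j0 j : ℕ) : ℕ := cntV m j + if j = j0 then P.nb - m (.hdr 6) else 0
open Classical in
noncomputable def blk (j p : ℕ) : ℕ :=
  if p < cntV m j then m (.dn j p)
  else SetColl.lz (fun b => m (.ta b)) (fun b => m (.tb b)) (m (.hdr 6))
    (m (.hdr 6) + (p - cntV m j))
end

section
variable {P : Par} {m : Loc → ℕ} {s : ℕ → ℕ} {j0 : ℕ}

theorem mem_mts {j l i : ℕ} :
    i ∈ mts P s j l ↔ i < P.d ∧ l * P.d + i < P.n ∧ s (l * P.d + i) = j := by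
  simp [mts]

theorem mem_lvs {j b v : ℕ} :
    v ∈ lvs P s j b ↔ v < P.q ∧ (mts P s j (b * P.q + v)).Nonempty := by
  simp [lvs]

theorem leaf_lt (G : P.Good) {l i : ℕ} (hi : i < P.d) (h : l * P.d + i < P.n) : l < P.nl := by
  have h1 := lt_ceil G.codec.hd h
  rw [mul_comm, Nat.mul_add_div G.codec.hd, Nat.div_eq_of_lt hi, add_zero] at h1
  exact h1

theorem leaf_div (G : P.Good) {b v : ℕ} (hv : v < P.q) :
    (b * P.q + v) / P.q = b ∧ (b * P.q + v) % P.q = v := by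
  have := G.q_pos
  constructor
  · rw [mul_comm, Nat.mul_add_div this, Nat.div_eq_of_lt hv, add_zero]
  · rw [mul_comm, Nat.mul_add_mod, Nat.mod_eq_of_lt hv]

theorem elt_div (G : P.Good) {l i : ℕ} (hi : i < P.d) :
    (l * P.d + i) / P.d = l ∧ (l * P.d + i) % P.d = i := by
  have := G.codec.hd
  constructor
  · rw [mul_comm, Nat.mul_add_div this, Nat.div_eq_of_lt hi, add_zero]
  · rw [mul_comm, Nat.mul_add_mod, Nat.mod_eq_of_lt hi]

theorem elt_leaf_lt (G : P.Good) {x : ℕ} (hx : x < P.n) : x / P.d < P.nl := lt_ceil G.codec.hd hx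

theorem leaf_blk_lt (G : P.Good) {l : ℕ} (hl : l < P.nl) : l / P.q < P.nb := lt_ceil G.q_pos hl

theorem mem_lvs_elt (G : P.Good) {x : ℕ} (hx : x < P.n) :
    x / P.d % P.q ∈ lvs P s (s x) (x / P.d / P.q) ∧ x % P.d ∈ mts P s (s x) (x / P.d) := by
  have h1 : x % P.d ∈ mts P s (s x) (x / P.d) := by
    rw [mem_mts, mul_comm, Nat.div_add_mod]
    exact ⟨Nat.mod_lt _ G.codec.hd, hx, rfl⟩
  refine ⟨?_, h1⟩
  rw [mem_lvs, mul_comm (_ / P.q), Nat.div_add_mod]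
  exact ⟨Nat.mod_lt _ G.q_pos, ⟨_, h1⟩⟩

theorem lvs_blk_lt (G : P.Good) {j b : ℕ} (h : (lvs P s j b).Nonempty) : b < P.nb := by
  obtain ⟨v, hv⟩ := h
  rw [mem_lvs] at hv
  obtain ⟨i, hi⟩ := hv.2
  rw [mem_mts] at hi
  have := leaf_blk_lt G (leaf_lt G hi.1 hi.2.1)
  rwa [(leaf_div G hv.1).1] at this

theorem FInv.untouched (I : FInv P m s j0) {b : ℕ} (hb : ¬ Tch m b) {l : ℕ}
    (hl : l < P.nl) (hlb : l / P.q = b) {i : ℕ} (hi : i < P.d) : s (l * P.d + i) = j0 :=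
  I.nlf l hl (fun h => hb (hlb ▸ h.1)) i hi

/-- Place 0 of a leaf always lies in the universe, so every leaf of an untouched block contains
`j0`, even a short last one. -/
theorem FInv.untouched_mts (G : P.Good) (I : FInv P m s j0) {b : ℕ} (hb : ¬ Tch m b) {l : ℕ}
    (hl : l < P.nl) (hlb : l / P.q = b) : (mts P s j0 l).Nonempty := by
  refine ⟨0, mem_mts.2 ⟨G.codec.hd, ?_, I.untouched hb hl hlb G.codec.hd⟩⟩
  exact mul_lt_of_lt_ceil hl

theorem FInv.untouched_lvs (G : P.Good) (I : FInv P m s j0) {b : ℕ} (hb : ¬ Tch m b) :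
    lvs P s j0 b = Finset.range (min (P.nl - b * P.q) P.q) := by
  ext v
  rw [mem_lvs, Finset.mem_range, lt_min_iff]
  constructor
  · rintro ⟨hv, i, hi⟩
    rw [mem_mts] at hi
    have := leaf_lt G hi.1 hi.2.1
    omega
  · rintro ⟨h1, h2⟩
    exact ⟨h2, I.untouched_mts G hb (by omega) (leaf_div G h2).1⟩

theorem FInv.lvs_other (G : P.Good) (I : FInv P m s j0) {b j : ℕ} (hb : ¬ Tch m b) (hj : j ≠ j0) :
    ¬ (lvs P s j b).Nonempty := by
  rintro ⟨v, hv⟩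
  rw [mem_lvs] at hv
  obtain ⟨i, hi⟩ := hv.2
  rw [mem_mts] at hi
  exact hj (hi.2.2.symm.trans
    (I.untouched hb (leaf_lt G hi.1 hi.2.1) (leaf_div G hv.1).1 hi.1))

theorem FInv.blk_cases (I : FInv P m s j0) {j p : ℕ} (hj : j < P.c) (hp : p < tot P m j0 j) :
    (p < cntV m j ∧ blk m j p = m (.dn j p) ∧ Mem m j (blk m j p)) ∨
    (cntV m j ≤ p ∧ j = j0 ∧ m (.hdr 6) + (p - cntV m j) < P.nb ∧ ¬ Tch m (blk m j p) ∧
      blk m j p = SetColl.lz (fun b => m (.ta b)) (fun b => m (.tb b)) (m (.hdr 6))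
        (m (.hdr 6) + (p - cntV m j)) ∧ blk m j p < P.nb) := by
  by_cases h : p < cntV m j
  · have h1 : blk m j p = m (.dn j p) := by rw [blk, if_pos h]
    exact Or.inl ⟨h, h1, h1 ▸ (I.sp j hj).mem_dn h⟩
  · have h1 : blk m j p = SetColl.lz (fun b => m (.ta b)) (fun b => m (.tb b)) (m (.hdr 6))
        (m (.hdr 6) + (p - cntV m j)) := by rw [blk, if_neg h]
    unfold tot at hp
    have h2 : j = j0 := by by_contra h2; rw [if_neg h2] at hp; omega
    rw [if_pos h2] at hp
    refine Or.inr ⟨by omega, h2, by omega, ?_, h1, ?_⟩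
    · rw [h1]; exact I.lz.lz_not_mem (by omega)
    · rw [h1]; exact I.lz.lz_lt (by omega) (by omega)

theorem FInv.blk_spec (G : P.Good) (I : FInv P m s j0) {j p : ℕ} (hj : j < P.c)
    (hp : p < tot P m j0 j) : blk m j p < P.nb ∧ (lvs P s j (blk m j p)).Nonempty := by
  rcases I.blk_cases hj hp with ⟨_, _, h3⟩ | ⟨_, h2, _, h4, _, h6⟩
  · have := ((I.mem j hj _).1 h3).2
    exact ⟨lvs_blk_lt G this, this⟩
  · refine ⟨h6, ?_⟩
    rw [h2] at *
    rw [I.untouched_lvs G h4]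
    have h7 : blk m j0 p * P.q < P.nl := mul_lt_of_lt_ceil h6
    have := G.q_pos
    exact ⟨0, by rw [Finset.mem_range]; omega⟩

theorem FInv.blk_inj (I : FInv P m s j0) {j p p' : ℕ} (hj : j < P.c) (hp : p < tot P m j0 j)
    (hp' : p' < tot P m j0 j) (h : blk m j p = blk m j p') : p = p' := by
  rcases I.blk_cases hj hp with ⟨h1, h2, h3⟩ | ⟨h1, h2, h3, h4, h5, h6⟩ <;>
  rcases I.blk_cases hj hp' with ⟨h1', h2', h3'⟩ | ⟨h1', h2', h3', h4', h5', h6'⟩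
  · exact (I.sp j hj).inj h1 h1' (by rw [← h2, ← h2', h])
  · rw [h] at h3; exact absurd ((I.mem j hj _).1 h3).1 h4'
  · rw [← h] at h3'; exact absurd ((I.mem j hj _).1 h3').1 h4
  · have := I.lz.lz_inj (by omega) (by omega) (h5.symm.trans (h.trans h5'))
    omega

/-- With `FInv.blk_spec` and `FInv.blk_inj`, `blk m j` is a bijection from the numbers below `tot`
to the blocks in which colour `j` occurs. Finding and enumerating rest on this. -/
theorem FInv.blk_surj (G : P.Good) (I : FInv P m s j0) {j b : ℕ} (hj : j < P.c)
    (hb : (lvs P s j b).Nonempty) : ∃ p < tot P m j0 j, blk m j p = b := by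
  by_cases ht : Tch m b
  · have h1 : Mem m j b := (I.mem j hj b).2 ⟨ht, hb⟩
    exact ⟨m (.sp j b), lt_of_lt_of_le h1.1 (Nat.le_add_right _ _),
      by rw [blk, if_pos h1.1]; exact h1.2⟩
  · have h1 : j = j0 := by by_contra h1; exact I.lvs_other G ht h1 hb
    obtain ⟨h2, h3, h4⟩ := I.lz.lpos_spec ht (lvs_blk_lt G hb)
    refine ⟨cntV m j + (lpos (fun b => m (.tb b)) (m (.hdr 6)) b - m (.hdr 6)), ?_, ?_⟩
    · unfold tot; rw [if_pos h1]; omega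
    · rw [blk, if_neg (by omega)]
      convert h4 using 2
      omega

end

namespace EV
variable {P : Par} (G : P.Good) {σ : St} {a b e i j l p t X Y : Ex} {x y v j0 : ℕ} {s : ℕ → ℕ}

section
include G
theorem bit (ha : EV P.lay σ a x) (hi : EV P.lay σ i y) :
    EV P.lay σ ((a >>> i) % 2) (if Bit x y then 1 else 0) :=
  ((ha.shr hi).mod (nm G 2)).of_eq (by
    by_cases h : Bit x y
    · rw [if_pos h]; exact h
    · rw [if_neg h]; unfold Bit at h; omega)

/-- The pointer read from the second array may be garbage, but it is used as an address only after
it was found to be less than the size, which keeps the access inside the first array. -/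
theorem spm {aD aS : Ex → Ex} {D S : ℕ → Loc} {N tv : ℕ} (hb : EV P.lay σ b v)
    (hS : EV P.lay σ (aS b) (P.addr (S v))) (hS' : P.valid (S v))
    (hD : ∀ e x, EV P.lay σ e x → x < N → EV P.lay σ (aD e) (P.addr (D x)))
    (hD' : ∀ x < N, P.valid (D x)) (ht : EV P.lay σ t tv) (htN : tv ≤ N) :
    EV P.lay σ (spmE aD aS t b)
      (if SpMem (fun x => σ.m (D x)) (fun x => σ.m (S x)) tv v then 1 else 0) := by
  have h1 := EV.ld hS hS'
  refine EV.cond (h1.lt ht) (fun h => ?_) (fun h => (nm G 0).of_eq ?_)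
  · have h3 := EV.ld (hD _ _ h1 (h.trans_le htN)) (hD' _ (h.trans_le htN))
    exact h3.eq' hb (by simp [SpMem, h])
  · simp [SpMem, h]
end

variable (H : Hdr P σ.m)

section
include G H

theorem tch (I : FInv P σ.m s j0) (hb : EV P.lay σ b v) (hv : v < P.nb) :
    EV P.lay σ (tchE P.c b) (if Tch σ.m v then 1 else 0) :=
  spm G (D := .ta) (S := .tb) hb (tb G H hb hv) hv (fun _ _ he hx => rec G H he hx)
    (fun _ hx => hx) (hd G 6) I.lz.le

theorem lz (I : FInv P σ.m s j0) (hi : EV P.lay σ i v) (hv : v < P.nb) :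
    EV P.lay σ (lzE P.c i)
      (SetColl.lz (fun b => σ.m (.ta b)) (fun b => σ.m (.tb b)) (σ.m (.hdr 6)) v) := by
  refine EV.cond (tch G H I hi hv) (fun h => ?_) (fun h => ?_)
  · exact (EV.ld (l := .ta v) (rec G H hi hv) hv).of_eq (by unfold SetColl.lz; exact (if_pos h).symm)
  · exact hi.of_eq (by unfold SetColl.lz; exact (if_neg h).symm)

theorem liv (I : FInv P σ.m s j0) (hb : EV P.lay σ b v) (hv : v < P.nb) :
    EV P.lay σ (liE P.c b) (liV σ.m v) := by
  refine EV.cond (tch G H I hb hv) (fun h => ?_) (fun h => ?_)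
  · exact (EV.ld (li G H hb hv) hv).of_eq (by rw [liV, if_pos h])
  · exact (nm G 0).of_eq (by rw [liV, if_neg h])

omit H in
theorem cntv (hj : EV P.lay σ j x) (hx : x < P.c) : EV P.lay σ (cntE j) (cntV σ.m x) := by
  refine EV.cond (bit G (hd G 7) hj) (fun h => ?_) (fun h => ?_)
  · exact (EV.ld (cnt G hj hx) hx).of_eq (by rw [cntV, if_pos h])
  · exact (nm G 0).of_eq (by rw [cntV, if_neg h])

theorem Yv (I : FInv P σ.m s j0) (hj0 : σ.m (.hdr 1) = j0)
    (hl : EV P.lay σ l x) (hx : x < P.nl)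
    (hi : EV P.lay σ i (liV σ.m (x / P.q))) :
    EV P.lay σ (YE P.c l i) (pk (fun s => P.k * s) (fun u => s (x * P.d + u)) P.d) := by
  have h1 : ∀ u, Bit (liV σ.m (x / P.q)) u ↔ Tch σ.m (x / P.q) ∧ Bit (σ.m (.li (x / P.q))) u := by
    intro u; unfold liV; split_ifs with h <;> simp [h, bit_zero]
  have hkk : 2 ^ (P.k - 1) ≤ 2 ^ P.k := Nat.pow_le_pow_right (by norm_num) (by omega)
  have hc := G.c_le_k
  refine EV.cond (bit G hi (hl.mod (q G H))) (fun h => ?_) (fun h => ?_)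
  · rw [h1] at h
    exact dec G H (fun i _ => I.col _) ((leaf G H hl hx).of_eq (I.lf x hx h))
  · rw [h1] at h
    have h2 : j0 * pk (fun s => P.k * s) (fun _ => 1) P.d
        = pk (fun s => P.k * s) (fun u => s (x * P.d + u)) P.d := by
      rw [pk_mul]
      exact pk_congr fun u hu => by rw [I.nlf x hx h u hu, mul_one]
    refine (((hd G 1).of_eq hj0).mul (onesd G H) ?_).of_eq h2
    rw [h2]
    refine (pk_lt (sep_mul le_rfl) (fun s _ => ?_) (B := P.k * P.d) fun s hs => ?_).trans
      (G.pow_lt G.kd_lt)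
    · exact (I.col _).trans (hc.trans_le hkk)
    · calc P.k * s + P.k = P.k * (s + 1) := by ring
        _ ≤ _ := Nat.mul_le_mul_left _ hs

theorem col (I : FInv P σ.m s j0) (hj0 : σ.m (.hdr 1) = j0) (hj0c : j0 < P.c)
    (he : EV P.lay σ e x) (hx : x < P.n) : EV P.lay σ (colE P.c e) (s x) := by
  have hl := elt_leaf_lt G hx
  have h1 := he.div (d G H)
  refine (dig G H (y := fun u => s (x / P.d * P.d + u)) (fun i _ => I.col _)
    (Yv G H I hj0 h1 hl (liv G H I (h1.div (q G H)) (leaf_blk_lt G hl)))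
    (he.mod (d G H)) (Nat.mod_lt _ G.codec.hd)).of_eq ?_
  rw [mul_comm, Nat.div_add_mod]

theorem totv (I : FInv P σ.m s j0) (hj0 : σ.m (.hdr 1) = j0) (hj : EV P.lay σ j x) (hx : x < P.c) :
    EV P.lay σ (totE j) (tot P σ.m j0 x) := by
  have h1 := (I.sp x hx).le
  have h2 := G.nb_le
  have h3 : EV P.lay σ (.cond (.eq j j0E) (nbE - tE) 0)
      (if x = j0 then P.nb - σ.m (.hdr 6) else 0) := by
    refine EV.cond (hj.eq ((hd G 1).of_eq hj0)) (fun h => ?_) (fun h => ?_)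
    · exact ((nb G H).sub (hd G 6) I.lz.le).of_eq (by rw [if_pos h])
    · exact (nm G 0).of_eq (by rw [if_neg h])
  refine (cntv G hj hx).add h3 ?_
  have h4 : P.nb + P.nb < 2 ^ P.w := by
    have h5 := G.LB_lt
    have h6 : P.LB = P.FB + P.nb * P.S := rfl
    have h7 : P.nb * 3 ≤ P.nb * P.S := Nat.mul_le_mul_left _ (by unfold Par.S; omega)
    omega
  simp only [Par.lay_w]; split_ifs <;> omega

theorem blkv (I : FInv P σ.m s j0) (hj : EV P.lay σ j x) (hx : x < P.c) (hp : EV P.lay σ p y)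
    (hy : y < tot P σ.m j0 x) : EV P.lay σ (blkE P.c j p) (blk σ.m x y) := by
  have hc := cntv G hj hx
  have hle := (I.sp x hx).le
  have hnb := G.nb_le.trans_lt (G.nl_le.trans_lt G.n_lt)
  rcases I.blk_cases hx hy with ⟨h1, h2, h3⟩ | ⟨h1, h2, h3, h4, h5, h6⟩
  · refine EV.cond (hp.lt hc) (fun _ => ?_) (fun h => absurd h1 h)
    rw [h2]
    exact EV.ld (dn G H hj hp hx (h1.trans_le hle)) ⟨hx, h1.trans_le hle⟩
  · refine EV.cond (hp.lt hc) (fun h => absurd h (by omega)) (fun _ => ?_)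
    rw [h5]
    exact lz G H I ((hd G 6).add (hp.sub hc h1) (by simp only [Par.lay_w]; omega)) h3

theorem vv (I : FInv P σ.m s j0) (hj : EV P.lay σ j x) (hx : x < P.c) (hp : EV P.lay σ p y)
    (hy : y < tot P σ.m j0 x) (hb : EV P.lay σ b (blk σ.m x y)) :
    EV P.lay σ (vE P.c j p b) (bs (fun v => P.h * v) (lvs P s x (blk σ.m x y))) := by
  have hc := cntv G hj hx
  have hbn := (I.blk_spec G hx hy).1
  rcases I.blk_cases hx hy with ⟨h1, h2, h3⟩ | ⟨h1, h2, h3, h4, h5, h6⟩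
  · refine EV.cond (hp.lt hc) (fun _ => ?_) (fun h => absurd h1 h)
    rw [← I.sm x hx _ h3]
    exact EV.ld (sm G H hj hb hx hbn) ⟨hx, hbn⟩
  · refine EV.cond (hp.lt hc) (fun h => absurd h (by omega)) (fun _ => ?_)
    have h7 := I.untouched_lvs G h4
    rw [← h2] at h7
    rw [h7]
    exact full G H hb hbn

theorem matv (I : FInv P σ.m s j0) (hj : EV P.lay σ j v) (hv : v < P.c)
    (hY : EV P.lay σ Y (pk (fun s => P.k * s) (fun u => s (x * P.d + u)) P.d))
    (hl : EV P.lay σ l x) (hx : x < P.nl) :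
    EV P.lay σ (matE Y j l) (bs (fun s => P.k * s) (mts P s v x)) :=
  mat G H (y := fun u => s (x * P.d + u)) (fun _ _ => I.col _) hY hj hv hl hx

end
end EV

/-! ### Updating the set of leaves that contain a colour -/

/-- `A b` is the set of leaves of block `b` that is recorded for colour `j`. -/
structure CInv (P : Par) (m : Loc → ℕ) (j : ℕ) (A : ℕ → Finset ℕ) : Prop where
  sp : SpInv (fun b => m (.dn j b)) (fun b => m (.sp j b)) (cntV m j) P.nb
  mem : ∀ b, Mem m j b ↔ (A b).Nonempty
  sm : ∀ b, (A b).Nonempty → m (.sm j b) = bs (fun v => P.h * v) (A b)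

/-- `m'` differs from `m` at most in the data of colour `j`. -/
structure ColEq (j : ℕ) (m m' : Loc → ℕ) : Prop where
  same : ∀ l, (∀ b, l ≠ .dn j b ∧ l ≠ .sp j b ∧ l ≠ .sm j b) → l ≠ .cnt j → l ≠ .hdr 7 → m' l = m l
  cnt : ∀ i ≠ j, cntV m' i = cntV m i

theorem ColEq.refl (j : ℕ) (m : Loc → ℕ) : ColEq j m m := ⟨fun _ _ _ _ => rfl, fun _ _ => rfl⟩

theorem CInv.congr {P : Par} {m m' : Loc → ℕ} {i j : ℕ} {A : ℕ → Finset ℕ} (h : CInv P m i A)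
    (e : ColEq j m m') (hij : i ≠ j) : CInv P m' i A := by
  have h1 : (fun b => m' (.dn i b)) = fun b => m (.dn i b) := by
    funext b; exact e.same _ (by simp [hij]) (by simp) (by simp)
  have h2 : (fun b => m' (.sp i b)) = fun b => m (.sp i b) := by
    funext b; exact e.same _ (by simp [hij]) (by simp) (by simp)
  have h3 : ∀ b, m' (.sm i b) = m (.sm i b) := by
    intro b; exact e.same _ (by simp [hij]) (by simp) (by simp)
  have h4 := e.cnt i hij
  refine ⟨?_, fun b => ?_, fun b hb => ?_⟩
  · rw [h1, h2, h4]; exact h.sp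
  · rw [← h.mem b]; unfold Mem; rw [h1, h2, h4]
  · rw [h3]; exact h.sm b hb

theorem CInv.of_eq {P : Par} {m m' : Loc → ℕ} {j : ℕ} {A : ℕ → Finset ℕ} (h : CInv P m j A)
    (h1 : ∀ b, m' (.dn j b) = m (.dn j b)) (h2 : ∀ b, m' (.sp j b) = m (.sp j b))
    (h3 : ∀ b, m' (.sm j b) = m (.sm j b)) (h4 : m' (.cnt j) = m (.cnt j))
    (h5 : m' (.hdr 7) = m (.hdr 7)) : CInv P m' j A := by
  have h6 : cntV m' j = cntV m j := by unfold cntV; rw [h4, h5]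
  refine ⟨?_, fun b => ?_, fun b hb => ?_⟩
  · simp only [h1, h2, h6]; exact h.sp
  · rw [← h.mem b]; unfold Mem; simp only [h1, h2, h6]
  · rw [h3]; exact h.sm b hb

theorem CInv.put_mem {P : Par} {m m' : Loc → ℕ} {j b : ℕ} {A : ℕ → Finset ℕ} {B : Finset ℕ}
    (h : CInv P m j A) (hb : Mem m j b) (hB : B.Nonempty)
    (h1 : ∀ b, m' (.dn j b) = m (.dn j b)) (h2 : ∀ b, m' (.sp j b) = m (.sp j b))
    (h3 : ∀ x, m' (.sm j x) = if x = b then bs (fun v => P.h * v) B else m (.sm j x))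
    (h4 : cntV m' j = cntV m j) : CInv P m' j (Function.update A b B) := by
  refine ⟨?_, fun x => ?_, fun x hx => ?_⟩
  · simp only [h1, h2, h4]; exact h.sp
  · have h5 : Mem m' j x ↔ Mem m j x := by unfold Mem; simp only [h1, h2, h4]
    rw [h5]
    by_cases hxb : x = b
    · subst hxb; simp [hb, hB]
    · rw [Function.update_of_ne hxb]; exact h.mem x
  · rw [h3]
    by_cases hxb : x = b
    · subst hxb; simp
    · rw [if_neg hxb]; rw [Function.update_of_ne hxb] at hx ⊢; exact h.sm x hx

theorem CInv.put_add {P : Par} {m m' : Loc → ℕ} {j b : ℕ} {A : ℕ → Finset ℕ} {B : Finset ℕ}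
    (h : CInv P m j A) (hb : ¬ Mem m j b) (hbn : b < P.nb) (hB : B.Nonempty)
    (h1 : (fun b => m' (.dn j b)) = Function.update (fun b => m (.dn j b)) (cntV m j) b)
    (h2 : (fun b => m' (.sp j b)) = Function.update (fun b => m (.sp j b)) b (cntV m j))
    (h3 : ∀ x, m' (.sm j x) = if x = b then bs (fun v => P.h * v) B else m (.sm j x))
    (h4 : cntV m' j = cntV m j + 1) : CInv P m' j (Function.update A b B) := by
  obtain ⟨h5, h6⟩ := h.sp.add hbn hb
  refine ⟨?_, fun x => ?_, fun x hx => ?_⟩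
  · rw [h1, h2, h4]; exact h5
  · have h7 : Mem m' j x ↔ x = b ∨ Mem m j x := by unfold Mem; rw [h1, h2, h4]; exact h6 x
    rw [h7]
    by_cases hxb : x = b
    · subst hxb; simp [hB]
    · rw [Function.update_of_ne hxb]; simp only [hxb, false_or]; exact h.mem x
  · rw [h3]
    by_cases hxb : x = b
    · subst hxb; simp
    · rw [if_neg hxb]; rw [Function.update_of_ne hxb] at hx ⊢; exact h.sm x hx

theorem CInv.put_del {P : Par} {m m' : Loc → ℕ} {j b : ℕ} {A : ℕ → Finset ℕ}
    (h : CInv P m j A) (hb : Mem m j b)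
    (h1 : (fun b => m' (.dn j b)) =
      Function.update (fun b => m (.dn j b)) (m (.sp j b)) (m (.dn j (cntV m j - 1))))
    (h2 : (fun b => m' (.sp j b)) =
      Function.update (fun b => m (.sp j b)) (m (.dn j (cntV m j - 1))) (m (.sp j b)))
    (h3 : ∀ x, m' (.sm j x) = m (.sm j x))
    (h4 : cntV m' j = cntV m j - 1) : CInv P m' j (Function.update A b ∅) := by
  obtain ⟨h5, h6⟩ := h.sp.del hb
  refine ⟨?_, fun x => ?_, fun x hx => ?_⟩
  · rw [h1, h2, h4]; exact h5
  · have h7 : Mem m' j x ↔ Mem m j x ∧ x ≠ b := by unfold Mem; rw [h1, h2, h4]; exact h6 x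
    rw [h7]
    by_cases hxb : x = b
    · subst hxb; simp
    · rw [Function.update_of_ne hxb, h.mem x]; simp [hxb]
  · rw [h3]
    by_cases hxb : x = b
    · subst hxb; simp at hx
    · rw [Function.update_of_ne hxb] at hx ⊢; exact h.sm x hx

/-- Record the set in register 15 for the block in register 12 and the colour in register `rj`. -/
def putP (c rj : ℕ) : Pg :=
  .ite (.reg 15)
    (.seq
      (.ite (memE c (.reg rj) (.reg 12)) .skip
        (.seq (.sto (dnA c (.reg rj) (cntE (.reg rj))) (.reg 12))
        (.seq (.sto (spA c (.reg rj) (.reg 12)) (cntE (.reg rj)))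
        (.seq (.sto (cntA (.reg rj)) (cntE (.reg rj) + 1))
        (.sto (.cst 7) (ciE ||| ((1 : Ex) <<< Ex.reg rj)))))))
      (.sto (smA c (.reg rj) (.reg 12)) (.reg 15)))
    (.ite (memE c (.reg rj) (.reg 12))
      (.seq (.set 16 (.ld (spA c (.reg rj) (.reg 12))))
      (.seq (.set 17 (.ld (dnA c (.reg rj) (cntE (.reg rj) - 1))))
      (.seq (.sto (dnA c (.reg rj) (.reg 16)) (.reg 17))
      (.seq (.sto (spA c (.reg rj) (.reg 17)) (.reg 16))
      (.sto (cntA (.reg rj)) (cntE (.reg rj) - 1))))))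
      .skip)

theorem Hdr.of_eq {P : Par} {m m' : Loc → ℕ} (H : Hdr P m)
    (h : ∀ i, i = 0 ∨ i = 3 ∨ i = 4 ∨ i = 5 → m' (.hdr i) = m (.hdr i)) : Hdr P m' :=
  ⟨by rw [h 0 (by simp), H.n], by rw [h 3 (by simp), H.d], by rw [h 4 (by simp), H.f],
    by rw [h 5 (by simp), H.h]⟩

theorem Hdr.sto {P : Par} {σ : St} (H : Hdr P σ.m) {l : Loc} (v : ℕ)
    (hl : ∀ i, i = 0 ∨ i = 3 ∨ i = 4 ∨ i = 5 → l ≠ .hdr i := by simp) : Hdr P (σ.sto l v).m :=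
  H.of_eq fun i hi => St.sto_m_ne _ _ _ _ (hl i hi).symm

theorem ColEq.hdr {P : Par} {m m' : Loc → ℕ} {j : ℕ} (e : ColEq j m m') (H : Hdr P m) : Hdr P m' :=
  H.of_eq fun i hi => e.same _ (by simp) (by simp) (by rcases hi with rfl | rfl | rfl | rfl <;> simp)

theorem cntV_sto {σ : St} {l : Loc} {v j : ℕ} (h1 : l ≠ .cnt j) (h2 : l ≠ .hdr 7) :
    cntV (σ.sto l v).m j = cntV σ.m j := by
  unfold cntV; rw [St.sto_m_ne _ _ _ _ h1.symm, St.sto_m_ne _ _ _ _ h2.symm]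

theorem memv' {P : Par} {σ : St} {j b : Ex} {x v : ℕ} {A : ℕ → Finset ℕ} (G : P.Good) (H : Hdr P σ.m)
    (C : CInv P σ.m x A) (hj : EV P.lay σ j x)
    (hx : x < P.c) (hb : EV P.lay σ b v) (hv : v < P.nb) :
    EV P.lay σ (memE P.c j b) (if Mem σ.m x v then 1 else 0) :=
  EV.spm G (D := .dn x) (S := .sp x) hb (EV.sp G H hj hb hx hv) ⟨hx, hv⟩
    (fun _ _ he hx' => EV.dn G H hj he hx hx') (fun _ hx' => ⟨hx, hx'⟩) (EV.cntv G hj hx) C.sp.le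

/-- A block is listed exactly if its recorded set is nonempty. So the cases are whether the new set
is empty and whether the block is listed now: overwrite the summary, append the block, remove it, or
do nothing. -/
theorem wp_put {P : Par} (G : P.Good) {σ : St} {Q : St → Prop} {rj x y : ℕ} {A : ℕ → Finset ℕ}
    {B : Finset ℕ} (H : Hdr P σ.m) (C : CInv P σ.m x A) (hx : x < P.c) (hy : y < P.nb)
    (hj : σ.ρ rj = x) (hb : σ.ρ 12 = y) (hB : σ.ρ 15 = bs (fun v => P.h * v) B)
    -- Registers 16 and 17 are scratch space of the removal.
    (hr : rj < 16 ∨ 17 < rj ∧ rj < 64)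
    (hQ : ∀ σ', (∀ r, r ≠ 16 → r ≠ 17 → σ'.ρ r = σ.ρ r) → σ'.out = σ.out → ColEq x σ.m σ'.m →
      CInv P σ'.m x (Function.update A y B) → Q σ') : wp P.lay (putP P.c rj) Q σ := by
  have hrj : rj < 64 := by omega
  have hnb := G.nb_le.trans_lt (G.nl_le.trans_lt G.n_lt)
  have hcn := C.sp.le
  have hxw := hx.trans G.c_lt_w
  have J : EV P.lay σ (.reg rj) x := EV.reg hj hrj
  have Y : EV P.lay σ (.reg 12) y := EV.reg hb
  have V : EV P.lay σ (.reg 15) (bs (fun v => P.h * v) B) := EV.reg hB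
  by_cases hB0 : B.Nonempty
  · have hne : bs (fun v => P.h * v) B ≠ 0 := fun h => hB0.ne_empty (bs_eq_zero.1 h)
    refine ⟨V.1, fun _ => ?_, fun h => absurd (V.2.symm.trans h) hne⟩
    refine wp_ite_of (memv' G H C J hx Y hy) (fun hm => ?_) (fun hm => ?_)
    · refine wp_sto_of (l := .sm x y) (EV.sm G H J Y hx hy) ⟨hx, hy⟩ V ?_
      refine hQ _ (fun _ _ _ => rfl) rfl ⟨fun l h1 h2 h3 => St.sto_m_ne _ _ _ _ (h1 y).2.2,
        fun i _ => cntV_sto (by simp) (by simp)⟩ (C.put_mem hm hB0 (fun b => by simp)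
        (fun b => by simp) (fun b => ?_) (cntV_sto (by simp) (by simp)))
      by_cases hby : b = y
      · subst hby; simp
      · simp [hby]
    · have hlt := C.sp.lt_of_not_mem hy hm
      generalize hc0 : cntV σ.m x = t at *
      refine wp_sto_of (l := .dn x t) (EV.dn G H J ((EV.cntv G J hx).of_eq hc0) hx hlt) ⟨hx, hlt⟩ Y ?_
      set σ1 := σ.sto (.dn x t) y with hσ1
      have H1 : Hdr P σ1.m := H.sto _
      have J1 : EV P.lay σ1 (.reg rj) x := EV.reg hj hrj
      have Y1 : EV P.lay σ1 (.reg 12) y := EV.reg hb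
      have hc1 : cntV σ1.m x = t := by rw [hσ1, cntV_sto (by simp) (by simp), hc0]
      refine wp_sto_of (l := .sp x y) (EV.sp G H1 J1 Y1 hx hy) ⟨hx, hy⟩
        ((EV.cntv G J1 hx).of_eq hc1) ?_
      set σ2 := σ1.sto (.sp x y) t with hσ2
      have J2 : EV P.lay σ2 (.reg rj) x := EV.reg hj hrj
      have hc2 : cntV σ2.m x = t := by rw [hσ2, cntV_sto (by simp) (by simp), hc1]
      refine wp_sto_of (l := .cnt x) (EV.cnt G J2 hx) hx
        (((EV.cntv G J2 hx).of_eq hc2).add (EV.nm G 1) (by simp only [Par.lay_w]; omega)) ?_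
      set σ3 := σ2.sto (.cnt x) (t + 1) with hσ3
      have J3 : EV P.lay σ3 (.reg rj) x := EV.reg hj hrj
      refine wp_sto_of (l := .hdr 7) (EV.cst (G.small (by norm_num))) (by simp [Par.lay, Par.valid])
        ((EV.hd G 7).or ((EV.nm G 1).shl J3 (by rw [one_mul]; exact G.pow_lt hxw))) ?_
      set σ4 := σ3.sto (.hdr 7) _ with hσ4
      have H4 : Hdr P σ4.m := (((H1.sto _).sto _).sto _)
      have J4 : EV P.lay σ4 (.reg rj) x := EV.reg hj hrj
      have Y4 : EV P.lay σ4 (.reg 12) y := EV.reg hb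
      have V4 : EV P.lay σ4 (.reg 15) (bs (fun v => P.h * v) B) := EV.reg hB
      refine wp_sto_of (l := .sm x y) (EV.sm G H4 J4 Y4 hx hy) ⟨hx, hy⟩ V4 ?_
      -- Setting the bit validates the counter of `x` and leaves the status of all other counters as
      -- it was.
      have hbit : ∀ i, Bit (σ3.m (.hdr 7) ||| 1 * 2 ^ x) i ↔ Bit (σ.m (.hdr 7)) i ∨ i = x := by
        intro i; rw [one_mul, bit_or_pow]; simp [hσ3, hσ2, hσ1]
      refine hQ _ (fun _ _ _ => rfl) rfl ⟨fun l h1 h2 h3 => ?_, fun i hi => ?_⟩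
        (C.put_add hm hy hB0 ?_ ?_ (fun b => ?_) ?_)
      · simp [hσ4, hσ3, hσ2, hσ1, h1, h2, h3]
      · rw [cntV_sto (by simp) (by simp)]
        have h5 : σ4.m (.cnt i) = σ.m (.cnt i) := by simp [hσ4, hσ3, hσ2, hσ1, hi]
        have h6 : Bit (σ4.m (.hdr 7)) i ↔ Bit (σ.m (.hdr 7)) i := by
          rw [hσ4, St.sto_m_self, hbit]; simp [hi]
        unfold cntV; rw [h5]; simp only [h6]
      · rw [hc0]; funext b; by_cases hbt : b = t
        · subst hbt; simp [hσ4, hσ3, hσ2, hσ1]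
        · simp [hσ4, hσ3, hσ2, hσ1, hbt]
      · rw [hc0]; funext b; by_cases hbt : b = y
        · subst hbt; simp [hσ4, hσ3, hσ2]
        · simp [hσ4, hσ3, hσ2, hσ1, hbt]
      · by_cases hbt : b = y
        · subst hbt; simp
        · simp [hσ4, hσ3, hσ2, hσ1, hbt]
      · rw [cntV_sto (by simp) (by simp), hc0]
        have h5 : σ4.m (.cnt x) = t + 1 := by simp [hσ4, hσ3]
        have h6 : Bit (σ4.m (.hdr 7)) x := by rw [hσ4, St.sto_m_self, hbit]; simp
        unfold cntV; rw [h5, if_pos h6]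
  · rw [Finset.not_nonempty_iff_eq_empty] at hB0
    subst hB0
    have hv0 : bs (fun v => P.h * v) ∅ = 0 := bs_eq_zero.2 rfl
    refine ⟨V.1, fun h => absurd (V.2.trans hv0) h, fun _ => ?_⟩
    refine wp_ite_of (memv' G H C J hx Y hy) (fun hm => ?_) (fun hm => ?_)
    · have hlt := hm.1
      have hm' := hm
      unfold Mem at hm
      have hsp : σ.m (.sp x y) < cntV σ.m x := hm.1
      have hdl := C.sp.lt (cntV σ.m x - 1) (by omega)
      refine wp_set_of (EV.ld (l := .sp x y) (EV.sp G H J Y hx hy) ⟨hx, hy⟩) ?_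
      have J1 : EV P.lay (σ.set 16 (σ.m (.sp x y))) (.reg rj) x :=
        EV.reg (by rw [St.set_ρ_ne _ _ _ _ (by omega), hj]) hrj
      have hl1 : cntV σ.m x - 1 < P.nb := by omega
      refine wp_set_of (EV.ld (l := .dn x (cntV σ.m x - 1)) (EV.dn G (by exact H) J1
        ((EV.cntv G J1 hx).sub (EV.nm G 1) (by simp only [St.set_m]; omega)) hx hl1) ⟨hx, hl1⟩) ?_
      set σ2 := (σ.set 16 (σ.m (.sp x y))).set 17 _ with hσ2
      have hm2 : σ2.m = σ.m := rfl
      have J2 : EV P.lay σ2 (.reg rj) x :=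
        EV.reg (by rw [hσ2, St.set_ρ_ne _ _ _ _ (by omega), St.set_ρ_ne _ _ _ _ (by omega), hj]) hrj
      have I2 : EV P.lay σ2 (.reg 16) (σ.m (.sp x y)) := EV.reg (by simp [hσ2])
      have L2 : EV P.lay σ2 (.reg 17) (σ.m (.dn x (cntV σ.m x - 1))) := EV.reg (by simp [hσ2])
      have hin : σ.m (.sp x y) < P.nb := by omega
      refine wp_sto_of (l := .dn x (σ.m (.sp x y))) (EV.dn G (by exact H) J2 I2 hx hin) ⟨hx, hin⟩ L2 ?_
      set σ3 := σ2.sto _ _ with hσ3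
      have H3 : Hdr P σ3.m := Hdr.sto (by exact H) _
      have J3 : EV P.lay σ3 (.reg rj) x := J2
      have I3 : EV P.lay σ3 (.reg 16) (σ.m (.sp x y)) := I2
      have L3 : EV P.lay σ3 (.reg 17) (σ.m (.dn x (cntV σ.m x - 1))) := L2
      refine wp_sto_of (l := .sp x (σ.m (.dn x (cntV σ.m x - 1)))) (EV.sp G H3 J3 L3 hx hdl)
        ⟨hx, hdl⟩ I3 ?_
      set σ4 := σ3.sto _ _ with hσ4
      have J4 : EV P.lay σ4 (.reg rj) x := J2
      have hc4 : cntV σ4.m x = cntV σ.m x := by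
        rw [hσ4, cntV_sto (by simp) (by simp), hσ3, cntV_sto (by simp) (by simp), hm2]
      refine wp_sto_of (l := .cnt x) (EV.cnt G J4 hx) hx
        (((EV.cntv G J4 hx).of_eq hc4).sub (EV.nm G 1) (by omega)) ?_
      have hbit : Bit (σ.m (.hdr 7)) x := by
        by_contra hbit; unfold cntV at hlt; rw [if_neg hbit] at hlt; omega
      refine hQ _ (fun r h1 h2 => by simp [hσ4, hσ3, hσ2, h1, h2]) rfl
        ⟨fun l h1 h2 h3 => ?_, fun i hi => ?_⟩ (C.put_del hm' ?_ ?_ (fun b => ?_) ?_)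
      · simp [hσ4, hσ3, hσ2, h1, h2]
      · unfold cntV; simp [hσ4, hσ3, hσ2, hi]
      · funext b; by_cases hbt : b = σ.m (.sp x y)
        · rw [hbt]; simp [hσ4, hσ3, hσ2]
        · simp [hσ4, hσ3, hσ2, hbt]
      · funext b; by_cases hbt : b = σ.m (.dn x (cntV σ.m x - 1))
        · rw [hbt]; simp [hσ4, hσ3, hσ2]
        · simp [hσ4, hσ3, hσ2, hbt]
      · simp [hσ4, hσ3, hσ2]
      · have h7 : σ4.m (.hdr 7) = σ.m (.hdr 7) := by simp [hσ4, hσ3, hσ2]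
        rw [cntV]
        simp [h7, hbit]
    · refine hQ _ (fun _ _ _ => rfl) rfl (ColEq.refl _ _) ?_
      rw [C.mem, Finset.not_nonempty_iff_eq_empty] at hm
      rw [← hm, Function.update_eq_self]; exact C

/-! ### The main data structure: insertion -/

/-- The part of the invariant that concerns the leaves. -/
structure Core (P : Par) (m : Loc → ℕ) (s : ℕ → ℕ) (j0 : ℕ) : Prop where
  lz : LzInv (fun b => m (.ta b)) (fun b => m (.tb b)) (m (.hdr 6)) P.nb
  lf : ∀ l < P.nl, Ini P m l → fieldV P m l = encV P fun i => s (l * P.d + i)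
  nlf : ∀ l < P.nl, ¬ Ini P m l → ∀ i < P.d, s (l * P.d + i) = j0
  bd : ∀ i ≤ P.nl / P.r, m (.lf i) < 2 ^ P.w
  col : ∀ x, s x < P.c

/-- The leaves recorded for a colour in a block. -/
def recd (P : Par) (m : Loc → ℕ) (s : ℕ → ℕ) (j b : ℕ) : Finset ℕ :=
  if Tch m b then lvs P s j b else ∅

section
variable {P : Par} {m m' : Loc → ℕ} {s s' : ℕ → ℕ} {j0 j b : ℕ}

theorem FInv.core (I : FInv P m s j0) : Core P m s j0 := ⟨I.lz, I.lf, I.nlf, I.bd, I.col⟩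

theorem recd_nonempty : (recd P m s j b).Nonempty ↔ Tch m b ∧ (lvs P s j b).Nonempty := by
  unfold recd; split_ifs with h <;> simp [h]

theorem FInv.cinv (I : FInv P m s j0) (hj : j < P.c) : CInv P m j (recd P m s j) :=
  ⟨I.sp j hj, fun b => (I.mem j hj b).trans recd_nonempty.symm, fun b hb => by
    rw [recd_nonempty] at hb
    rw [recd, if_pos hb.1]; exact I.sm j hj b ((I.mem j hj b).2 hb)⟩

theorem Core.finv (I : Core P m s j0) (h : ∀ j < P.c, CInv P m j (recd P m s j)) :
    FInv P m s j0 :=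
  { I with
    sp := fun j hj => (h j hj).sp
    mem := fun j hj b => ((h j hj).mem b).trans recd_nonempty
    sm := fun j hj b hb => by
      have h1 := ((h j hj).mem b).1 hb
      rw [(h j hj).sm b h1, recd, if_pos (recd_nonempty.1 h1).1] }

theorem tch_congr (h1 : ∀ b, m' (.ta b) = m (.ta b)) (h2 : ∀ b, m' (.tb b) = m (.tb b))
    (h3 : m' (.hdr 6) = m (.hdr 6)) : Tch m' b ↔ Tch m b := by
  unfold Tch; simp only [h1, h2, h3]

theorem Core.congr (I : Core P m s j0) (h1 : ∀ b, m' (.ta b) = m (.ta b))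
    (h2 : ∀ b, m' (.tb b) = m (.tb b)) (h3 : m' (.hdr 6) = m (.hdr 6))
    (h4 : ∀ b, m' (.li b) = m (.li b)) (h5 : ∀ b, m' (.lf b) = m (.lf b)) : Core P m' s j0 := by
  have h6 : ∀ l, Ini P m' l ↔ Ini P m l := fun l => by
    unfold Ini; rw [tch_congr h1 h2 h3, h4]
  have h7 : ∀ l, fieldV P m' l = fieldV P m l := fun l => by unfold fieldV; rw [h5]
  refine ⟨?_, fun l hl hi => ?_, fun l hl hi => ?_, fun i hi => ?_, I.col⟩
  · simp only [h1, h2, h3]; exact I.lz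
  · rw [h7]; exact I.lf l hl ((h6 l).1 hi)
  · exact I.nlf l hl (mt (h6 l).2 hi)
  · rw [h5]; exact I.bd i hi

theorem Core.of_colEq (I : Core P m s j0) (e : ColEq j m m') : Core P m' s j0 :=
  I.congr (fun _ => e.same _ (by simp) (by simp) (by simp))
    (fun _ => e.same _ (by simp) (by simp) (by simp)) (e.same _ (by simp) (by simp) (by simp))
    (fun _ => e.same _ (by simp) (by simp) (by simp))
    (fun _ => e.same _ (by simp) (by simp) (by simp))

theorem ColEq.tch (e : ColEq j m m') : Tch m' b ↔ Tch m b :=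
  tch_congr (fun _ => e.same _ (by simp) (by simp) (by simp))
    (fun _ => e.same _ (by simp) (by simp) (by simp)) (e.same _ (by simp) (by simp) (by simp))

/-- Everything outside the data of this structure is unchanged. -/
def Frame (m m' : Loc → ℕ) : Prop :=
  (∀ i, i ≠ 6 → i ≠ 7 → m' (.hdr i) = m (.hdr i)) ∧ (∀ k, m' (.es k) = m (.es k)) ∧
    ∀ k, m' (.ed k) = m (.ed k)

theorem Frame.refl (m : Loc → ℕ) : Frame m m := ⟨fun _ _ _ => rfl, fun _ => rfl, fun _ => rfl⟩
theorem Frame.trans {m m' m'' : Loc → ℕ} (h : Frame m m') (h' : Frame m' m'') : Frame m m'' :=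
  ⟨fun i h6 h7 => (h'.1 i h6 h7).trans (h.1 i h6 h7), fun k => (h'.2.1 k).trans (h.2.1 k),
    fun k => (h'.2.2 k).trans (h.2.2 k)⟩
theorem Frame.hdr (h : Frame m m') (H : Hdr P m) : Hdr P m' :=
  H.of_eq fun i hi => h.1 i (by omega) (by omega)
theorem ColEq.frame (e : ColEq j m m') : Frame m m' :=
  ⟨fun i _ h7 => e.same _ (by simp) (by simp) (by simpa using h7),
    fun _ => e.same _ (by simp) (by simp) (by simp),
    fun _ => e.same _ (by simp) (by simp) (by simp)⟩
theorem Frame.sto {σ : St} {l : Loc} {v : ℕ} (h1 : ∀ i, l = .hdr i → i = 6 ∨ i = 7)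
    (h2 : ∀ k, l ≠ .es k ∧ l ≠ .ed k) : Frame σ.m (σ.sto l v).m :=
  ⟨fun i h6 h7 => St.sto_m_ne _ _ _ _ fun h => by have := h1 i h.symm; omega,
    fun k => St.sto_m_ne _ _ _ _ (h2 k).1.symm, fun k => St.sto_m_ne _ _ _ _ (h2 k).2.symm⟩

/-- A newly touched block. -/
theorem Core.touch (I : Core P m s j0) (hb : ¬ Tch m b)
    (hlz : LzInv (fun b => m' (.ta b)) (fun b => m' (.tb b)) (m' (.hdr 6)) P.nb)
    (ht : ∀ x, Tch m' x ↔ x = b ∨ Tch m x)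
    (hli : ∀ x, m' (.li x) = if x = b then 0 else m (.li x))
    (hlf : ∀ i, m' (.lf i) = m (.lf i)) : Core P m' s j0 := by
  have h6 : ∀ l, Ini P m' l ↔ Ini P m l := fun l => by
    unfold Ini; rw [ht, hli]
    by_cases hlb : l / P.q = b
    · rw [if_pos hlb, hlb]; simp [bit_zero, hb]
    · rw [if_neg hlb]; simp [hlb]
  have h7 : ∀ l, fieldV P m' l = fieldV P m l := fun l => by unfold fieldV; rw [hlf]
  refine ⟨hlz, fun l hl hi => ?_, fun l hl hi => ?_, fun i hi => ?_, I.col⟩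
  · rw [h7]; exact I.lf l hl ((h6 l).1 hi)
  · exact I.nlf l hl (mt (h6 l).2 hi)
  · rw [hlf]; exact I.bd i hi
end

/-- Touch the block in register 12. -/
def touchP (c : ℕ) : Pg :=
  .ite (tchE c (.reg 12)) .skip
    (.seq (.set 13 (lzE c tE))
    (.seq (.set 14 (.cond (.lt (.reg 12) tE) (.ld (tbA c (.reg 12))) (.reg 12)))
    (.seq (.sto (recE c tE) (.reg 12))
    (.seq (.sto (tbA c (.reg 12)) tE)
    (.seq (.ite (.eq (.reg 13) (.reg 12)) .skip
      (.seq (.sto (recE c (.reg 14)) (.reg 13)) (.sto (tbA c (.reg 13)) (.reg 14))))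
    (.seq (.sto (.cst 6) (tE + 1))
    (.seq (.sto (liA c (.reg 12)) 0)
    (.seq (.set 15 (fullE (.reg 12)))
    (.seq (.set 18 j0E)
    (putP c 18))))))))))

def Keeps (R : ℕ → Prop) (σ σ' : St) : Prop := (∀ r, R r → σ'.ρ r = σ.ρ r) ∧ σ'.out = σ.out

/-- Touching a block does not change the colouring. The block joins the members of the permutation
and gets an empty bitmap of written leaves; as it consists of `j0` only, the records of the other
colours stay correct, and `j0` now has to list it explicitly with all of its leaves. -/
theorem wp_touch {P : Par} (G : P.Good) {σ : St} {Q : St → Prop} {s : ℕ → ℕ} {j0 b : ℕ}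
    (H : Hdr P σ.m) (I : FInv P σ.m s j0) (hj0 : σ.m (.hdr 1) = j0) (hj0c : j0 < P.c)
    (hb : σ.ρ 12 = b) (hbn : b < P.nb)
    (hQ : ∀ σ', Keeps (fun r => r < 13 ∨ 18 < r) σ σ' → Frame σ.m σ'.m → Tch σ'.m b →
      FInv P σ'.m s j0 → Q σ') : wp P.lay (touchP P.c) Q σ := by
  have B0 : EV P.lay σ (.reg 12) b := EV.reg hb
  refine wp_ite_of (EV.tch G H I B0 hbn) (fun ht => hQ _ ⟨fun _ _ => rfl, rfl⟩ (Frame.refl _) ht I)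
    fun ht => ?_
  have htn := I.lz.toSpInv.lt_of_not_mem hbn ht
  obtain ⟨hp1, hp2, hp3⟩ := I.lz.lpos_spec ht hbn
  have hyn := I.lz.lz_lt le_rfl htn
  have hnb := G.nb_le.trans_lt (G.nl_le.trans_lt G.n_lt)
  refine wp_set_of (EV.lz G H I (EV.hd G 6) htn) ?_
  set y := lz (fun b => σ.m (.ta b)) (fun b => σ.m (.tb b)) (σ.m (.hdr 6)) (σ.m (.hdr 6)) with hy
  set p := lpos (fun b => σ.m (.tb b)) (σ.m (.hdr 6)) b with hp
  set t := σ.m (.hdr 6) with hte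
  set σ1 := σ.set 13 y with hσ1
  have H1 : Hdr P σ1.m := H
  have B1 : EV P.lay σ1 (.reg 12) b := EV.reg (by simp [hσ1, hb])
  have h14 : EV P.lay σ1 (.cond (.lt (.reg 12) tE) (.ld (tbA P.c (.reg 12))) (.reg 12)) p := by
    refine EV.cond (B1.lt (EV.hd G 6)) (fun h => ?_) (fun h => ?_)
    · exact (EV.ld (l := .tb b) (EV.tb G H1 B1 hbn) hbn).of_eq (by rw [hp]; unfold lpos; exact (if_pos h).symm)
    · exact B1.of_eq (by rw [hp]; unfold lpos; exact (if_neg h).symm)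
  refine wp_set_of h14 ?_
  set σ2 := σ1.set 14 p with hσ2
  have B2 : EV P.lay σ2 (.reg 12) b := EV.reg (by simp [hσ2, hσ1, hb])
  have hm2 : σ2.m = σ.m := rfl
  refine wp_sto_of (l := .ta t) (EV.rec G (by exact H) (EV.hd G 6) htn) htn B2 ?_
  set σ3 := σ2.sto (.ta t) b with hσ3
  have H3 : Hdr P σ3.m := Hdr.sto (by exact H) _
  have B3 : EV P.lay σ3 (.reg 12) b := B2
  have T3 : EV P.lay σ3 tE t := (EV.hd G 6).of_eq (by simp [hσ3, hm2, hte])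
  refine wp_sto_of (l := .tb b) (EV.tb G H3 B3 hbn) hbn T3 ?_
  set σ4 := σ3.sto (.tb b) t with hσ4
  have H4 : Hdr P σ4.m := H3.sto _
  have Y4 : EV P.lay σ4 (.reg 13) y := EV.reg (by simp [hσ4, hσ3, hσ2, hσ1])
  have B4 : EV P.lay σ4 (.reg 12) b := B2
  have P4 : EV P.lay σ4 (.reg 14) p := EV.reg (by simp [hσ4, hσ3, hσ2])
  -- The rest of the program is verified once for both outcomes of the exchange in the permutation.
  have tail : ∀ σ5 : St, σ5.ρ = σ4.ρ → σ5.out = σ.out → Frame σ.m σ5.m → Hdr P σ5.m →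
      (∀ l, (∀ b, l ≠ .ta b ∧ l ≠ .tb b) → σ5.m l = σ.m l) →
      LzInv (fun b => σ5.m (.ta b)) (fun b => σ5.m (.tb b)) (t + 1) P.nb →
      (∀ x, SpMem (fun b => σ5.m (.ta b)) (fun b => σ5.m (.tb b)) (t + 1) x ↔ x = b ∨ Tch σ.m x) →
      wp P.lay (.seq (.sto (.cst 6) (tE + 1))
        (.seq (.sto (liA P.c (.reg 12)) 0)
        (.seq (.set 15 (fullE (.reg 12)))
        (.seq (.set 18 j0E)
        (putP P.c 18))))) Q σ5 := by
    intro σ5 hρ ho hF H5 hsame hlz hmem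
    have h6 : σ5.m (.hdr 6) = t := hsame _ (by simp)
    have T5 : EV P.lay σ5 tE t := (EV.hd G 6).of_eq h6
    refine wp_sto_of (l := .hdr 6) (EV.cst (G.small (by norm_num))) (by simp [Par.lay, Par.valid])
      (T5.add (EV.nm G 1) (by simp only [Par.lay_w]; omega)) ?_
    set σ6 := σ5.sto (.hdr 6) (t + 1) with hσ6
    have H6 : Hdr P σ6.m := H5.sto _
    have B6 : EV P.lay σ6 (.reg 12) b :=
      EV.reg (by rw [hσ6, St.sto_ρ, hρ]; exact B2.2)
    refine wp_sto_of (l := .li b) (EV.li G H6 B6 hbn) hbn (EV.nm G 0) ?_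
    set σ7 := σ6.sto (.li b) 0 with hσ7
    have H7 : Hdr P σ7.m := H6.sto _
    have B7 : EV P.lay σ7 (.reg 12) b := B6
    refine wp_set_of (EV.full G H7 B7 hbn) ?_
    rw [← I.untouched_lvs G ht]
    set σ8 := σ7.set 15 _ with hσ8
    refine wp_set_of (EV.hd G 1) ?_
    set σ9 := σ8.set 18 _ with hσ9
    have hm9 : σ9.m = σ7.m := rfl
    have hj9 : σ8.m (.hdr 1) = j0 := by
      rw [hσ8, St.set_m, hσ7, St.sto_m_ne _ _ _ _ (by simp), hσ6, St.sto_m_ne _ _ _ _ (by simp),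
        hsame _ (by simp), hj0]
    have hF9 : Frame σ.m σ9.m := by
      rw [hm9]
      exact (hF.trans (Frame.sto (by simp) (by simp))).trans (Frame.sto (by simp) (by simp))
    have ht9 : ∀ x, Tch σ9.m x ↔ x = b ∨ Tch σ.m x := by
      intro x; rw [← hmem]; unfold Tch; simp [hm9, hσ7, hσ6]
    have hs9 : ∀ l, (∀ b, l ≠ .ta b ∧ l ≠ .tb b) → l ≠ .hdr 6 → l ≠ .li b → σ9.m l = σ.m l := by
      intro l h1 h2 h3
      rw [hm9, hσ7, St.sto_m_ne _ _ _ _ h3, hσ6, St.sto_m_ne _ _ _ _ h2, hsame _ h1]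
    have hC : ∀ j < P.c, CInv P σ9.m j (recd P σ.m s j) := fun j hj =>
      (I.cinv hj).of_eq (fun _ => hs9 _ (by simp) (by simp) (by simp))
        (fun _ => hs9 _ (by simp) (by simp) (by simp))
        (fun _ => hs9 _ (by simp) (by simp) (by simp)) (hs9 _ (by simp) (by simp) (by simp))
        (hs9 _ (by simp) (by simp) (by simp))
    have hcore : Core P σ9.m s j0 := I.core.touch ht
      (by simpa [hm9, hσ7, hσ6] using hlz) ht9
      (fun x => by
        by_cases hx : x = b
        · subst hx; simp [hm9, hσ7]
        · rw [if_neg hx]; exact hs9 _ (by simp) (by simp) (by simp [hx]))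
      (fun i => hs9 _ (by simp) (by simp) (by simp))
    refine wp_put G (by exact H7) (hC j0 hj0c) hj0c hbn
      (by rw [hσ9, St.set_ρ_self]; exact hj9)
      (by simp [hσ9, hσ8]; exact B6.2) (by simp [hσ9, hσ8]) (by norm_num)
      (B := lvs P s j0 b) ?_
    intro σ' hk ho' hce hci
    have hnew : ∀ j, recd P σ'.m s j b = lvs P s j b := fun j => by
      rw [recd, if_pos ((hce.tch).2 ((ht9 b).2 (Or.inl rfl)))]
    have hold : ∀ j x, x ≠ b → recd P σ'.m s j x = recd P σ.m s j x := fun j x hx => by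
      have : Tch σ'.m x ↔ Tch σ.m x := by rw [hce.tch, ht9]; simp [hx]
      unfold recd; simp only [this]
    refine hQ σ' ⟨fun r hr => ?_, ?_⟩ (hF9.trans hce.frame) (hce.tch.2 ((ht9 b).2 (Or.inl rfl)))
      ((hcore.of_colEq hce).finv fun j hj => ?_)
    · have e1 : σ9.ρ r = σ7.ρ r := by
        rw [hσ9, St.set_ρ_ne _ _ _ _ (by omega), hσ8, St.set_ρ_ne _ _ _ _ (by omega)]
      rw [hk r (by omega) (by omega), e1, hσ7, St.sto_ρ, hσ6, St.sto_ρ, hρ, hσ4, St.sto_ρ, hσ3,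
        St.sto_ρ, hσ2, St.set_ρ_ne _ _ _ _ (by omega), hσ1, St.set_ρ_ne _ _ _ _ (by omega)]
    · rw [ho']; exact ho
    · by_cases hjj : j = j0
      · subst hjj
        convert hci using 1
        funext x
        by_cases hx : x = b
        · subst hx; rw [Function.update_self]; exact hnew _
        · rw [Function.update_of_ne hx]; exact hold _ _ hx
      · have : recd P σ'.m s j = recd P σ.m s j := by
          funext x
          by_cases hx : x = b
          · subst hx
            rw [hnew, recd, if_neg ht]
            exact Finset.not_nonempty_iff_eq_empty.1 (I.lvs_other G ht hjj)
          · exact hold _ _ hx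
        rw [this]
        exact (hC j hj).congr hce hjj
  have hF4 : Frame σ.m σ4.m := by
    have h3 : Frame σ.m σ3.m := Frame.sto (σ := σ2) (by simp) (by simp)
    exact h3.trans (Frame.sto (by simp) (by simp))
  have hta4 : (fun x => σ4.m (.ta x)) = Function.update (fun x => σ.m (.ta x)) t b := by
    funext x; by_cases hx : x = t
    · rw [hx]; simp [hσ4, hσ3]
    · simp [hσ4, hσ3, hm2, hx]
  have htb4 : (fun x => σ4.m (.tb x)) = Function.update (fun x => σ.m (.tb x)) b t := by
    funext x; by_cases hx : x = b
    · rw [hx]; simp [hσ4]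
    · simp [hσ4, hσ3, hm2, hx]
  refine wp_ite_of (Y4.eq B4) (fun hyb => ?_) (fun hyb => ?_)
  · refine tail σ4 rfl rfl hF4 H4 (fun l h => by simp [hσ4, hσ3, hm2, h]) ?_ ?_
    · rw [hta4, htb4]; exact I.lz.touch_eq ht hbn hyb
    · rw [hta4, htb4]; exact (I.lz.toSpInv.add hbn ht).2
  · refine wp_sto_of (l := .ta p) (EV.rec G H4 P4 hp2) hp2 Y4 ?_
    set σ5 := σ4.sto (.ta p) y with hσ5
    have H5 : Hdr P σ5.m := H4.sto _
    have Y5 : EV P.lay σ5 (.reg 13) y := Y4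
    have P5 : EV P.lay σ5 (.reg 14) p := P4
    refine wp_sto_of (l := .tb y) (EV.tb G H5 Y5 hyn) hyn P5 ?_
    have hta5 : (fun x => (σ5.sto (.tb y) p).m (.ta x)) =
        Function.update (Function.update (fun x => σ.m (.ta x)) t b) p y := by
      rw [← hta4]
      funext x; by_cases hx : x = p
      · rw [hx]; simp [hσ5]
      · simp [hσ5, hx]
    have htb5 : (fun x => (σ5.sto (.tb y) p).m (.tb x)) =
        Function.update (Function.update (fun x => σ.m (.tb x)) b t) y p := by
      rw [← htb4]
      funext x; by_cases hx : x = y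
      · rw [hx]; simp
      · simp [hσ5, hx]
    obtain ⟨h7, h8⟩ := I.lz.touch_ne ht hbn rfl hyb rfl
    refine tail _ rfl rfl ((hF4.trans (Frame.sto (by simp) (by simp))).trans
      (Frame.sto (by simp) (by simp))) (H5.sto _) (fun l h => by simp [hσ5, hσ4, hσ3, hm2, h]) ?_ ?_
    · rw [hta5, htb5]; exact h7
    · rw [hta5, htb5]; exact h8

def shE (l : Ex) : Ex := fE * (l % rE)

/-- Write colour `r11` of element `r10` into the leaf; the block `r12` has been touched.  The
digits of the leaf are left in register 13 and the former colour in register 14. -/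
def writeP (c : ℕ) : Pg :=
  let l : Ex := .reg 10 / dE
  let i : Ex := .reg 10 % dE
  .seq (.set 13 (YE c l (liE c (.reg 12))))
  (.seq (.set 14 (digE (.reg 13) i))
  (.seq (.set 13 (.reg 13 - (Ex.reg 14 <<< (kE * i)) + (Ex.reg 11 <<< (kE * i))))
  (.seq (.set 15 (.ld (lfA c (l / rE)) - (leafE c l <<< shE l) + (encE c (.reg 13) <<< shE l)))
  (.seq (.sto (lfA c (l / rE)) (.reg 15))
  (.sto (liA c (.reg 12)) (.ld (liA c (.reg 12)) ||| ((1 : Ex) <<< (l % qE))))))))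

section
variable {P : Par} {m m' : Loc → ℕ} {s : ℕ → ℕ} {j0 : ℕ}

theorem leaf_upd (G : P.Good) {x l i j : ℕ} (hi : i < P.d) (s : ℕ → ℕ) :
    Function.update s x j (l * P.d + i) =
      if l = x / P.d then Function.update (fun u => s (l * P.d + u)) (x % P.d) j i
      else s (l * P.d + i) := by
  have h1 : l * P.d + i = x ↔ l = x / P.d ∧ i = x % P.d := by
    constructor
    · rintro rfl; exact ⟨(elt_div G hi).1.symm, (elt_div G hi).2.symm⟩
    · rintro ⟨rfl, rfl⟩; rw [mul_comm, Nat.div_add_mod]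
  split_ifs with h
  · by_cases h2 : i = x % P.d
    · rw [h1.2 ⟨h, h2⟩, h2]; simp
    · rw [Function.update_of_ne (fun h3 => h2 (h1.1 h3).2), Function.update_of_ne h2]
  · rw [Function.update_of_ne fun h3 => h (h1.1 h3).1]

theorem encV_congr {y y' : ℕ → ℕ} (h : ∀ i < P.d, y i = y' i) : encV P y = encV P y' := by
  unfold encV hn
  rw [Finset.sum_congr rfl fun i hi => by rw [h i (Finset.mem_range.1 hi)]]

/-- A newly written leaf. -/
theorem Core.write (G : P.Good) (I : Core P m s j0) {x j : ℕ} (hj : j < P.c)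
    (hx : x < P.n) (ht : Tch m (x / P.d / P.q))
    (h1 : ∀ b, m' (.ta b) = m (.ta b)) (h2 : ∀ b, m' (.tb b) = m (.tb b))
    (h3 : m' (.hdr 6) = m (.hdr 6))
    (h4 : ∀ b, m' (.li b) = if b = x / P.d / P.q then m (.li b) ||| 2 ^ (x / P.d % P.q)
      else m (.li b))
    (h5 : ∀ i, m' (.lf i) = if i = x / P.d / P.r then
      m (.lf i) - fieldV P m (x / P.d) * 2 ^ (P.f * (x / P.d % P.r)) +
        encV P (fun u => Function.update s x j (x / P.d * P.d + u)) *
          2 ^ (P.f * (x / P.d % P.r)) else m (.lf i))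
    (h6 : ∀ i ≤ P.nl / P.r, m' (.lf i) < 2 ^ P.w) : Core P m' (Function.update s x j) j0 := by
  have hs' : ∀ z, Function.update s x j z < P.c := fun z => by
    by_cases hz : z = x
    · subst hz; simpa using hj
    · rw [Function.update_of_ne hz]; exact I.col z
  have henc : encV P (fun u => Function.update s x j (x / P.d * P.d + u)) < 2 ^ P.f :=
    G.codec.enc_lt (hn_lt fun i _ => hs' _)
  have htc : ∀ b, Tch m' b ↔ Tch m b := fun b => tch_congr h1 h2 h3
  have hini : ∀ l, Ini P m' l ↔ l = x / P.d ∨ Ini P m l := by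
    intro l
    unfold Ini
    rw [htc, h4]
    by_cases hb : l / P.q = x / P.d / P.q
    · rw [if_pos hb, bit_or_pow, hb]
      have : l % P.q = x / P.d % P.q ↔ l = x / P.d := by
        constructor
        · intro h
          rw [← Nat.div_add_mod l P.q, hb, h, Nat.div_add_mod]
        · rintro rfl; rfl
      rw [this]; tauto
    · rw [if_neg hb]
      have : l ≠ x / P.d := fun h => hb (by rw [h])
      tauto
  have hfl : ∀ l, l ≠ x / P.d → fieldV P m' l = fieldV P m l := by
    intro l hl
    unfold fieldV
    rw [h5]
    split_ifs with hw
    · rw [hw]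
      refine field_other henc ?_
      have hne : l % P.r ≠ x / P.d % P.r := fun h => hl (by
        rw [← Nat.div_add_mod l P.r, hw, h, Nat.div_add_mod])
      rcases Nat.lt_or_gt_of_ne hne with h | h
      · right
        calc P.f * (l % P.r) + P.f = P.f * (l % P.r + 1) := by ring
          _ ≤ _ := Nat.mul_le_mul_left _ h
      · left
        calc P.f * (x / P.d % P.r) + P.f = P.f * (x / P.d % P.r + 1) := by ring
          _ ≤ _ := Nat.mul_le_mul_left _ h
    · rfl
  refine ⟨?_, fun l hl hi => ?_, fun l hl hi i hid => ?_, h6, hs'⟩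
  · simp only [h1, h2, h3]; exact I.lz
  · rw [hini] at hi
    by_cases hlx : l = x / P.d
    · subst hlx
      unfold fieldV
      rw [h5, if_pos rfl]
      exact field_self henc
    · rw [hfl l hlx, I.lf l hl (hi.resolve_left hlx)]
      exact encV_congr fun i hi => by rw [leaf_upd G hi, if_neg hlx]
  · rw [hini] at hi
    push Not at hi
    rw [leaf_upd G hid, if_neg hi.1]
    exact I.nlf l hl hi.2 i hid
end

theorem field_bound {W sh f v w : ℕ} (hW : W < 2 ^ w) (hv : v < 2 ^ f) (h : sh + f ≤ w) :
    W - W / 2 ^ sh % 2 ^ f * 2 ^ sh + v * 2 ^ sh < 2 ^ w := by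
  have h0 := Nat.two_pow_pos sh
  have h1 := Nat.div_add_mod W (2 ^ sh)
  have h2 := Nat.div_add_mod (W / 2 ^ sh) (2 ^ f)
  have h3 := Nat.mod_lt W h0
  set a := W / 2 ^ sh
  set u := W % 2 ^ sh
  set b := a / 2 ^ f
  set e := a % 2 ^ f
  have h4 : b < 2 ^ (w - sh - f) := by
    rw [Nat.div_lt_iff_lt_mul (Nat.two_pow_pos _), Nat.div_lt_iff_lt_mul h0, mul_assoc, ← pow_add,
      ← pow_add]
    rwa [show w - sh - f + (f + sh) = w by omega]
  have h5 : W = 2 ^ sh * (2 ^ f * b) + e * 2 ^ sh + u := by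
    rw [← h1, ← h2]; ring
  have h6 : W - e * 2 ^ sh + v * 2 ^ sh = 2 ^ sh * (2 ^ f * b + v) + u := by
    have : W - e * 2 ^ sh = 2 ^ sh * (2 ^ f * b) + u := by omega
    rw [this]; ring
  rw [h6]
  calc 2 ^ sh * (2 ^ f * b + v) + u < 2 ^ sh * (2 ^ f * b + v + 1) := by
        rw [Nat.mul_succ]; omega
    _ ≤ 2 ^ sh * (2 ^ f * (b + 1)) := Nat.mul_le_mul_left _ (by rw [Nat.mul_succ]; omega)
    _ ≤ 2 ^ sh * (2 ^ f * 2 ^ (w - sh - f)) :=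
        Nat.mul_le_mul_left _ (Nat.mul_le_mul_left _ h4)
    _ = 2 ^ w := by rw [← pow_add, ← pow_add]; congr 1; omega

/-- The write concerns only leaf data, so afterwards `Core` refers to the new colouring while the
colour records still describe the old one; `refreshP` repairs them for the two colours involved. -/
theorem wp_write {P : Par} (G : P.Good) {σ : St} {Q : St → Prop} {s : ℕ → ℕ} {j0 x j : ℕ}
    (H : Hdr P σ.m) (I : FInv P σ.m s j0) (hj0 : σ.m (.hdr 1) = j0) (hj0c : j0 < P.c)
    (hx : σ.ρ 10 = x) (hxn : x < P.n) (hj : σ.ρ 11 = j) (hjc : j < P.c)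
    (hb : σ.ρ 12 = x / P.d / P.q) (ht : Tch σ.m (x / P.d / P.q))
    (hQ : ∀ σ', Keeps (fun r => r < 13 ∨ 15 < r) σ σ' → Frame σ.m σ'.m →
      (∀ b, Tch σ'.m b ↔ Tch σ.m b) → Core P σ'.m (Function.update s x j) j0 →
      (∀ i < P.c, CInv P σ'.m i (recd P σ.m s i)) → σ'.ρ 14 = s x →
      σ'.ρ 13 = pk (fun v => P.k * v) (fun u => Function.update s x j (x / P.d * P.d + u)) P.d →
      Q σ') : wp P.lay (writeP P.c) Q σ := by
  have hl := elt_leaf_lt G hxn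
  have hbn := leaf_blk_lt G hl
  have hid : x % P.d < P.d := Nat.mod_lt _ G.codec.hd
  set l := x / P.d with hl_def
  set i := x % P.d with hi_def
  set b := l / P.q with hb_def
  have hli : l * P.d + i = x := by rw [mul_comm]; exact Nat.div_add_mod x P.d
  have hs' : ∀ z, Function.update s x j z < P.c := fun z => by
    by_cases hz : z = x
    · subst hz; simpa using hjc
    · rw [Function.update_of_ne hz]; exact I.col z
  have LE : ∀ σ' : St, Hdr P σ'.m → σ'.ρ 10 = x → EV P.lay σ' (.reg 10 / dE) l :=
    fun σ' H' h => (EV.reg h).div (EV.d G H')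
  have IE : ∀ σ' : St, Hdr P σ'.m → σ'.ρ 10 = x → EV P.lay σ' (.reg 10 % dE) i :=
    fun σ' H' h => (EV.reg h).mod (EV.d G H')
  have hwi : l / P.r ≤ P.nl / P.r := Nat.div_le_div_right hl.le
  have hrlt := Nat.mod_lt l (show 0 < P.r from G.r_pos)
  have hfr : P.f * (l % P.r) + P.f ≤ P.w := by
    calc P.f * (l % P.r) + P.f = P.f * (l % P.r + 1) := by ring
      _ ≤ P.f * P.r := Nat.mul_le_mul_left _ hrlt
      _ ≤ _ := G.fr_le
  have hki : P.k * i + P.k ≤ P.k * P.d := by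
    calc P.k * i + P.k = P.k * (i + 1) := by ring
      _ ≤ _ := Nat.mul_le_mul_left _ hid
  have hkd := G.kd_lt
  have hww := G.w_lt
  have hkk : 2 ^ (P.k - 1) ≤ 2 ^ P.k := Nat.pow_le_pow_right (by norm_num) (by omega)
  have hck := G.c_le_k
  have KI : ∀ σ' : St, Hdr P σ'.m → σ'.ρ 10 = x → EV P.lay σ' (kE * (.reg 10 % dE)) (P.k * i) :=
    fun σ' H' h => (EV.k G H').mul (IE σ' H' h) (by simp only [Par.lay_w]; omega)
  have SH : ∀ σ' : St, Hdr P σ'.m → σ'.ρ 10 = x →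
      EV P.lay σ' (shE (.reg 10 / dE)) (P.f * (l % P.r)) :=
    fun σ' H' h => (EV.f G H').mul ((LE σ' H' h).mod (EV.r G H'))
      (by simp only [Par.lay_w]; omega)
  -- the digits before and after
  have B0 : EV P.lay σ (.reg 12) b := EV.reg hb
  -- For a leaf never written before these digits are copies of `j0`, so the first write initialises
  -- the whole leaf whatever its bits were.
  refine wp_set_of (EV.Yv G H I hj0 (LE σ H hx) hl (EV.liv G H I B0 hbn)) ?_
  set σ1 := σ.set 13 _ with hσ1
  have H1 : Hdr P σ1.m := H
  have hx1 : σ1.ρ 10 = x := by simp [hσ1, hx]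
  have Y1 : EV P.lay σ1 (.reg 13) (pk (fun v => P.k * v) (fun u => s (l * P.d + u)) P.d) :=
    EV.reg (by simp [hσ1])
  refine wp_set_of ((EV.dig G H1 (y := fun u => s (l * P.d + u)) (fun _ _ => I.col _) Y1
    (IE σ1 H1 hx1) hid).of_eq (by rw [hli])) ?_
  set σ2 := σ1.set 14 (s x) with hσ2
  have H2 : Hdr P σ2.m := H
  have hx2 : σ2.ρ 10 = x := by simp [hσ2, hσ1, hx]
  have Y2 : EV P.lay σ2 (.reg 13) (pk (fun v => P.k * v) (fun u => s (l * P.d + u)) P.d) :=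
    EV.reg (by simp [hσ2, hσ1])
  have hsh : ∀ v < P.c, v * 2 ^ (P.k * i) < 2 ^ P.w := fun v hv => by
    calc v * 2 ^ (P.k * i) < 2 ^ P.k * 2 ^ (P.k * i) :=
          Nat.mul_lt_mul_of_pos_right (by omega) (Nat.two_pow_pos _)
      _ = 2 ^ (P.k * i + P.k) := by rw [← pow_add, add_comm]
      _ ≤ _ := Nat.pow_le_pow_right (by norm_num) (by omega)
  have hupd : pk (fun v => P.k * v) (fun u => s (l * P.d + u)) P.d - s x * 2 ^ (P.k * i) +
      j * 2 ^ (P.k * i) =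
      pk (fun v => P.k * v) (fun u => Function.update s x j (l * P.d + u)) P.d := by
    have := pk_update (o := fun v => P.k * v) (a := fun u => s (l * P.d + u)) (v := j) hid
    simp only [hli] at this
    rw [this]
    exact pk_congr fun u hu => by rw [leaf_upd G hu, if_pos rfl]
  have hpk : pk (fun v => P.k * v) (fun u => Function.update s x j (l * P.d + u)) P.d < 2 ^ P.w := by
    refine (pk_lt (sep_mul le_rfl) (fun v _ => ?_) (B := P.k * P.d) fun v hv => ?_).trans
      (G.pow_lt G.kd_lt)
    · exact (hs' _).trans (hck.trans_le hkk)
    · calc P.k * v + P.k = P.k * (v + 1) := by ring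
        _ ≤ _ := Nat.mul_le_mul_left _ hv
  have hle : s x * 2 ^ (P.k * i) ≤ pk (fun v => P.k * v) (fun u => s (l * P.d + u)) P.d := by
    have := pk_le_of_mem (o := fun v => P.k * v) (a := fun u => s (l * P.d + u)) hid
    simpa only [hli] using this
  refine wp_set_of (((Y2.sub ((EV.reg (by simp [hσ2])).shl (KI σ2 H2 hx2) (hsh _ (I.col x))) hle).add
    ((EV.reg (v := j) (by simp [hσ2, hσ1, hj])).shl (KI σ2 H2 hx2) (hsh _ hjc)) ?_).of_eq hupd) ?_
  · simp only [Par.lay_w]; rw [hupd]; exact hpk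
  set σ3 := σ2.set 13 _ with hσ3
  have H3 : Hdr P σ3.m := H
  have hx3 : σ3.ρ 10 = x := by simp [hσ3, hσ2, hσ1, hx]
  have Y3 : EV P.lay σ3 (.reg 13)
    (pk (fun v => P.k * v) (fun u => Function.update s x j (l * P.d + u)) P.d) :=
    EV.reg (by simp [hσ3])
  have E3 : EV P.lay σ3 (encE P.c (.reg 13)) (encV P fun u => Function.update s x j (l * P.d + u)) :=
    EV.enc G H3 (y := fun u => Function.update s x j (l * P.d + u)) (fun _ _ => hs' _) Y3
  have henc : encV P (fun u => Function.update s x j (l * P.d + u)) < 2 ^ P.f :=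
    G.codec.enc_lt (hn_lt fun i _ => hs' _)
  have A3 : EV P.lay σ3 (lfA P.c (.reg 10 / dE / rE)) (P.addr (.lf (l / P.r))) :=
    EV.lf G H3 ((LE σ3 H3 hx3).div (EV.r G H3)) hwi
  have W3 : EV P.lay σ3 (.ld (lfA P.c (.reg 10 / dE / rE))) (σ.m (.lf (l / P.r))) := EV.ld A3 hwi
  have F3 : EV P.lay σ3 (leafE P.c (.reg 10 / dE)) (fieldV P σ.m l) := EV.leaf G H3 (LE σ3 H3 hx3) hl
  have hWb := I.bd _ hwi
  have hnew := field_bound hWb henc hfr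
  have hfle : fieldV P σ.m l * 2 ^ (P.f * (l % P.r)) ≤ σ.m (.lf (l / P.r)) :=
    (Nat.mul_le_mul_right _ (Nat.mod_le _ _)).trans (Nat.div_mul_le_self _ _)
  refine wp_set_of ((W3.sub (F3.shl (SH σ3 H3 hx3) (hfle.trans_lt hWb)) hfle).add
    (E3.shl (SH σ3 H3 hx3) ?_) hnew) ?_
  · exact (Nat.le_add_left _ _).trans_lt hnew
  set σ4 := σ3.set 15 _ with hσ4
  have H4 : Hdr P σ4.m := H
  have hx4 : σ4.ρ 10 = x := by simp [hσ4, hσ3, hσ2, hσ1, hx]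
  refine wp_sto_of (l := .lf (l / P.r)) (EV.lf G H4 ((LE σ4 H4 hx4).div (EV.r G H4)) hwi) hwi
    (EV.reg (by rw [hσ4, St.set_ρ_self])) ?_
  set σ5 := σ4.sto (.lf (l / P.r)) _ with hσ5
  have H5 : Hdr P σ5.m := Hdr.sto (by exact H4) _
  have hx5 : σ5.ρ 10 = x := hx4
  have B5 : EV P.lay σ5 (.reg 12) b := EV.reg (by simp [hσ5, hσ4, hσ3, hσ2, hσ1, hb])
  have hlq : l % P.q < P.w := (Nat.mod_lt _ G.q_pos).trans G.q_lt_w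
  refine wp_sto_of (l := .li b) (EV.li G H5 B5 hbn) hbn ((EV.ld (l := .li b) (EV.li G H5 B5 hbn) hbn).or
    ((EV.nm G 1).shl ((LE σ5 H5 hx5).mod (EV.q G H5)) (by rw [one_mul]; exact G.pow_lt hlq))) ?_
  set σ6 := σ5.sto (.li b) _ with hσ6
  have hs6 : ∀ l', l' ≠ .lf (l / P.r) → l' ≠ .li b → σ6.m l' = σ.m l' := fun l' h1 h2 => by
    rw [hσ6, St.sto_m_ne _ _ _ _ h2, hσ5, St.sto_m_ne _ _ _ _ h1]; rfl
  refine hQ σ6 ⟨fun r hr => ?_, rfl⟩ ⟨fun _ _ _ => hs6 _ (by simp) (by simp),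
    fun _ => hs6 _ (by simp) (by simp), fun _ => hs6 _ (by simp) (by simp)⟩
    (fun _ => tch_congr (fun _ => hs6 _ (by simp) (by simp)) (fun _ => hs6 _ (by simp) (by simp))
      (hs6 _ (by simp) (by simp))) (I.core.write G hjc hxn ht
      (fun _ => hs6 _ (by simp) (by simp)) (fun _ => hs6 _ (by simp) (by simp))
      (hs6 _ (by simp) (by simp)) (fun b' => ?_) (fun i' => ?_) (fun i' hi' => ?_))
    (fun _ hi => (I.cinv hi).of_eq (fun _ => hs6 _ (by simp) (by simp))
      (fun _ => hs6 _ (by simp) (by simp)) (fun _ => hs6 _ (by simp) (by simp))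
      (hs6 _ (by simp) (by simp)) (hs6 _ (by simp) (by simp))) ?_ ?_
  · rw [hσ6, St.sto_ρ, hσ5, St.sto_ρ, hσ4, St.set_ρ_ne _ _ _ _ (by omega), hσ3,
      St.set_ρ_ne _ _ _ _ (by omega), hσ2, St.set_ρ_ne _ _ _ _ (by omega), hσ1,
      St.set_ρ_ne _ _ _ _ (by omega)]
  · by_cases hbb : b' = b
    · rw [if_pos hbb, hbb, hσ6, St.sto_m_self, one_mul, hσ5, St.sto_m_ne _ _ _ _ (by simp)]; rfl
    · rw [if_neg hbb]; exact hs6 _ (by simp) (by simp [hbb])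
  · by_cases hii : i' = l / P.r
    · rw [if_pos hii, hii, hσ6, St.sto_m_ne _ _ _ _ (by simp), hσ5, St.sto_m_self]
    · rw [if_neg hii]; exact hs6 _ (by simp [hii]) (by simp)
  · by_cases hii : i' = l / P.r
    · rw [hii, hσ6, St.sto_m_ne _ _ _ _ (by simp), hσ5, St.sto_m_self]; exact hnew
    · rw [hs6 _ (by simp [hii]) (by simp)]; exact I.bd i' hi'
  · simp [hσ6, hσ5, hσ4, hσ3, hσ2]
  · simp [hσ6, hσ5, hσ4, hσ3]

/-- Bring the record of colour `rj` up to date for the leaf of element `r10`. -/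
def svE (c rj : ℕ) : Ex :=
  .cond (memE c (.reg rj) (.reg 12)) (.ld (smA c (.reg rj) (.reg 12))) 0
def hlE : Ex := hE * (.reg 10 / dE % qE)
def refreshP (c rj : ℕ) : Pg :=
  .seq (.set 15 (svE c rj - (((svE c rj >>> hlE) % 2) <<< hlE) +
    (Ex.cond (matE (.reg 13) (.reg rj) (.reg 10 / dE)) 1 0 <<< hlE))) (putP c rj)

/-- Recolouring one element affects a colour record only at the leaf of that element. Its old bit is
subtracted, and the new bit is obtained by matching the updated digits, so the same code handles
gain, loss and no change. -/
theorem wp_refresh {P : Par} (G : P.Good) {σ : St} {Q : St → Prop} {s : ℕ → ℕ} {x j rj : ℕ}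
    {A A' : ℕ → Finset ℕ}
    (H : Hdr P σ.m) (C : CInv P σ.m j A) (hs : ∀ z, s z < P.c)
    (hx : σ.ρ 10 = x) (hxn : x < P.n) (hj : σ.ρ rj = j) (hjc : j < P.c)
    (hb : σ.ρ 12 = x / P.d / P.q)
    (hY : σ.ρ 13 = pk (fun v => P.k * v) (fun u => s (x / P.d * P.d + u)) P.d)
    (hA : ∀ b v, (b ≠ x / P.d / P.q ∨ v ≠ x / P.d % P.q) → (v ∈ A b ↔ v ∈ A' b))
    (hA' : x / P.d % P.q ∈ A' (x / P.d / P.q) ↔ (mts P s j (x / P.d)).Nonempty)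
    (hAq : ∀ v ∈ A' (x / P.d / P.q), v < P.q)
    (hr : rj < 15 ∨ 17 < rj ∧ rj < 64)
    (hQ : ∀ σ', Keeps (fun r => r < 15 ∨ 17 < r) σ σ' → ColEq j σ.m σ'.m →
      CInv P σ'.m j A' → Q σ') : wp P.lay (refreshP P.c rj) Q σ := by
  have hl := elt_leaf_lt G hxn
  have hbn := leaf_blk_lt G hl
  have hvq : x / P.d % P.q < P.q := Nat.mod_lt _ G.q_pos
  set l := x / P.d with hl_def
  set b := l / P.q with hb_def
  set v := l % P.q with hv_def
  have h1 := G.h1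
  have hw := G.w_lt
  have hhq := G.hq_lt
  have hhv : P.h * v + P.h ≤ P.h * P.q := by
    calc P.h * v + P.h = P.h * (v + 1) := by ring
      _ ≤ _ := Nat.mul_le_mul_left _ hvq
  have J : EV P.lay σ (.reg rj) j := EV.reg hj (by omega)
  have B : EV P.lay σ (.reg 12) b := EV.reg hb
  have L : EV P.lay σ (.reg 10 / dE) l := (EV.reg hx).div (EV.d G H)
  have HL : EV P.lay σ hlE (P.h * v) :=
    (EV.h G H).mul (L.mod (EV.q G H)) (by simp only [Par.lay_w]; omega)
  have hinj : ∀ a b : ℕ, P.h * a = P.h * b → a = b := fun a b h =>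
    Nat.eq_of_mul_eq_mul_left h1 h
  have SV : EV P.lay σ (svE P.c rj) (bs (fun v => P.h * v) (A b)) := by
    refine EV.cond (memv' G H C J hjc B hbn) (fun h => ?_) (fun h => ?_)
    · exact (EV.ld (l := .sm j b) (EV.sm G H J B hjc hbn) ⟨hjc, hbn⟩).of_eq (C.sm b ((C.mem b).1 h))
    · refine (EV.nm G 0).of_eq ?_
      rw [C.mem, Finset.not_nonempty_iff_eq_empty] at h
      rw [h]; rfl
  have hbit := bs_bit (o := fun v => P.h * v) (A := A b) (i := v) (fun _ _ h => hinj _ _ h)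
    (fun a _ b _ h => hinj _ _ h)
  have BT : EV P.lay σ ((svE P.c rj >>> hlE) % 2) (if v ∈ A b then 1 else 0) :=
    ((SV.shr HL).mod (EV.nm G 2)).of_eq hbit
  have h2v : 2 ^ (P.h * v) < 2 ^ P.w := G.pow_lt (by omega)
  have hif : ∀ p : Prop, [Decidable p] → (if p then 1 else 0) * 2 ^ (P.h * v) < 2 ^ P.w := by
    intro p _; split_ifs <;> simp [h2v]
  have MT : EV P.lay σ (.cond (matE (.reg 13) (.reg rj) (.reg 10 / dE)) 1 0)
      (if v ∈ A' b then 1 else 0) := by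
    have h : EV P.lay σ (matE (.reg 13) (.reg rj) (.reg 10 / dE))
        (bs (fun s => P.k * s) (mts P s j l)) :=
      EV.mat G H (y := fun u => s (l * P.d + u)) (fun _ _ => hs _) (EV.reg hY) J hjc L hl
    by_cases hm : (mts P s j l).Nonempty
    · rw [if_pos (hA'.2 hm)]
      exact h.cond_pos (fun h => hm.ne_empty (bs_eq_zero.1 h)) (EV.nm G 1)
    · rw [if_neg (mt hA'.1 hm)]
      rw [Finset.not_nonempty_iff_eq_empty] at hm
      exact (h.of_eq (bs_eq_zero.2 hm)).cond_neg (EV.nm G 0)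
  have hsub : bs (fun v => P.h * v) (A b) - (if v ∈ A b then 1 else 0) * 2 ^ (P.h * v) =
      bs (fun v => P.h * v) ((A b).erase v) := by
    split_ifs with h
    · rw [bs_erase h, one_mul, Nat.add_sub_cancel]
    · rw [Finset.erase_eq_of_notMem h]; simp
  have hle : (if v ∈ A b then 1 else 0) * 2 ^ (P.h * v) ≤ bs (fun v => P.h * v) (A b) := by
    split_ifs with h
    · rw [bs_erase h, one_mul]; exact Nat.le_add_left _ _
    · simp
  have her : (A b).erase v = (A' b).erase v := by
    ext u; simp only [Finset.mem_erase]
    constructor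
    · rintro ⟨h3, h4⟩; exact ⟨h3, (hA b u (Or.inr h3)).1 h4⟩
    · rintro ⟨h3, h4⟩; exact ⟨h3, (hA b u (Or.inr h3)).2 h4⟩
  have hval : bs (fun v => P.h * v) (A b) - (if v ∈ A b then 1 else 0) * 2 ^ (P.h * v) +
      (if v ∈ A' b then 1 else 0) * 2 ^ (P.h * v) = bs (fun v => P.h * v) (A' b) := by
    rw [hsub, her]
    split_ifs with h
    · rw [bs_erase h, one_mul]
    · rw [Finset.erase_eq_of_notMem h]; simp
  have hbd : bs (fun v => P.h * v) (A' b) < 2 ^ P.w := by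
    refine (bs_lt (B := P.h * P.q) (fun a _ b _ h => hinj _ _ h) fun u hu => ?_).trans
      (G.pow_lt hhq)
    exact Nat.mul_lt_mul_of_pos_left (hAq u hu) h1
  refine wp_set_of (((SV.sub (BT.shl HL (hif _)) hle).add (MT.shl HL (hif _)) ?_).of_eq hval) ?_
  · simp only [Par.lay_w]; rw [hval]; exact hbd
  refine wp_put G (by exact H) (by exact C) hjc hbn (by rw [St.set_ρ_ne _ _ _ _ (by omega), hj])
    (by simp [hb]) (St.set_ρ_self _ _ _) (by omega) fun σ' hk ho hce hci => ?_
  refine hQ σ' ⟨fun r hr => ?_, ho⟩ hce ?_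
  · rw [hk r (by omega) (by omega), St.set_ρ_ne _ _ _ _ (by omega)]
  · convert hci using 1
    funext b'
    by_cases hbb : b' = b
    · rw [hbb, Function.update_self]
    · rw [Function.update_of_ne hbb]
      ext u; exact (hA b' u (Or.inl hbb)).symm

/-- Give element `r10` the colour `r11`. -/
def finsP (c : ℕ) : Pg :=
  .seq (.set 12 (.reg 10 / dE / qE))
  (.seq (touchP c) (.seq (writeP c) (.seq (refreshP c 14) (refreshP c 11))))

section
variable {P : Par} {m m' : Loc → ℕ} {s : ℕ → ℕ} {j0 x j : ℕ}

theorem mts_upd_other (G : P.Good) {l i : ℕ} (h : l ≠ x / P.d) :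
    mts P (Function.update s x j) i l = mts P s i l := by
  ext u
  rw [mem_mts, mem_mts]
  refine and_congr_right fun hu => ?_
  rw [leaf_upd G hu, if_neg h]

theorem mts_upd_col {l i : ℕ} (h1 : i ≠ s x) (h2 : i ≠ j) :
    mts P (Function.update s x j) i l = mts P s i l := by
  ext u
  rw [mem_mts, mem_mts]
  refine and_congr_right fun hu => and_congr_right fun _ => ?_
  by_cases hx : l * P.d + u = x
  · rw [hx, Function.update_self]; exact ⟨fun h => absurd h.symm h2, fun h => absurd h.symm h1⟩
  · rw [Function.update_of_ne hx]

theorem recd_upd_other (G : P.Good) (ht : ∀ b, Tch m' b ↔ Tch m b) {i b v : ℕ}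
    (h : b ≠ x / P.d / P.q ∨ v ≠ x / P.d % P.q) :
    v ∈ recd P m s i b ↔ v ∈ recd P m' (Function.update s x j) i b := by
  unfold recd
  simp only [ht]
  split_ifs
  · rw [mem_lvs, mem_lvs]
    refine and_congr_right fun hv => ?_
    rw [mts_upd_other G]
    rintro h3
    rw [← h3, (leaf_div G hv).1, (leaf_div G hv).2] at h
    tauto
  · rfl

theorem FInv.congr (I : FInv P m s j0) (h : ∀ l, (∀ k, l ≠ .es k ∧ l ≠ .ed k) →
    (∀ i, l = .hdr i → i = 6 ∨ i = 7) → m' l = m l) : FInv P m' s j0 :=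
  (I.core.congr (fun _ => h _ (by simp) (by simp)) (fun _ => h _ (by simp) (by simp))
    (h _ (by simp) (by simp)) (fun _ => h _ (by simp) (by simp))
    (fun _ => h _ (by simp) (by simp))).finv fun j hj => by
  have h1 : recd P m' s j = recd P m s j := by
    funext b; unfold recd
    simp only [tch_congr (b := b) (fun b => h (.ta b) (by simp) (by simp))
      (fun b => h (.tb b) (by simp) (by simp)) (h (.hdr 6) (by simp) (by simp))]
  rw [h1]
  exact (I.cinv hj).of_eq (fun _ => h _ (by simp) (by simp)) (fun _ => h _ (by simp) (by simp))
    (fun _ => h _ (by simp) (by simp)) (h _ (by simp) (by simp)) (h _ (by simp) (by simp))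

/-- No block is touched and no counter is valid, so all requirements on block records are void; the
contents of the memory do not matter beyond the two zero header words. -/
theorem FInv.init (h6 : m (.hdr 6) = 0) (h7 : m (.hdr 7) = 0) (hj : j0 < P.c)
    (hm : ∀ i ≤ P.nl / P.r, m (.lf i) < 2 ^ P.w) : FInv P m (fun _ => j0) j0 := by
  have ht : ∀ b, ¬ Tch m b := fun b h => by
    unfold Tch SpMem at h; rw [h6] at h; exact absurd h.1 (Nat.not_lt_zero _)
  have hc : ∀ j, cntV m j = 0 := fun j => by
    unfold cntV; rw [h7, if_neg (bit_zero _)]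
  have hme : ∀ j b, ¬ Mem m j b := fun j b h => by
    unfold Mem SpMem at h; rw [hc] at h; exact absurd h.1 (Nat.not_lt_zero _)
  refine ⟨?_, fun l _ h => absurd h.1 (ht _), fun _ _ _ _ _ => rfl, hm, fun _ => hj,
    fun j _ => ?_, fun j _ b => ?_, fun j _ b h => absurd h (hme j b)⟩
  · rw [h6]
    exact { lt := fun _ h => absurd h (Nat.not_lt_zero _), inv := fun _ h => absurd h (Nat.not_lt_zero _),
            low := fun _ h => absurd h (Nat.not_lt_zero _), high := fun _ _ h => absurd h.1 (Nat.not_lt_zero _) }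
  · rw [hc]
    exact ⟨fun _ h => absurd h (Nat.not_lt_zero _), fun _ h => absurd h (Nat.not_lt_zero _)⟩
  · exact ⟨fun h => absurd h (hme _ _), fun h => absurd h.1 (ht _)⟩
end

/-- A leaf can lose only the former colour of the element and gain only the new one, so two
refreshes suffice; for every other colour the matches are unchanged by `mts_upd_col`. -/
theorem wp_fins {P : Par} (G : P.Good) {σ : St} {Q : St → Prop} {s : ℕ → ℕ} {j0 x j : ℕ}
    (H : Hdr P σ.m) (I : FInv P σ.m s j0) (hj0 : σ.m (.hdr 1) = j0) (hj0c : j0 < P.c)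
    (hx : σ.ρ 10 = x) (hxn : x < P.n) (hj : σ.ρ 11 = j) (hjc : j < P.c)
    (hQ : ∀ σ', Keeps (fun r => r < 12 ∨ 18 < r) σ σ' → Frame σ.m σ'.m →
      FInv P σ'.m (Function.update s x j) j0 → Q σ') : wp P.lay (finsP P.c) Q σ := by
  have hl := elt_leaf_lt G hxn
  have hbn := leaf_blk_lt G hl
  have hcx := I.col x
  refine wp_set_of (((EV.reg hx).div (EV.d G H)).div (EV.q G H)) ?_
  refine wp_touch G (s := s) (j0 := j0) (by exact H) (by exact I) hj0 hj0c (St.set_ρ_self _ _ _) hbn ?_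
  intro σ1 k1 F1 ht1 I1
  have H1 : Hdr P σ1.m := F1.hdr (by exact H)
  have e1 : ∀ r, r < 12 ∨ 18 < r → σ1.ρ r = σ.ρ r := fun r hr => by
    rw [k1.1 r (by omega), St.set_ρ_ne _ _ _ _ (by omega)]
  have hj1 : σ1.m (.hdr 1) = j0 := by rw [F1.1 1 (by norm_num) (by norm_num)]; exact hj0
  have hb1 : σ1.ρ 12 = x / P.d / P.q := by rw [k1.1 12 (by norm_num), St.set_ρ_self]
  refine wp_write G (j := j) H1 I1 hj1 hj0c (by rw [e1 10 (by norm_num), hx]) hxn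
    (by rw [e1 11 (by norm_num), hj]) hjc hb1 ht1 ?_
  intro σ2 k2 F2 ht2 C2 D2 ho hY
  set s' := Function.update s x j with hs'
  have H2 : Hdr P σ2.m := F2.hdr H1
  have e2 : ∀ r, r < 12 ∨ 18 < r → σ2.ρ r = σ.ρ r := fun r hr => by
    rw [k2.1 r (by omega), e1 r hr]
  have hx2 : σ2.ρ 10 = x := by rw [e2 10 (by norm_num), hx]
  have hj2 : σ2.ρ 11 = j := by rw [e2 11 (by norm_num), hj]
  have hb2 : σ2.ρ 12 = x / P.d / P.q := by rw [k2.1 12 (by norm_num), hb1]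
  have ht2' := (ht2 _).2 ht1
  have hvq : x / P.d % P.q < P.q := Nat.mod_lt _ G.q_pos
  have hmemA : ∀ m, Tch m (x / P.d / P.q) → ∀ i, x / P.d % P.q ∈ recd P m s' i (x / P.d / P.q) ↔
      (mts P s' i (x / P.d)).Nonempty := fun m hm i => by
    rw [recd, if_pos hm, mem_lvs, mul_comm, Nat.div_add_mod]; simp [hvq]
  have hAq : ∀ m i, ∀ v ∈ recd P m s' i (x / P.d / P.q), v < P.q := fun m i v hv => by
    unfold recd at hv; split_ifs at hv
    · exact (mem_lvs.1 hv).1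
    · simp at hv
  refine wp_refresh G (s := s') (A' := recd P σ2.m s' (s x)) H2 (D2 _ hcx) C2.col hx2 hxn ho hcx hb2
    hY (fun b v h => recd_upd_other G ht2 h) (hmemA _ ht2' _) (hAq _ _) (by norm_num) ?_
  intro σ3 k3 E3 C3
  have hr3 : ∀ i, recd P σ3.m s' i = recd P σ2.m s' i := fun i => by
    funext b; unfold recd; simp only [E3.tch]
  have D3 : ∀ i < P.c, i ≠ s x → CInv P σ3.m i (recd P σ1.m s i) := fun i hi hne =>
    (D2 i hi).congr E3 hne
  have C3' : CInv P σ3.m (s x) (recd P σ3.m s' (s x)) := by rw [hr3]; exact C3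
  have ht3 : Tch σ3.m (x / P.d / P.q) := E3.tch.2 ht2'
  -- If the new colour equals the former one, the second refresh starts from the record just
  -- repaired; otherwise from the old record, which differs from the desired one at most at the leaf
  -- of `x`.
  have hA3 : ∃ A, CInv P σ3.m j A ∧ ∀ b v, (b ≠ x / P.d / P.q ∨ v ≠ x / P.d % P.q) →
      (v ∈ A b ↔ v ∈ recd P σ3.m s' j b) := by
    by_cases h : j = s x
    · exact ⟨_, h ▸ C3', fun b v _ => by rw [h]⟩
    · exact ⟨_, D3 j hjc h, fun b v hb => recd_upd_other G
        (fun b => by rw [E3.tch, ht2]) hb⟩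
  obtain ⟨A, CA, hA⟩ := hA3
  refine wp_refresh G (s := s') (A' := recd P σ3.m s' j) (E3.hdr H2) CA C2.col
    (by rw [k3.1 10 (by norm_num), hx2]) hxn (by rw [k3.1 11 (by norm_num), hj2]) hjc
    (by rw [k3.1 12 (by norm_num), hb2]) (by rw [k3.1 13 (by norm_num), hY]) hA
    (hmemA _ ht3 _) (hAq _ _) (by norm_num) ?_
  intro σ4 k4 E4 C4
  have hr4 : ∀ i, recd P σ4.m s' i = recd P σ3.m s' i := fun i => by
    funext b; unfold recd; simp only [E4.tch]
  refine hQ σ4 ⟨fun r hr => ?_, ?_⟩ (((Frame.trans (by exact F1) F2).trans E3.frame).trans E4.frame)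
    (((C2.of_colEq E3).of_colEq E4).finv fun i hi => ?_)
  · rw [k4.1 r (by omega), k3.1 r (by omega), e2 r hr]
  · rw [k4.2, k3.2, k2.2, k1.2]; rfl
  · by_cases h1 : i = j
    · rw [h1, hr4]; exact C4
    · refine CInv.congr ?_ E4 h1
      by_cases h2 : i = s x
      · rw [h2, hr4]; exact C3'
      · convert D3 i hi h2 using 1
        funext b; unfold recd
        have h3 : Tch σ4.m b ↔ Tch σ1.m b := by rw [E4.tch, E3.tch, ht2]
        simp only [h3]
        congr 1
        ext v
        rw [mem_lvs, mem_lvs, hs', mts_upd_col h2 h1]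

/-! ### The main data structure: queries -/

theorem Par.Good.w_pos {P : Par} (G : P.Good) : 1 ≤ P.lay.w := by
  have := G.w_ge; simp only [Par.lay_w]; omega

/-- An element of colour `r10`, plus one. -/
def ffindP (c : ℕ) : Pg :=
  .ite (totE (.reg 10))
    (.seq (.set 11 0)
    (.seq (.set 12 (blkE c (.reg 10) (.reg 11)))
    (.seq (.set 13 (vE c (.reg 10) (.reg 11) (.reg 12)))
    (.seq (.set 14 (.reg 12 * qE + logE hE (lsbE (.reg 13))))
    (.seq (.set 15 (YE c (.reg 14) (liE c (.reg 12))))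
    (.seq (.set 16 (matE (.reg 15) (.reg 10) (.reg 14)))
    (.set 0 (.reg 14 * dE + logE kE (lsbE (.reg 16)) + 1))))))))
    (.set 0 0)

section
variable {P : Par} {m : Loc → ℕ} {s : ℕ → ℕ} {j0 j x : ℕ}

theorem FInv.tot_eq_zero (G : P.Good) (I : FInv P m s j0) (hj : j < P.c) (h : tot P m j0 j = 0)
    (hx : x < P.n) : s x ≠ j := by
  intro hxj
  have h1 := mem_lvs_elt (s := s) G hx
  rw [hxj] at h1
  obtain ⟨p, hp, _⟩ := I.blk_surj G hj ⟨_, h1.1⟩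
  omega

theorem EV.lsb_leaf (G : P.Good) {σ : St} (H : Hdr P σ.m) {e : Ex} {A : Finset ℕ}
    (hA : A.Nonempty) (hq : ∀ v ∈ A, v < P.q) (h : EV P.lay σ e (bs (fun v => P.h * v) A)) :
    EV P.lay σ (logE hE (lsbE e)) (A.min' hA) := by
  have h1 := G.h1
  have h2 := hq _ (A.min'_mem hA)
  refine EV.log G (EV.h G H) (EV.lsb G (fun _ _ _ _ h => Nat.mul_lt_mul_of_pos_left h h1) hA h) h1
    (by have := G.hw; omega) (h2.trans G.q_lt)

theorem EV.lsb_digit (G : P.Good) {σ : St} (H : Hdr P σ.m) {e : Ex} {A : Finset ℕ}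
    (hA : A.Nonempty) (hq : ∀ v ∈ A, v < P.d) (h : EV P.lay σ e (bs (fun v => P.k * v) A)) :
    EV P.lay σ (logE kE (lsbE e)) (A.min' hA) := by
  have h1 : 0 < P.k := by unfold Par.k; omega
  have h2 := hq _ (A.min'_mem hA)
  exact EV.log G (EV.k G H) (EV.lsb G (fun _ _ _ _ h => Nat.mul_lt_mul_of_pos_left h h1) hA h) h1
    G.k_lt (h2.trans G.d_lt_k)

theorem leaf_idx (G : P.Good) {b v : ℕ} (h : v ∈ lvs P s j b) :
    b * P.q + v < P.nl ∧ (b * P.q + v) / P.q = b := by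
  rw [mem_lvs] at h
  obtain ⟨hv, i, hi⟩ := h
  rw [mem_mts] at hi
  exact ⟨leaf_lt G hi.1 hi.2.1, (leaf_div G hv).1⟩
end

/-- Block number 0 of the colour contains it by `FInv.blk_spec`, so the set of its leaves is
nonempty, and so is the set of matches in the lowest of these leaves. -/
theorem wp_ffind {P : Par} (G : P.Good) {σ : St} {Q : St → Prop} {s : ℕ → ℕ} {j0 j : ℕ}
    (H : Hdr P σ.m) (I : FInv P σ.m s j0) (hj0 : σ.m (.hdr 1) = j0) (hj0c : j0 < P.c)
    (hj : σ.ρ 10 = j) (hjc : j < P.c)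
    (hQ : ∀ σ' : St, σ'.m = σ.m → ((∃ x < P.n, s x = j ∧ σ'.ρ 0 = x + 1) ∨
      ((∀ x < P.n, s x ≠ j) ∧ σ'.ρ 0 = 0)) → Q σ') : wp P.lay (ffindP P.c) Q σ := by
  have T0 := EV.totv G H I hj0 (EV.reg hj) hjc
  refine ⟨T0.1, fun h => ?_, fun h => ?_⟩
  · rw [T0.2] at h
    have hp : 0 < tot P σ.m j0 j := Nat.pos_of_ne_zero h
    obtain ⟨hbn, hbl⟩ := I.blk_spec G hjc hp
    refine wp_set_of (EV.nm G 0) ?_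
    set σ1 := σ.set 11 0
    have J1 : EV P.lay σ1 (.reg 10) j := EV.reg (by simp [σ1, hj])
    have P1 : EV P.lay σ1 (.reg 11) 0 := EV.reg (by simp [σ1])
    refine wp_set_of (EV.blkv G (by exact H) (by exact I) J1 hjc P1 hp) ?_
    set σ2 := σ1.set 12 _
    have J2 : EV P.lay σ2 (.reg 10) j := EV.reg (by simp [σ2, σ1, hj])
    have P2 : EV P.lay σ2 (.reg 11) 0 := EV.reg (by simp [σ2, σ1])
    have B2 : EV P.lay σ2 (.reg 12) (blk σ.m j 0) := EV.reg (by simp [σ2]; rfl)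
    refine wp_set_of (EV.vv G (by exact H) (by exact I) J2 hjc P2 hp B2) ?_
    change wp P.lay _ Q (σ2.set 13 (bs (fun v => P.h * v) (lvs P s j (blk σ.m j 0))))
    set b := blk σ.m j 0
    set σ3 := σ2.set 13 _
    have B3 : EV P.lay σ3 (.reg 12) b := EV.reg (by simp [σ3, σ2]; rfl)
    have V3 : EV P.lay σ3 (.reg 13) (bs (fun v => P.h * v) (lvs P s j b)) :=
      EV.reg (by simp [σ3])
    have hv := (lvs P s j b).min'_mem hbl
    set v := (lvs P s j b).min' hbl
    obtain ⟨hl, hlb⟩ := leaf_idx G hv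
    have hlw := hl.trans_le G.nl_le |>.trans G.n_lt
    refine wp_set_of ((B3.mul (EV.q G (by exact H)) (by simp only [Par.lay_w]; omega)).add
      (EV.lsb_leaf G (by exact H) hbl (fun v hv => (mem_lvs.1 hv).1) V3) hlw) ?_
    set σ4 := σ3.set 14 (b * P.q + v)
    have J4 : EV P.lay σ4 (.reg 10) j := EV.reg (by simp [σ4, σ3, σ2, σ1, hj])
    have B4 : EV P.lay σ4 (.reg 12) b := EV.reg (by simp [σ4, σ3, σ2]; rfl)
    have L4 : EV P.lay σ4 (.reg 14) (b * P.q + v) := EV.reg (by simp [σ4])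
    refine wp_set_of (EV.Yv G (by exact H) (by exact I) hj0 L4 hl
      ((EV.liv G (by exact H) (by exact I) B4 hbn).of_eq (by rw [hlb]))) ?_
    set σ5 := σ4.set 15 _
    have J5 : EV P.lay σ5 (.reg 10) j := EV.reg (by simp [σ5, σ4, σ3, σ2, σ1, hj])
    have L5 : EV P.lay σ5 (.reg 14) (b * P.q + v) := EV.reg (by simp [σ5, σ4])
    refine wp_set_of (EV.matv G (by exact H) (by exact I) J5 hjc (EV.reg (St.set_ρ_self _ _ _))
      L5 hl) ?_
    set σ6 := σ5.set 16 _
    have L6 : EV P.lay σ6 (.reg 14) (b * P.q + v) := EV.reg (by simp [σ6, σ5, σ4])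
    have hm := (mem_lvs.1 hv).2
    have hi := (mts P s j (b * P.q + v)).min'_mem hm
    rw [mem_mts] at hi
    have hxn := hi.2.1
    have hxw := G.n_lt
    refine wp_set_of (((L6.mul (EV.d G (by exact H)) (by simp only [Par.lay_w]; omega)).add
      (EV.lsb_digit G (by exact H) hm (fun v hv => (mem_mts.1 hv).1)
      (EV.reg (St.set_ρ_self _ _ _))) (hxn.trans hxw)).add (EV.nm G 1)
      (by simp only [Par.lay_w]; omega)) ?_
    exact hQ _ rfl (Or.inl ⟨_, hxn, hi.2.2, St.set_ρ_self _ _ _⟩)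
  · rw [T0.2] at h
    refine wp_set_of (EV.nm G 0) (hQ _ rfl (Or.inr ⟨fun x hx => I.tot_eq_zero G hjc h hx,
      St.set_ρ_self _ _ _⟩))

/-! ### Enumeration in the main structure, in time linear in the output. -/

theorem sorted_cons {a : ℕ} {l : List ℕ} (h : (a :: l).Pairwise (· < ·)) :
    ∃ hA : (a :: l).toFinset.Nonempty, (a :: l).toFinset.min' hA = a ∧
      (a :: l).toFinset.erase a = l.toFinset := by
  rw [List.pairwise_cons] at h
  refine ⟨⟨a, by simp⟩, le_antisymm (Finset.min'_le _ _ (by simp)) ?_, ?_⟩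
  · refine Finset.le_min' _ _ _ fun x hx => ?_
    simp only [List.toFinset_cons, Finset.mem_insert, List.mem_toFinset] at hx
    rcases hx with rfl | hx
    · exact le_rfl
    · exact (h.1 x hx).le
  · rw [List.toFinset_cons, Finset.erase_insert]
    rw [List.mem_toFinset]
    exact fun h' => lt_irrefl _ (h.1 a h')

/-- Every block and every leaf that is visited contributes at least one element, so the fixed cost
of a visit can be charged to the output. -/
theorem sum_le_flatMap {α β : Type*} {K : ℕ} {ct : α → ℕ} {f : α → List β} {l : List α}
    (h : ∀ a ∈ l, ct a ≤ K * (f a).length) : (l.map ct).sum ≤ K * (l.flatMap f).length := by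
  induction l with
  | nil => simp
  | cons a l ih =>
    have h1 := h a (by simp)
    have h2 := ih fun b hb => h b (by simp [hb])
    simp only [List.map_cons, List.sum_cons, List.flatMap_cons, List.length_append, Nat.mul_add]
    omega

def emitP : Pg :=
  .seq (.emit (.reg 14 * dE + logE kE (lsbE (.reg 16)) + 1)) (.set 16 (.reg 16 &&& (.reg 16 - 1)))
def leafP (c : ℕ) : Pg :=
  .seq (.set 14 (.reg 12 * qE + logE hE (lsbE (.reg 13))))
  (.seq (.set 13 (.reg 13 &&& (.reg 13 - 1)))
  (.seq (.set 15 (YE c (.reg 14) (liE c (.reg 12))))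
  (.set 16 (matE (.reg 15) (.reg 10) (.reg 14)))))
def blockP (c : ℕ) : Pg :=
  .seq (.set 12 (blkE c (.reg 10) (.reg 11)))
  (.seq (.set 13 (vE c (.reg 10) (.reg 11) (.reg 12)))
  (.set 11 (.reg 11 + 1)))
/-- Enumerate the elements of colour `r10`. -/
def fenumP (c : ℕ) : Pg :=
  .seq (.set 11 0)
  (.whl (.lt (.reg 11) (totE (.reg 10)))
    (.seq (blockP c) (.whl (.reg 13) (.seq (leafP c) (.whl (.reg 16) emitP)))))

def leafK (c : ℕ) : ℕ := (leafP c).cost + emitP.cost + 8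
def fenumK (c : ℕ) : ℕ := (blockP c).cost + leafK c + 8 + (totE (.reg 10)).cost

section
variable (P : Par) (s : ℕ → ℕ) (j : ℕ)
/-- The elements of a leaf, of a block, and of all blocks. -/
def eltsL (l : ℕ) : List ℕ := ((mts P s j l).sort (· ≤ ·)).map fun i => l * P.d + i
def eltsB (b : ℕ) : List ℕ := ((lvs P s j b).sort (· ≤ ·)).flatMap fun v => eltsL P s j (b * P.q + v)
end

section
variable {P : Par} {s : ℕ → ℕ} {j j0 : ℕ}

theorem mem_eltsL (G : P.Good) {l x : ℕ} :
    x ∈ eltsL P s j l ↔ x < P.n ∧ s x = j ∧ x / P.d = l := by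
  unfold eltsL
  simp only [List.mem_map, Finset.mem_sort, mem_mts]
  constructor
  · rintro ⟨i, ⟨h1, h2, h3⟩, rfl⟩
    exact ⟨h2, h3, (elt_div G h1).1⟩
  · rintro ⟨h1, h2, rfl⟩
    have h4 : x / P.d * P.d + x % P.d = x := by rw [mul_comm]; exact Nat.div_add_mod _ _
    exact ⟨x % P.d, ⟨Nat.mod_lt _ G.codec.hd, by rw [h4]; exact h1, by rw [h4]; exact h2⟩, h4⟩

theorem mem_eltsB (G : P.Good) {b x : ℕ} :
    x ∈ eltsB P s j b ↔ x < P.n ∧ s x = j ∧ x / P.d / P.q = b := by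
  unfold eltsB
  simp only [List.mem_flatMap, Finset.mem_sort, mem_eltsL G]
  constructor
  · rintro ⟨v, hv, h1, h2, h3⟩
    exact ⟨h1, h2, by rw [h3]; exact (leaf_div G (mem_lvs.1 hv).1).1⟩
  · rintro ⟨h1, h2, rfl⟩
    have h := mem_lvs_elt (s := s) G h1
    rw [h2] at h
    exact ⟨_, h.1, h1, h2, by rw [mul_comm]; exact (Nat.div_add_mod _ _).symm⟩

theorem nodup_eltsL (l : ℕ) : (eltsL P s j l).Nodup :=
  (Finset.sort_nodup _ _).map fun a b h => by simpa using h

theorem nodup_eltsB (G : P.Good) (b : ℕ) : (eltsB P s j b).Nodup := by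
  refine List.nodup_flatMap.2 ⟨fun _ _ => nodup_eltsL _, ?_⟩
  refine (Finset.sort_nodup _ _).imp_of_mem fun {u v} hu hv huv => ?_
  intro x h1 h2
  rw [mem_eltsL G] at h1 h2
  have := h1.2.2.symm.trans h2.2.2
  exact huv (by omega)

theorem nodup_elts (G : P.Good) {m : Loc → ℕ} (I : FInv P m s j0) (hj : j < P.c) :
    ((List.range (tot P m j0 j)).flatMap fun p => eltsB P s j (blk m j p)).Nodup := by
  refine List.nodup_flatMap.2 ⟨fun _ _ => nodup_eltsB G _, ?_⟩
  refine List.nodup_range.imp_of_mem fun {u v} hu hv huv => ?_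
  intro x h1 h2
  rw [mem_eltsB G] at h1 h2
  exact huv (I.blk_inj hj (List.mem_range.1 hu) (List.mem_range.1 hv) (h1.2.2.symm.trans h2.2.2))

theorem mem_elts (G : P.Good) {m : Loc → ℕ} (I : FInv P m s j0) (hj : j < P.c) {x : ℕ} :
    x ∈ ((List.range (tot P m j0 j)).flatMap fun p => eltsB P s j (blk m j p)) ↔
      x < P.n ∧ s x = j := by
  simp only [List.mem_flatMap, List.mem_range, mem_eltsB G]
  constructor
  · rintro ⟨_, _, h1, h2, _⟩; exact ⟨h1, h2⟩
  · rintro ⟨h1, h2⟩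
    have h := mem_lvs_elt (s := s) G h1
    rw [h2] at h
    obtain ⟨p, hp, hb⟩ := I.blk_surj G hj ⟨_, h.1⟩
    exact ⟨p, hp, h1, h2, hb.symm⟩

theorem tr_emit (G : P.Good) {σ : St} (H : Hdr P σ.m) {l : ℕ} {il : List ℕ}
    (hil : il.Pairwise (· < ·)) (hid : ∀ i ∈ il, i < P.d ∧ l * P.d + i < P.n)
    (hl : σ.ρ 14 = l) (h16 : σ.ρ 16 = bs (fun v => P.k * v) il.toFinset) :
    Tr P.lay (.whl (.reg 16) emitP) σ (2 + il.length * (emitP.cost + 2)) fun σ' =>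
      σ'.m = σ.m ∧ (∀ r, r ≠ 16 → σ'.ρ r = σ.ρ r) ∧
      σ'.out = σ.out ++ il.map fun i => l * P.d + i + 1 := by
  have hk1 : 0 < P.k := by unfold Par.k; omega
  have hnw := G.n_lt
  refine (Tr.while_list G.w_pos (α := ℕ) (ct := fun _ => emitP.cost) (I := fun il σ' =>
    il.Pairwise (· < ·) ∧ (∀ i ∈ il, i < P.d ∧ l * P.d + i < P.n) ∧ σ'.m = σ.m ∧
    (∀ r, r ≠ 16 → σ'.ρ r = σ.ρ r) ∧ σ'.ρ 16 = bs (fun v => P.k * v) il.toFinset ∧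
    σ'.out ++ (il.map fun i => l * P.d + i + 1) = σ.out ++ _) ?_ ?_ il σ
    ⟨hil, hid, rfl, fun _ _ => rfl, h16, rfl⟩).mono ?_ ?_
  · rintro σ' ⟨-, -, -, -, h, -⟩
    exact ⟨by simp, h⟩
  · rintro a il σ' ⟨h1, h2, h3, h4, h5, h6⟩
    obtain ⟨hA, hmin, her⟩ := sorted_cons h1
    have H' : Hdr P σ'.m := h3 ▸ H
    have E16 : EV P.lay σ' (.reg 16) (bs (fun v => P.k * v) (a :: il).toFinset) := EV.reg h5
    refine ⟨by simp, fun h => ?_, wp_sound G.w_pos _ ?_⟩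
    · rw [E16.2] at h; exact hA.ne_empty (bs_eq_zero.1 h)
    · have ha := (h2 a (by simp)).2
      have L : EV P.lay σ' (.reg 14) l := EV.reg (by rw [h4 14 (by norm_num), hl])
      have X := EV.lsb_digit G H' hA (fun v hv => (h2 v (by simpa using hv)).1) E16
      rw [hmin] at X
      refine wp_emit_of (((L.mul (EV.d G H') (by simp only [Par.lay_w]; omega)).add X
        (ha.trans hnw)).add (EV.nm G 1) (by simp only [Par.lay_w]; omega)) ?_
      have C := EV.clear (σ := σ'.emit (l * P.d + a + 1)) G
        (o := fun v => P.k * v) (fun _ _ _ _ h => Nat.mul_lt_mul_of_pos_left h hk1) hA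
        (EV.reg (r := 16) h5)
      rw [hmin, her] at C
      refine wp_set_of C ⟨(List.pairwise_cons.1 h1).2, fun i hi => h2 i (by simp [hi]), h3,
        fun r hr => ?_, St.set_ρ_self _ _ _, ?_⟩
      · rw [St.set_ρ_ne _ _ _ _ hr]; exact h4 r hr
      · rw [← h6]; simp
  · simp only [Ex.cost, List.map_const', List.sum_replicate, smul_eq_mul]
    rw [show emitP.cost + 1 + 1 = emitP.cost + 2 from rfl]
  · rintro σ' ⟨-, -, h3, h4, -, h6⟩
    exact ⟨h3, h4, by simpa using h6⟩

theorem eltsL_length (l : ℕ) : (eltsL P s j l).length = ((mts P s j l).sort (· ≤ ·)).length := by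
  simp [eltsL]

theorem tr_leaf (G : P.Good) {σ : St} (H : Hdr P σ.m) (I : FInv P σ.m s j0)
    (hj0 : σ.m (.hdr 1) = j0) (hj0c : j0 < P.c) (hjc : j < P.c) {b : ℕ} (hbn : b < P.nb)
    {vl : List ℕ} (hvl : vl.Pairwise (· < ·)) (hvb : ∀ v ∈ vl, v ∈ lvs P s j b)
    (hj : σ.ρ 10 = j) (hb : σ.ρ 12 = b) (h13 : σ.ρ 13 = bs (fun v => P.h * v) vl.toFinset) :
    Tr P.lay (.whl (.reg 13) (.seq (leafP P.c) (.whl (.reg 16) emitP))) σ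
      (2 + leafK P.c * (vl.flatMap fun v => eltsL P s j (b * P.q + v)).length) fun σ' =>
      σ'.m = σ.m ∧ (∀ r, r < 13 → σ'.ρ r = σ.ρ r) ∧
      σ'.out = σ.out ++ (vl.flatMap fun v => eltsL P s j (b * P.q + v)).map (· + 1) := by
  have h1 := G.h1
  have hnw := G.n_lt
  have hnl := G.nl_le
  refine (Tr.while_list G.w_pos (α := ℕ)
    (ct := fun v => (leafP P.c).cost + (2 + (eltsL P s j (b * P.q + v)).length * (emitP.cost + 2)))
    (I := fun vl σ' => vl.Pairwise (· < ·) ∧ (∀ v ∈ vl, v ∈ lvs P s j b) ∧ σ'.m = σ.m ∧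
    (∀ r, r < 13 → σ'.ρ r = σ.ρ r) ∧ σ'.ρ 13 = bs (fun v => P.h * v) vl.toFinset ∧
    σ'.out ++ (vl.flatMap fun v => eltsL P s j (b * P.q + v)).map (· + 1) = σ.out ++ _) ?_ ?_ vl σ
    ⟨hvl, hvb, rfl, fun _ _ => rfl, h13, rfl⟩).mono ?_ ?_
  · rintro σ' ⟨-, -, -, -, h, -⟩
    exact ⟨by simp, h⟩
  · rintro v vl σ' ⟨p1, p2, p3, p4, p5, p6⟩
    obtain ⟨hA, hmin, her⟩ := sorted_cons p1
    have H' : Hdr P σ'.m := p3 ▸ H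
    have I' : FInv P σ'.m s j0 := p3 ▸ I
    have hj0' : σ'.m (.hdr 1) = j0 := p3 ▸ hj0
    have E13 : EV P.lay σ' (.reg 13) (bs (fun v => P.h * v) (v :: vl).toFinset) := EV.reg p5
    refine ⟨by simp, fun h => ?_, ?_⟩
    · rw [E13.2] at h; exact hA.ne_empty (bs_eq_zero.1 h)
    have hv := p2 v (by simp)
    obtain ⟨hl, hlb⟩ := leaf_idx G hv
    set l := b * P.q + v with hl_def
    have B : EV P.lay σ' (.reg 12) b := EV.reg (by rw [p4 12 (by norm_num), hb])
    have V := EV.lsb_leaf G H' hA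
      (fun v hv => (mem_lvs.1 (p2 v (by simpa using hv))).1) E13
    rw [hmin] at V
    refine Tr.seq (R := fun σ2 => σ2.m = σ.m ∧ (∀ r, r < 13 → σ2.ρ r = σ.ρ r) ∧
      σ2.ρ 13 = bs (fun v => P.h * v) vl.toFinset ∧ σ2.ρ 14 = l ∧
      σ2.ρ 16 = bs (fun v => P.k * v) (mts P s j l) ∧ σ2.out = σ'.out) (wp_sound G.w_pos _ ?_) ?_
    · refine wp_set_of ((B.mul (EV.q G H') (by simp only [Par.lay_w]; omega)).add V
        (by simp only [Par.lay_w]; omega)) ?_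
      set σ1 := σ'.set 14 l
      have C := EV.clear (σ := σ1) G (o := fun v => P.h * v)
        (fun _ _ _ _ h => Nat.mul_lt_mul_of_pos_left h h1) hA (EV.reg (r := 13) (by simp [σ1, p5]))
      rw [hmin, her] at C
      refine wp_set_of C ?_
      set σ2 := σ1.set 13 _
      have L2 : EV P.lay σ2 (.reg 14) l := EV.reg (by simp [σ2, σ1])
      have B2 : EV P.lay σ2 (.reg 12) b :=
        EV.reg (by simp only [σ2, σ1]; simp [p4 12 (by norm_num), hb])
      refine wp_set_of (EV.Yv G (by exact H') (by exact I') hj0' L2 hl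
        ((EV.liv G (by exact H') (by exact I') B2 hbn).of_eq (by rw [hlb]))) ?_
      set σ3 := σ2.set 15 _
      have J3 : EV P.lay σ3 (.reg 10) j :=
        EV.reg (by simp only [σ3, σ2, σ1]; simp [p4 10 (by norm_num), hj])
      have L3 : EV P.lay σ3 (.reg 14) l := EV.reg (by simp [σ3, σ2, σ1])
      refine wp_set_of (EV.matv G (by exact H') (by exact I') J3 hjc
        (EV.reg (St.set_ρ_self _ _ _)) L3 hl) ⟨p3, fun r hr => ?_, ?_, ?_, ?_, rfl⟩
      · simp only [σ3, σ2, σ1]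
        rw [St.set_ρ_ne _ _ _ _ (by omega), St.set_ρ_ne _ _ _ _ (by omega),
          St.set_ρ_ne _ _ _ _ (by omega), St.set_ρ_ne _ _ _ _ (by omega), p4 r hr]
      · simp [σ3, σ2]
      · simp [σ3, σ2, σ1]
      · simp
    · rintro σ2 ⟨q1, q2, q3, q4, q5, q6⟩
      refine (tr_emit G (q1 ▸ H) (il := (mts P s j l).sort (· ≤ ·)) (Finset.sortedLT_sort _).pairwise
        (fun i hi => ?_) q4 (by rw [q5, Finset.sort_toFinset])).mono ?_ ?_
      · rw [Finset.mem_sort, mem_mts] at hi; exact ⟨hi.1, hi.2.1⟩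
      · rw [eltsL_length]
      · rintro σ3 ⟨r1, r2, r3⟩
        refine ⟨(List.pairwise_cons.1 p1).2, fun v hv => p2 v (by simp [hv]), r1.trans q1,
          fun r hr => by rw [r2 r (by omega), q2 r hr], by rw [r2 13 (by norm_num), q3], ?_⟩
        rw [r3, q6, ← p6]
        simp [eltsL, ← hl_def]
  · have := sum_le_flatMap (K := leafK P.c) (l := vl)
      (ct := fun v => (leafP P.c).cost + (2 + (eltsL P s j (b * P.q + v)).length * (emitP.cost + 2))
        + (Ex.reg 13).cost + 1) (f := fun v => eltsL P s j (b * P.q + v)) fun v hv => ?_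
    · simp only [Ex.cost] at this ⊢; omega
    -- A recorded leaf contains the colour, so it pays for its own visit.
    · have h2 : 1 ≤ (eltsL P s j (b * P.q + v)).length := by
        rw [eltsL_length, Finset.length_sort]
        exact Finset.card_pos.2 (mem_lvs.1 (hvb v hv)).2
      simp only [Ex.cost, leafK]
      nlinarith [(leafP P.c).cost.zero_le]
  · rintro σ' ⟨-, -, h3, h4, -, h6⟩
    exact ⟨h3, h4, by simpa using h6⟩

theorem tr_fenum (G : P.Good) {σ : St} (H : Hdr P σ.m) (I : FInv P σ.m s j0)
    (hj0 : σ.m (.hdr 1) = j0) (hj0c : j0 < P.c) (hj : σ.ρ 10 = j) (hjc : j < P.c) :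
    ∃ L : List ℕ, L.Nodup ∧ (∀ x, x ∈ L ↔ x < P.n ∧ s x = j) ∧
      Tr P.lay (fenumP P.c) σ (fenumK P.c * (L.length + 1)) fun σ' =>
        σ'.m = σ.m ∧ σ'.out = σ.out ++ L.map (· + 1) := by
  refine ⟨_, nodup_elts G I hjc, fun x => mem_elts G I hjc, ?_⟩
  set T := tot P σ.m j0 j with hT
  set f := fun p => eltsB P s j (blk σ.m j p) with hf
  have h1 := G.h1
  have hnb := G.nb_le.trans_lt (G.nl_le.trans_lt G.n_lt)
  have hTw : T < 2 ^ P.w := by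
    have h5 := G.LB_lt
    have h6 : P.LB = P.FB + P.nb * P.S := rfl
    have h7 : P.nb * 3 ≤ P.nb * P.S := Nat.mul_le_mul_left _ (by unfold Par.S; omega)
    have h8 := (I.sp j hjc).le
    rw [hT]; unfold tot; split_ifs <;> omega
  refine (Tr.seq (p := .set 11 0) (t := 2)
    (t' := 3 + fenumK P.c * ((List.range T).flatMap f).length + (totE (.reg 10)).cost) (R := fun σ1 => σ1 = σ.set 11 0)
    (wp_sound G.w_pos _ (wp_set_of (EV.nm G 0) rfl)) ?_).mono ?_ fun _ h => h
  · rintro σ1 rfl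
    refine (Tr.while_list G.w_pos (α := ℕ) (ct := fun p =>
      (blockP P.c).cost + (2 + leafK P.c * (f p).length))
      (I := fun pl σ' => ∃ p, pl = List.range' p (T - p) ∧ p ≤ T ∧ σ'.m = σ.m ∧ σ'.ρ 10 = j ∧
        σ'.ρ 11 = p ∧ σ'.out ++ (pl.flatMap f).map (· + 1) = σ.out ++ _) ?_ ?_
        (List.range T) (σ.set 11 0) ⟨0, by rw [List.range_eq_range']; simp, Nat.zero_le _, rfl,
          by rw [St.set_ρ_ne _ _ _ _ (by norm_num), hj], St.set_ρ_self _ _ _, rfl⟩).mono ?_ ?_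
    · rintro σ' ⟨p, q1, q2, q3, q4, q5, q6⟩
      have hp : T - p = 0 := by simpa using (congrArg List.length q1).symm
      have T1 := (EV.reg (L := P.lay) (r := 11) q5).lt
        (EV.totv G (σ := σ') (q3 ▸ H) (q3 ▸ I) (q3 ▸ hj0) (EV.reg (r := 10) q4) hjc)
      refine ⟨T1.1, T1.2.trans (if_neg ?_)⟩
      rw [q3]; omega
    · rintro a l σ' ⟨p, q1, q2, q3, q4, q5, q6⟩
      have H' : Hdr P σ'.m := q3 ▸ H
      have I' : FInv P σ'.m s j0 := q3 ▸ I
      have hj0' : σ'.m (.hdr 1) = j0 := q3 ▸ hj0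
      have hp : p < T := by
        have := congrArg List.length q1
        simp at this; omega
      have hp' : p < tot P σ'.m j0 j := by rw [q3]; exact hp
      rw [show T - p = (T - (p + 1)) + 1 by omega, List.range'_succ] at q1
      obtain ⟨rfl, rfl⟩ := List.cons.inj q1
      have T1 := (EV.reg (L := P.lay) (r := 11) q5).lt (EV.totv G H' I' hj0' (EV.reg q4) hjc)
      refine ⟨T1.1, fun h => ?_, ?_⟩
      · rw [T1.2, if_pos hp'] at h; exact absurd h (by norm_num)
      obtain ⟨hbn, hbl⟩ := I'.blk_spec G hjc hp'
      have hbm : blk σ'.m j a = blk σ.m j a := by rw [q3]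
      refine Tr.seq (R := fun σ2 => σ2.m = σ.m ∧ σ2.ρ 10 = j ∧ σ2.ρ 11 = a + 1 ∧
        σ2.ρ 12 = blk σ.m j a ∧ σ2.ρ 13 = bs (fun v => P.h * v) (lvs P s j (blk σ.m j a)) ∧
        σ2.out = σ'.out) (wp_sound G.w_pos _ ?_) ?_
      · refine wp_set_of (EV.blkv G H' I' (EV.reg (r := 10) q4) hjc (EV.reg (r := 11) q5) hp') ?_
        set σ1 := σ'.set 12 _
        have J1 : EV P.lay σ1 (.reg 10) j := EV.reg (by simp [σ1, q4])
        have P1 : EV P.lay σ1 (.reg 11) a := EV.reg (by simp [σ1, q5])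
        have B1 : EV P.lay σ1 (.reg 12) (blk σ1.m j a) := EV.reg (by simp [σ1])
        refine wp_set_of (EV.vv G (by exact H') (by exact I') J1 hjc P1 hp' B1) ?_
        refine wp_set_of ((EV.reg (r := 11) (v := a) (by simp [σ1, q5])).add (EV.nm G 1)
          (by simp only [Par.lay_w]; omega)) ⟨q3, ?_, ?_, ?_, ?_, rfl⟩
        · simp [σ1, q4]
        · simp
        · simp [σ1, hbm]
        · simp [σ1, hbm]
      · rintro σ2 ⟨r1, r2, r3, r4, r5, r6⟩
        refine (tr_leaf G (r1 ▸ H) (r1 ▸ I) (r1 ▸ hj0) hj0c hjc (hbm ▸ hbn)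
          (vl := (lvs P s j (blk σ.m j a)).sort (· ≤ ·)) (Finset.sortedLT_sort _).pairwise
          (fun v hv => (Finset.mem_sort _).1 hv) r2 r4 (by rw [r5, Finset.sort_toFinset])).mono
          le_rfl ?_
        rintro σ3 ⟨t1, t2, t3⟩
        refine ⟨a + 1, rfl, by omega, t1.trans r1, by rw [t2 10 (by norm_num), r2],
          by rw [t2 11 (by norm_num), r3], ?_⟩
        rw [t3, r6, ← q6]
        simp [hf, eltsB]
    · have := sum_le_flatMap (K := fenumK P.c) (l := List.range T)
        (ct := fun p => (blockP P.c).cost + (2 + leafK P.c * (f p).length) +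
          (Ex.lt (.reg 11) (totE (.reg 10))).cost + 1) (f := f) fun p hp => ?_
      · simp only [Ex.cost, Ex.lt] at this ⊢; omega
      · have hbl := (I.blk_spec G hjc (List.mem_range.1 hp)).2
        obtain ⟨v, hv⟩ := hbl
        -- Likewise, a listed block yields at least one element.
        have h2 : 1 ≤ (f p).length := by
          obtain ⟨i, hi⟩ := (mem_lvs.1 hv).2
          have hi' := mem_mts.1 hi
          have : (blk σ.m j p * P.q + v) * P.d + i ∈ f p := by
            rw [hf, mem_eltsB G]
            refine ⟨hi'.2.1, hi'.2.2, ?_⟩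
            rw [(elt_div G hi'.1).1, (leaf_div G (mem_lvs.1 hv).1).1]
          exact List.length_pos_of_mem this
        simp only [Ex.cost, Ex.lt, fenumK]
        nlinarith [(leafK P.c).zero_le, (blockP P.c).cost.zero_le]
    · rintro σ' ⟨p, q1, -, q3, -, -, q6⟩
      exact ⟨q3, by simpa using q6⟩
  · simp only [fenumK]; nlinarith
end

/-! ### The structure for the first few insertions: invariant and queries -/

def NE : Ex := hd 8
def LKE : Ex := hd 9
def LCE : Ex := hd 10
def RE : Ex := hd 11
def loE : Ex := hd 12
def lenE : Ex := hd 13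
def wwE : Ex := .wl * .wl
-- Every field has at least `w / 2 ^ N` bits when there are `N` of them; one bit is kept as a guard
-- for the parallel comparison.
def uE : Ex := (Ex.wl >>> NE) - 1
def edmE (c : ℕ) (x : Ex) : Ex := spmE (edA c) (esA c) (hd 14) (x / wwE)
def keyE (c : ℕ) (x : Ex) : Ex := .ld (esA c (x / wwE)) * wwE + x % wwE
/-- The fields of `L` that are equal to `v`. -/
def ematE (L v : Ex) : Ex := (((RE <<< uE) - (L ^^^ (v * RE))) &&& (RE <<< uE)) >>> uE
def ezE (c : ℕ) (x : Ex) : Ex := .cond (edmE c x) (ematE LKE (keyE c x)) 0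
def efldE (L p : Ex) : Ex := (L / p) % ((1 : Ex) <<< uE)
/-- The colour of an element. -/
def ecolE (c : ℕ) (x : Ex) : Ex := .cond (ezE c x) (efldE LCE (lsbE (ezE c x))) j0E
/-- The element in the field at the bit `p`. -/
def eeltE (c : ℕ) (p : Ex) : Ex := .ld (edA c (efldE LKE p / wwE)) * wwE + efldE LKE p % wwE

section
variable (P : Par)

/-- Offset of a field. -/
def eo (s : ℕ) : ℕ := P.w - P.w / 2 ^ s
/-- There is room for `N` fields. -/
structure Cap (N : ℕ) : Prop where
  key : N * (P.w * P.w) ≤ 2 ^ (P.w / 2 ^ N - 1)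
  col : P.c ≤ 2 ^ (P.w / 2 ^ N - 1)
  two : 2 ≤ P.w / 2 ^ N
  -- After `N` halvings the interval without entries is still nonempty, and at most half of the
  -- universe has been inserted.
  elt : 2 ^ N ≤ P.n

/-- An element may need almost `w` bits, too many for a field. So the universe is cut into buckets
of `w * w` elements, and the number of a bucket is replaced by its place in the list of the buckets
in use, which is less than the number of entries. -/
def ekey (m : Loc → ℕ) (x : ℕ) : ℕ := m (.es (x / (P.w * P.w))) * (P.w * P.w) + x % (P.w * P.w)

/-- The elements `e 0, …, e (N - 1)` have been inserted. -/
structure EInv (m : Loc → ℕ) (S : ℕ → ℕ) (j0 N : ℕ) (e : ℕ → ℕ) : Prop where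
  cap : Cap P N
  cnt : m (.hdr 8) = N
  sp : SpInv (fun p => m (.ed p)) (fun b => m (.es b)) (m (.hdr 14)) P.nk
  ble : m (.hdr 14) ≤ N
  bk : ∀ s < N, SpMem (fun p => m (.ed p)) (fun b => m (.es b)) (m (.hdr 14)) (e s / (P.w * P.w))
  lk : m (.hdr 9) = pk (eo P) (fun s => ekey P m (e s)) N
  lc : m (.hdr 10) = pk (eo P) (fun s => S (e s)) N
  r : m (.hdr 11) = pk (eo P) (fun _ => 1) N
  lt : ∀ s < N, e s < P.n
  inj : ∀ s < N, ∀ s' < N, e s = e s' → s = s'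
  out : ∀ x, (∀ s < N, e s ≠ x) → S x = j0
  col : ∀ x, S x < P.c
  lo : ∀ x, m (.hdr 12) ≤ x → x < m (.hdr 12) + m (.hdr 13) → x < P.n ∧ ∀ s < N, e s ≠ x
  len : P.n + 1 ≤ (m (.hdr 13) + 1) * 2 ^ N
end

section
variable {P : Par} {m : Loc → ℕ} {S : ℕ → ℕ} {j0 N : ℕ} {e : ℕ → ℕ}

/-- Field `s` occupies the bits from `w - w / 2 ^ s` to `w - w / 2 ^ (s + 1)`, so the widths roughly
halve. The offset comes from a shift by `s`, without knowing how many fields there will be; as that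
number is logarithmic in `w`, the last field is still wide. -/
theorem eo_add (P : Par) {s N : ℕ} (h : s < N) : eo P s + P.w / 2 ^ N ≤ eo P (s + 1) := by
  have h1 : P.w / 2 ^ N ≤ P.w / 2 ^ (s + 1) :=
    Nat.div_le_div_left (Nat.pow_le_pow_right (by norm_num) h) (Nat.two_pow_pos _)
  have h2 : P.w / 2 ^ (s + 1) = P.w / 2 ^ s / 2 := by rw [pow_succ, Nat.div_div_eq_div_mul]
  have h3 : P.w / 2 ^ s ≤ P.w := Nat.div_le_self _ _
  unfold eo; omega

theorem eo_sep (P : Par) (N : ℕ) : Sep (eo P) (P.w / 2 ^ N) N := fun _ hs => eo_add P (by omega)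

theorem eo_le (P : Par) {s N : ℕ} (h : s < N) : eo P s + P.w / 2 ^ N ≤ P.w :=
  (eo_add P h).trans (Nat.sub_le _ _)

theorem Cap.eo_lt (C : Cap P N) {s t : ℕ} (ht : t < N) (h : s < t) : eo P s < eo P t := by
  have := (eo_sep P N).add_le h ht; have := C.two; omega

theorem Cap.one_le (C : Cap P N) : P.w / 2 ^ N - 1 + 1 = P.w / 2 ^ N := by have := C.two; omega

theorem EInv.key_lt (I : EInv P m S j0 N e) (G : P.Good) {x : ℕ}
    (hx : SpMem (fun p => m (.ed p)) (fun b => m (.es b)) (m (.hdr 14)) (x / (P.w * P.w))) :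
    ekey P m x < 2 ^ (P.w / 2 ^ N - 1) := by
  have hw : 0 < P.w * P.w := by have := G.w_ge; positivity
  have h1 : m (.es (x / (P.w * P.w))) < m (.hdr 14) := hx.1
  have h2 := I.ble
  have h3 := Nat.mod_lt x hw
  refine lt_of_lt_of_le ?_ I.cap.key
  calc ekey P m x < (m (.es (x / (P.w * P.w))) + 1) * (P.w * P.w) := by
        unfold ekey; rw [Nat.succ_mul]; omega
    _ ≤ N * (P.w * P.w) := Nat.mul_le_mul_right _ (by omega)

theorem ekey_inj (G : P.Good) {x y : ℕ}
    (hx : SpMem (fun p => m (.ed p)) (fun b => m (.es b)) (m (.hdr 14)) (x / (P.w * P.w)))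
    (hy : SpMem (fun p => m (.ed p)) (fun b => m (.es b)) (m (.hdr 14)) (y / (P.w * P.w)))
    (h : ekey P m x = ekey P m y) : x = y := by
  have hw : 0 < P.w * P.w := by have := G.w_ge; positivity
  have h3 := Nat.mod_lt x hw
  have h4 := Nat.mod_lt y hw
  have h1 : m (.es (x / (P.w * P.w))) = m (.es (y / (P.w * P.w))) := by
    have := congrArg (· / (P.w * P.w)) h
    simpa [ekey, mul_comm _ (P.w * P.w), Nat.mul_add_div hw, Nat.div_eq_of_lt, h3, h4] using this
  have h2 : x % (P.w * P.w) = y % (P.w * P.w) := by unfold ekey at h; rw [h1] at h; omega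
  have h5 : x / (P.w * P.w) = y / (P.w * P.w) := by
    rw [← hx.2, ← hy.2]; simp only [h1]
  rw [← Nat.div_add_mod x (P.w * P.w), h5, h2, Nat.div_add_mod]

/-- An empty interval would give `n + 1 ≤ 2 ^ N ≤ n`. -/
theorem EInv.len_pos (I : EInv P m S j0 N e) : 1 ≤ m (.hdr 13) := by
  have h1 := I.len
  have h2 := I.cap.elt
  by_contra h
  rw [show m (.hdr 13) = 0 by omega] at h1; omega

end

namespace EV
variable {P : Par} (G : P.Good) {σ : St} {a b i j l p t X L v : Ex} {x y z : ℕ} {S : ℕ → ℕ}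
  {j0 N : ℕ} {e : ℕ → ℕ}

section
include G

theorem ww : EV P.lay σ wwE (P.w * P.w) := (EV.wl (L := P.lay)).mul EV.wl G.ww_lt

theorem ed (hp : EV P.lay σ p x) (hx : x < P.nk) : EV P.lay σ (edA P.c p) (P.addr (.ed x)) := by
  have h1 := G.addr_lt (l := .ed x) hx
  have h2 : P.addr (.ed x) = 20 + P.c + 2 * x + 1 := rfl
  have h3 := G.c_lt
  exact (((EV.cst (v := 20 + P.c) (by simp only [Par.lay_w]; omega)).add ((nm G 2).mul hp
    (by simp only [Par.lay_w]; omega)) (by simp only [Par.lay_w]; omega)).add (nm G 1) h1)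

theorem es (hp : EV P.lay σ p x) (hx : x < P.nk) : EV P.lay σ (esA P.c p) (P.addr (.es x)) := by
  have h1 := G.addr_lt (l := .es x) hx
  have h2 : P.addr (.es x) = 20 + P.c + 2 * x := rfl
  have h3 := G.c_lt
  exact (EV.cst (v := 20 + P.c) (by simp only [Par.lay_w]; omega)).add ((nm G 2).mul hp
    (by simp only [Par.lay_w]; omega)) h1

theorem u (I : EInv P σ.m S j0 N e) : EV P.lay σ uE (P.w / 2 ^ N - 1) :=
  ((EV.wl (L := P.lay)).shr ((hd G 8).of_eq I.cnt)).sub (nm G 1) (by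
    have := I.cap.two; simp only [Par.lay_w]; omega)

theorem edm (I : EInv P σ.m S j0 N e) (hx : EV P.lay σ X x) (hxn : x < P.n) :
    EV P.lay σ (edmE P.c X) (if SpMem (fun p => σ.m (.ed p)) (fun b => σ.m (.es b)) (σ.m (.hdr 14))
      (x / (P.w * P.w)) then 1 else 0) := by
  have h1 : x / (P.w * P.w) < P.nk := Nat.lt_succ_of_le (Nat.div_le_div_right hxn.le)
  exact spm G (D := .ed) (S := .es) (hx.div (ww G)) (es G (hx.div (ww G)) h1) h1
    (fun _ _ he hx => ed G he hx) (fun _ hx => hx) (hd G 14) I.sp.le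

theorem key (I : EInv P σ.m S j0 N e) (hx : EV P.lay σ X x)
    (hm : SpMem (fun p => σ.m (.ed p)) (fun b => σ.m (.es b)) (σ.m (.hdr 14))
      (x / (P.w * P.w))) : EV P.lay σ (keyE P.c X) (ekey P σ.m x) := by
  have h1 := I.sp.mem_lt hm
  have h2 := I.key_lt G hm
  have h3 : P.w / 2 ^ N ≤ P.w := Nat.div_le_self _ _
  have h5 : 2 ^ (P.w / 2 ^ N - 1) < 2 ^ P.w := G.pow_lt (by have := I.cap.two; omega)
  have h4 := h2.trans h5
  unfold ekey at h4
  exact ((EV.ld (l := .es _) (es G (hx.div (ww G)) h1) h1).mul (ww G)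
    (by simp only [Par.lay_w]; omega)).add (hx.mod (ww G)) h4

theorem emat {a : ℕ → ℕ} {w : ℕ} (I : EInv P σ.m S j0 N e)
    (ha : ∀ s < N, a s < 2 ^ (P.w / 2 ^ N - 1))
    (hw : w < 2 ^ (P.w / 2 ^ N - 1)) (hL : EV P.lay σ L (pk (eo P) a N)) (hv : EV P.lay σ v w) :
    EV P.lay σ (ematE L v) (bs (eo P) ((Finset.range N).filter fun s => a s = w)) := by
  have hR : EV P.lay σ RE (pk (eo P) (fun _ => 1) N) := (hd G 11).of_eq I.r
  have hu := u G I
  have h1 := I.cap.one_le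
  set u := P.w / 2 ^ N - 1
  have hsep : Sep (eo P) (u + 1) N := by rw [h1]; exact eo_sep P N
  have hB : ∀ s < N, eo P s + (u + 1) ≤ P.w := fun s hs => by rw [h1]; exact eo_le P hs
  have h2 : 2 ^ u < 2 ^ (u + 1) := Nat.pow_lt_pow_right (by norm_num) (by omega)
  have hxor : ∀ s < N, a s ^^^ w < 2 ^ u := fun s hs => Nat.xor_lt_two_pow (ha s hs) hw
  have hRu : EV P.lay σ (RE <<< uE) (pk (eo P) (fun _ => 1) N * 2 ^ u) := by
    refine hR.shl hu ?_
    rw [mul_comm, pk_mul]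
    exact pk_lt hsep (fun s _ => by simpa using h2) hB
  have hvR : EV P.lay σ (v * RE) (pk (eo P) (fun _ => w) N) := by
    have h3 : w * pk (eo P) (fun _ => 1) N = pk (eo P) (fun _ => w) N := by rw [pk_mul]; simp
    refine (hv.mul hR ?_).of_eq h3
    rw [h3]; exact pk_lt hsep (fun s _ => by omega) hB
  have hx : EV P.lay σ (L ^^^ (v * RE)) (pk (eo P) (fun s => a s ^^^ w) N) :=
    (hL.xor hvR).of_eq (pk_xor hsep (fun s hs => (ha s hs).trans h2) (fun s _ => hw.trans h2))
  have hle : pk (eo P) (fun s => a s ^^^ w) N ≤ pk (eo P) (fun _ => 1) N * 2 ^ u := by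
    rw [mul_comm, pk_mul]; exact pk_le fun s hs => by have := hxor s hs; omega
  refine (((hRu.sub hx hle).and hRu).shr hu).of_eq ?_
  rw [zero_fields hsep hxor]
  simp only [Nat.xor_eq_zero_iff]

/-- If the bucket of `x` is not listed, `x` cannot be an entry, since the buckets of all entries
are. Otherwise keys over listed buckets are injective, and equal keys mean equal elements. -/
theorem ez (I : EInv P σ.m S j0 N e) (hx : EV P.lay σ X x) (hxn : x < P.n) :
    EV P.lay σ (ezE P.c X) (bs (eo P) ((Finset.range N).filter fun s => e s = x)) := by
  refine EV.cond (edm G I hx hxn) (fun h => ?_) (fun h => (nm G 0).of_eq ?_)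
  · refine (emat G I (fun s hs => I.key_lt G (I.bk s hs)) (I.key_lt G h)
      ((hd G 9).of_eq I.lk) (key G I hx h)).of_eq ?_
    congr 1
    refine Finset.filter_congr fun s hs => ⟨fun h' => ?_, fun h' => by rw [h']⟩
    exact ekey_inj G (I.bk s (Finset.mem_range.1 hs)) h h'
  · refine (bs_eq_zero.2 (Finset.filter_eq_empty_iff.2 fun s hs h' => h ?_)).symm
    rw [← h']; exact I.bk s (Finset.mem_range.1 hs)

theorem elsb (I : EInv P σ.m S j0 N e) {A : Finset ℕ} (hA : A.Nonempty) (hq : ∀ s ∈ A, s < N)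
    (h : EV P.lay σ X (bs (eo P) A)) : EV P.lay σ (lsbE X) (2 ^ eo P (A.min' hA)) :=
  lsb G (fun _ _ t ht h => I.cap.eo_lt (hq t ht) h) hA h

theorem efld {a : ℕ → ℕ} {s : ℕ} (I : EInv P σ.m S j0 N e)
    (ha : ∀ s < N, a s < 2 ^ (P.w / 2 ^ N - 1)) (hs : s < N)
    (hL : EV P.lay σ L (pk (eo P) a N)) (hp : EV P.lay σ p (2 ^ eo P s)) :
    EV P.lay σ (efldE L p) (a s) := by
  refine ((hL.div hp).mod ((nm G 1).shl (u G I) ?_)).of_eq ?_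
  · rw [one_mul]
    have h3 : P.w / 2 ^ N ≤ P.w := Nat.div_le_self _ _
    exact G.pow_lt (by have := I.cap.two; omega)
  · rw [one_mul]
    exact pk_field ((eo_sep P N).mono (Nat.sub_le _ _)) ha hs

theorem ecol (I : EInv P σ.m S j0 N e) (hj0 : σ.m (.hdr 1) = j0) (hx : EV P.lay σ X x)
    (hxn : x < P.n) : EV P.lay σ (ecolE P.c X) (S x) := by
  have h := ez G I hx hxn
  by_cases hA : ((Finset.range N).filter fun s => e s = x).Nonempty
  · have hm := Finset.mem_filter.1 (Finset.min'_mem _ hA)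
    refine h.cond_pos (fun h => hA.ne_empty (bs_eq_zero.1 h)) ?_
    refine (efld G I (a := fun s => S (e s)) (fun s _ => (I.col _).trans_le I.cap.col) (Finset.mem_range.1 hm.1)
      ((hd G 10).of_eq I.lc) (elsb G I hA (fun s hs => Finset.mem_range.1 (Finset.mem_filter.1 hs).1)
      h)).of_eq ?_
    rw [hm.2]
  · rw [Finset.not_nonempty_iff_eq_empty] at hA
    rw [hA] at h
    refine (h.of_eq (bs_eq_zero.2 rfl)).cond_neg ((hd G 1).of_eq ?_)
    rw [hj0, I.out x fun s hs h => ?_]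
    exact (Finset.filter_eq_empty_iff.1 hA) (Finset.mem_range.2 hs) h

theorem eelt {s : ℕ} (I : EInv P σ.m S j0 N e) (hs : s < N) (hp : EV P.lay σ p (2 ^ eo P s)) :
    EV P.lay σ (eeltE P.c p) (e s) := by
  have hw : 0 < P.w * P.w := by have := G.w_ge; positivity
  have h1 := efld G I (fun s hs => I.key_lt G (I.bk s hs)) hs ((hd G 9).of_eq I.lk) hp
  have h3 := Nat.mod_lt (e s) hw
  have hb := I.bk s hs
  have h4 : ekey P σ.m (e s) / (P.w * P.w) = σ.m (.es (e s / (P.w * P.w))) := by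
    unfold ekey
    rw [mul_comm _ (P.w * P.w), Nat.mul_add_div hw, Nat.div_eq_of_lt h3, add_zero]
  have h5 : ekey P σ.m (e s) % (P.w * P.w) = e s % (P.w * P.w) := by
    unfold ekey
    rw [mul_comm _ (P.w * P.w), Nat.mul_add_mod, Nat.mod_mod]
  have h6 : σ.m (.ed (σ.m (.es (e s / (P.w * P.w))))) = e s / (P.w * P.w) := hb.2
  have h7 : σ.m (.es (e s / (P.w * P.w))) < P.nk := hb.1.trans_le I.sp.le
  have h8 := Nat.div_add_mod (e s) (P.w * P.w)
  have h9 := (I.lt s hs).trans G.n_lt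
  rw [mul_comm] at h8
  exact (((EV.ld (l := .ed _) (ed G ((h1.div (ww G)).of_eq h4) h7) h7).of_eq h6).mul (ww G)
    (by simp only [Par.lay_w]; omega)).add ((h1.mod (ww G)).of_eq h5)
    (by simp only [Par.lay_w]; omega) |>.of_eq h8
end
end EV

/-! ### The structure for the first few insertions: insertion -/

/-- Insert `r10` with colour `r11`. -/
def einsP (c : ℕ) : Pg :=
  .seq (.set 12 (ezE c (.reg 10)))
  (.ite (.reg 12)
    (.seq (.set 13 (lsbE (.reg 12)))
      (.sto (.cst 10) (LCE - efldE LCE (.reg 13) * .reg 13 + .reg 11 * .reg 13)))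
    (.seq (.set 14 (.reg 10 / wwE))
    (.seq (.ite (edmE c (.reg 10)) .skip
      (.seq (.sto (esA c (.reg 14)) (hd 14))
      (.seq (.sto (edA c (hd 14)) (.reg 14)) (.sto (.cst 14) (hd 14 + 1)))))
    (.seq (.set 13 (keyE c (.reg 10)))
    (.seq (.set 14 (Ex.wl - (Ex.wl >>> NE)))
    (.seq (.sto (.cst 9) (LKE + (Ex.reg 13 <<< Ex.reg 14)))
    (.seq (.sto (.cst 10) (LCE + (Ex.reg 11 <<< Ex.reg 14)))
    (.seq (.sto (.cst 11) (RE + ((1 : Ex) <<< Ex.reg 14)))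
    (.seq (.sto (.cst 8) (NE + 1))
    (.ite (.lt (.reg 10) loE) .skip
      (.ite (.lt (.reg 10 - loE) lenE)
        (.seq (.set 13 (lenE / 2))
        (.ite (.lt (.reg 10 - loE) (.reg 13))
          (.seq (.sto (.cst 12) (loE + .reg 13)) (.sto (.cst 13) (lenE - .reg 13)))
          (.sto (.cst 13) (.reg 13))))
        .skip)))))))))))

/-- Everything outside the data of this structure is unchanged. -/
def EFrame (m m' : Loc → ℕ) : Prop :=
  ∀ l, (∀ k, l ≠ .es k ∧ l ≠ .ed k) → (∀ i, l = .hdr i → i < 8 ∨ 14 < i) → m' l = m l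

theorem EFrame.refl (m : Loc → ℕ) : EFrame m m := fun _ _ _ => rfl
theorem EFrame.trans {m m' m'' : Loc → ℕ} (h : EFrame m m') (h' : EFrame m' m'') : EFrame m m'' :=
  fun l h1 h2 => (h' l h1 h2).trans (h l h1 h2)
theorem EFrame.sto_es {σ : St} {k v : ℕ} : EFrame σ.m (σ.sto (.es k) v).m :=
  fun _ h1 _ => St.sto_m_ne _ _ _ _ (h1 k).1
theorem EFrame.sto_ed {σ : St} {k v : ℕ} : EFrame σ.m (σ.sto (.ed k) v).m :=
  fun _ h1 _ => St.sto_m_ne _ _ _ _ (h1 k).2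
theorem EFrame.sto_hdr {σ : St} {i v : ℕ} (hi : 8 ≤ i) (hi' : i ≤ 14) :
    EFrame σ.m (σ.sto (.hdr i) v).m :=
  fun _ _ h2 => St.sto_m_ne _ _ _ _ fun h => by have := h2 _ h; omega

section
variable {P : Par} {m m' : Loc → ℕ} {S : ℕ → ℕ} {j0 N x j : ℕ} {e : ℕ → ℕ}

theorem EInv.congr (I : EInv P m S j0 N e) (h1 : ∀ i, 8 ≤ i → i ≤ 14 → m' (.hdr i) = m (.hdr i))
    (h2 : ∀ k, m' (.es k) = m (.es k)) (h3 : ∀ k, m' (.ed k) = m (.ed k)) :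
    EInv P m' S j0 N e := by
  have hk : ∀ x, ekey P m' x = ekey P m x := fun x => by unfold ekey; rw [h2]
  constructor
  · exact I.cap
  · rw [h1 8 (by norm_num) (by norm_num)]; exact I.cnt
  · simp only [h2, h3, h1 14 (by norm_num) (by norm_num)]; exact I.sp
  · rw [h1 14 (by norm_num) (by norm_num)]; exact I.ble
  · simp only [h2, h3, h1 14 (by norm_num) (by norm_num)]; exact I.bk
  · simp only [hk, h1 9 (by norm_num) (by norm_num)]; exact I.lk
  · rw [h1 10 (by norm_num) (by norm_num)]; exact I.lc
  · rw [h1 11 (by norm_num) (by norm_num)]; exact I.r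
  · exact I.lt
  · exact I.inj
  · exact I.out
  · exact I.col
  · rw [h1 12 (by norm_num) (by norm_num), h1 13 (by norm_num) (by norm_num)]; exact I.lo
  · rw [h1 13 (by norm_num) (by norm_num)]; exact I.len

theorem EInv.init (hC : Cap P 0) (h8 : m (.hdr 8) = 0) (h9 : m (.hdr 9) = 0)
    (h10 : m (.hdr 10) = 0) (h11 : m (.hdr 11) = 0) (h12 : m (.hdr 12) = 0)
    (h13 : m (.hdr 13) = P.n) (h14 : m (.hdr 14) = 0) (hj : j0 < P.c) :
    EInv P m (fun _ => j0) j0 0 e := by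
  refine ⟨hC, h8, ?_, h14.le, fun _ h => absurd h (Nat.not_lt_zero _), h9, h10, h11,
    fun _ h => absurd h (Nat.not_lt_zero _), fun _ h => absurd h (Nat.not_lt_zero _),
    fun _ _ => rfl, fun _ => hj, fun x _ h => ⟨by omega, fun _ h => absurd h (Nat.not_lt_zero _)⟩,
    by rw [h13]; simp⟩
  rw [h14]
  exact ⟨fun _ h => absurd h (Nat.not_lt_zero _), fun _ h => absurd h (Nat.not_lt_zero _)⟩

/-- The colour of an inserted element changes. -/
theorem EInv.recolour (I : EInv P m S j0 N e) {s : ℕ} (hs : s < N) (hx : e s = x) (hj : j < P.c)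
    (h10 : m' (.hdr 10) = pk (eo P) (Function.update (fun s => S (e s)) s j) N)
    (h : ∀ l, l ≠ .hdr 10 → m' l = m l) : EInv P m' (Function.update S x j) j0 N e := by
  have hk : ∀ x, ekey P m' x = ekey P m x := fun x => by unfold ekey; rw [h _ (by simp)]
  constructor
  · exact I.cap
  · rw [h _ (by simp)]; exact I.cnt
  · simp only [h _ (show Loc.hdr 14 ≠ .hdr 10 by simp), h (.ed _) (by simp), h (.es _) (by simp)]
    exact I.sp
  · rw [h _ (by simp)]; exact I.ble
  · simp only [h _ (show Loc.hdr 14 ≠ .hdr 10 by simp), h (.ed _) (by simp), h (.es _) (by simp)]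
    exact I.bk
  · simp only [hk, h _ (show Loc.hdr 9 ≠ .hdr 10 by simp)]; exact I.lk
  · rw [h10]
    refine pk_congr fun t ht => ?_
    by_cases hts : t = s
    · subst hts; rw [Function.update_self, hx, Function.update_self]
    · rw [Function.update_of_ne hts, Function.update_of_ne]
      exact fun h' => hts (I.inj t ht s hs (h'.trans hx.symm))
  · rw [h _ (by simp)]; exact I.r
  · exact I.lt
  · exact I.inj
  · intro z hz
    rw [Function.update_of_ne]
    · exact I.out z hz
    · rintro rfl; exact hz s hs hx
  · intro z
    by_cases hz : z = x
    · subst hz; simpa using hj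
    · rw [Function.update_of_ne hz]; exact I.col z
  · rw [h _ (by simp), h _ (by simp)]; exact I.lo
  · rw [h _ (by simp)]; exact I.len

/-- A new element. -/
theorem EInv.add (I : EInv P m S j0 N e) (hC : Cap P (N + 1)) (hx : ∀ s < N, e s ≠ x)
    (hxn : x < P.n) (hj : j < P.c)
    (hsp : SpInv (fun p => m' (.ed p)) (fun b => m' (.es b)) (m' (.hdr 14)) P.nk)
    (hble : m' (.hdr 14) ≤ N + 1)
    (hbk : ∀ b, SpMem (fun p => m' (.ed p)) (fun b => m' (.es b)) (m' (.hdr 14)) b ↔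
      b = x / (P.w * P.w) ∨ SpMem (fun p => m (.ed p)) (fun b => m (.es b)) (m (.hdr 14)) b)
    (hes : ∀ b, SpMem (fun p => m (.ed p)) (fun b => m (.es b)) (m (.hdr 14)) b →
      m' (.es b) = m (.es b))
    (h8 : m' (.hdr 8) = N + 1)
    (h9 : m' (.hdr 9) = m (.hdr 9) + ekey P m' x * 2 ^ eo P N)
    (h10 : m' (.hdr 10) = m (.hdr 10) + j * 2 ^ eo P N)
    (h11 : m' (.hdr 11) = m (.hdr 11) + 1 * 2 ^ eo P N)
    (hlo : ∀ z, m' (.hdr 12) ≤ z → z < m' (.hdr 12) + m' (.hdr 13) →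
      m (.hdr 12) ≤ z ∧ z < m (.hdr 12) + m (.hdr 13) ∧ z ≠ x)
    (hlen : m (.hdr 13) + 1 ≤ (m' (.hdr 13) + 1) * 2) :
    EInv P m' (Function.update S x j) j0 (N + 1) (Function.update e N x) := by
  have he : ∀ s < N, Function.update e N x s = e s := fun s hs =>
    Function.update_of_ne (by omega) _ _
  have hk : ∀ s < N, ekey P m' (e s) = ekey P m (e s) := fun s hs => by
    unfold ekey; rw [hes _ (I.bk s hs)]
  constructor
  · exact hC
  · exact h8
  · exact hsp
  · exact hble
  · intro s hs
    rw [hbk]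
    rcases Nat.lt_succ_iff_lt_or_eq.1 hs with hs | rfl
    · rw [he s hs]; exact Or.inr (I.bk s hs)
    · rw [Function.update_self]; exact Or.inl rfl
  · rw [pk_succ, Function.update_self, h9, I.lk]
    congr 1
    exact pk_congr fun s hs => by rw [he s hs, hk s hs]
  · rw [pk_succ, Function.update_self, Function.update_self, h10, I.lc]
    congr 1
    exact pk_congr fun s hs => by rw [he s hs, Function.update_of_ne (hx s hs)]
  · rw [pk_succ, h11, I.r]
  · intro s hs
    rcases Nat.lt_succ_iff_lt_or_eq.1 hs with hs | rfl
    · rw [he s hs]; exact I.lt s hs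
    · rw [Function.update_self]; exact hxn
  · intro s hs t ht h
    rcases Nat.lt_succ_iff_lt_or_eq.1 hs with hs | rfl <;>
    rcases Nat.lt_succ_iff_lt_or_eq.1 ht with ht | rfl
    · rw [he s hs, he t ht] at h; exact I.inj s hs t ht h
    · rw [he s hs, Function.update_self] at h; exact absurd h (hx s hs)
    · rw [he t ht, Function.update_self] at h; exact absurd h.symm (hx t ht)
    · rfl
  · intro z hz
    have h1 := hz N (by omega)
    rw [Function.update_self] at h1
    rw [Function.update_of_ne h1.symm]
    exact I.out z fun s hs h => hz s (by omega) (by rw [he s hs, h])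
  · intro z
    by_cases hz : z = x
    · subst hz; simpa using hj
    · rw [Function.update_of_ne hz]; exact I.col z
  · intro z h1 h2
    obtain ⟨h3, h4, h5⟩ := hlo z h1 h2
    refine ⟨(I.lo z h3 h4).1, fun s hs => ?_⟩
    rcases Nat.lt_succ_iff_lt_or_eq.1 hs with hs | rfl
    · rw [he s hs]; exact (I.lo z h3 h4).2 s hs
    · rw [Function.update_self]; exact h5.symm
  · calc P.n + 1 ≤ (m (.hdr 13) + 1) * 2 ^ N := I.len
      _ ≤ ((m' (.hdr 13) + 1) * 2) * 2 ^ N := Nat.mul_le_mul_right _ hlen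
      _ = _ := by rw [pow_succ]; ring

theorem EInv.bound (I : EInv P m S j0 N e) : m (.hdr 12) + m (.hdr 13) ≤ P.n := by
  have h := I.len_pos
  have := (I.lo (m (.hdr 12) + m (.hdr 13) - 1) (by omega) (by omega)).1
  omega

end

theorem EV.key' {P : Par} (G : P.Good) {σ : St} {X : Ex} {x : ℕ} (hx : EV P.lay σ X x)
    (hxn : x < P.n) (h4 : ekey P σ.m x < 2 ^ P.w) : EV P.lay σ (keyE P.c X) (ekey P σ.m x) := by
  have h1 : x / (P.w * P.w) < P.nk := Nat.lt_succ_of_le (Nat.div_le_div_right hxn.le)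
  have h5 := h4
  unfold ekey at h4
  exact ((EV.ld (l := .es _) (EV.es G (hx.div (EV.ww G)) h1) h1).mul (EV.ww G)
    (by simp only [Par.lay_w]; omega)).add (hx.mod (EV.ww G)) h5

theorem hdr_valid {P : Par} {i : ℕ} (h : i < 20) : P.lay.valid (.hdr i) := h

/-- An element that is already an entry is only recoloured in its field, and then `N' = N`. A new
one takes the next field, after its bucket has been listed if necessary. Old entries keep their
indices, on which the migration relies. -/
theorem wp_eins {P : Par} (G : P.Good) {σ : St} {Q : St → Prop} {S : ℕ → ℕ} {j0 x j N : ℕ}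
    {e : ℕ → ℕ} (I : EInv P σ.m S j0 N e) (hC : Cap P (N + 1))
    (hx : σ.ρ 10 = x) (hxn : x < P.n) (hj : σ.ρ 11 = j) (hjc : j < P.c)
    (hQ : ∀ σ', Keeps (fun r => r < 12 ∨ 14 < r) σ σ' → EFrame σ.m σ'.m →
      (∃ N' e', N ≤ N' ∧ N' ≤ N + 1 ∧ (∀ s < N, e' s = e s) ∧
        EInv P σ'.m (Function.update S x j) j0 N' e') → Q σ') : wp P.lay (einsP P.c) Q σ := by
  have X : EV P.lay σ (.reg 10) x := EV.reg hx
  have EZ := EV.ez G I X hxn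
  have hww : 0 < P.w * P.w := by have := G.w_ge; positivity
  refine wp_set_of EZ ?_
  set σ1 := σ.set 12 _ with hσ1
  have I1 : EInv P σ1.m S j0 N e := I
  have Z1 : EV P.lay σ1 (.reg 12) (bs (eo P) ((Finset.range N).filter fun s => e s = x)) :=
    EV.reg (St.set_ρ_self _ _ _)
  by_cases hA : ((Finset.range N).filter fun s => e s = x).Nonempty
  · refine ⟨Z1.1, fun _ => ?_, fun h => absurd (bs_eq_zero.1 (Z1.2.symm.trans h)) hA.ne_empty⟩
    have hm := Finset.mem_filter.1 (Finset.min'_mem _ hA)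
    have LS := EV.elsb G I1 hA (fun s hs => Finset.mem_range.1 (Finset.mem_filter.1 hs).1) Z1
    set s := Finset.min' _ hA
    have hs : s < N := Finset.mem_range.1 hm.1
    refine wp_set_of LS ?_
    set σ2 := σ1.set 13 _ with hσ2
    have I2 : EInv P σ2.m S j0 N e := I
    have P2 : EV P.lay σ2 (.reg 13) (2 ^ eo P s) := EV.reg (St.set_ρ_self _ _ _)
    have J2 : EV P.lay σ2 (.reg 11) j := EV.reg (by simp [hσ2, hσ1, hj])
    have C2 : EV P.lay σ2 LCE (pk (eo P) (fun s => S (e s)) N) := (EV.hd G 10).of_eq I.lc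
    have F2 := EV.efld G I2 (a := fun s => S (e s)) (fun s _ => (I.col _).trans_le I.cap.col) hs C2 P2
    have h1 := I.cap.one_le
    have h2 : 2 ^ (P.w / 2 ^ N - 1) ≤ 2 ^ (P.w / 2 ^ N) := Nat.pow_le_pow_right (by norm_num) (by omega)
    have hub : ∀ a : ℕ → ℕ, (∀ s < N, a s < P.c) → pk (eo P) a N < 2 ^ P.w := fun a ha =>
      pk_lt (eo_sep P N) (fun s hs => (ha s hs).trans_le (I.cap.col.trans h2)) fun s hs => eo_le P hs
    have hup := pk_update (o := eo P) (a := fun s => S (e s)) (v := j) hs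
    have hle := pk_le_of_mem (o := eo P) (a := fun s => S (e s)) hs
    have hb1 := hub (fun s => S (e s)) fun s _ => I.col _
    have hb2 := hub (Function.update (fun s => S (e s)) s j) fun t _ => by
      by_cases ht : t = s
      · subst ht; simpa using hjc
      · rw [Function.update_of_ne ht]; exact I.col _
    refine wp_sto_of (l := .hdr 10) (EV.cst (G.small (by norm_num))) (hdr_valid (by norm_num))
      (((C2.sub (F2.mul P2 (by simp only [Par.lay_w]; omega)) hle).add (J2.mul P2
        (by simp only [Par.lay_w]; omega)) (by simp only [Par.lay_w]; omega)).of_eq hup) ?_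
    refine hQ _ ⟨fun r hr => ?_, rfl⟩
      ((EFrame.sto_hdr (σ := σ2) (by norm_num) (by norm_num)).trans (EFrame.refl _))
      ⟨N, e, le_rfl, by omega, fun _ _ => rfl, I2.recolour hs hm.2 hjc (St.sto_m_self _ _ _)
        fun l hl => St.sto_m_ne _ _ _ _ hl⟩
    rw [St.sto_ρ, hσ2, St.set_ρ_ne _ _ _ _ (by omega), hσ1, St.set_ρ_ne _ _ _ _ (by omega)]
  · rw [Finset.not_nonempty_iff_eq_empty] at hA
    refine ⟨Z1.1, fun h => absurd (Z1.2.trans (by rw [hA]; rfl)) h, fun _ => ?_⟩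
    have hne : ∀ s < N, e s ≠ x := fun s hs h =>
      (Finset.filter_eq_empty_iff.1 hA) (Finset.mem_range.2 hs) h
    have X1 : EV P.lay σ1 (.reg 10) x := EV.reg (by simp [hσ1, hx])
    refine wp_set_of (X1.div (EV.ww G)) ?_
    set σ2 := σ1.set 14 _ with hσ2
    have I2 : EInv P σ2.m S j0 N e := I
    have X2 : EV P.lay σ2 (.reg 10) x := EV.reg (by simp [hσ2, hσ1, hx])
    have K2 : EV P.lay σ2 (.reg 14) (x / (P.w * P.w)) := EV.reg (St.set_ρ_self _ _ _)
    have hbk : x / (P.w * P.w) < P.nk := Nat.lt_succ_of_le (Nat.div_le_div_right hxn.le)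
    have hcap := hC.key
    -- the rest of the program
    have tail : ∀ σ3 : St, σ3.ρ = σ2.ρ → σ3.out = σ.out → EFrame σ.m σ3.m →
        (∀ i, i ≠ 14 → σ3.m (.hdr i) = σ.m (.hdr i)) →
        SpInv (fun p => σ3.m (.ed p)) (fun b => σ3.m (.es b)) (σ3.m (.hdr 14)) P.nk →
        σ3.m (.hdr 14) ≤ N + 1 →
        (∀ b, SpMem (fun p => σ3.m (.ed p)) (fun b => σ3.m (.es b)) (σ3.m (.hdr 14)) b ↔
          b = x / (P.w * P.w) ∨
          SpMem (fun p => σ.m (.ed p)) (fun b => σ.m (.es b)) (σ.m (.hdr 14)) b) →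
        (∀ b, SpMem (fun p => σ.m (.ed p)) (fun b => σ.m (.es b)) (σ.m (.hdr 14)) b →
          σ3.m (.es b) = σ.m (.es b)) →
        wp P.lay (.seq (.set 13 (keyE P.c (.reg 10)))
          (.seq (.set 14 (Ex.wl - (Ex.wl >>> NE)))
          (.seq (.sto (.cst 9) (LKE + (Ex.reg 13 <<< Ex.reg 14)))
          (.seq (.sto (.cst 10) (LCE + (Ex.reg 11 <<< Ex.reg 14)))
          (.seq (.sto (.cst 11) (RE + ((1 : Ex) <<< Ex.reg 14)))
          (.seq (.sto (.cst 8) (NE + 1))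
          (.ite (.lt (.reg 10) loE) .skip
            (.ite (.lt (.reg 10 - loE) lenE)
              (.seq (.set 13 (lenE / 2))
              (.ite (.lt (.reg 10 - loE) (.reg 13))
                (.seq (.sto (.cst 12) (loE + .reg 13)) (.sto (.cst 13) (lenE - .reg 13)))
                (.sto (.cst 13) (.reg 13))))
              .skip)))))))) Q σ3 := by
      intro σ3 hρ3 ho3 hf3 hh3 hsp3 hble3 hbk3 hes3
      have X3 : EV P.lay σ3 (.reg 10) x := EV.reg (by rw [hρ3]; exact X2.2)
      have hmem3 := (hbk3 (x / (P.w * P.w))).2 (Or.inl rfl)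
      have hu1 := hC.one_le
      have hu2 := hC.two
      have hkey : ekey P σ3.m x < 2 ^ (P.w / 2 ^ (N + 1) - 1) := by
        have h1 : σ3.m (.es (x / (P.w * P.w))) < σ3.m (.hdr 14) := hmem3.1
        have h3 := Nat.mod_lt x hww
        refine lt_of_lt_of_le ?_ hcap
        calc ekey P σ3.m x < (σ3.m (.es (x / (P.w * P.w))) + 1) * (P.w * P.w) := by
              unfold ekey; rw [Nat.succ_mul]; omega
          _ ≤ (N + 1) * (P.w * P.w) := Nat.mul_le_mul_right _ (by omega)
      have hdw : P.w / 2 ^ (N + 1) ≤ P.w := Nat.div_le_self _ _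
      have h2p : 2 ^ (P.w / 2 ^ (N + 1) - 1) < 2 ^ (P.w / 2 ^ (N + 1)) :=
        Nat.pow_lt_pow_right (by norm_num) (by omega)
      refine wp_set_of (EV.key' G X3 hxn (hkey.trans (G.pow_lt (by omega)))) ?_
      set K := ekey P σ3.m x with hK
      set σ4 := σ3.set 13 K with hσ4
      have hh4 : ∀ i, i ≠ 14 → σ4.m (.hdr i) = σ.m (.hdr i) := hh3
      have N4 : EV P.lay σ4 NE N := (EV.hd G 8).of_eq ((hh4 8 (by norm_num)).trans I.cnt)
      refine wp_set_of ((EV.wl (L := P.lay)).sub ((EV.wl (L := P.lay)).shr N4)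
        (Nat.div_le_self _ _)) ?_
      change wp P.lay _ Q (σ4.set 14 (eo P N))
      set σ5 := σ4.set 14 (eo P N) with hσ5
      have hsh : ∀ v < 2 ^ (P.w / 2 ^ (N + 1)), v * 2 ^ eo P N < 2 ^ P.w := fun v hv => by
        calc v * 2 ^ eo P N < 2 ^ (P.w / 2 ^ (N + 1)) * 2 ^ eo P N :=
              Nat.mul_lt_mul_of_pos_right hv (Nat.two_pow_pos _)
          _ = 2 ^ (eo P N + P.w / 2 ^ (N + 1)) := by rw [← pow_add, add_comm]
          _ ≤ _ := Nat.pow_le_pow_right (by norm_num) (eo_le P (by omega))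
      have hsum : ∀ (a : ℕ → ℕ) (v : ℕ), (∀ s < N, a s < 2 ^ (P.w / 2 ^ (N + 1))) →
          v < 2 ^ (P.w / 2 ^ (N + 1)) → pk (eo P) a N + v * 2 ^ eo P N < 2 ^ P.w := by
        intro a v ha hv
        have h1 : pk (eo P) (Function.update a N v) (N + 1) = pk (eo P) a N + v * 2 ^ eo P N := by
          rw [pk_succ, Function.update_self]
          congr 1
          exact pk_congr fun s hs => Function.update_of_ne (by omega) _ _
        rw [← h1]
        refine pk_lt (eo_sep P (N + 1)) (fun s hs => ?_) fun s hs => eo_le P hs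
        rcases Nat.lt_succ_iff_lt_or_eq.1 hs with hs | rfl
        · rw [Function.update_of_ne (by omega)]; exact ha s hs
        · rwa [Function.update_self]
      have K5 : EV P.lay σ5 (.reg 13) K := EV.reg (by simp [hσ5, hσ4])
      have O5 : EV P.lay σ5 (.reg 14) (eo P N) := EV.reg (St.set_ρ_self _ _ _)
      have hc1 := hC.col
      have hkeys : ∀ s < N, ekey P σ.m (e s) < 2 ^ (P.w / 2 ^ (N + 1)) := fun s hs => by
        have hb := I.bk s hs
        have h1 : σ.m (.es (e s / (P.w * P.w))) < σ.m (.hdr 14) := hb.1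
        have h3 := Nat.mod_lt (e s) hww
        have h4 := I.ble
        refine lt_of_lt_of_le ?_ (hcap.trans h2p.le)
        calc ekey P σ.m (e s) < (σ.m (.es (e s / (P.w * P.w))) + 1) * (P.w * P.w) := by
              unfold ekey; rw [Nat.succ_mul]; omega
          _ ≤ (N + 1) * (P.w * P.w) := Nat.mul_le_mul_right _ (by omega)
      have LK5 : EV P.lay σ5 LKE (σ.m (.hdr 9)) := (EV.hd G 9).of_eq (hh4 9 (by norm_num))
      have b9 : σ.m (.hdr 9) + K * 2 ^ eo P N < 2 ^ P.w := by
        rw [I.lk]; exact hsum _ _ hkeys (hkey.trans h2p)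
      refine wp_sto_of (l := .hdr 9) (EV.cst (G.small (by norm_num))) (hdr_valid (by norm_num))
        (LK5.add (K5.shl O5 (hsh _ (hkey.trans h2p))) b9) ?_
      set σ6 := σ5.sto (.hdr 9) _ with hσ6
      have O6 : EV P.lay σ6 (.reg 14) (eo P N) := O5
      have J6 : EV P.lay σ6 (.reg 11) j := EV.reg (by
        rw [hσ6, St.sto_ρ, hσ5, St.set_ρ_ne _ _ _ _ (by norm_num), hσ4,
          St.set_ρ_ne _ _ _ _ (by norm_num), hρ3, hσ2, St.set_ρ_ne _ _ _ _ (by norm_num), hσ1,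
          St.set_ρ_ne _ _ _ _ (by norm_num), hj])
      have LC6 : EV P.lay σ6 LCE (σ.m (.hdr 10)) := (EV.hd G 10).of_eq (by
        rw [hσ6, St.sto_m_ne _ _ _ _ (by simp)]; exact hh4 10 (by norm_num))
      have b10 : σ.m (.hdr 10) + j * 2 ^ eo P N < 2 ^ P.w := by
        rw [I.lc]; exact hsum _ _ (fun s _ => (I.col _).trans_le (hc1.trans h2p.le)) (by omega)
      refine wp_sto_of (l := .hdr 10) (EV.cst (G.small (by norm_num))) (hdr_valid (by norm_num))
        (LC6.add (J6.shl O6 (hsh _ (by omega))) b10) ?_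
      set σ7 := σ6.sto (.hdr 10) _ with hσ7
      have O7 : EV P.lay σ7 (.reg 14) (eo P N) := O5
      have R7 : EV P.lay σ7 RE (σ.m (.hdr 11)) := (EV.hd G 11).of_eq (by
        rw [hσ7, St.sto_m_ne _ _ _ _ (by simp), hσ6, St.sto_m_ne _ _ _ _ (by simp)]
        exact hh4 11 (by norm_num))
      have h1p : 1 < 2 ^ (P.w / 2 ^ (N + 1)) := Nat.one_lt_two_pow (by omega)
      have b11 : σ.m (.hdr 11) + 1 * 2 ^ eo P N < 2 ^ P.w := by
        rw [I.r]; exact hsum _ _ (fun s _ => h1p) h1p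
      refine wp_sto_of (l := .hdr 11) (EV.cst (G.small (by norm_num))) (hdr_valid (by norm_num))
        (R7.add ((EV.nm G 1).shl O7 (hsh _ h1p)) b11) ?_
      set σ8 := σ7.sto (.hdr 11) _ with hσ8
      have N8 : EV P.lay σ8 NE N := (EV.hd G 8).of_eq (by
        rw [hσ8, St.sto_m_ne _ _ _ _ (by simp), hσ7, St.sto_m_ne _ _ _ _ (by simp), hσ6,
          St.sto_m_ne _ _ _ _ (by simp)]
        exact (hh4 8 (by norm_num)).trans I.cnt)
      have hNw : N + 1 < 2 ^ P.w := by
        have := hC.elt; have h3 : N + 1 < 2 ^ (N + 1) := Nat.lt_two_pow_self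
        have := G.n_lt; omega
      refine wp_sto_of (l := .hdr 8) (EV.cst (G.small (by norm_num))) (hdr_valid (by norm_num))
        (N8.add (EV.nm G 1) hNw) ?_
      set σ9 := σ8.sto (.hdr 8) _ with hσ9
      have hf9 : EFrame σ.m σ9.m :=
        (((EFrame.trans (by exact hf3) (EFrame.sto_hdr (σ := σ5) (by norm_num) (by norm_num))).trans
        (EFrame.sto_hdr (by norm_num) (by norm_num))).trans
        (EFrame.sto_hdr (by norm_num) (by norm_num))).trans
        (EFrame.sto_hdr (by norm_num) (by norm_num))
      have hk9 : ∀ r, r < 12 ∨ 14 < r → σ9.ρ r = σ.ρ r := fun r hr => by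
        rw [hσ9, St.sto_ρ, hσ8, St.sto_ρ, hσ7, St.sto_ρ, hσ6, St.sto_ρ, hσ5,
          St.set_ρ_ne _ _ _ _ (by omega), hσ4, St.set_ρ_ne _ _ _ _ (by omega), hρ3, hσ2,
          St.set_ρ_ne _ _ _ _ (by omega), hσ1, St.set_ρ_ne _ _ _ _ (by omega)]
      have hr9 : ∀ l, l ≠ .hdr 9 → l ≠ .hdr 10 → l ≠ .hdr 11 → l ≠ .hdr 8 → σ9.m l = σ3.m l :=
        fun l h1 h2 h3 h4 => by
          rw [hσ9, St.sto_m_ne _ _ _ _ h4, hσ8, St.sto_m_ne _ _ _ _ h3, hσ7,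
            St.sto_m_ne _ _ _ _ h2, hσ6, St.sto_m_ne _ _ _ _ h1]; rfl
      -- the final state
      have fin : ∀ σ' : St, (∀ r, r < 12 ∨ 14 < r → σ'.ρ r = σ9.ρ r) → σ'.out = σ9.out →
          (∀ l, l ≠ .hdr 12 → l ≠ .hdr 13 → σ'.m l = σ9.m l) →
          (∀ z, σ'.m (.hdr 12) ≤ z → z < σ'.m (.hdr 12) + σ'.m (.hdr 13) →
            σ.m (.hdr 12) ≤ z ∧ z < σ.m (.hdr 12) + σ.m (.hdr 13) ∧ z ≠ x) →
          σ.m (.hdr 13) + 1 ≤ (σ'.m (.hdr 13) + 1) * 2 → Q σ' := by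
        intro σ' g1 g2 g3 g4 g5
        have g6 : ∀ l, l ≠ .hdr 12 → l ≠ .hdr 13 → l ≠ .hdr 9 → l ≠ .hdr 10 → l ≠ .hdr 11 →
            l ≠ .hdr 8 → σ'.m l = σ3.m l := fun l a1 a2 a3 a4 a5 a6 =>
          (g3 l a1 a2).trans (hr9 l a3 a4 a5 a6)
        have ges : ∀ b, σ'.m (.es b) = σ3.m (.es b) := fun b =>
          g6 _ (by simp) (by simp) (by simp) (by simp) (by simp) (by simp)
        have ged : ∀ b, σ'.m (.ed b) = σ3.m (.ed b) := fun b =>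
          g6 _ (by simp) (by simp) (by simp) (by simp) (by simp) (by simp)
        have g14 : σ'.m (.hdr 14) = σ3.m (.hdr 14) :=
          g6 _ (by simp) (by simp) (by simp) (by simp) (by simp) (by simp)
        refine hQ σ' ⟨fun r hr => (g1 r hr).trans (hk9 r hr), g2.trans ho3⟩
          (hf9.trans fun l h1 h2 => g3 l (fun h => by have := h2 12 h; omega)
            fun h => by have := h2 13 h; omega)
          ⟨N + 1, Function.update e N x, by omega, le_rfl,
            fun s hs => Function.update_of_ne (by omega) _ _,
            I.add hC hne hxn hjc ?_ ?_ ?_ ?_ ?_ ?_ ?_ ?_ g4 g5⟩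
        · simp only [ges, ged, g14]; exact hsp3
        · rw [g14]; exact hble3
        · simp only [ges, ged, g14]; exact hbk3
        · intro b hb; rw [ges]; exact hes3 b hb
        · rw [g3 _ (by simp) (by simp), hσ9, St.sto_m_self]
        · have : ekey P σ'.m x = K := by rw [hK]; unfold ekey; rw [ges]
          rw [this, g3 _ (by simp) (by simp), hσ9, St.sto_m_ne _ _ _ _ (by simp), hσ8,
            St.sto_m_ne _ _ _ _ (by simp), hσ7, St.sto_m_ne _ _ _ _ (by simp), hσ6, St.sto_m_self]
        · rw [g3 _ (by simp) (by simp), hσ9, St.sto_m_ne _ _ _ _ (by simp), hσ8,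
            St.sto_m_ne _ _ _ _ (by simp), hσ7, St.sto_m_self]
        · rw [g3 _ (by simp) (by simp), hσ9, St.sto_m_ne _ _ _ _ (by simp), hσ8, St.sto_m_self]
      have X9 : EV P.lay σ9 (.reg 10) x := EV.reg (by rw [hk9 10 (by norm_num), hx])
      have e12 : σ9.m (.hdr 12) = σ.m (.hdr 12) :=
        (hr9 _ (by simp) (by simp) (by simp) (by simp)).trans (hh3 12 (by norm_num))
      have e13 : σ9.m (.hdr 13) = σ.m (.hdr 13) :=
        (hr9 _ (by simp) (by simp) (by simp) (by simp)).trans (hh3 13 (by norm_num))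
      have L9 : EV P.lay σ9 loE (σ.m (.hdr 12)) := (EV.hd G 12).of_eq e12
      have M9 : EV P.lay σ9 lenE (σ.m (.hdr 13)) := (EV.hd G 13).of_eq e13
      have hbd := I.bound
      have hnw := G.n_lt
      refine wp_ite_of (X9.lt L9) (fun h1 => ?_) (fun h1 => ?_)
      · refine fin σ9 (fun _ _ => rfl) rfl (fun _ _ _ => rfl) ?_ ?_
        · rw [e12, e13]; intro z h2 h3; exact ⟨h2, h3, by omega⟩
        · rw [e13]; omega
      refine wp_ite_of ((X9.sub L9 (by omega)).lt M9) (fun h2 => ?_) (fun h2 => ?_)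
      -- The new element falls into the free interval; the half without it is kept. Counting length
      -- plus one, the loss is at most a factor of 2, with no error from rounding.
      · refine wp_set_of (M9.div (EV.nm G 2)) ?_
        set σ10 := σ9.set 13 _ with hσ10
        have X10 : EV P.lay σ10 (.reg 10) x := EV.reg (by
          rw [hσ10, St.set_ρ_ne _ _ _ _ (by norm_num)]; exact X9.2)
        have H10 : EV P.lay σ10 (.reg 13) (σ.m (.hdr 13) / 2) := EV.reg (St.set_ρ_self _ _ _)
        have L10 : EV P.lay σ10 loE (σ.m (.hdr 12)) := (EV.hd G 12).of_eq e12
        have hr10 : ∀ r, r < 12 ∨ 14 < r → σ10.ρ r = σ9.ρ r := fun r hr => by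
          rw [hσ10, St.set_ρ_ne _ _ _ _ (by omega)]
        refine wp_ite_of ((X10.sub L10 (by omega)).lt H10) (fun h3 => ?_) (fun h3 => ?_)
        · refine wp_sto_of (l := .hdr 12) (EV.cst (G.small (by norm_num))) (hdr_valid (by norm_num))
            (L10.add H10 (by simp only [Par.lay_w]; omega)) ?_
          set σ11 := σ10.sto (.hdr 12) _ with hσ11
          have M11 : EV P.lay σ11 lenE (σ.m (.hdr 13)) := (EV.hd G 13).of_eq (by
            rw [hσ11, St.sto_m_ne _ _ _ _ (by simp)]; exact e13)
          have H11 : EV P.lay σ11 (.reg 13) (σ.m (.hdr 13) / 2) := H10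
          refine wp_sto_of (l := .hdr 13) (EV.cst (G.small (by norm_num))) (hdr_valid (by norm_num))
            (M11.sub H11 (Nat.div_le_self _ _)) ?_
          refine fin _ hr10 rfl (fun l g1 g2 => ?_) ?_ ?_
          · rw [St.sto_m_ne _ _ _ _ g2, hσ11, St.sto_m_ne _ _ _ _ g1]; rfl
          · rw [St.sto_m_self, St.sto_m_ne _ _ _ _ (by simp), hσ11, St.sto_m_self]
            intro z g1 g2; exact ⟨by omega, by omega, by omega⟩
          · rw [St.sto_m_self]; omega
        · refine wp_sto_of (l := .hdr 13) (EV.cst (G.small (by norm_num))) (hdr_valid (by norm_num))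
            H10 ?_
          refine fin _ hr10 rfl (fun l g1 g2 => ?_) ?_ ?_
          · rw [St.sto_m_ne _ _ _ _ g2]; rfl
          · rw [St.sto_m_self, St.sto_m_ne _ _ _ _ (by simp)]
            change ∀ z, σ9.m (.hdr 12) ≤ z → z < σ9.m (.hdr 12) + _ → _
            rw [e12]
            intro z g1 g2; exact ⟨by omega, by omega, by omega⟩
          · rw [St.sto_m_self]; omega
      · refine fin σ9 (fun _ _ => rfl) rfl (fun _ _ _ => rfl) ?_ ?_
        · rw [e12, e13]; intro z h3 h4; exact ⟨h3, h4, by omega⟩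
        · rw [e13]; omega
    refine wp_ite_of (EV.edm G I2 X2 hxn) (fun hm => ?_) (fun hm => ?_)
    · refine tail σ2 rfl rfl (EFrame.refl _) (fun _ _ => rfl) I.sp (I.ble.trans (by omega))
        (fun b => ⟨Or.inr, fun h => h.elim (fun h => h ▸ hm) id⟩) fun _ _ => rfl
    · obtain ⟨hs1, hs2⟩ := I.sp.add hbk hm
      have hlt := I.sp.lt_of_not_mem hbk hm
      have hnk : P.nk < 2 ^ P.w := by
        have := G.LB_lt; have h2 : P.LB = 20 + P.c + 2 * P.nk + P.nb * P.S := rfl; omega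
      refine wp_sto_of (l := .es (x / (P.w * P.w))) (EV.es G K2 hbk) hbk (EV.hd G 14) ?_
      set σa := σ2.sto (.es (x / (P.w * P.w))) _ with hσa
      have Ka : EV P.lay σa (.reg 14) (x / (P.w * P.w)) := K2
      have Ba : EV P.lay σa (hd 14) (σ.m (.hdr 14)) := (EV.hd G 14).of_eq (by
        rw [hσa, St.sto_m_ne _ _ _ _ (by simp)]; rfl)
      refine wp_sto_of (l := .ed (σ.m (.hdr 14))) (EV.ed G Ba hlt) hlt Ka ?_
      set σb := σa.sto (.ed (σ.m (.hdr 14))) _ with hσb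
      have Bb : EV P.lay σb (hd 14) (σ.m (.hdr 14)) := (EV.hd G 14).of_eq (by
        rw [hσb, St.sto_m_ne _ _ _ _ (by simp), hσa, St.sto_m_ne _ _ _ _ (by simp)]; rfl)
      refine wp_sto_of (l := .hdr 14) (EV.cst (G.small (by norm_num))) (hdr_valid (by norm_num))
        (Bb.add (EV.nm G 1) (by simp only [Par.lay_w]; omega)) ?_
      set σc := σb.sto (.hdr 14) _ with hσc
      have ced : (fun p => σc.m (.ed p)) =
          Function.update (fun p => σ.m (.ed p)) (σ.m (.hdr 14)) (x / (P.w * P.w)) := by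
        funext p; by_cases hp : p = σ.m (.hdr 14)
        · rw [hp]; simp [hσc, hσb]
        · rw [Function.update_of_ne hp, hσc, St.sto_m_ne _ _ _ _ (by simp), hσb,
            St.sto_m_ne _ _ _ _ (by simp [hp]), hσa, St.sto_m_ne _ _ _ _ (by simp)]; rfl
      have ces : (fun p => σc.m (.es p)) =
          Function.update (fun p => σ.m (.es p)) (x / (P.w * P.w)) (σ.m (.hdr 14)) := by
        funext p; by_cases hp : p = x / (P.w * P.w)
        · rw [hp]; simp [hσc, hσb, hσa]; rfl
        · rw [Function.update_of_ne hp, hσc, St.sto_m_ne _ _ _ _ (by simp), hσb,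
            St.sto_m_ne _ _ _ _ (by simp), hσa, St.sto_m_ne _ _ _ _ (by simp [hp])]; rfl
      have c14 : σc.m (.hdr 14) = σ.m (.hdr 14) + 1 := St.sto_m_self _ _ _
      refine tail σc rfl rfl ((EFrame.trans (EFrame.sto_es (σ := σ2)) EFrame.sto_ed).trans
        (EFrame.sto_hdr (by norm_num) (by norm_num))) (fun i hi => ?_) ?_ ?_ ?_ (fun b hb => ?_)
      · rw [hσc, St.sto_m_ne _ _ _ _ (by simp [hi]), hσb, St.sto_m_ne _ _ _ _ (by simp), hσa,
          St.sto_m_ne _ _ _ _ (by simp)]; rfl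
      · rw [ced, ces, c14]; exact hs1
      · rw [c14]; have := I.ble; omega
      · rw [ced, ces, c14]; exact hs2
      · have : b ≠ x / (P.w * P.w) := fun h => hm (h ▸ hb)
        have := congrFun ces b
        rw [Function.update_of_ne (by assumption)] at this
        exact this

/-! ### The structure for the first few insertions: queries -/

theorem Tr.ite {L : Lay} (hw : 1 ≤ L.w) {e : Ex} {p q : Pg} {σ : St} {t : ℕ} {Q : St → Prop}
    (hok : e.ok L σ) (h1 : e.val L σ ≠ 0 → Tr L p σ t Q) (h2 : e.val L σ = 0 → Tr L q σ t Q) :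
    Tr L (.ite e p q) σ (e.cost + 1 + t) Q := by
  intro s hs
  obtain ⟨s1, n1, hn1, he1, hv1, hs1⟩ := e.run L hw hs hok
  by_cases h0 : e.val L σ = 0
  · obtain ⟨s2, n2, σ2, hn2, he2, hs2, hq⟩ := h2 h0 s1 hs1
    exact ⟨s2, n1 + (n2 + 1), σ2, by omega,
      Exec.seq he1 (Exec.ite_false _ ((reg_eq_zero_iff hv1).2 h0) he2), hs2, hq⟩
  · obtain ⟨s2, n2, σ2, hn2, he2, hs2, hq⟩ := h1 h0 s1 hs1
    exact ⟨s2, n1 + (n2 + 1), σ2, by omega,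
      Exec.seq he1 (Exec.ite_true _ (fun h => h0 ((reg_eq_zero_iff hv1).1 h)) he2), hs2, hq⟩

/-- An element of colour `r10`, plus one. -/
def efindP (c : ℕ) : Pg :=
  .ite (.eq (.reg 10) j0E) (.set 0 (loE + 1))
    (.seq (.set 12 (ematE LCE (.reg 10)))
    (.ite (.reg 12) (.set 0 (eeltE c (lsbE (.reg 12)) + 1)) (.set 0 0)))

def scanP (c : ℕ) : Pg :=
  .seq (.ite (.eq (ecolE c (.reg 11)) (.reg 10)) (.emit (.reg 11 + 1)) .skip)
    (.set 11 (.reg 11 + 1))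
def listP (c : ℕ) : Pg :=
  .seq (.emit (eeltE c (lsbE (.reg 12)) + 1)) (.set 12 (.reg 12 &&& (.reg 12 - 1)))
/-- Enumerate the elements of colour `r10`. -/
def eenumP (c : ℕ) : Pg :=
  .ite (.eq (.reg 10) j0E)
    (.seq (.set 11 0) (.whl (.lt (.reg 11) nE) (scanP c)))
    (.seq (.set 12 (ematE LCE (.reg 10))) (.whl (.reg 12) (listP c)))

def eenumK (c : ℕ) : ℕ :=
  2 * (scanP c).cost + (listP c).cost + (ematE LCE (.reg 10)).cost + 40

section
variable {P : Par} {S : ℕ → ℕ} {j0 j N : ℕ} {e : ℕ → ℕ}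

theorem EV.colmat (G : P.Good) {σ : St} (I : EInv P σ.m S j0 N e) (hjc : j < P.c) {X : Ex}
    (hX : EV P.lay σ X j) : EV P.lay σ (ematE LCE X)
      (bs (eo P) ((Finset.range N).filter fun s => S (e s) = j)) :=
  EV.emat G I (a := fun s => S (e s)) (fun _ _ => (I.col _).trans_le I.cap.col)
    (hjc.trans_le I.cap.col) ((EV.hd G 10).of_eq I.lc) hX

theorem EInv.exists_entry {m : Loc → ℕ} (I : EInv P m S j0 N e) {x : ℕ} (hx : S x ≠ j0) :
    ∃ s < N, e s = x := by
  by_contra h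
  push Not at h
  exact hx (I.out x h)

theorem wp_efind (G : P.Good) {σ : St} {Q : St → Prop} (I : EInv P σ.m S j0 N e)
    (hj0 : σ.m (.hdr 1) = j0) (hj : σ.ρ 10 = j) (hjc : j < P.c)
    (hQ : ∀ σ' : St, σ'.m = σ.m → ((∃ x < P.n, S x = j ∧ σ'.ρ 0 = x + 1) ∨
      ((∀ x < P.n, S x ≠ j) ∧ σ'.ρ 0 = 0)) → Q σ') : wp P.lay (efindP P.c) Q σ := by
  have J : EV P.lay σ (.reg 10) j := EV.reg hj
  have hnw := G.n_lt
  refine wp_ite_of (J.eq ((EV.hd G 1).of_eq hj0)) (fun h => ?_) (fun h => ?_)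
  · have h1 := I.len_pos
    obtain ⟨h2, h3⟩ := I.lo (σ.m (.hdr 12)) le_rfl (by omega)
    refine wp_set_of ((EV.hd G 12).add (EV.nm G 1) (by simp only [Par.lay_w]; omega)) ?_
    exact hQ _ rfl (Or.inl ⟨_, h2, by rw [I.out _ h3, h], St.set_ρ_self _ _ _⟩)
  · have Z := EV.colmat G I hjc J
    refine wp_set_of Z ?_
    set σ1 := σ.set 12 _ with hσ1
    have Z1 : EV P.lay σ1 (.reg 12) (bs (eo P) ((Finset.range N).filter fun s => S (e s) = j)) :=
      EV.reg (St.set_ρ_self _ _ _)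
    by_cases hA : ((Finset.range N).filter fun s => S (e s) = j).Nonempty
    · refine ⟨Z1.1, fun _ => ?_, fun h => absurd (bs_eq_zero.1 (Z1.2.symm.trans h)) hA.ne_empty⟩
      have hm := Finset.mem_filter.1 (Finset.min'_mem _ hA)
      have I1 : EInv P σ1.m S j0 N e := I
      have LS := EV.elsb G I1 hA (fun s hs => Finset.mem_range.1 (Finset.mem_filter.1 hs).1) Z1
      have hs := Finset.mem_range.1 hm.1
      have hlt := I.lt _ hs
      refine wp_set_of ((EV.eelt G I1 hs LS).add (EV.nm G 1) (by simp only [Par.lay_w]; omega)) ?_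
      exact hQ _ rfl (Or.inl ⟨_, hlt, hm.2, St.set_ρ_self _ _ _⟩)
    · rw [Finset.not_nonempty_iff_eq_empty] at hA
      refine ⟨Z1.1, fun h => absurd (Z1.2.trans (by rw [hA]; rfl)) h, fun _ => ?_⟩
      refine wp_set_of (EV.nm G 0) (hQ _ rfl (Or.inr ⟨fun x _ hx => ?_, St.set_ρ_self _ _ _⟩))
      obtain ⟨s, hs, rfl⟩ := I.exists_entry (x := x) (by rw [hx]; exact h)
      exact (Finset.filter_eq_empty_iff.1 hA) (Finset.mem_range.2 hs) hx

/-- At most `N` elements have left colour `j0`, and `2 * N ≤ 2 ^ N ≤ n`. So `j0` owns at least half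
of the universe, and scanning all of it takes time linear in the output. -/
theorem EInv.n_le {m : Loc → ℕ} (I : EInv P m S j0 N e) :
    P.n ≤ 2 * ((List.range P.n).filter fun x => S x = j0).length := by
  have h1 : P.n ≤ ((Finset.range P.n).filter fun x => S x = j0).card + N := by
    have h2 : Finset.range P.n ⊆ ((Finset.range P.n).filter fun x => S x = j0) ∪
        (Finset.range N).image e := by
      intro x hx
      by_cases h : S x = j0
      · exact Finset.mem_union_left _ (Finset.mem_filter.2 ⟨hx, h⟩)
      · obtain ⟨s, hs, rfl⟩ := I.exists_entry h
        exact Finset.mem_union_right _ (Finset.mem_image_of_mem _ (Finset.mem_range.2 hs))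
    have h3 := (Finset.card_le_card h2).trans (Finset.card_union_le _ _)
    have h4 := Finset.card_image_le (s := Finset.range N) (f := e)
    simp only [Finset.card_range] at h3 h4
    omega
  have h2 : ((Finset.range P.n).filter fun x => S x = j0).card =
      ((List.range P.n).filter fun x => S x = j0).length := rfl
  have h3 := I.cap.elt
  have h4 : 2 * N ≤ 2 ^ N := by
    rcases N with _ | N
    · simp
    · rw [pow_succ, mul_comm]
      exact Nat.mul_le_mul_right _ (Nat.lt_two_pow_self (n := N))
  omega

theorem tr_eenum (G : P.Good) {σ : St} (hn : σ.m (.hdr 0) = P.n) (I : EInv P σ.m S j0 N e)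
    (hj0 : σ.m (.hdr 1) = j0) (hj : σ.ρ 10 = j) (hjc : j < P.c) :
    ∃ L : List ℕ, L.Nodup ∧ (∀ x, x ∈ L ↔ x < P.n ∧ S x = j) ∧
      Tr P.lay (eenumP P.c) σ (eenumK P.c * (L.length + 1)) fun σ' =>
        σ'.m = σ.m ∧ σ'.out = σ.out ++ L.map (· + 1) := by
  have J : EV P.lay σ (.reg 10) j := EV.reg hj
  have hnw := G.n_lt
  have C := J.eq ((EV.hd G 1).of_eq hj0)
  -- The initial colour is enumerated by a scan of the universe. Every other colour occurs only
  -- among the entries and is read off the packed colours.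
  by_cases hjj : j = j0
  · set L := (List.range P.n).filter fun x => S x = j with hL
    refine ⟨L, List.nodup_range.filter _, fun x => by simp [hL], ?_⟩
    refine (Tr.ite G.w_pos C.1 (t := (eenumK P.c * (L.length + 1)) - 10) (fun _ => ?_) fun h => ?_).mono
      ?_ fun _ h => h
    · refine (Tr.seq (p := .set 11 0) (t := 2) (t' := 7 + P.n * ((scanP P.c).cost + 10))
        (R := fun σ1 => σ1 = σ.set 11 0) (wp_sound G.w_pos _ (wp_set_of (EV.nm G 0) rfl)) ?_).mono
        ?_ fun _ h => h
      · rintro σ1 rfl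
        refine (Tr.while_list G.w_pos (α := ℕ) (ct := fun _ => (scanP P.c).cost)
          (I := fun pl σ' => ∃ p, pl = List.range' p (P.n - p) ∧ p ≤ P.n ∧ σ'.m = σ.m ∧
            σ'.ρ 10 = j ∧ σ'.ρ 11 = p ∧ σ'.out ++ (pl.filter fun x => S x = j).map (· + 1) =
            σ.out ++ L.map (· + 1)) ?_ ?_ (List.range P.n) (σ.set 11 0)
            ⟨0, by rw [List.range_eq_range']; simp, Nat.zero_le _, rfl,
              by rw [St.set_ρ_ne _ _ _ _ (by norm_num), hj], St.set_ρ_self _ _ _, rfl⟩).mono ?_ ?_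
        · rintro σ' ⟨p, q1, q2, q3, q4, q5, q6⟩
          have hp : P.n - p = 0 := by simpa using (congrArg List.length q1).symm
          have hN : EV P.lay σ' nE P.n := (EV.hd G 0).of_eq (by rw [q3]; exact hn)
          have T1 := (EV.reg (L := P.lay) (r := 11) q5).lt hN
          exact ⟨T1.1, T1.2.trans (if_neg (by omega))⟩
        · rintro a l σ' ⟨p, q1, q2, q3, q4, q5, q6⟩
          have hp : p < P.n := by
            have := congrArg List.length q1
            simp at this; omega
          rw [show P.n - p = (P.n - (p + 1)) + 1 by omega, List.range'_succ] at q1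
          obtain ⟨rfl, rfl⟩ := List.cons.inj q1
          have hN : EV P.lay σ' nE P.n := (EV.hd G 0).of_eq (by rw [q3]; exact hn)
          have T1 := (EV.reg (L := P.lay) (r := 11) q5).lt hN
          refine ⟨T1.1, fun h => ?_, wp_sound G.w_pos _ ?_⟩
          · rw [T1.2, if_pos hp] at h; exact absurd h (by norm_num)
          have I' : EInv P σ'.m S j0 N e := q3 ▸ I
          have next : ∀ σ2 : St, σ2.m = σ.m → σ2.ρ = σ'.ρ → σ2.out ++ ((List.range' (a + 1)
              (P.n - (a + 1))).filter fun x => S x = j).map (· + 1) = σ.out ++ L.map (· + 1) →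
              wp P.lay (.set 11 (.reg 11 + 1)) (fun σ' => ∃ p, List.range' (a + 1) (P.n - (a + 1)) =
                List.range' p (P.n - p) ∧ p ≤ P.n ∧ σ'.m = σ.m ∧ σ'.ρ 10 = j ∧ σ'.ρ 11 = p ∧
                σ'.out ++ ((List.range' (a + 1) (P.n - (a + 1))).filter fun x => S x = j).map (· + 1)
                  = σ.out ++ L.map (· + 1)) σ2 := by
            intro σ2 g1 g2 g3
            refine wp_set_of ((EV.reg (r := 11) (v := a) (by rw [g2, q5])).add (EV.nm G 1)
              (by simp only [Par.lay_w]; omega)) ⟨a + 1, rfl, hp, g1, ?_, St.set_ρ_self _ _ _, g3⟩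
            rw [St.set_ρ_ne _ _ _ _ (by norm_num), g2, q4]
          refine wp_ite_of ((EV.ecol G I' (by rw [q3]; exact hj0) (EV.reg (r := 11) q5) hp).eq
            (EV.reg (r := 10) q4)) (fun h => ?_) (fun h => ?_)
          · refine wp_emit_of ((EV.reg (r := 11) q5).add (EV.nm G 1)
              (by simp only [Par.lay_w]; omega)) (next _ q3 rfl ?_)
            rw [← q6]; simp [h]
          · refine next _ q3 rfl ?_
            rw [← q6]; simp [h]
        · simp only [Ex.cost, Ex.lt, nE, hd, List.map_const', List.sum_replicate, smul_eq_mul,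
            List.length_range]
          nlinarith
        · rintro σ' ⟨p, q1, -, q3, -, -, q6⟩
          exact ⟨q3, by simpa using q6⟩
      · have h1 := I.n_le
        rw [← hjj, ← hL] at h1
        have h2 : P.n * ((scanP P.c).cost + 10) ≤ 2 * L.length * ((scanP P.c).cost + 10) :=
          Nat.mul_le_mul_right _ h1
        have h3 : eenumK P.c * (L.length + 1) = 2 * L.length * ((scanP P.c).cost + 10) +
            L.length * ((listP P.c).cost + (ematE LCE (.reg 10)).cost + 20) + eenumK P.c := by
          unfold eenumK; ring
        have h4 : 40 ≤ eenumK P.c := by unfold eenumK; omega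
        omega
    · rw [C.2, if_pos hjj] at h; exact absurd h (by norm_num)
    · have h4 : 40 ≤ eenumK P.c := by unfold eenumK; omega
      have h5 : eenumK P.c ≤ eenumK P.c * (L.length + 1) := Nat.le_mul_of_pos_right _ (by omega)
      simp only [Ex.cost, Ex.eq, hd]; omega
  · set A := (Finset.range N).filter fun s => S (e s) = j with hA
    set L := (A.sort (· ≤ ·)).map e with hL
    have hmA : ∀ s, s ∈ A ↔ s < N ∧ S (e s) = j := by simp [hA]
    refine ⟨L, ?_, fun x => ?_, ?_⟩
    · refine (Finset.sort_nodup _ _).map_on fun a ha b hb h => ?_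
      rw [Finset.mem_sort, hmA] at ha hb
      exact I.inj a ha.1 b hb.1 h
    · simp only [hL, List.mem_map, Finset.mem_sort, hmA]
      constructor
      · rintro ⟨s, ⟨h1, h2⟩, rfl⟩; exact ⟨I.lt s h1, h2⟩
      · rintro ⟨h1, h2⟩
        obtain ⟨s, hs, rfl⟩ := I.exists_entry (x := x) (by rw [h2]; exact hjj)
        exact ⟨s, ⟨hs, h2⟩, rfl⟩
    have hlen : (A.sort (· ≤ ·)).length = L.length := by simp [hL]
    refine (Tr.ite G.w_pos C.1 (t := (ematE LCE (.reg 10)).cost + 1 +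
      (2 + L.length * ((listP P.c).cost + 2))) (fun h => ?_) fun _ => ?_).mono
      ?_ fun _ h => h
    · rw [C.2, if_neg hjj] at h; exact absurd rfl h
    · refine Tr.seq (R := fun σ1 => σ1 = σ.set 12 (bs (eo P) A))
        (wp_sound G.w_pos (.set 12 (ematE LCE (.reg 10))) (wp_set_of (EV.colmat G I hjc J) rfl)) ?_
      rintro σ1 rfl
      refine (Tr.while_list G.w_pos (α := ℕ) (ct := fun _ => (listP P.c).cost)
        (I := fun il σ' => il.Pairwise (· < ·) ∧ (∀ s ∈ il, s < N) ∧ σ'.m = σ.m ∧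
          σ'.ρ 12 = bs (eo P) il.toFinset ∧
          σ'.out ++ (il.map fun s => e s + 1) = σ.out ++ L.map (· + 1)) ?_ ?_
          (A.sort (· ≤ ·)) (σ.set 12 (bs (eo P) A)) ⟨(Finset.sortedLT_sort _).pairwise,
            fun s hs => ((hmA s).1 ((Finset.mem_sort _).1 hs)).1, rfl, ?_, ?_⟩).mono ?_ ?_
      · rintro σ' ⟨-, -, -, h, -⟩
        exact ⟨by simp, h⟩
      · rintro a il σ' ⟨p1, p2, p3, p4, p5⟩
        obtain ⟨hB, hmin, her⟩ := sorted_cons p1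
        have I' : EInv P σ'.m S j0 N e := p3 ▸ I
        have E12 : EV P.lay σ' (.reg 12) (bs (eo P) (a :: il).toFinset) := EV.reg p4
        have ha := p2 a (by simp)
        have hBN : ∀ s ∈ (a :: il).toFinset, s < N := fun s hs => p2 s (by simpa using hs)
        refine ⟨by simp, fun h => ?_, wp_sound G.w_pos _ ?_⟩
        · rw [E12.2] at h; exact hB.ne_empty (bs_eq_zero.1 h)
        have LS := EV.elsb G I' hB hBN E12
        rw [hmin] at LS
        have hlt := I.lt a ha
        refine wp_emit_of ((EV.eelt G I' ha LS).add (EV.nm G 1) (by simp only [Par.lay_w]; omega)) ?_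
        have CL := EV.clear (σ := σ'.emit (e a + 1)) G (o := eo P)
          (fun _ _ t ht h => I.cap.eo_lt (hBN t ht) h) hB (EV.reg (r := 12) p4)
        rw [hmin, her] at CL
        refine wp_set_of CL ⟨(List.pairwise_cons.1 p1).2, fun i hi => p2 i (by simp [hi]), p3,
          St.set_ρ_self _ _ _, ?_⟩
        rw [← p5]; simp
      · rw [St.set_ρ_self, Finset.sort_toFinset]
      · simp [hL]
      · simp only [Ex.cost, List.map_const', List.sum_replicate, smul_eq_mul, hlen]
        rw [show (listP P.c).cost + 1 + 1 = (listP P.c).cost + 2 from rfl]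
      · rintro σ' ⟨-, -, h3, -, h6⟩
        exact ⟨h3, by simpa using h6⟩
    · have h3 : eenumK P.c * (L.length + 1) = L.length * ((listP P.c).cost + 2) +
          L.length * (2 * (scanP P.c).cost + (ematE LCE (.reg 10)).cost + 38) + eenumK P.c := by
        unfold eenumK; ring
      have h4 : eenumK P.c = 2 * (scanP P.c).cost + (listP P.c).cost +
        (ematE LCE (.reg 10)).cost + 40 := rfl
      simp only [Ex.cost, Ex.eq, hd] at h3 h4 ⊢; omega
end

/-! ### Parameters that double with every insertion -/

/-- Leaf size for `2 ^ t` elements. -/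
def fS (c : ℕ) : ℕ → ℕ
  | 0 => Nat.log 2 c + 1
  | t + 1 => if c = 1 then fS c t + 1 else
      if c ^ 2 ^ t * c ^ 2 ^ t < 2 ^ (2 * fS c t - 1) then 2 * fS c t - 1 else 2 * fS c t

theorem fS_pos (c t : ℕ) : 1 ≤ fS c t := by
  cases t with
  | zero => exact Nat.le_add_left _ _
  | succ t => have := fS_pos c t; unfold fS; split_ifs <;> omega

theorem fS_mono (c : ℕ) : Monotone (fS c) := by
  refine monotone_nat_of_le_succ fun t => ?_
  have := fS_pos c t
  conv_rhs => unfold fS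
  split_ifs <;> omega

theorem fS_codec {c : ℕ} (hc : 1 ≤ c) (t : ℕ) : Codec c (2 ^ t) (fS c t) := by
  refine ⟨hc, Nat.one_le_two_pow, ?_⟩
  induction t with
  | zero => rw [pow_zero, pow_one]; exact Nat.lt_pow_succ_log_self (by norm_num) c
  | succ t ih =>
    unfold fS
    split_ifs with h1 h2
    · subst h1; rw [one_pow]; exact Nat.one_lt_two_pow (by have := fS_pos 1 t; omega)
    · rwa [pow_succ 2 t, pow_mul, sq]
    · rw [pow_succ 2 t, pow_mul, sq, two_mul, pow_add]
      exact Nat.mul_lt_mul'' ih ih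

/-- Places in a leaf are recovered modulo `2 ^ k - 1`, which requires leaves of fewer than `2 ^ f`
elements. For `c = 1` the colours need no space, and this is what forces the width to grow with `t`.
-/
theorem pow_lt_fS {c : ℕ} (hc : 1 ≤ c) (t : ℕ) : 2 ^ t < 2 ^ fS c t := by
  rcases hc.eq_or_lt with rfl | h
  · refine Nat.pow_lt_pow_right (by norm_num) ?_
    induction t with
    | zero => exact fS_pos _ _
    | succ t ih => unfold fS; simp; omega
  · exact (Nat.lt_pow_self h).trans (fS_codec hc t).hf

theorem fS_le (c t : ℕ) : fS c t ≤ 2 ^ t * (Nat.log 2 c + 1) := by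
  induction t with
  | zero => simp [fS]
  | succ t ih =>
    have := fS_pos c t
    unfold fS
    rw [pow_succ, mul_comm (2 ^ t), mul_assoc]
    split_ifs <;> omega

/-- For `c ≥ 2` the bound `2 ^ f ≤ 2 * c ^ d` is maintained: doubling the leaf squares both sides,
and a bit is saved whenever `2 * f - 1` bits suffice. So the width exceeds `d * lg c` by at most
one. For `c = 1` it is exactly `t + 1`. -/
theorem le_fS {c : ℕ} (hc : 1 ≤ c) (t : ℕ) : 2 ^ fS c t ≤ 2 ^ (t + 1) * c ^ 2 ^ t := by
  rcases hc.eq_or_lt with rfl | h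
  · rw [one_pow, mul_one]
    refine Nat.pow_le_pow_right (by norm_num) ?_
    induction t with
    | zero => simp [fS]
    | succ t ih => unfold fS; simp; omega
  · suffices h : 2 ^ fS c t ≤ 2 * c ^ 2 ^ t from h.trans (Nat.mul_le_mul_right _
      (by rw [pow_succ]; have := Nat.one_le_two_pow (n := t); omega))
    induction t with
    | zero => rw [fS, pow_zero, pow_one, pow_succ, mul_comm]
              exact Nat.mul_le_mul_left _ (Nat.pow_log_le_self 2 (by omega))
    | succ t ih =>
      have := fS_pos c t
      have e : 2 ^ (2 * fS c t) = 2 * 2 ^ (2 * fS c t - 1) := by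
        rw [← pow_succ']; congr 1; omega
      unfold fS
      rw [if_neg (by omega), pow_succ 2 t, pow_mul, sq]
      split_ifs with h2
      · have : 2 ^ (2 * fS c t) ≤ (2 * c ^ 2 ^ t) * (2 * c ^ 2 ^ t) := by
          rw [two_mul, pow_add]; exact Nat.mul_le_mul ih ih
        nlinarith
      · rw [e]; exact Nat.mul_le_mul_left _ (by omega)

/-- The parameters for all but very small universes. -/
structure Big (P : Par) (t : ℕ) : Prop where
  d : P.d = 2 ^ t
  f : P.f = fS P.c t
  h : P.h = 8 + 8 * t
  lt : ∀ s < t, (2 ^ s) ^ 8 < P.w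
  le : P.w ≤ (2 ^ t) ^ 8
  -- At most `t` entries arise before the parameters are complete, and at most `t` more during the
  -- migration.
  cap : ∀ N ≤ 2 * t, Cap P N

/-! ### The combined structure -/

/-- Move an entry of the early structure. -/
def migP (c : ℕ) : Pg :=
  .seq (.set 19 ((1 : Ex) <<< (Ex.wl - (Ex.wl >>> hd 15))))
  (.seq (.set 10 (eeltE c (.reg 19)))
  (.seq (.set 11 (efldE LCE (.reg 19)))
  (.seq (finsP c)
  (.seq (.sto (.cst 15) (hd 15 + 1)) (.ite (.lt (hd 15) (hd 16)) .skip (.sto (.cst 2) 2))))))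

/-- Double the parameters. -/
def doubleP (c : ℕ) : Pg :=
  .seq (.set 12 (powE c))
  (.seq (.sto (.cst 4) (.cond (.cst (c - 1))
    (.cond (.lt (.reg 12 * .reg 12) ((1 : Ex) <<< (2 * fE - 1))) (2 * fE - 1) (2 * fE)) (fE + 1)))
  (.seq (.sto (.cst 3) (2 * dE))
  (.seq (.sto (.cst 5) (hE + 8))
  (.seq (.set 12 (dE * dE))
  (.seq (.set 12 (.reg 12 * .reg 12))
  (.ite (.lt (.reg 12 * .reg 12) .wl) .skip
    (.seq (.sto (.cst 15) 0) (.seq (.sto (.cst 16) NE) (.sto (.cst 2) (.cond NE 1 2))))))))))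

/-- Insert `r10` with colour `r11`. -/
def insP (c : ℕ) : Pg :=
  .ite (.eq (hd 2) 2) (finsP c)
    (.seq (einsP c) (.ite (.eq (hd 2) 1) (.seq (finsP c) (migP c)) (doubleP c)))

/-- The colour of an element. -/
def colX (c : ℕ) (x : Ex) : Ex := .cond (.eq (hd 2) 2) (colE c x) (ecolE c x)

/-- The parameters have been doubled `s` times, once per insertion, so there are at most `s`
entries. The main structure is not in use yet; the zero words and the bound on leaf words are what
`FInv.init` will need. -/
def Mode0 (P : Par) (t : ℕ) (m : Loc → ℕ) (S : ℕ → ℕ) (j0 : ℕ) : Prop :=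
  ∃ s N e, Big P t ∧ s < t ∧ N ≤ s ∧ m (.hdr 2) = 0 ∧ m (.hdr 3) = 2 ^ s ∧ m (.hdr 4) = fS P.c s ∧
    m (.hdr 5) = 8 + 8 * s ∧ m (.hdr 6) = 0 ∧ m (.hdr 7) = 0 ∧
    (∀ i ≤ P.nl / P.r, m (.lf i) < 2 ^ P.w) ∧ EInv P m S j0 N e

/-- The early structure is complete and answers the queries. The main structure holds `sF`, which
may be wrong only at the entries `i, …, p - 1` that are still to be moved. An insertion adds at most
one entry and moves one, so `N ≤ t + i` persists and the capacity `2 * t` is not exceeded. -/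
def Mode1 (P : Par) (t : ℕ) (m : Loc → ℕ) (S : ℕ → ℕ) (j0 : ℕ) : Prop :=
  ∃ N e sF i p, Big P t ∧ m (.hdr 2) = 1 ∧ Hdr P m ∧ EInv P m S j0 N e ∧ FInv P m sF j0 ∧
    m (.hdr 15) = i ∧ m (.hdr 16) = p ∧ i < p ∧ p ≤ N ∧ p ≤ t ∧ N ≤ t + i ∧
    ∀ x, sF x = S x ∨ ∃ s, i ≤ s ∧ s < p ∧ e s = x

def Mode2 (P : Par) (m : Loc → ℕ) (S : ℕ → ℕ) (j0 : ℕ) : Prop :=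
  m (.hdr 2) = 2 ∧ Hdr P m ∧ FInv P m S j0

/-- The memory `m` represents the colouring `S`. -/
structure RInv (P : Par) (t : ℕ) (m : Loc → ℕ) (S : ℕ → ℕ) (j0 : ℕ) : Prop where
  n : m (.hdr 0) = P.n
  hj0 : m (.hdr 1) = j0
  j0c : j0 < P.c
  mode : Mode0 P t m S j0 ∨ Mode1 P t m S j0 ∨ Mode2 P m S j0

section
variable {P : Par} {σ : St} {S : ℕ → ℕ} {j0 x j N i v t : ℕ} {e : ℕ → ℕ} {X : Ex} {Q : St → Prop}

theorem wp_hdr (G : P.Good) (h : EV P.lay σ X v) (hQ : Q (σ.sto (.hdr i) v))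
    (hi : i < 20 := by norm_num) : wp P.lay (.sto (.cst i) X) Q σ :=
  wp_sto_of (l := .hdr i) (EV.cst (G.small (by omega))) (hdr_valid hi) h hQ

theorem FInv.sto_hdr (I : FInv P σ.m S j0) (hi : i ≠ 6 ∧ i ≠ 7 := by norm_num) :
    FInv P (σ.sto (.hdr i) v).m S j0 :=
  I.congr fun _ _ h => St.sto_m_ne _ _ _ _ fun e => by have := h _ e; omega

theorem EInv.sto_hdr (I : EInv P σ.m S j0 N e) (hi : i < 8 ∨ 14 < i := by norm_num) :
    EInv P (σ.sto (.hdr i) v).m S j0 N e :=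
  I.congr (fun k h1 h2 => St.sto_m_ne _ _ _ _ fun h => by injection h; omega)
    (fun _ => St.sto_m_ne _ _ _ _ (by simp)) fun _ => St.sto_m_ne _ _ _ _ (by simp)

theorem EInv.frame {m' : Loc → ℕ} (I : EInv P σ.m S j0 N e) (F : Frame σ.m m') :
    EInv P m' S j0 N e := I.congr (fun k _ _ => F.1 k (by omega) (by omega)) F.2.1 F.2.2

theorem EFrame.hdr {m m' : Loc → ℕ} (F : EFrame m m') (hi : i < 8 ∨ 14 < i := by norm_num) :
    m' (.hdr i) = m (.hdr i) := F _ (by simp) fun k h => by injection h; omega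

theorem EV.colX (G : P.Good) (R : RInv P t σ.m S j0) (hX : EV P.lay σ X x) (hx : x < P.n) :
    EV P.lay σ (colX P.c X) (S x) := by
  have M := EV.eq (EV.hd G (σ := σ) 2) (EV.nm G 2)
  rcases R.mode with ⟨s, N, e, -, -, -, h2, -, -, -, -, -, -, I⟩ |
    ⟨N, e, -, -, -, -, h2, -, I, -⟩ | ⟨h2, H, I⟩
  · exact EV.cond M (fun h => by omega) fun _ => EV.ecol G I R.hj0 hX hx
  · exact EV.cond M (fun h => by omega) fun _ => EV.ecol G I R.hj0 hX hx
  · exact EV.cond M (fun _ => EV.col G H I R.hj0 R.j0c hX hx) fun h => absurd h2 h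

/-- The colour moved is the current one of the early structure, so the move is right even if the
element has been recoloured in the meantime. The hypothesis `N ≤ t + (i + 1)` allows for the entry
that the preceding insertion may have added. -/
theorem wp_mig (G : P.Good) {sF : ℕ → ℕ} {p : ℕ} (B : Big P t) (hn : σ.m (.hdr 0) = P.n)
    (hj : σ.m (.hdr 1) = j0) (hjc : j0 < P.c) (h2 : σ.m (.hdr 2) = 1) (H : Hdr P σ.m)
    (I : EInv P σ.m S j0 N e) (J : FInv P σ.m sF j0) (hi : σ.m (.hdr 15) = i)
    (hp : σ.m (.hdr 16) = p) (hip : i < p) (hpN : p ≤ N) (hpt : p ≤ t) (hN : N ≤ t + (i + 1))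
    (hS : ∀ x, sF x = S x ∨ ∃ s, i ≤ s ∧ s < p ∧ e s = x)
    (hQ : ∀ σ', RInv P t σ'.m S j0 → Q σ') : wp P.lay (migP P.c) Q σ := by
  have hiN : i < N := by omega
  have hlt := eo_le P hiN
  have h2N := I.cap.two
  have hw := G.w_lt
  refine wp_set_of ((EV.nm G 1).shl ((EV.wl (L := P.lay)).sub ((EV.wl (L := P.lay)).shr
    ((EV.hd G 15).of_eq hi)) (Nat.div_le_self _ _))
    (by rw [one_mul]; exact G.pow_lt (x := eo P i) (by omega))) ?_
  rw [one_mul]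
  change wp P.lay _ Q (σ.set 19 (2 ^ eo P i))
  set σ1 := σ.set 19 (2 ^ eo P i) with hσ1
  have E1 : EV P.lay σ1 (.reg 19) (2 ^ eo P i) := EV.reg (St.set_ρ_self _ _ _)
  refine wp_set_of (EV.eelt G (σ := σ1) I hiN E1) ?_
  have E2 : EV P.lay (σ1.set 10 (e i)) (.reg 19) (2 ^ eo P i) := EV.reg (by simp [hσ1])
  refine wp_set_of (EV.efld G (σ := σ1.set 10 (e i)) I (a := fun s => S (e s))
    (fun s _ => (I.col _).trans_le I.cap.col) hiN ((EV.hd G 10).of_eq I.lc) E2) ?_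
  refine wp_fins G (x := e i) (j := S (e i)) (by exact H) (by exact J) hj hjc (by simp)
    (I.lt _ hiN) (by simp) (I.col _) ?_
  intro σ' K F J'
  have F' : Frame σ.m σ'.m := F
  have hh : ∀ k, k ≠ 6 → k ≠ 7 → σ'.m (.hdr k) = σ.m (.hdr k) := F'.1
  have I' := I.frame F'
  have hi15 : σ'.m (.hdr 15) = i := (hh 15 (by norm_num) (by norm_num)).trans hi
  refine wp_hdr G (((EV.hd G 15).of_eq hi15).add (EV.nm G 1)
    (by have := B.lt 0 (by omega); have := Nat.lt_two_pow_self (n := t); have := G.d_lt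
        rw [B.d] at this; simp only [Par.lay_w]; omega)) ?_
  set σ2 := σ'.sto (.hdr 15) (i + 1) with hσ2
  have hh2 : ∀ k, k ≠ 6 → k ≠ 7 → k ≠ 15 → σ2.m (.hdr k) = σ.m (.hdr k) := fun k a b c => by
    rw [hσ2, St.sto_m_ne _ _ _ _ (by simpa using c), hh k a b]
  have H2 : Hdr P σ2.m := (F'.hdr H).sto _
  have hi2 : σ2.m (.hdr 15) = i + 1 := St.sto_m_self _ _ _
  have hp2 := (hh2 16 (by norm_num) (by norm_num) (by norm_num)).trans hp
  have hn2 := (hh2 0 (by norm_num) (by norm_num) (by norm_num)).trans hn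
  have hj2 := (hh2 1 (by norm_num) (by norm_num) (by norm_num)).trans hj
  have hS2 : ∀ x, Function.update sF (e i) (S (e i)) x = S x ∨
      ∃ s, i + 1 ≤ s ∧ s < p ∧ e s = x := by
    intro x
    by_cases hx : x = e i
    · subst hx; left; rw [Function.update_self]
    · rw [Function.update_of_ne hx]
      rcases hS x with h | ⟨s, h1, h2, rfl⟩
      · exact Or.inl h
      · exact Or.inr ⟨s, Nat.succ_le_of_lt (lt_of_le_of_ne h1 fun h => hx (by rw [h])), h2, rfl⟩
  refine wp_ite_of (((EV.hd G 15).of_eq hi2).lt ((EV.hd G 16).of_eq hp2)) (fun h => ?_) (fun h => ?_)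
  · exact hQ _ ⟨hn2, hj2, hjc, Or.inr (Or.inl ⟨N, e, _, i + 1, p, B,
      (hh2 2 (by norm_num) (by norm_num) (by norm_num)).trans h2, H2, I'.sto_hdr, J'.sto_hdr, hi2,
      hp2, h, hpN, hpt, hN, hS2⟩)⟩
  -- No entry is left to be moved, so the main structure represents `S` and the early one can be
  -- forgotten.
  · have hSS : Function.update sF (e i) (S (e i)) = S := funext fun x => by
      rcases hS2 x with h | ⟨s, h1, h2, -⟩
      · exact h
      · omega
    rw [hSS] at J'
    refine wp_hdr G (EV.nm G 2) (hQ _ ⟨?_, ?_, hjc, Or.inr (Or.inr ⟨St.sto_m_self _ _ _, H2.sto _,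
      (J'.sto_hdr (i := 15) (v := i + 1)).sto_hdr⟩)⟩)
    · rw [St.sto_m_ne _ _ _ _ (by simp)]; exact hn2
    · rw [St.sto_m_ne _ _ _ _ (by simp)]; exact hj2

theorem EV.powc' (G : P.Good) {d f : ℕ} (hd : σ.m (.hdr 3) = d) (hf : σ.m (.hdr 4) = f)
    (C : Codec P.c d f) (hk : (2 * f + 2) * (d + 1) < P.w) : EV P.lay σ (powE P.c) (P.c ^ d) := by
  have h0 := G.w_lt
  have h1 := G.c_lt
  have h2 : (2 * f + 2) * d + (2 * f + 2) < P.w := by rw [← Nat.mul_succ]; exact hk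
  have K : EV P.lay σ kE (2 * f + 2) := ((EV.nm G 2).mul ((EV.hd G 4).of_eq hf)
    (by simp only [Par.lay_w]; omega)).add (EV.nm G 2) (by simp only [Par.lay_w]; omega)
  have M : EV P.lay σ (modE P.c) (2 ^ (2 * f + 2) - P.c) := by
    refine (((EV.nm G 1).shl K (by rw [one_mul]; exact G.pow_lt (by omega))).sub
      (EV.cst (by simp only [Par.lay_w]; omega)) ?_).of_eq (by rw [one_mul])
    have := C.add_lt; rw [one_mul]; omega
  refine (((EV.nm G 1).shl (K.mul ((EV.hd G 3).of_eq hd) (by simp only [Par.lay_w]; omega))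
    (by rw [one_mul]; exact G.pow_lt (by omega))).mod M).of_eq ?_
  rw [one_mul]; exact C.pow_mod

/-- The next width needs only a comparison of `(c ^ d) ^ 2` with a power of two, so all parameters
of twice the leaf size follow from the present ones in constant time. The doubling is complete when
`d ^ 8`, obtained by three squarings, is no longer below `w`. -/
theorem wp_double (G : P.Good) {s : ℕ} (B : Big P t) (hst : s < t) (hN : N ≤ s + 1)
    (hn : σ.m (.hdr 0) = P.n) (hj : σ.m (.hdr 1) = j0) (hjc : j0 < P.c) (h2 : σ.m (.hdr 2) = 0)
    (h3 : σ.m (.hdr 3) = 2 ^ s) (h4 : σ.m (.hdr 4) = fS P.c s) (h5 : σ.m (.hdr 5) = 8 + 8 * s)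
    (h6 : σ.m (.hdr 6) = 0) (h7 : σ.m (.hdr 7) = 0)
    (hm : ∀ i ≤ P.nl / P.r, σ.m (.lf i) < 2 ^ P.w) (I : EInv P σ.m S j0 N e)
    (hQ : ∀ σ', RInv P t σ'.m S j0 → Q σ') : wp P.lay (doubleP P.c) Q σ := by
  have hc := G.codec.hc
  have hw := G.w_lt
  have hcw := G.c_lt
  have hd : 2 ^ (s + 1) ≤ P.d := by
    rw [B.d]; exact Nat.pow_le_pow_right (by norm_num) hst
  have hf : fS P.c (s + 1) ≤ P.f := by rw [B.f]; exact fS_mono _ hst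
  have hf0 : fS P.c s ≤ fS P.c (s + 1) := fS_mono _ s.le_succ
  have hfp := fS_pos P.c s
  have hdw := G.d_lt
  have hff : 2 * fS P.c s + 2 ≤ P.k ∧ P.k < P.w := ⟨by unfold Par.k; omega, G.k_lt⟩
  have hd2 : 2 ^ (s + 1) = 2 * 2 ^ s := by rw [pow_succ, mul_comm]
  have hC := fS_codec hc s
  have hk : (2 * fS P.c s + 2) * (2 ^ s + 1) < P.w :=
    (Nat.mul_le_mul hff.1 (by omega)).trans_lt G.kd
  refine wp_set_of (EV.powc' G h3 h4 hC hk) ?_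
  set σ1 := σ.set 12 (P.c ^ 2 ^ s) with hσ1
  have E12 : EV P.lay σ1 (.reg 12) (P.c ^ 2 ^ s) := EV.reg (St.set_ρ_self _ _ _)
  have E4 : EV P.lay σ1 fE (fS P.c s) := (EV.hd G 4).of_eq h4
  have T4 : EV P.lay σ1 (2 * fE) (2 * fS P.c s) :=
    (EV.nm G 2).mul E4 (by simp only [Par.lay_w]; omega)
  have T4' := T4.sub (EV.nm G 1) (by omega)
  have NF : EV P.lay σ1 (.cond (.cst (P.c - 1))
      (.cond (.lt (.reg 12 * .reg 12) ((1 : Ex) <<< (2 * fE - 1))) (2 * fE - 1) (2 * fE))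
      (fE + 1)) (fS P.c (s + 1)) := by
    have E0 : EV P.lay σ1 (.cst (P.c - 1)) (P.c - 1) := EV.cst (by simp only [Par.lay_w]; omega)
    by_cases h1 : P.c = 1
    · refine (EV.cond_neg (E0.of_eq (by omega)) (E4.add (EV.nm G 1) ?_)).of_eq ?_
      · simp only [Par.lay_w]; omega
      · rw [fS, if_pos h1]
    · have sq : P.c ^ 2 ^ s * P.c ^ 2 ^ s < 2 ^ P.w := by
        calc _ < 2 ^ fS P.c s * 2 ^ fS P.c s := Nat.mul_lt_mul'' hC.hf hC.hf
          _ ≤ _ := by rw [← pow_add]; exact Nat.pow_le_pow_right (by norm_num) (by omega)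
      refine EV.cond_pos E0 (by omega) ?_
      have T := (E12.mul E12 sq).lt ((EV.nm G 1).shl T4'
        (by rw [one_mul]; exact G.pow_lt (by omega)))
      rw [one_mul] at T
      refine EV.cond T (fun h => T4'.of_eq ?_) fun h => T4.of_eq ?_
      · rw [fS, if_neg h1, if_pos h]
      · rw [fS, if_neg h1, if_neg h]
  refine wp_hdr G NF ?_
  have D1 : EV P.lay (σ1.sto (.hdr 4) (fS P.c (s + 1))) dE (2 ^ s) := (EV.hd G 3).of_eq
    (by rw [St.sto_m_ne _ _ _ _ (by simp)]; exact h3)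
  refine wp_hdr G (((EV.nm G 2).mul D1 (by simp only [Par.lay_w]; omega)).of_eq hd2.symm) ?_
  have hs2 := Nat.lt_two_pow_self (n := s)
  have hsw : 8 + 8 * s + 8 < 2 ^ P.w := by
    have h := G.hw; rw [B.h] at h; omega
  have D2 : EV P.lay ((σ1.sto (.hdr 4) (fS P.c (s + 1))).sto (.hdr 3) (2 ^ (s + 1))) hE (8 + 8 * s) :=
    (EV.hd G 5).of_eq (by rw [St.sto_m_ne _ _ _ _ (by simp), St.sto_m_ne _ _ _ _ (by simp)]; exact h5)
  refine wp_hdr G (D2.add (EV.nm G 8) hsw) ?_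
  set σ2 := (((σ1.sto (.hdr 4) (fS P.c (s + 1))).sto (.hdr 3) (2 ^ (s + 1))).sto (.hdr 5)
    (8 + 8 * s + 8)) with hσ2
  have a3 : σ2.m (.hdr 3) = 2 ^ (s + 1) := by simp [hσ2]
  have a4 : σ2.m (.hdr 4) = fS P.c (s + 1) := by simp [hσ2]
  have a5 : σ2.m (.hdr 5) = 8 + 8 * (s + 1) := by simp [hσ2]; ring
  have ao : ∀ l, l ≠ .hdr 3 → l ≠ .hdr 4 → l ≠ .hdr 5 → σ2.m l = σ.m l := fun l x y z => by
    rw [hσ2, St.sto_m_ne _ _ _ _ z, St.sto_m_ne _ _ _ _ x, St.sto_m_ne _ _ _ _ y]; rfl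
  have I2 : EInv P σ2.m S j0 N e := ((I.sto_hdr (i := 4)).sto_hdr (i := 3)).sto_hdr (i := 5)
  have D0 : EV P.lay σ2 dE (2 ^ (s + 1)) := (EV.hd G 3).of_eq a3
  -- The eighth power of the previous leaf size was below `w`, so the new one is below `2 ^ 8 * w`
  -- and does not overflow.
  have hb8 : (2 ^ (s + 1)) ^ 8 < 2 ^ P.w := by
    have h1 := B.lt s hst
    rw [hd2, mul_pow]
    calc 2 ^ 8 * (2 ^ s) ^ 8 < 2 ^ 8 * P.w := (Nat.mul_lt_mul_left (show 0 < 2 ^ 8 by norm_num)).2 h1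
      _ ≤ 2 ^ 8 * 2 ^ (P.w - 8) := Nat.mul_le_mul_left _ (by
          have hw8 : P.w ≤ 4 * (P.w - 8) + 0 := by have := G.w_ge; omega
          have : ∀ m, 16 ≤ m → 4 * m ≤ 2 ^ m := fun m hm => by
            induction m, hm using Nat.le_induction with
            | base => norm_num
            | succ m _ ih => rw [pow_succ]; omega
          exact hw8.trans (this _ (by have := G.w_ge; omega)))
      _ = 2 ^ P.w := by rw [← pow_add]; congr 1; have := G.w_ge; omega
  have hb4 : ∀ k ≤ 8, (2 ^ (s + 1)) ^ k < 2 ^ P.w := fun k hk =>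
    (Nat.pow_le_pow_right (Nat.two_pow_pos _) hk).trans_lt hb8
  refine wp_set_of ((D0.mul D0 (by rw [← sq]; exact hb4 2 (by norm_num))).of_eq
    (sq (2 ^ (s + 1))).symm) ?_
  have R1 : EV P.lay (σ2.set 12 ((2 ^ (s + 1)) ^ 2)) (.reg 12) ((2 ^ (s + 1)) ^ 2) :=
    EV.reg (St.set_ρ_self _ _ _)
  refine wp_set_of ((R1.mul R1 (by rw [← pow_add]; exact hb4 4 (by norm_num))).of_eq
    (y := (2 ^ (s + 1)) ^ 4) (by rw [← pow_add])) ?_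
  set σ3 := (σ2.set 12 _).set 12 _ with hσ3
  have R2 : EV P.lay σ3 (.reg 12) ((2 ^ (s + 1)) ^ 4) := EV.reg (St.set_ρ_self _ _ _)
  have R3 := (R2.mul R2 (by rw [← pow_add]; exact hb8)).lt EV.wl
  rw [← pow_add, Par.lay_w, show 4 + 4 = 8 from rfl] at R3
  have b0 := (ao (.hdr 0) (by simp) (by simp) (by simp)).trans hn
  have b1 := (ao (.hdr 1) (by simp) (by simp) (by simp)).trans hj
  have b2 := (ao (.hdr 2) (by simp) (by simp) (by simp)).trans h2
  have b6 := (ao (.hdr 6) (by simp) (by simp) (by simp)).trans h6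
  have b7 := (ao (.hdr 7) (by simp) (by simp) (by simp)).trans h7
  have bl : ∀ i ≤ P.nl / P.r, σ2.m (.lf i) < 2 ^ P.w := fun i hi => by
    rw [ao _ (by simp) (by simp) (by simp)]; exact hm i hi
  refine wp_ite_of R3 (fun h => ?_) (fun h => ?_)
  · refine hQ _ ⟨b0, b1, hjc, Or.inl ⟨s + 1, N, e, B, lt_of_le_of_ne hst fun h' => ?_, hN, b2, a3, a4,
      a5, b6, b7, bl, I2⟩⟩
    have := B.le
    rw [← h'] at this
    omega
  · have ht : s + 1 = t := by
      by_contra h'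
      exact h (B.lt (s + 1) (lt_of_le_of_ne hst h'))
    have H2 : Hdr P σ2.m := ⟨b0, by rw [a3, B.d, ht], by rw [a4, B.f, ht], by rw [a5, B.h, ht]⟩
    have J2 : FInv P σ2.m (fun _ => j0) j0 := FInv.init b6 b7 hjc bl
    refine wp_hdr G (EV.nm G 0) (wp_hdr G (i := 16) (v := N) ((EV.hd G 8).of_eq ?_) ?_)
    · exact I2.cnt
    set σ4 := (σ3.sto (.hdr 15) 0).sto (.hdr 16) N with hσ4
    have H4 : Hdr P σ4.m := (Hdr.sto (σ := σ3) (by exact H2) 0 (l := .hdr 15)).sto _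
    have J4 : FInv P σ4.m (fun _ => j0) j0 :=
      (FInv.sto_hdr (σ := σ3) (i := 15) (by exact J2)).sto_hdr (i := 16)
    have I4 : EInv P σ4.m S j0 N e :=
      (EInv.sto_hdr (σ := σ3) (i := 15) (by exact I2)).sto_hdr (i := 16)
    have N4 : EV P.lay σ4 NE N := (EV.hd G 8).of_eq I4.cnt
    have c0 : σ4.m (.hdr 0) = P.n := by simp [hσ4, hσ3, b0]
    have c1 : σ4.m (.hdr 1) = j0 := by simp [hσ4, hσ3, b1]
    -- Without entries there is nothing to move, and the main structure takes over directly.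
    by_cases h0 : N = 0
    · subst h0
      have hS : S = fun _ => j0 := funext fun x => I.out x fun _ h => absurd h (Nat.not_lt_zero _)
      refine wp_hdr G (v := 2) (EV.cond_neg N4 (EV.nm G 2)) (hQ _ ⟨?_, ?_, hjc, Or.inr (Or.inr
        ⟨St.sto_m_self _ _ _, H4.sto _, hS ▸ J4.sto_hdr⟩)⟩)
      · rw [St.sto_m_ne _ _ _ _ (by simp)]; exact c0
      · rw [St.sto_m_ne _ _ _ _ (by simp)]; exact c1
    · refine wp_hdr G (v := 1) (EV.cond_pos N4 h0 (EV.nm G 1)) (hQ _ ⟨?_, ?_, hjc, Or.inr (Or.inl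
        ⟨N, e, _, 0, N, B, St.sto_m_self _ _ _, H4.sto _, I4.sto_hdr, J4.sto_hdr, ?_, ?_, by omega,
        le_rfl, by omega, by omega, fun x => ?_⟩)⟩)
      · rw [St.sto_m_ne _ _ _ _ (by simp)]; exact c0
      · rw [St.sto_m_ne _ _ _ _ (by simp)]; exact c1
      · rw [St.sto_m_ne _ _ _ _ (by simp)]; simp [hσ4]
      · rw [St.sto_m_ne _ _ _ _ (by simp)]; simp [hσ4]
      · by_cases hx : S x = j0
        · exact Or.inl hx.symm
        · obtain ⟨s, hs, h⟩ := I.exists_entry hx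
          exact Or.inr ⟨s, by omega, hs, h⟩

theorem wp_ins (G : P.Good) (R : RInv P t σ.m S j0) (hx : σ.ρ 10 = x) (hxn : x < P.n)
    (hj : σ.ρ 11 = j) (hjc : j < P.c) (hQ : ∀ σ', RInv P t σ'.m (Function.update S x j) j0 → Q σ') :
    wp P.lay (insP P.c) Q σ := by
  have M := EV.eq (EV.hd G (σ := σ) 2) (EV.nm G 2)
  rcases R.mode with ⟨s, N, e, B, hst, hN, h2, h3, h4, h5, h6, h7, hm, I⟩ |
    ⟨N, e, sF, i, p, B, h2, H, I, J, hi, hp, hip, hpN, hpt, hN, hS⟩ | ⟨h2, H, J⟩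
  · refine wp_ite_of M (fun h => by omega) fun _ => ?_
    refine wp_eins G I (B.cap _ (by omega)) hx hxn hj hjc ?_
    rintro σ' K F ⟨N', e', h1, h1', -, I'⟩
    refine wp_ite_of ((EV.hd G (σ := σ') 2).eq (EV.nm G 1)) (fun h => ?_) fun _ => ?_
    · rw [F.hdr, h2] at h; omega
    · refine wp_double G B hst (N := N') (by omega) (F.hdr.trans R.n) (F.hdr.trans R.hj0) R.j0c
        (F.hdr.trans h2) (F.hdr.trans h3) (F.hdr.trans h4) (F.hdr.trans h5) (F.hdr.trans h6)
        (F.hdr.trans h7) (fun i hi => ?_) I' hQ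
      rw [F _ (by simp) (by simp)]; exact hm i hi
  -- During the migration the insertion goes to both structures, so they agree at `x`; then one
  -- further entry is moved.
  · refine wp_ite_of M (fun h => by omega) fun _ => ?_
    refine wp_eins G I (B.cap _ (by omega)) hx hxn hj hjc ?_
    rintro σ' K F ⟨N', e', h1, h1', he, I'⟩
    refine wp_ite_of ((EV.hd G (σ := σ') 2).eq (EV.nm G 1)) (fun _ => ?_) fun h => ?_
    · have H' : Hdr P σ'.m := H.of_eq fun i hi => F.hdr (by omega)
      have J' : FInv P σ'.m sF j0 := J.congr fun l h1 h2 => F l h1 fun i hi => by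
        have := h2 i hi; omega
      refine wp_fins G H' J' (F.hdr.trans R.hj0) R.j0c ((K.1 10 (by norm_num)).trans hx) hxn
        ((K.1 11 (by norm_num)).trans hj) hjc ?_
      intro σ2 K2 F2 J2
      have hh : ∀ k, k ≠ 6 → k ≠ 7 → (k < 8 ∨ 14 < k) → σ2.m (.hdr k) = σ.m (.hdr k) :=
        fun k a b c => (F2.1 k a b).trans (F.hdr c)
      refine wp_mig G (i := i) (p := p) B ((hh 0 (by norm_num) (by norm_num) (by norm_num)).trans R.n)
        ((hh 1 (by norm_num) (by norm_num) (by norm_num)).trans R.hj0) R.j0c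
        ((hh 2 (by norm_num) (by norm_num) (by norm_num)).trans h2) (F2.hdr H') (I'.frame F2) J2
        ((hh 15 (by norm_num) (by norm_num) (by norm_num)).trans hi)
        ((hh 16 (by norm_num) (by norm_num) (by norm_num)).trans hp) hip (by omega) hpt (by omega)
        (fun z => ?_) hQ
      by_cases hz : z = x
      · subst hz; left; simp
      · rw [Function.update_of_ne hz, Function.update_of_ne hz]
        rcases hS z with h | ⟨s, a1, a2, rfl⟩
        · exact Or.inl h
        · exact Or.inr ⟨s, a1, a2, he s (by omega)⟩
    · exact absurd (F.hdr.trans h2) h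
  · refine wp_ite_of M (fun _ => ?_) fun h => absurd h2 h
    refine wp_fins G H J R.hj0 R.j0c hx hxn hj hjc fun σ' K F J' => hQ _ ⟨?_, ?_, R.j0c, Or.inr
      (Or.inr ⟨?_, F.hdr H, J'⟩)⟩
    · exact (F.1 0 (by norm_num) (by norm_num)).trans R.n
    · exact (F.1 1 (by norm_num) (by norm_num)).trans R.hj0
    · exact (F.1 2 (by norm_num) (by norm_num)).trans h2

end

/-! ### The operations -/

def lgc (c : ℕ) : ℕ := Nat.log 2 c + 1

/-- The universe is very small. -/
def Tiny (c n w : ℕ) : Prop := n < w ∧ (2 * lgc c + 2) * ((n + 2) * (n + 2)) < w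

instance (c n w : ℕ) : Decidable (Tiny c n w) := inferInstanceAs (Decidable (_ ∧ _))

/-- Only header words are written. In the main case the parameters start with leaves of a single
element, `lgc c` being `fS c 0`; a tiny universe starts with its final parameters and in the final
mode. -/
def initP (c : ℕ) : Pg :=
  .seq (.sto (.cst 0) (.reg 0)) (.seq (.sto (.cst 1) (.reg 1))
  (.seq (.sto (.cst 6) 0) (.seq (.sto (.cst 7) 0)
  (.ite (.cond (.lt (.reg 0) .wl)
      (.lt (.cst (2 * lgc c + 2) * ((Ex.reg 0 + 2) * (Ex.reg 0 + 2))) .wl) 0)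
    (.seq (.sto (.cst 2) 2) (.seq (.sto (.cst 3) (.reg 0 + 1))
      (.seq (.sto (.cst 4) (.cst (lgc c) * (.reg 0 + 1))) (.sto (.cst 5) (.wl / 2 - 1)))))
    (.seq (.sto (.cst 2) 0) (.seq (.sto (.cst 3) 1) (.seq (.sto (.cst 4) (.cst (lgc c)))
    (.seq (.sto (.cst 5) 8) (.seq (.sto (.cst 8) 0) (.seq (.sto (.cst 9) 0)
    (.seq (.sto (.cst 10) 0) (.seq (.sto (.cst 11) 0) (.seq (.sto (.cst 12) 0)
    (.seq (.sto (.cst 13) (.reg 0)) (.sto (.cst 14) 0)))))))))))))))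
def insertP (c : ℕ) : Pg :=
  .seq (.set 10 (.reg 0 - 1)) (.seq (.set 11 (.reg 1)) (insP c))
def deleteP (c : ℕ) : Pg :=
  .seq (.set 10 (.reg 0 - 1)) (.seq (.set 11 (.reg 2))
    (.ite (.eq (colX c (.reg 10)) (.reg 1)) (insP c) .skip))
def searchP (c : ℕ) : Pg := .set 0 (.eq (colX c (.reg 0 - 1)) (.reg 1))
def findP (c : ℕ) : Pg := .seq (.set 10 (.reg 0)) (.ite (.eq (hd 2) 2) (ffindP c) (efindP c))
def enumP (c : ℕ) : Pg := .seq (.set 10 (.reg 0)) (.ite (.eq (hd 2) 2) (fenumP c) (eenumP c))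

def coll (c : ℕ) : SetCollection where
  init := (initP c).compile
  insert := (insertP c).compile
  delete := (deleteP c).compile
  search := (searchP c).compile
  findany := (findP c).compile
  enumerate := (enumP c).compile

/-- The time bound. -/
def timeK (c : ℕ) : ℕ :=
  (initP c).cost + (insertP c).cost + (deleteP c).cost + (searchP c).cost + (findP c).cost +
    fenumK c + eenumK c + 8

/-- Costs count the nodes of the program texts, in which `c` appears only as a constant. Hence the
time bound is independent of the number of colours, definitionally. -/
theorem timeK_eq (c : ℕ) : timeK c = timeK 0 := rfl

section
variable {P : Par} {t : ℕ} {σ : St} {S : ℕ → ℕ} {j0 x j l : ℕ} {Q : St → Prop}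

theorem wp_init (G : P.Good) (hn : σ.ρ 0 = P.n) (hj : σ.ρ 1 = j) (hjc : j < P.c)
    (hm : ∀ i ≤ P.nl / P.r, σ.m (.lf i) < 2 ^ P.w) (hb : (2 * lgc P.c + 2) * ((P.w + 1) * (P.w + 1)) < 2 ^ P.w)
    (hs : Tiny P.c P.n P.w → P.d = P.n + 1 ∧ P.f = lgc P.c * (P.n + 1) ∧ P.h = P.w / 2 - 1)
    (hB : ¬ Tiny P.c P.n P.w → Big P t) (hQ : ∀ σ', RInv P t σ'.m (fun _ => j) j → Q σ') :
    wp P.lay (initP P.c) Q σ := by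
  have hw := G.w_lt
  have hww := G.ww_lt
  have h64 := G.w_ge
  have hb0 : 2 * lgc P.c + 2 < 2 ^ P.w :=
    (Nat.le_mul_of_pos_right _ (by positivity)).trans_lt hb
  have hw1 : P.w + 1 < 2 ^ P.w := lt_of_le_of_lt (by nlinarith) hww
  have N0 : ∀ σ' : St, σ'.ρ = σ.ρ → EV P.lay σ' (.reg 0) P.n := fun σ' h => EV.reg (by rw [h, hn])
  refine wp_hdr G (N0 σ rfl) (wp_hdr G (EV.reg (v := j) hj) (wp_hdr G (EV.nm G 0)
    (wp_hdr G (EV.nm G 0) ?_)))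
  set σ1 := (((σ.sto (.hdr 0) P.n).sto (.hdr 1) j).sto (.hdr 6) 0).sto (.hdr 7) 0 with hσ1
  have N1 : EV P.lay σ1 (.reg 0) P.n := N0 σ1 rfl
  have hl : ∀ i ≤ P.nl / P.r, σ1.m (.lf i) < 2 ^ P.w := fun i hi => by
    simpa [hσ1] using hm i hi
  have T : EV P.lay σ1 (.cond (.lt (.reg 0) .wl)
      (.lt (.cst (2 * lgc P.c + 2) * ((Ex.reg 0 + 2) * (Ex.reg 0 + 2))) .wl) 0)
      (if Tiny P.c P.n P.w then 1 else 0) := by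
    refine EV.cond (N1.lt EV.wl) (fun h => ?_) fun h => (EV.nm G 0).of_eq ?_
    · simp only [Par.lay_w] at h
      have h1 : EV P.lay σ1 (Ex.reg 0 + 2) (P.n + 2) :=
        N1.add (EV.nm G 2) (by simp only [Par.lay_w]; omega)
      have h2 : (P.n + 2) * (P.n + 2) ≤ (P.w + 1) * (P.w + 1) := Nat.mul_le_mul (by omega) (by omega)
      have h3 := Nat.mul_le_mul_left (2 * lgc P.c + 2) h2
      have h4 : (P.w + 1) * (P.w + 1) ≤ (2 * lgc P.c + 2) * ((P.w + 1) * (P.w + 1)) :=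
        Nat.le_mul_of_pos_left _ (by omega)
      refine ((EV.cst (v := 2 * lgc P.c + 2) ?_).mul (h1.mul h1 ?_) ?_).lt' EV.wl ?_
      · simp only [Par.lay_w]; omega
      · simp only [Par.lay_w]; omega
      · simp only [Par.lay_w]; omega
      · simp [Tiny, h]
    · rw [if_neg]; exact fun h' => h h'.1
  refine wp_ite_of T (fun h => ?_) fun h => ?_
  · obtain ⟨h1, h2, h3⟩ := hs h
    have hnw := h.1
    have hf := G.f_lt
    have hle : lgc P.c ≤ P.f := by rw [h2]; exact Nat.le_mul_of_pos_right _ (by omega)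
    have NX : ∀ σ' : St, σ'.ρ = σ.ρ → EV P.lay σ' (Ex.reg 0 + 1) (P.n + 1) := fun σ' h =>
      (N0 σ' h).add (EV.nm G 1) (by simp only [Par.lay_w]; omega)
    refine wp_hdr G (EV.nm G 2) (wp_hdr G (NX _ rfl) (wp_hdr G ((EV.cst (v := lgc P.c) ?_).mul (NX _ rfl) ?_)
      (wp_hdr G ((EV.wl.div (EV.nm G 2)).sub (EV.nm G 1) ?_) (hQ _ ⟨by simp [hσ1], by simp [hσ1], hjc,
      Or.inr (Or.inr ⟨by simp, ⟨by simp [hσ1], by simp [h1], by simp [h2], by simp [h3]⟩,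
      FInv.init (by simp [hσ1]) (by simp [hσ1]) hjc fun i hi => by simpa using hl i hi⟩)⟩))))
    · simp only [Par.lay_w]; omega
    · rw [← h2]; simp only [Par.lay_w]; omega
    · simp only [Par.lay_w]; omega
  · have B := hB h
    have ht : 0 < t := by
      rcases Nat.eq_zero_or_pos t with rfl | h
      · have := B.le; simp at this; omega
      · exact h
    refine wp_hdr G (EV.nm G 0) (wp_hdr G (EV.nm G 1) (wp_hdr G (EV.cst (v := lgc P.c) ?_)
      (wp_hdr G (EV.nm G 8) (wp_hdr G (EV.nm G 0) (wp_hdr G (EV.nm G 0) (wp_hdr G (EV.nm G 0)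
      (wp_hdr G (EV.nm G 0) (wp_hdr G (EV.nm G 0) (wp_hdr G (N0 _ rfl) (wp_hdr G (EV.nm G 0)
      (hQ _ ⟨by simp [hσ1], by simp [hσ1], hjc, Or.inl ⟨0, 0, fun _ => 0, B, ht, le_rfl, by simp,
      by simp, by simp [fS, lgc], by simp, by simp [hσ1], by simp [hσ1], fun i hi => by simpa using hl i hi,
      EInv.init (B.cap 0 (by omega)) ?_ ?_ ?_ ?_ ?_ ?_ ?_ hjc⟩⟩)))))))))))
    · simp only [Par.lay_w]; omega
    all_goals simp

theorem wp_insert (G : P.Good) (R : RInv P t σ.m S j0) (hx : σ.ρ 0 = x + 1) (hxn : x < P.n)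
    (hj : σ.ρ 1 = j) (hjc : j < P.c) (hQ : ∀ σ', RInv P t σ'.m (Function.update S x j) j0 → Q σ') :
    wp P.lay (insertP P.c) Q σ := by
  refine wp_set_of ((EV.reg hx).sub (EV.nm G 1) (by omega)) (wp_set_of (EV.reg (v := j) (by simp [hj]))
    (wp_ins G (by exact R) (by simp) hxn (by simp) hjc hQ))

theorem wp_delete (G : P.Good) (R : RInv P t σ.m S j0) (hx : σ.ρ 0 = x + 1) (hxn : x < P.n)
    (hj : σ.ρ 1 = j) (hl : σ.ρ 2 = l) (hlc : l < P.c)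
    (hQ : ∀ σ', RInv P t σ'.m (if S x = j then Function.update S x l else S) j0 → Q σ') :
    wp P.lay (deleteP P.c) Q σ := by
  refine wp_set_of ((EV.reg hx).sub (EV.nm G 1) (by omega)) (wp_set_of (EV.reg (v := l) (by simp [hl]))
    (wp_ite_of ((EV.colX G (by exact R) (EV.reg (v := x) (by simp)) hxn).eq
      (EV.reg (v := j) (by simp [hj]))) (fun h => ?_) fun h => ?_))
  · rw [if_pos h] at hQ
    exact wp_ins G (by exact R) (by simp) hxn (by simp) hlc hQ
  · rw [if_neg h] at hQ
    exact hQ _ R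

theorem wp_search (G : P.Good) (R : RInv P t σ.m S j0) (hx : σ.ρ 0 = x + 1) (hxn : x < P.n)
    (hj : σ.ρ 1 = j) (hQ : ∀ σ' : St, σ'.m = σ.m → σ'.ρ 0 = (if S x = j then 1 else 0) → Q σ') :
    wp P.lay (searchP P.c) Q σ :=
  wp_set_of ((EV.colX G R ((EV.reg hx).sub (EV.nm G 1) (by omega)) hxn).eq (EV.reg hj))
    (hQ _ rfl (St.set_ρ_self _ _ _))

theorem wp_find (G : P.Good) (R : RInv P t σ.m S j0) (hj : σ.ρ 0 = j) (hjc : j < P.c)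
    (hQ : ∀ σ' : St, σ'.m = σ.m → ((∃ x < P.n, S x = j ∧ σ'.ρ 0 = x + 1) ∨
      ((∀ x < P.n, S x ≠ j) ∧ σ'.ρ 0 = 0)) → Q σ') : wp P.lay (findP P.c) Q σ := by
  refine wp_set_of (EV.reg hj) ?_
  set σ1 := σ.set 10 j with hσ1
  have h10 : σ1.ρ 10 = j := St.set_ρ_self _ _ _
  have M := EV.eq (EV.hd G (σ := σ1) 2) (EV.nm G 2)
  rcases R.mode with ⟨s, N, e, -, -, -, h2, -, -, -, -, -, -, I⟩ |
    ⟨N, e, -, -, -, -, h2, -, I, -⟩ | ⟨h2, H, I⟩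
  · exact wp_ite_of M (fun h => by simp [hσ1, h2] at h) fun _ => wp_efind G I R.hj0 h10 hjc hQ
  · exact wp_ite_of M (fun h => by simp [hσ1, h2] at h) fun _ => wp_efind G I R.hj0 h10 hjc hQ
  · exact wp_ite_of M (fun _ => wp_ffind G H I R.hj0 R.j0c h10 hjc hQ) fun h => absurd h2 h

theorem tr_enum (G : P.Good) (R : RInv P t σ.m S j0) (hj : σ.ρ 0 = j) (hjc : j < P.c) :
    ∃ L : List ℕ, L.Nodup ∧ (∀ x, x ∈ L ↔ x < P.n ∧ S x = j) ∧
      Tr P.lay (enumP P.c) σ (timeK P.c * (L.length + 1)) fun σ' =>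
        σ'.m = σ.m ∧ σ'.out = σ.out ++ L.map (· + 1) := by
  set σ1 := σ.set 10 j with hσ1
  have h10 : σ1.ρ 10 = j := St.set_ρ_self _ _ _
  have M := EV.eq (EV.hd G (σ := σ1) 2) (EV.nm G 2)
  have glue : ∀ (L : List ℕ) (K : ℕ), K + 8 ≤ timeK P.c →
      Tr P.lay (.ite (.eq (hd 2) 2) (fenumP P.c) (eenumP P.c)) σ1
        ((Ex.eq (hd 2) 2).cost + 1 + K * (L.length + 1)) (fun σ' =>
        σ'.m = σ.m ∧ σ'.out = σ.out ++ L.map (· + 1)) →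
      Tr P.lay (enumP P.c) σ (timeK P.c * (L.length + 1)) fun σ' =>
        σ'.m = σ.m ∧ σ'.out = σ.out ++ L.map (· + 1) := fun L K hK h => by
    refine (Tr.seq (p := .set 10 (.reg 0)) (R := fun σ' => σ' = σ1)
      (wp_sound G.w_pos _ (wp_set_of (EV.reg hj) rfl)) (by rintro _ rfl; exact h)).mono ?_ fun _ h => h
    have : (K + 8) * (L.length + 1) ≤ timeK P.c * (L.length + 1) := Nat.mul_le_mul_right _ hK
    rw [Nat.add_mul] at this
    simp only [Ex.cost, Ex.eq, hd, Pg.cost]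
    omega
  have hE : eenumK P.c + 8 ≤ timeK P.c := by unfold timeK; omega
  have hF : fenumK P.c + 8 ≤ timeK P.c := by unfold timeK; omega
  rcases R.mode with ⟨s, N, e, -, -, -, h2, -, -, -, -, -, -, I⟩ |
    ⟨N, e, -, -, -, -, h2, -, I, -⟩ | ⟨h2, H, I⟩
  · obtain ⟨L, h1, h3, h4⟩ := tr_eenum G (σ := σ1) R.n I R.hj0 h10 hjc
    exact ⟨L, h1, h3, glue L _ hE (Tr.ite G.w_pos M.1
      (fun h => absurd (M.2.trans (if_neg (by simp [hσ1, h2]))) h) fun _ => h4)⟩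
  · obtain ⟨L, h1, h3, h4⟩ := tr_eenum G (σ := σ1) R.n I R.hj0 h10 hjc
    exact ⟨L, h1, h3, glue L _ hE (Tr.ite G.w_pos M.1
      (fun h => absurd (M.2.trans (if_neg (by simp [hσ1, h2]))) h) fun _ => h4)⟩
  · obtain ⟨L, h1, h3, h4⟩ := tr_fenum G (σ := σ1) H I R.hj0 R.j0c h10 hjc
    exact ⟨L, h1, h3, glue L _ hF (Tr.ite G.w_pos M.1 (fun _ => h4) fun h => absurd
      (h.symm.trans (M.2.trans (if_pos h2))) (by norm_num))⟩

/-- The memory contents represent a partition. -/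
def Rep (P : Par) (t : ℕ) (S : Fin P.n → Fin P.c) (mem : ℕ → BitVec P.w) : Prop :=
  ∃ (m : Loc → ℕ) (S' : ℕ → ℕ) (j0 : ℕ), (∀ l, P.valid l → (mem (P.addr l)).toNat = m l) ∧ (∀ i : Fin P.n, S' i = S i) ∧
    RInv P t m S' j0

/-- Registers that are not arguments are arbitrary, so the abstract run has to succeed from every
register file that extends the arguments. -/
theorem call_of {p : Pg} {args : List (BitVec P.w)} {mem : ℕ → BitVec P.w} {m : Loc → ℕ} {T : ℕ}
    {post : State P.w → Prop} (hm : ∀ l, P.valid l → (mem (P.addr l)).toNat = m l)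
    (h : ∀ ρ : ℕ → ℕ, (∀ (k : ℕ) (hk : k < args.length), ρ k = args[k].toNat) →
      Tr P.lay p ⟨ρ, m, []⟩ T fun σ' => ∀ s : State P.w, P.lay.Sim s σ' → post s) :
    Call P.M p.compile args mem T post := by
  intro regs hr
  obtain ⟨s', k, σ', hk, he, hs, hp⟩ := h (fun r => (regs r).toNat) (fun k hk => by rw [hr k hk])
    ⟨regs, mem, []⟩ ⟨fun _ _ => rfl, hm, rfl⟩
  exact ⟨k, s', hk, he, hp s' hs⟩

theorem eltWord_toNat (G : P.Good) (i : Fin P.n) : (eltWord P.w i).toNat = i + 1 := by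
  have := G.n_lt
  have := i.2
  simp only [eltWord, BitVec.toNat_ofNat]
  exact Nat.mod_eq_of_lt (by omega)

theorem idxWord_toNat (G : P.Good) (j : Fin P.c) : (idxWord P.w j).toNat = j := by
  have := G.c_lt
  have := j.2
  simp only [idxWord, BitVec.toNat_ofNat]
  exact Nat.mod_eq_of_lt (by omega)

theorem mem_cell {n c : ℕ} {S : Fin n → Fin c} {i : Fin n} {j : Fin c} : i ∈ cell S j ↔ S i = j := by
  simp [cell]

theorem Rep.upd {S : Fin P.n → Fin P.c} {S' : ℕ → ℕ} (hS : ∀ i : Fin P.n, S' i = S i) (i : Fin P.n)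
    (j : Fin P.c) (k : Fin P.n) : Function.update S' i j k = (Function.update S i j k : Fin P.c) := by
  by_cases h : k = i
  · subst h; simp
  · rw [Function.update_of_ne h, Function.update_of_ne (fun e => h (Fin.ext e)), hS]

/-- Initialisation may read the logical memory off any machine memory; the other operations start
from the logical memory and the initial colour provided by `Rep`. Queries leave the logical memory
as it was. -/
theorem maintains (G : P.Good) (hb : (2 * lgc P.c + 2) * ((P.w + 1) * (P.w + 1)) < 2 ^ P.w)
    (hs : Tiny P.c P.n P.w → P.d = P.n + 1 ∧ P.f = lgc P.c * (P.n + 1) ∧ P.h = P.w / 2 - 1)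
    (hB : ¬ Tiny P.c P.n P.w → Big P t) :
    (coll P.c).Maintains P.n P.c P.w P.M (timeK P.c) (Rep P t) := by
  have hE := eltWord_toNat G
  have hI := idxWord_toNat G
  constructor
  · intro j mem
    refine call_of (m := fun l => (mem (P.addr l)).toNat) (fun _ _ => rfl) fun ρ hρ => ?_
    refine (wp_sound G.w_pos (initP P.c) (wp_init G (j := j) (t := t) ?_ ?_ j.2 (fun i _ => (mem _).isLt)
      hb hs hB fun σ' R s hs => ⟨σ'.m, _, _, hs.mem, fun _ => rfl, R⟩)).mono
      (by unfold timeK; omega) fun _ h => h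
    · refine (hρ 0 (by simp)).trans ?_
      simp only [List.getElem_cons_zero, BitVec.toNat_ofNat]
      exact Nat.mod_eq_of_lt G.n_lt
    · exact (hρ 1 (by simp)).trans (hI j)
  · rintro S mem ⟨m, S', j0, hm, hS, R⟩ i j
    refine call_of hm fun ρ hρ => (wp_sound G.w_pos (insertP P.c) (wp_insert G R (x := i) (j := j)
      ((hρ 0 (by simp)).trans (hE i)) i.2 ((hρ 1 (by simp)).trans (hI j)) j.2
      fun σ' R s hs => ⟨σ'.m, _, _, hs.mem, Rep.upd hS i j, R⟩)).mono
      (by unfold timeK; omega) fun _ h => h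
  · rintro S mem ⟨m, S', j0, hm, hS, R⟩ i j l
    refine call_of hm fun ρ hρ => (wp_sound G.w_pos (deleteP P.c) (wp_delete G R (x := i) (j := j) (l := l)
      ((hρ 0 (by simp)).trans (hE i)) i.2 ((hρ 1 (by simp)).trans (hI j))
      ((hρ 2 (by simp)).trans (hI l)) l.2 fun σ' R s hs => ⟨σ'.m, _, _, hs.mem, ?_, R⟩)).mono
      (by unfold timeK; omega) fun _ h => h
    intro k
    simp only [mem_cell, hS, Fin.val_inj]
    split_ifs
    · exact Rep.upd hS i l k
    · exact hS k
  · rintro S mem ⟨m, S', j0, hm, hS, R⟩ i j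
    refine call_of hm fun ρ hρ => (wp_sound G.w_pos (searchP P.c) (wp_search G R (x := i) (j := j)
      ((hρ 0 (by simp)).trans (hE i)) i.2 ((hρ 1 (by simp)).trans (hI j))
      fun σ' hm' h0 s hs => ⟨⟨m, S', j0, fun l hl => ?_, hS, R⟩, ?_⟩)).mono
      (by unfold timeK; omega) fun _ h => h
    · exact (hs.mem l hl).trans (congrFun hm' l)
    · have h1 := (hs.regs 0 (by norm_num)).trans h0
      have h2 : (1 : ℕ) < 2 ^ P.w := G.small (by norm_num)
      simp only [hS, Fin.val_inj, mem_cell] at h1 ⊢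
      apply BitVec.eq_of_toNat_eq
      refine h1.trans ?_
      split_ifs
      · simp [Nat.mod_eq_of_lt h2]
      · simp
  · rintro S mem ⟨m, S', j0, hm, hS, R⟩ j
    refine call_of hm fun ρ hρ => (wp_sound G.w_pos (findP P.c) (wp_find G R (j := j)
      ((hρ 0 (by simp)).trans (hI j)) j.2
      fun σ' hm' h0 s hs => ⟨⟨m, S', j0, fun l hl => ?_, hS, R⟩, ?_⟩)).mono
      (by unfold timeK; omega) fun _ h => h
    · exact (hs.mem l hl).trans (congrFun hm' l)
    · have h1 := hs.regs 0 (by norm_num)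
      rcases h0 with ⟨x, hx, hSx, h⟩ | ⟨hx, h⟩
      · refine Or.inl ⟨⟨x, hx⟩, mem_cell.2 (Fin.ext ((hS ⟨x, hx⟩).symm.trans hSx)), ?_⟩
        apply BitVec.eq_of_toNat_eq
        exact (h1.trans h).trans (hE ⟨x, hx⟩).symm
      · refine Or.inr ⟨Finset.eq_empty_of_forall_notMem fun i hi => hx i i.2 ?_, ?_⟩
        · rw [hS, mem_cell.1 hi]
        · apply BitVec.eq_of_toNat_eq
          exact (h1.trans h).trans (by simp)
  · rintro S mem ⟨m, S', j0, hm, hS, R⟩ j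
    refine call_of hm fun ρ hρ => ?_
    obtain ⟨L, h1, h2, h3⟩ := tr_enum G (σ := ⟨ρ, m, []⟩) R (j := j) ((hρ 0 (by simp)).trans (hI j)) j.2
    set L' : List (Fin P.n) := L.pmap (fun x h => ⟨x, h⟩) fun x hx => ((h2 x).1 hx).1 with hL'
    have hnd : L'.Nodup := h1.pmap fun a _ b _ h => congrArg Fin.val h
    have hc : L'.toFinset = cell S j := by
      ext i
      rw [List.mem_toFinset, mem_cell, hL', List.mem_pmap]
      constructor
      · rintro ⟨x, hx, rfl⟩
        exact Fin.ext ((hS _).symm.trans ((h2 x).1 hx).2)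
      · intro h
        exact ⟨i, (h2 _).2 ⟨i.2, by rw [hS, h]⟩, rfl⟩
    have hlen : (cell S j).card = L.length := by
      rw [← hc, List.toFinset_card_of_nodup hnd, hL', List.length_pmap]
    rw [hlen]
    refine h3.mono le_rfl fun σ' h s hs => ⟨⟨m, S', j0, fun l hl => ?_, hS, R⟩, L', hnd, hc, ?_⟩
    · exact (hs.mem l hl).trans (congrFun h.1 l)
    · have h4 := hs.out.trans h.2
      rw [List.nil_append] at h4
      apply List.map_injective_iff.2 (fun a b h => BitVec.eq_of_toNat_eq h)
      refine h4.trans ?_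
      rw [List.map_map]
      have : (BitVec.toNat ∘ eltWord P.w) = fun i : Fin P.n => (i : ℕ) + 1 := funext hE
      rw [this, hL', List.map_pmap]
      simp [List.pmap_eq_map]

end

/-! ### The choice of the parameters, and space -/

theorem succ_pow_le {m : ℕ} (hm : 40 ≤ m) : (m + 1) ^ 6 ≤ 2 ^ (m - 1) := by
  induction m, hm using Nat.le_induction with
  | base => norm_num
  | succ m hm ih =>
    have e : 2 ^ (m + 1 - 1) = 2 * 2 ^ (m - 1) := by rw [← pow_succ']; congr 1; omega
    rw [e]
    refine le_trans ?_ (Nat.mul_le_mul_left 2 ih)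
    obtain ⟨k, rfl⟩ : ∃ k, m = k + 40 := ⟨m - 40, by omega⟩
    have : 0 ≤ k := Nat.zero_le _
    ring_nf
    nlinarith [pow_nonneg this 2, pow_nonneg this 3, pow_nonneg this 4, pow_nonneg this 5,
      pow_nonneg this 6]

theorem succ_sq_le (t : ℕ) : (t + 1) * (t + 1) ≤ 3 * 2 ^ t := by
  induction t with
  | zero => norm_num
  | succ t ih =>
    rcases Nat.lt_or_ge t 3 with h | h
    · interval_cases t <;> norm_num
    · rw [pow_succ]; nlinarith

theorem lgc_le (c : ℕ) : lgc c ≤ c + 1 := Nat.succ_le_succ (Nat.log_le_self 2 c)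

theorem tiny_bound {c w : ℕ} (hw : 1000 * (c + 1) ≤ w) :
    (2 * lgc c + 2) * ((w + 1) * (w + 1)) < 2 ^ w := by
  have h1 := lgc_le c
  have h2 := succ_pow_le (m := w) (by omega)
  have h3 : 2 ^ (w - 1) < 2 ^ w := Nat.pow_lt_pow_right (by norm_num) (by omega)
  calc (2 * lgc c + 2) * ((w + 1) * (w + 1)) ≤ (w + 1) * ((w + 1) * (w + 1)) :=
        Nat.mul_le_mul_right _ (by omega)
    _ = (w + 1) ^ 3 := by ring
    _ ≤ (w + 1) ^ 6 := Nat.pow_le_pow_right (by omega) (by norm_num)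
    _ < _ := by omega

theorem const_lt {c w : ℕ} (hw : 1000 * (c + 1) ≤ w) : 4 * c + 64 < 2 ^ w :=
  lt_of_le_of_lt (by omega) (Nat.lt_two_pow_self (n := w))

theorem ceil_le_succ (a b : ℕ) : a / b + (if 0 < a % b then 1 else 0) ≤ a / b + 1 := by
  split_ifs <;> omega

/-- The universe is one leaf of size `n + 1`, which is positive even for `n = 0`, and `h = w / 2 -
1` makes `q = 1`. The memory then has O(c) cells, which the term `K * w` absorbs. -/
theorem tiny_spec {c n w : ℕ} (hc : 1 ≤ c) (hw : 1000 * (c + 1) ≤ w) (hn : n < 2 ^ w)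
    (hT : Tiny c n w) {P : Par} (hP : P = ⟨c, n, w, n + 1, lgc c * (n + 1), w / 2 - 1⟩) :
    P.Good ∧ P.M ≤ 9 * c + 32 := by
  have hb : 1 ≤ lgc c := Nat.le_add_left _ _
  have hM : P.M ≤ 9 * c + 32 := by
    have h1 : P.nl ≤ 1 := by
      have : n / (n + 1) = 0 := Nat.div_eq_of_lt (by omega)
      subst hP; unfold Par.nl; simp only [this]; split_ifs <;> omega
    have h2 : P.nb ≤ P.nl := ceil_le _ _
    have h3 : P.nk = 1 := by
      have : n / (w * w) = 0 := Nat.div_eq_of_lt (by nlinarith [hT.1])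
      subst hP; simp only [Par.nk, this]
    have h4 : P.nl / P.r ≤ P.nl := Nat.div_le_self _ _
    have h5 : P.nb * P.S ≤ 1 * P.S := Nat.mul_le_mul_right _ (h2.trans h1)
    have h6 : P.S = 3 * c + 3 := by subst hP; rfl
    have h7 : P.c = c := by subst hP; rfl
    unfold Par.M Par.LB Par.FB; omega
  have hd : (2 * (lgc c * (n + 1)) + 2) * (n + 1 + 1) < w := by
    refine lt_of_le_of_lt ?_ hT.2
    calc _ ≤ (2 * lgc c + 2) * (n + 2) * (n + 2) := Nat.mul_le_mul_right _ (by nlinarith)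
      _ = _ := by ring
  have hcl := const_lt hw
  refine ⟨?_, hM⟩
  subst hP
  refine ⟨⟨hc, Nat.le_add_left _ _, ?_⟩, hd, ?_, ?_, ?_, ?_, hn, ?_, hcl, ?_, ?_⟩
  · change c ^ (n + 1) < 2 ^ (lgc c * (n + 1))
    rw [pow_mul]
    exact Nat.pow_lt_pow_left (Nat.lt_pow_succ_log_self (by norm_num) c) (by omega)
  · exact (Nat.le_mul_of_pos_left (n + 1) hb).trans_lt Nat.lt_two_pow_self
  · simp only; omega
  · simp only; omega
  · simp only
    have h1 : w / (w / 2 - 1) < 3 := (Nat.div_lt_iff_lt_mul (by omega)).2 (by omega)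
    have h2 : 2 ^ 2 ≤ 2 ^ (w / 2 - 1) := Nat.pow_le_pow_right (by norm_num) (by omega)
    omega
  · exact hM.trans (lt_of_le_of_lt (by omega) (Nat.lt_two_pow_self (n := w))).le
  · simp only; omega
  · simp only; omega

/-- The space in terms of the parameters. -/
theorem space_le {P : Par} (hd : 0 < P.d) (hdw : P.d ≤ P.w) (hr : P.w ≤ (P.f + 1) * P.r)
    (hq : P.w ≤ 3 * P.h * P.q) (hh : 2 * P.h ≤ P.w) (hf : P.f + 1 ≤ P.w) :
    (P.M * P.w : ℝ) ≤ P.n / P.d * (P.f + 3 + 9 * (P.c + 1) * P.h) + (9 * P.c + 32) * P.w := by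
  have hw0 : 0 < P.w := by omega
  have hr0 : 0 < P.r := Nat.pos_of_ne_zero fun h => by rw [h] at hr; omega
  have hq0 : 0 < P.q := Nat.pos_of_ne_zero fun h => by rw [h] at hq; omega
  have hw1 : (0 : ℝ) < P.w := by exact_mod_cast hw0
  have hr1 : (0 : ℝ) < P.r := by exact_mod_cast hr0
  have hq1 : (0 : ℝ) < P.q := by exact_mod_cast hq0
  have hd1 : (0 : ℝ) < P.d := by exact_mod_cast hd
  have hdw' : (P.d : ℝ) ≤ P.w := by exact_mod_cast hdw
  have hr' : (P.w : ℝ) ≤ (P.f + 1) * P.r := by exact_mod_cast hr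
  have hq' : (P.w : ℝ) ≤ 3 * P.h * P.q := by exact_mod_cast hq
  have hh' : (2 * P.h : ℝ) ≤ P.w := by exact_mod_cast hh
  have hf' : (P.f + 1 : ℝ) ≤ P.w := by exact_mod_cast hf
  have hn0 : (0 : ℝ) ≤ P.n := Nat.cast_nonneg _
  -- All terms are measured against the number `x` of leaves. Each rounding up of a number of
  -- leaves, blocks, buckets or words costs a bounded number of words, collected in the last
  -- summand.
  set x : ℝ := P.n / P.d with hx
  have hx0 : 0 ≤ x := by positivity
  have hnl : (P.nl : ℝ) ≤ x + 1 := by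
    have h1 : (P.nl : ℝ) ≤ ((P.n / P.d : ℕ) : ℝ) + 1 := by exact_mod_cast ceil_le_succ _ _
    have h2 : ((P.n / P.d : ℕ) : ℝ) ≤ P.n / P.d := Nat.cast_div_le
    linarith
  have hnb : (P.w * P.nb : ℝ) ≤ 3 * P.h * (x + 1) + P.w := by
    have h1 : (P.nb : ℝ) ≤ ((P.nl / P.q : ℕ) : ℝ) + 1 := by exact_mod_cast ceil_le_succ _ _
    have h2 : ((P.nl / P.q : ℕ) : ℝ) ≤ P.nl / P.q := Nat.cast_div_le
    have h3 : (P.w * (P.nl / P.q) : ℝ) ≤ 3 * P.h * P.nl := by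
      rw [← mul_div_assoc, div_le_iff₀ hq1]
      nlinarith [mul_le_mul_of_nonneg_right hq' (Nat.cast_nonneg (α := ℝ) P.nl)]
    have h4 : (3 * P.h * P.nl : ℝ) ≤ 3 * P.h * (x + 1) :=
      mul_le_mul_of_nonneg_left hnl (by positivity)
    nlinarith [mul_le_mul_of_nonneg_left (h1.trans (add_le_add_left h2 1)) hw1.le]
  have hnk : (P.w * P.nk : ℝ) ≤ x + P.w := by
    have h1 : (P.nk : ℝ) = ((P.n / (P.w * P.w) : ℕ) : ℝ) + 1 := by unfold Par.nk; push_cast; ring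
    have h2 : ((P.n / (P.w * P.w) : ℕ) : ℝ) ≤ P.n / (P.w * P.w) := by
      refine Nat.cast_div_le.trans (le_of_eq ?_); push_cast; rfl
    have h3 : (P.w * (P.n / (P.w * P.w)) : ℝ) = P.n / P.w := by field_simp
    have h4 : (P.n / P.w : ℝ) ≤ x := div_le_div_of_nonneg_left hn0 hd1 hdw'
    rw [h1]
    nlinarith [mul_le_mul_of_nonneg_left h2 hw1.le]
  have hlr : (P.w * (P.nl / P.r : ℕ) : ℝ) ≤ (P.f + 1) * (x + 1) := by
    have h2 : ((P.nl / P.r : ℕ) : ℝ) ≤ P.nl / P.r := Nat.cast_div_le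
    have h3 : (P.w * (P.nl / P.r) : ℝ) ≤ (P.f + 1) * P.nl := by
      rw [← mul_div_assoc, div_le_iff₀ hr1]
      nlinarith [mul_le_mul_of_nonneg_right hr' (Nat.cast_nonneg (α := ℝ) P.nl)]
    have h4 : ((P.f + 1) * P.nl : ℝ) ≤ (P.f + 1) * (x + 1) :=
      mul_le_mul_of_nonneg_left hnl (by positivity)
    nlinarith [mul_le_mul_of_nonneg_left h2 hw1.le]
  have hM : (P.M * P.w : ℝ) = (20 + P.c + 1) * P.w + 2 * (P.w * P.nk) +
      (3 * P.c + 3) * (P.w * P.nb) + P.w * (P.nl / P.r : ℕ) := by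
    unfold Par.M Par.LB Par.FB Par.S; push_cast; ring
  have hc0 : (0 : ℝ) ≤ P.c := Nat.cast_nonneg _
  have h1 := mul_le_mul_of_nonneg_left hnb (show (0 : ℝ) ≤ 3 * P.c + 3 by positivity)
  have h2 := mul_le_mul_of_nonneg_left hh' (show (0 : ℝ) ≤ P.c + 1 by positivity)
  have h3 := mul_nonneg hc0 hw1.le
  rw [hM]
  nlinarith

theorem lgc_fS_le {c : ℕ} (hc : 1 ≤ c) (t : ℕ) :
    (fS c t : ℝ) ≤ t + 1 + 2 ^ t * Real.logb 2 c := by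
  have hc0 : (c : ℝ) ≠ 0 := by positivity
  have h1 : ((2 ^ fS c t : ℕ) : ℝ) ≤ ((2 ^ (t + 1) * c ^ 2 ^ t : ℕ) : ℝ) := by
    exact_mod_cast le_fS hc t
  have h2 := Real.logb_le_logb_of_le (b := 2) (by norm_num) (by positivity) h1
  push_cast at h2
  rw [Real.logb_mul (by positivity) (by positivity), Real.logb_pow, Real.logb_pow, Real.logb_pow,
    Real.logb_self_eq_one (by norm_num)] at h2
  push_cast at h2
  linarith

/-- The lower order term. -/
noncomputable def lowK (c : ℕ) : ℝ := 24 * (72 * c + 76)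

/-- The true overhead depends on `w` through `t`. Longer words only make the leaves larger and the
relative overhead smaller, and `n < 2 ^ w` bounds `w` from below, so a function of `n` alone can
dominate it. -/
noncomputable def lowg (c n : ℕ) : ℝ := lowK c / ((Nat.log 2 (Nat.log 2 n) : ℝ) + 1) * n

theorem lowg_isLittleO (c : ℕ) : (lowg c) =o[atTop] fun n : ℕ => (n : ℝ) := by
  have h1 : Tendsto (Nat.log 2) atTop atTop := tendsto_atTop.2 fun b =>
    (eventually_ge_atTop (2 ^ b)).mono fun n hn => Nat.le_log_of_pow_le (by norm_num) hn
  have h2 : Tendsto (fun n : ℕ => lowK c / ((Nat.log 2 (Nat.log 2 n) : ℝ) + 1)) atTop (nhds 0) :=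
    (tendsto_const_nhds.div_atTop (tendsto_atTop_add_const_right _ _ tendsto_natCast_atTop_atTop)).comp
      (h1.comp h1)
  have h3 := ((isLittleO_one_iff ℝ).2 h2).mul_isBigO (isBigO_refl (fun n : ℕ => (n : ℝ)) atTop)
  simp only [one_mul] at h3
  exact h3

/-- For `n < 4 * (D * D)` with `D` large, `n + 2 ≤ D ^ 3` and `2 * lgc c + 2 ≤ D`, so the quantity
in the definition of `Tiny` is at most `D ^ 7 < w`. With `D = 2 ^ (t - 1)` the conclusion says that
`2 ^ (2 * t) ≤ n`, as the early structure requires. -/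
theorem le_of_not_tiny {c n w D : ℕ} (hX : 1000 * (c + 1) < D) (hw : D ^ 8 < w)
    (hT : ¬ Tiny c n w) : 4 * (D * D) ≤ n := by
  by_contra h
  push Not at h
  have hb := lgc_le c
  have hpw : ∀ k ≤ 8, D ^ k < w := fun k hk =>
    (Nat.pow_le_pow_right (by omega) hk).trans_lt hw
  have h1 : 1000 * (D * D) ≤ D * (D * D) := Nat.mul_le_mul_right _ (by omega)
  have h2 : 1000 * D ≤ D * D := Nat.mul_le_mul_right _ (by omega)
  have h3 : D * (D * D) = D ^ 3 := by ring
  have h4 := hpw 3 (by norm_num)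
  have h5 : n + 2 ≤ D ^ 3 := by omega
  refine hT ⟨by omega, ?_⟩
  calc (2 * lgc c + 2) * ((n + 2) * (n + 2)) ≤ D * (D ^ 3 * D ^ 3) :=
        Nat.mul_le_mul (by omega) (Nat.mul_le_mul h5 h5)
    _ = D ^ 7 := by ring
    _ < w := hpw 7 (by norm_num)

/-- A leaf wastes O(c * (t + 1)) bits and there are about `n / 2 ^ t` leaves. By `hlog`, `log log n
+ 1 ≤ 8 * (t + 1)`, and `(t + 1) ^ 2 ≤ 3 * 2 ^ t` converts `(t + 1) / 2 ^ t` into `24 / (log log n +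
1)`. -/
theorem low_le {c n w t : ℕ} (hc : 1 ≤ c) (hn : n < 2 ^ w) (ht : w ≤ (2 ^ t) ^ 8) :
    (n / 2 ^ t * (fS c t + 3 + 9 * (c + 1) * (8 + 8 * t)) : ℝ) ≤
      n * Real.logb 2 c + lowg c n := by
  have hx0 : (0 : ℝ) ≤ n / 2 ^ t := by positivity
  have h1 := lgc_fS_le hc t
  have hlog : Nat.log 2 (Nat.log 2 n) ≤ 8 * t := by
    have h2 : Nat.log 2 n ≤ 2 ^ (8 * t) := by
      rw [mul_comm, pow_mul]
      refine le_trans ?_ ht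
      rw [← Nat.log_pow (b := 2) (by norm_num) w]
      exact Nat.log_mono_right hn.le
    calc _ ≤ Nat.log 2 (2 ^ (8 * t)) := Nat.log_mono_right h2
      _ = 8 * t := Nat.log_pow (by norm_num) _
  have h2 : (t + 1) * (Nat.log 2 (Nat.log 2 n) + 1) ≤ 24 * 2 ^ t := by
    have h3 := succ_sq_le t
    have h4 : Nat.log 2 (Nat.log 2 n) + 1 ≤ 8 * (t + 1) := by omega
    have := Nat.mul_le_mul_left (t + 1) h4
    nlinarith
  have h3 : ((t + 1) * (Nat.log 2 (Nat.log 2 n) + 1) : ℝ) ≤ 24 * 2 ^ t := by exact_mod_cast h2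
  have h2t : (0 : ℝ) < 2 ^ t := by positivity
  have h4 : (n / 2 ^ t * (t + 1) : ℝ) ≤ 24 / ((Nat.log 2 (Nat.log 2 n) : ℝ) + 1) * n := by
    rw [div_mul_eq_mul_div, div_mul_eq_mul_div, div_le_div_iff₀ h2t (by positivity)]
    have := mul_le_mul_of_nonneg_left h3 (Nat.cast_nonneg (α := ℝ) n)
    nlinarith
  have h5 : (n / 2 ^ t * (2 ^ t * Real.logb 2 c) : ℝ) = n * Real.logb 2 c := by field_simp
  have h6 : (n / 2 ^ t * (fS c t + 3 + 9 * (c + 1) * (8 + 8 * t)) : ℝ) ≤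
      n / 2 ^ t * ((2 ^ t * Real.logb 2 c) + (t + 1) * (72 * c + 76)) := by
    refine mul_le_mul_of_nonneg_left ?_ hx0
    nlinarith [Nat.cast_nonneg (α := ℝ) t]
  refine h6.trans ?_
  rw [mul_add, h5, lowg, lowK]
  have h7 := mul_le_mul_of_nonneg_right h4 (show (0 : ℝ) ≤ 72 * c + 76 by positivity)
  have h8 : (24 / ((Nat.log 2 (Nat.log 2 n) : ℝ) + 1) * n * (72 * c + 76) : ℝ) =
    24 * (72 * c + 76) / ((Nat.log 2 (Nat.log 2 n) : ℝ) + 1) * n := by ring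
  rw [← h8]
  nlinarith

theorem big_spec {c n w : ℕ} (hc : 1 ≤ c) (hw : (2000 * (c + 1)) ^ 8 < w) (hn : n < 2 ^ w)
    (hT : ¬ Tiny c n w) : ∃ t, ∃ P : Par, P = ⟨c, n, w, 2 ^ t, fS c t, 8 + 8 * t⟩ ∧ P.Good ∧ Big P t ∧
      (P.M * w : ℝ) ≤ n * Real.logb 2 c + lowg c n + (9 * c + 32) * w := by
  have hex : ∃ t, w ≤ (2 ^ t) ^ 8 := ⟨w, (Nat.lt_two_pow_self (n := w)).le.trans
    (Nat.le_self_pow (by norm_num) _)⟩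
  -- The least such `t` gives `D ^ 8 < w ≤ (2 * D) ^ 8` for `D = 2 ^ (t - 1)`, so all size
  -- conditions below become comparisons of powers of `D`.
  obtain ⟨t, ht, hmin⟩ : ∃ t, w ≤ (2 ^ t) ^ 8 ∧ ∀ s < t, (2 ^ s) ^ 8 < w := by
    classical
    exact ⟨Nat.find hex, Nat.find_spec hex, fun s hs => not_le.1 (Nat.find_min hex hs)⟩
  have ht0 : 0 < t := by
    rcases Nat.eq_zero_or_pos t with rfl | h
    · have : 1 ≤ (2000 * (c + 1)) ^ 8 := Nat.one_le_pow _ _ (by omega)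
      simp at ht; omega
    · exact h
  obtain ⟨D, hD⟩ : ∃ D, D = 2 ^ (t - 1) := ⟨_, rfl⟩
  have hd : 2 ^ t = 2 * D := by rw [hD, ← pow_succ']; congr 1; omega
  have hDw : D ^ 8 < w := by rw [hD]; exact hmin _ (by omega)
  have hDX : 1000 * (c + 1) < D := by
    have : 2000 * (c + 1) < 2 ^ t := lt_of_pow_lt_pow_left₀ 8 (Nat.zero_le _) (hw.trans_le ht)
    omega
  have htD : t ≤ D := by have := Nat.lt_two_pow_self (n := t - 1); omega
  have hb := lgc_le c
  have hpw : ∀ k ≤ 8, D ^ k < w := fun k hk =>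
    (Nat.pow_le_pow_right (by omega) hk).trans_lt hDw
  have hD1 := hpw 1 (by norm_num)
  have hD2 := hpw 2 (by norm_num)
  have hD4 := hpw 4 (by norm_num)
  have hww := Nat.lt_two_pow_self (n := w)
  have hf : fS c t + 1 ≤ D * D := by
    have h1 : fS c t ≤ 2 * D * lgc c := by rw [← hd]; exact fS_le c t
    have h2 : 2 * D * lgc c + 1 ≤ D * (2 * lgc c + 1) := by nlinarith
    exact (by omega : _ ≤ _).trans (h2.trans (Nat.mul_le_mul_left _ (by omega)))
  have hfD : 2 * fS c t + 2 ≤ D * D := by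
    have h1 : fS c t ≤ 2 * D * lgc c := by rw [← hd]; exact fS_le c t
    have h2 : 2 * (2 * D * lgc c) + 2 ≤ D * (4 * lgc c + 1) := by nlinarith
    exact (by omega : _ ≤ _).trans (h2.trans (Nat.mul_le_mul_left _ (by omega)))
  have hfp := fS_pos c t
  have hff : fS c t * fS c t ≤ w := by
    calc _ ≤ (D * D) * (D * D) := Nat.mul_le_mul (by omega) (by omega)
      _ = D ^ 4 := by ring
      _ ≤ w := hD4.le
  have hDD : D * D = D ^ 2 := (sq D).symm
  have hDl : 1000 * D ≤ D * D := Nat.mul_le_mul_right _ (by omega)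
  have hhw : 2 * (8 + 8 * t) ≤ w := by omega
  refine ⟨t, _, rfl, ?_⟩
  set P : Par := ⟨c, n, w, 2 ^ t, fS c t, 8 + 8 * t⟩ with hP
  -- Because `f * f ≤ w`, a word holds at least `f` leaves, and the fewer than `f` bits left over in
  -- it are less than one bit per leaf.
  have hr : P.w ≤ (P.f + 1) * P.r := by
    have h1 : fS c t ≤ w / fS c t := (Nat.le_div_iff_mul_le hfp).2 hff
    have h2 := Nat.div_add_mod w (fS c t)
    have h3 := Nat.mod_lt w hfp
    change w ≤ (fS c t + 1) * (w / fS c t)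
    rw [Nat.add_mul]; omega
  have hq : P.w ≤ 3 * P.h * P.q := by
    have h1 : 2 ≤ w / (8 + 8 * t) := (Nat.le_div_iff_mul_le (by omega)).2 hhw
    have h2 := Nat.div_add_mod w (8 + 8 * t)
    have h3 := Nat.mod_lt w (show 0 < 8 + 8 * t by omega)
    change w ≤ 3 * (8 + 8 * t) * (w / (8 + 8 * t) - 1)
    obtain ⟨q, hq⟩ : ∃ q, w / (8 + 8 * t) = q + 2 := ⟨_, (Nat.sub_add_cancel h1).symm⟩
    rw [hq] at h2 ⊢
    rw [show q + 2 - 1 = q + 1 from rfl]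
    nlinarith
  have hS := space_le (P := P) (Nat.two_pow_pos t) (by change 2 ^ t ≤ w; omega) hr hq hhw
    (by change fS c t + 1 ≤ w; omega)
  change (P.M * w : ℝ) ≤ n / (2 ^ t : ℕ) * (fS c t + 3 + 9 * (c + 1) * (8 + 8 * t : ℕ)) +
    (9 * c + 32) * w at hS
  push_cast at hS
  have hx0 : (0 : ℝ) ≤ n / 2 ^ t := by positivity
  -- Addresses must fit into words. The space bound itself yields this, since it allows at most `w /
  -- 2` bits per element apart from O(c) words.
  have hML : P.M ≤ 2 ^ w := by
    have h1 : 2 * (fS c t + 3 + 9 * (c + 1) * (8 + 8 * t)) ≤ w := by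
      have h2 : 9 * (c + 1) * (8 + 8 * t) ≤ D * (9 * D) := Nat.mul_le_mul (by omega) (by omega)
      have h3 : D * (9 * D) = 9 * (D * D) := by ring
      have h4 : 20 * (D * D) + 6 ≤ D ^ 4 := by
        have : D ^ 4 = (D * D) * (D * D) := by ring
        rw [this]; nlinarith
      omega
    have h2 : (2 * (fS c t + 3 + 9 * (c + 1) * (8 + 8 * t)) : ℝ) ≤ w := by exact_mod_cast h1
    have h3 : (n / 2 ^ t : ℝ) ≤ n := div_le_self (Nat.cast_nonneg _) (one_le_pow₀ (by norm_num))
    have h4 : (n / 2 ^ t * (fS c t + 3 + 9 * (c + 1) * (8 + 8 * t)) : ℝ) ≤ n * (w / 2) :=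
      mul_le_mul h3 (by linarith) (by positivity) (Nat.cast_nonneg _)
    have hw1 : (0 : ℝ) < w := by exact_mod_cast (show 0 < w by omega)
    have h5 : (P.M : ℝ) ≤ n / 2 + (9 * c + 32) := by
      refine le_of_mul_le_mul_right (hS.trans ?_) hw1
      nlinarith
    have h6 : 2 * P.M ≤ n + 2 * (9 * c + 32) := by
      have : (2 * P.M : ℝ) ≤ n + 2 * (9 * c + 32) := by linarith
      exact_mod_cast this
    omega
  have h4D := le_of_not_tiny hDX hDw hT
  -- Even the narrowest of `2 * t` fields has at least `D ^ 5` bits, whereas keys need only `17 * t`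
  -- bits: `N * w ^ 2` is at most `2 ^ t * (2 ^ (8 * t)) ^ 2`.
  have hD5 : D ^ 5 ≤ w / 2 ^ (2 * t) := by
    rw [Nat.le_div_iff_mul_le (Nat.two_pow_pos _), two_mul, pow_add, hd]
    calc D ^ 5 * (2 * D * (2 * D)) = 4 * D ^ 7 := by ring
      _ ≤ D * D ^ 7 := Nat.mul_le_mul_right _ (by omega)
      _ = D ^ 8 := by ring
      _ ≤ w := hDw.le
  have h17 : 17 * t + 1 ≤ D ^ 5 := by
    calc 17 * t + 1 ≤ D * D := by omega
      _ = D ^ 2 := hDD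
      _ ≤ D ^ 5 := Nat.pow_le_pow_right (by omega) (by norm_num)
  refine ⟨⟨fS_codec hc t, ?_, pow_lt_fS hc t, ?_, hhw, ?_, hn, hML, const_lt (c := c) (w := w) (by omega), ?_, ?_⟩,
    ⟨rfl, rfl, rfl, hmin, ht, fun N hN => ?_⟩, ?_⟩
  · change (2 * fS c t + 2) * (2 ^ t + 1) < w
    calc _ ≤ (D * D) * (D * D) := Nat.mul_le_mul hfD (by omega)
      _ = D ^ 4 := by ring
      _ < w := hD4
  · change 1 ≤ 8 + 8 * t; omega
  -- The choice of `h` makes `2 ^ h` exceed `(2 ^ t) ^ 8`, hence `w`.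
  · change w / (8 + 8 * t) ≤ 2 ^ (8 + 8 * t) - 1
    have h1 : (2 ^ t) ^ 8 < 2 ^ (8 + 8 * t) := by
      rw [← pow_mul]; exact Nat.pow_lt_pow_right (by norm_num) (by omega)
    have := Nat.div_le_self w (8 + 8 * t)
    omega
  · change 64 ≤ w; omega
  · change c < w; omega
  · have hu : D ^ 5 ≤ w / 2 ^ N := hD5.trans (Nat.div_le_div_left
      (Nat.pow_le_pow_right (by norm_num) hN) (Nat.two_pow_pos _))
    have h2u : 2 ^ (17 * t) ≤ 2 ^ (w / 2 ^ N - 1) := Nat.pow_le_pow_right (by norm_num) (by omega)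
    refine ⟨?_, ?_, ?_, (Nat.pow_le_pow_right (by norm_num) hN).trans (by rw [two_mul, pow_add, hd]; refine le_trans (le_of_eq ?_) h4D; ring)⟩
    · refine le_trans ?_ h2u
      calc N * (w * w) ≤ 2 ^ t * ((2 ^ t) ^ 8 * (2 ^ t) ^ 8) :=
            Nat.mul_le_mul (by omega) (Nat.mul_le_mul ht ht)
        _ = 2 ^ (17 * t) := by rw [← pow_add, ← pow_succ', ← pow_mul]; congr 1; ring
    · refine le_trans ?_ h2u
      have : 2 ^ t ≤ 2 ^ (17 * t) := Nat.pow_le_pow_right (by norm_num) (by omega)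
      change c ≤ _
      omega
    · change 2 ≤ w / 2 ^ N; omega
  · exact hS.trans (add_le_add_left (low_le hc hn ht) _)

end SetColl

open SetColl in
theorem mainTheorem3 :
    ∃ T : ℕ, ∀ c : ℕ, 1 ≤ c →
      ∃ (D : SetCollection) (w₀ K : ℕ) (g : ℕ → ℝ),
        (g =o[atTop] fun n : ℕ => (n : ℝ)) ∧
        ∀ n w : ℕ, w₀ ≤ w → n < 2 ^ w →
          ∃ (M : ℕ) (Rep : (Fin n → Fin c) → (ℕ → BitVec w) → Prop),
            (((M + D.registers) * w : ℕ) : ℝ) ≤ n * Real.logb 2 c + g n + K * w ∧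
            D.Maintains n c w M T Rep := by
  -- The bound on `w` forces `D > 1000 * (c + 1)`, so that powers of `D` dominate all quantities
  -- depending on `c`. The constant `K` collects the cells not proportional to the number of leaves,
  -- and the registers.
  refine ⟨timeK 0, fun c hc => ⟨coll c, (2000 * (c + 1)) ^ 8 + 1, 9 * c + 32 + (coll c).registers,
    lowg c, lowg_isLittleO c, fun n w hw hn => ?_⟩⟩
  have hcw : 1000 * (c + 1) ≤ w := by
    have : 2000 * (c + 1) ≤ (2000 * (c + 1)) ^ 8 := Nat.le_self_pow (by norm_num) _
    omega
  have hb := tiny_bound hcw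
  have hlog : 0 ≤ Real.logb 2 c := Real.logb_nonneg (by norm_num) (by exact_mod_cast hc)
  by_cases hT : Tiny c n w
  · obtain ⟨G, hM⟩ := tiny_spec hc hcw hn hT rfl
    refine ⟨_, _, ?_, timeK_eq c ▸ maintains G (t := 0) hb (fun _ => ⟨rfl, rfl, rfl⟩) fun h => absurd hT h⟩
    have h1 : 0 ≤ lowg c n := by unfold lowg lowK; positivity
    have h2 : (0 : ℝ) ≤ n * Real.logb 2 c := by positivity
    have h3 : ((Par.M ⟨c, n, w, n + 1, lgc c * (n + 1), w / 2 - 1⟩ + (coll c).registers) * w : ℕ) ≤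
        (9 * c + 32 + (coll c).registers) * w := Nat.mul_le_mul_right _ (by omega)
    have h4 : ((((Par.M ⟨c, n, w, n + 1, lgc c * (n + 1), w / 2 - 1⟩ + (coll c).registers) * w : ℕ)) : ℝ) ≤
        ((9 * c + 32 + (coll c).registers : ℕ) : ℝ) * w := by exact_mod_cast h3
    linarith
  · obtain ⟨t, P, rfl, G, B, hM⟩ := big_spec hc (by omega) hn hT
    refine ⟨_, _, ?_, timeK_eq c ▸ maintains G (t := t) hb (fun h => absurd h hT) fun _ => B⟩
    push_cast
    linarith
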